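/- Let $Q(x)=2\sqrt2/(e^{x}+e^{-x})$, regarded as a function of $(x,y)\in\mathbb R^2$, let $\lambda>0$, and consider, for a complex-valued $u$ and a real-valued $n$ on $[0,T]\times\mathbb R^2$, the Zakharov system perturbed by the line soliton, $$ i\partial_t(u+Q)-(u+Q)+\Delta(u+Q)=(n-Q^2)(u+Q),\qquad \frac1{\lambda^2}\partial_t^2(n-Q^2)-\Delta(n-Q^2)=\Delta(|u+Q|^2), $$ with initial data $u(0)=u_0$, $n(0)=n_0$, $n_t(0)=\nabla\cdot f_0$, where $u_0$ is complex-valued, $n_0$ is real-valued and $f_0$ is an $\mathbb R^2$-valued vector field on $\mathbb R^2$. **Theorem.** Let $s>2$ and $C_1\ge 0$. There are $T>0$ and $C_2<\infty$, depending only on $s$ and $C_1$ (in particular not on $\lambda$), such that for every $\lambda>0$ and all data with $$ \|u_0\|_{H^{s+1}}+\|n_0\|_{H^{s}}+\frac1\lambda\|f_0\|_{H^{s}}\le C_1 $$ the initial value problem has a unique (distributional) solution $(u,n)\in L^\infty([0,T];H^{s+1}(\mathbb R^2))\times L^\infty([0,T];H^{s}(\mathbb R^2))$. Moreover, after modification on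 a null set of times, $u$ is once and $n$ is twice differentiable in time as a map from $[0,T]$ to $L^2(\mathbb R^2)$, the initial data are attained, and for all $t\in[0,T]$ $$ \|u(t)\|_{H^{s+1}}+\|u_t(t)\|_{H^{s-1}}+\|n(t)\|_{H^{s}}+\frac1\lambda\|n_t(t)\|_{H^{s-1}}+\frac1{\lambda^2}\|n_{tt}(t)\|_{H^{s-2}}\le C_2 . $$ -/

import Mathlib

open MeasureTheory
open scoped ENNReal NNReal ContDiff FourierTransform Laplacian

namespace Zakharov

/-- The plane `ℝ²` with its Euclidean structure; `x 0`, `x 1` are the two space variables. -/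
abbrev Plane : Type := EuclideanSpace ℝ (Fin 2)

/-- `L²(ℝ²; ℂ)`. -/
abbrev L2C : Type := Lp ℂ 2 (volume : Measure Plane)

/-- `L²(ℝ²; ℝ)`. -/
abbrev L2R : Type := Lp ℝ 2 (volume : Measure Plane)

/-- A real-valued `L²` function regarded as a complex-valued one. -/
noncomputable def toComplex (f : L2R) : L2C := Complex.ofRealCLM.compLp f

/-- The norm of `f` in the usual Sobolev space `H^r(ℝ²)`, `‖(1 + |ξ|²)^{r/2} 𝓕 f‖_{L²}`, with
value `∞` if `f` is not in `H^r(ℝ²)`. For `r ≥ 0` (the only case that is used) every element of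
`H^r(ℝ²)` is in `L²(ℝ²)`, so nothing is lost by restricting to `f ∈ L²`. The weight is the one of
`TemperedDistribution.MemSobolev`. -/
noncomputable def sobolevNorm (r : ℝ) (f : L2C) : ℝ≥0∞ :=
  eLpNorm (fun ξ : Plane => ((((1 + ‖ξ‖ ^ 2) ^ (r / 2) : ℝ)) : ℂ) * (𝓕 f : L2C) ξ) 2 volume

/-- The `H^r(ℝ²)` norm of a real-valued function. -/
noncomputable def sobolevNormReal (r : ℝ) (f : L2R) : ℝ≥0∞ :=
  sobolevNorm r (toComplex f)

/-- The `H^r(ℝ²)` norm of a real vector field. -/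
noncomputable def sobolevNormVec (r : ℝ) (f : Fin 2 → L2R) : ℝ≥0∞ :=
  (∑ j, sobolevNormReal r (f j) ^ (2 : ℝ)) ^ (1 / 2 : ℝ)

/-- `u ∈ L^∞([0,T]; H^r(ℝ²))`, for complex-valued `u` and `r ≥ 0`. (Measurability into `L²` and
measurability into the separable space `H^r ⊆ L²` are equivalent for functions with values
in `H^r`.) -/
def MemLInftySobolev (T r : ℝ) (u : ℝ → L2C) : Prop :=
  AEStronglyMeasurable u (volume.restrict (Set.Icc 0 T)) ∧
    ∃ M : ℝ≥0, ∀ᵐ t ∂(volume.restrict (Set.Icc 0 T)), sobolevNorm r (u t) ≤ (M : ℝ≥0∞)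

/-- `n ∈ L^∞([0,T]; H^r(ℝ²))`, for real-valued `n` and `r ≥ 0`. -/
def MemLInftySobolevReal (T r : ℝ) (n : ℝ → L2R) : Prop :=
  AEStronglyMeasurable n (volume.restrict (Set.Icc 0 T)) ∧
    ∃ M : ℝ≥0, ∀ᵐ t ∂(volume.restrict (Set.Icc 0 T)), sobolevNormReal r (n t) ≤ (M : ℝ≥0∞)

/-- The profile `Q(x) = 2√2 / (e^x + e^{-x})` of the line soliton, as a function on the plane that
is constant in the second variable. -/
noncomputable def lineSoliton (x : Plane) : ℝ :=
  2 * Real.sqrt 2 / (Real.exp (x 0) + Real.exp (-(x 0)))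

/-- The `j`-th partial derivative of a function on the plane. -/
noncomputable def partialDeriv (j : Fin 2) (φ : Plane → ℝ) (x : Plane) : ℝ :=
  fderiv ℝ φ x (EuclideanSpace.single j (1 : ℝ))

/-- Test functions in `C_c^∞((-∞, T) × ℝ²; F)`; they need not vanish at time `0`. -/
structure IsTestFunction {F : Type} [NormedAddCommGroup F] [NormedSpace ℝ F] (T : ℝ)
    (ψ : ℝ → Plane → F) : Prop where
  smooth : ContDiff ℝ ∞ (Function.uncurry ψ)
  compact_support : HasCompactSupport (Function.uncurry ψ)
  support_subset : tsupport (Function.uncurry ψ) ⊆ Set.Iio T ×ˢ Set.univ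

/-- `(u, n)` is a solution on `[0,T] × ℝ²`, in the sense of distributions and with the initial
data included in the weak formulation, of
`i ∂ₜ(u + Q) - (u + Q) + Δ(u + Q) = (n - Q²)(u + Q)`,
`λ⁻² ∂ₜ²(n - Q²) - Δ(n - Q²) = Δ(|u + Q|²)`,
`u(0) = u₀`, `n(0) = n₀`, `∂ₜ n(0) = ∇ · f₀`. -/
structure IsWeakSolution (lam T : ℝ) (u₀ : L2C) (n₀ : L2R) (f₀ : Fin 2 → L2R)
    (u : ℝ → L2C) (n : ℝ → L2R) : Prop where
  schrodinger : ∀ ψ : ℝ → Plane → ℂ, IsTestFunction T ψ →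
    -Complex.I * (∫ x, (u₀ x + (lineSoliton x : ℂ)) * ψ 0 x) +
      (∫ t in Set.Icc 0 T, ∫ x, (u t x + (lineSoliton x : ℂ)) *
        (-Complex.I * deriv (fun τ => ψ τ x) t - ψ t x + Δ (ψ t) x)) =
    ∫ t in Set.Icc 0 T, ∫ x,
      ((n t x - lineSoliton x ^ 2 : ℝ) : ℂ) * (u t x + (lineSoliton x : ℂ)) * ψ t x
  wave : ∀ ψ : ℝ → Plane → ℝ, IsTestFunction T ψ →
    (1 / lam ^ 2) *
        ((∑ j, ∫ x, f₀ j x * partialDeriv j (ψ 0) x) +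
          (∫ x, (n₀ x - lineSoliton x ^ 2) * deriv (fun τ => ψ τ x) 0) +
          (∫ t in Set.Icc 0 T, ∫ x,
            (n t x - lineSoliton x ^ 2) * iteratedDeriv 2 (fun τ => ψ τ x) t)) -
      (∫ t in Set.Icc 0 T, ∫ x, (n t x - lineSoliton x ^ 2) * Δ (ψ t) x) =
    ∫ t in Set.Icc 0 T, ∫ x, ‖u t x + (lineSoliton x : ℂ)‖ ^ 2 * Δ (ψ t) x

/-- `g = ∇ · f` in the sense of distributions on the plane. -/
def IsWeakDivergence (g : L2R) (f : Fin 2 → L2R) : Prop :=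
  ∀ φ : Plane → ℝ, ContDiff ℝ ∞ φ → HasCompactSupport φ →
    ∫ x, g x * φ x = -∑ j, ∫ x, f j x * partialDeriv j φ x

/-- `v'` is the time derivative of the curve `v` in `L²(ℝ²)` at every time of `[0,T]` (one-sided at
the two endpoints). -/
def HasTimeDeriv {X : Type} [NormedAddCommGroup X] [NormedSpace ℝ X] (T : ℝ) (v v' : ℝ → X) :
    Prop :=
  ∀ t ∈ Set.Icc 0 T, HasDerivWithinAt v (v' t) (Set.Icc 0 T) t

end Zakharov

/-!
The soliton `Q` is a stationary solution, so the terms that only involve `Q` cancel in the weak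
formulation (`schrodinger_iff`, `wave_iff`). Put `w = u + Q` and `N = n + |w|² - Q²`. The wave
equation becomes `n_tt = λ² Δ N`, and it is of first order for `P = N + i M` with `n_t = λ |∇| M`.
The system for `(u, P)` reads
`u_t = i Δu - i u - i (n w - Q² u)`, `P_t = -i λ |∇| P + ∂ₜ|w|²`, `n = Re P - |w|² + Q²`,
where `∂ₜ|w|² = 2 Re (w̄ u_t)` does not contain `n`, because `n` is real.

**Bounds that are uniform in `λ`.** The term with `λ` is skew-adjoint and commutes with derivatives,
so it drops out of the energy `8π² ‖u‖²_{H^{s+1}} + ‖P‖²_{H^s}`. Two terms lose a derivative: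
`N w` in the first equation, tested with `⟨D⟩^{2s+2} u`, and `w̄ Δu` in the second one, tested with
`⟨D⟩^{2s} P`. Because of the factor `8π²` they combine to a commutator of `⟨D⟩^{2s}` with the
multiplication by `w`, which costs one derivative of `w` only (`IsMult.commutator`,
`energy_estimate`). Gronwall's inequality then gives a time of existence and a bound that do not
depend on `λ`. The same energy for differences, in `H¹ × L²`, gives `difference_estimate`; there the
two terms cancel without a commutator.

**Existence.** The unknowns are `a = ⟨D⟩² u` and `b = ⟨D⟩ P`, which are in `L²`. After truncation of
the frequencies the system is an ordinary differential equation in `L²` with a vector field that is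
Lipschitz on balls, and the energy estimate still holds (`exists_galerkin`). The truncated solutions
form a Cauchy sequence in `H¹ × L²` by the difference estimate, hence by interpolation in every
space below `H^{s+1} × H^s`. The limit solves the system (`exists_solution`), and it is a weak
solution of the Zakharov system (`IsSol.isWeakSolution`). The initial velocity `∇ · f₀` is
`λ |∇| M(0)`, where `M(0)` is obtained from `λ⁻¹ f₀` by Riesz transforms
(`exists_initial_velocity`), so the data for `P` are bounded independently of `λ`.

**Uniqueness.** Testing with products of functions of `t` and of `x` shows that a weak solution in
the class of the theorem satisfies, after modification on a null set of times, the Schrödinger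
equation integrated once and the wave equation integrated twice in time, as equations in `L²`
(`EssBdd.eq_prim`, `EssBdd.eq_prim_prim`). So it comes from a solution of the system for `(u, P)`
(`IsWeakSolution.exists_isSol`), and there the difference estimate applies (`IsSol.unique`).

**Products.** All product estimates are made on the Fourier side and for a class of multipliers
`IsMult`, defined by a bound for the differences of two weighted trilinear forms. It contains the
functions in `H^r` (`isMult_emb`), by Young's inequality, and superpositions of plane waves with
rapidly decreasing amplitude (`FRep.isMult`). The soliton does not decay in the second variable; it
is a superposition of plane waves with frequencies on a line (`exists_isMult_Qinf`).
-/

open scoped ComplexConjugate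

namespace Zakharov

open Filter Topology

/-! ### Multiplication and conjugation on `L²` -/

/-- `L^∞(ℝ²; ℂ)`, the space of multipliers. -/
abbrev Linf : Type := Lp ℂ ∞ (volume : Measure Plane)

/-- Pointwise multiplication `L^∞ × L² → L²`. -/
noncomputable def mul : Linf →L[ℂ] L2C →L[ℂ] L2C :=
  (ContinuousLinearMap.mul ℂ ℂ).holderL volume ∞ 2 2

theorem coeFn_mul (w : Linf) (f : L2C) : mul w f =ᵐ[volume] fun x => w x * f x := by
  have := (ContinuousLinearMap.mul ℂ ℂ).coeFn_holder (r := 2) w f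
  filter_upwards [this] with x hx
  exact hx

theorem norm_mul_le (w : Linf) (f : L2C) : ‖mul w f‖ ≤ ‖w‖ * ‖f‖ := by
  have h := (ContinuousLinearMap.mul ℂ ℂ).norm_holder_apply_apply_le (r := 2) w f
  refine h.trans ?_
  have : ‖ContinuousLinearMap.mul ℂ ℂ‖ ≤ 1 := ContinuousLinearMap.opNorm_mul_le ℂ ℂ
  calc _ ≤ 1 * ‖w‖ * ‖f‖ := by gcongr
    _ = _ := by ring

theorem mul_left_comm' (v w : Linf) (f : L2C) : mul v (mul w f) = mul w (mul v f) := by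
  apply Lp.ext
  filter_upwards [coeFn_mul v (mul w f), coeFn_mul w f, coeFn_mul w (mul v f), coeFn_mul v f]
    with x h1 h2 h3 h4
  rw [h1, h2, h3, h4]; ring

/-- Complex conjugation on `L²`. -/
noncomputable def conjL : L2C →L[ℝ] L2C :=
  (Complex.conjCLE : ℂ →L[ℝ] ℂ).compLpL 2 volume

/-- Complex conjugation on `L^∞`. -/
noncomputable def conjI : Linf →L[ℝ] Linf :=
  (Complex.conjCLE : ℂ →L[ℝ] ℂ).compLpL ∞ volume

theorem coeFn_conjL (f : L2C) : conjL f =ᵐ[volume] fun x => conj (f x) := by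
  filter_upwards [(Complex.conjCLE : ℂ →L[ℝ] ℂ).coeFn_compLpL (p := 2) (μ := volume) f] with x hx
  exact hx

theorem coeFn_conjI (f : Linf) : conjI f =ᵐ[volume] fun x => conj (f x) := by
  filter_upwards [(Complex.conjCLE : ℂ →L[ℝ] ℂ).coeFn_compLpL (p := ∞) (μ := volume) f] with x hx
  exact hx

@[simp] theorem conjL_conjL (f : L2C) : conjL (conjL f) = f := by
  apply Lp.ext
  filter_upwards [coeFn_conjL (conjL f), coeFn_conjL f] with x h1 h2
  rw [h1, h2]; simp

@[simp] theorem conjI_conjI (f : Linf) : conjI (conjI f) = f := by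
  apply Lp.ext
  filter_upwards [coeFn_conjI (conjI f), coeFn_conjI f] with x h1 h2
  rw [h1, h2]; simp

theorem conjL_smul (c : ℂ) (f : L2C) : conjL (c • f) = conj c • conjL f := by
  apply Lp.ext
  filter_upwards [coeFn_conjL (c • f), coeFn_conjL f, Lp.coeFn_smul c f,
    Lp.coeFn_smul (conj c) (conjL f)] with x h1 h2 h3 h4
  rw [h1, h3, h4]; simp [h2]

theorem conjL_mul (w : Linf) (f : L2C) : conjL (mul w f) = mul (conjI w) (conjL f) := by
  apply Lp.ext
  filter_upwards [coeFn_conjL (mul w f), coeFn_conjL f, coeFn_conjI w, coeFn_mul w f,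
    coeFn_mul (conjI w) (conjL f)] with x h1 h2 h3 h4 h5
  rw [h1, h4, h5, h2, h3]; simp

theorem inner_eq_integral (f g : L2C) : inner ℂ f g = ∫ x, conj (f x) * g x := by
  rw [L2.inner_def]
  congr with x
  simp [mul_comm]

theorem inner_conjL_conjL (f g : L2C) : inner ℂ (conjL f) (conjL g) = inner ℂ g f := by
  rw [inner_eq_integral, inner_eq_integral]
  apply integral_congr_ae
  filter_upwards [coeFn_conjL f, coeFn_conjL g] with x h1 h2
  rw [h1, h2]; simp [mul_comm]

@[simp] theorem norm_conjL (f : L2C) : ‖conjL f‖ = ‖f‖ := by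
  rw [@norm_eq_sqrt_re_inner ℂ _ _ _ _ (conjL f), inner_conjL_conjL,
    ← @norm_eq_sqrt_re_inner ℂ _ _ _ _ f]

theorem inner_mul_right (w : Linf) (f g : L2C) :
    inner ℂ f (mul w g) = inner ℂ (mul (conjI w) f) g := by
  rw [inner_eq_integral, inner_eq_integral]
  apply integral_congr_ae
  filter_upwards [coeFn_mul w g, coeFn_mul (conjI w) f, coeFn_conjI w] with x h1 h2 h3
  rw [h1, h2, h3]; simp; ring

/-! ### Fourier multipliers -/

/-- A bounded measurable real symbol. -/
structure BddSym (m : Plane → ℝ) : Prop where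
  meas : Measurable m
  bdd : ∃ C, ∀ ξ, |m ξ| ≤ C

theorem BddSym.memLp {m : Plane → ℝ} (h : BddSym m) :
    MemLp (fun ξ => (m ξ : ℂ)) ∞ (volume : Measure Plane) := by
  obtain ⟨C, hC⟩ := h.bdd
  refine memLp_top_of_bound (Complex.measurable_ofReal.comp h.meas).aestronglyMeasurable C ?_
  filter_upwards with ξ
  simpa using hC ξ

open Classical in
/-- The multiplication operator on the Fourier side. -/
noncomputable def symI (m : Plane → ℝ) : Linf :=
  if h : BddSym m then h.memLp.toLp else 0

/-- The Fourier multiplier with the bounded real symbol `m`; zero if `m` is not bounded and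
measurable. -/
noncomputable def D (m : Plane → ℝ) : L2C →L[ℂ] L2C :=
  ((Lp.fourierTransformₗᵢ Plane ℂ).symm.toContinuousLinearEquiv : L2C →L[ℂ] L2C) ∘L
    (mul (symI m)) ∘L ((Lp.fourierTransformₗᵢ Plane ℂ).toContinuousLinearEquiv : L2C →L[ℂ] L2C)

theorem fourier_D {m : Plane → ℝ} (h : BddSym m) (f : L2C) :
    (𝓕 (D m f) : L2C) =ᵐ[volume] fun ξ => (m ξ : ℂ) * (𝓕 f : L2C) ξ := by
  have h1 : (𝓕 (D m f) : L2C) = mul (symI m) (𝓕 f) :=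
    (Lp.fourierTransformₗᵢ Plane ℂ).apply_symm_apply _
  rw [h1]
  have h2 : symI m = h.memLp.toLp := by simp [symI, h]
  rw [h2]
  filter_upwards [coeFn_mul h.memLp.toLp (𝓕 f), h.memLp.coeFn_toLp] with x h3 h4
  rw [h3, h4]

theorem ext_fourier {f g : L2C} (h : (𝓕 f : L2C) =ᵐ[volume] (𝓕 g : L2C)) : f = g := by
  have : (𝓕 f : L2C) = 𝓕 g := Lp.ext h
  exact (Lp.fourierTransformₗᵢ Plane ℂ).injective this

theorem BddSym.mul {m n : Plane → ℝ} (hm : BddSym m) (hn : BddSym n) :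
    BddSym (fun ξ => m ξ * n ξ) := by
  obtain ⟨C, hC⟩ := hm.bdd
  obtain ⟨C', hC'⟩ := hn.bdd
  refine ⟨hm.meas.mul hn.meas, C * C', fun ξ => ?_⟩
  rw [abs_mul]
  exact mul_le_mul (hC ξ) (hC' ξ) (abs_nonneg _) ((abs_nonneg _).trans (hC ξ))

theorem D_D {m n : Plane → ℝ} (hm : BddSym m) (hn : BddSym n) (f : L2C) :
    D m (D n f) = D (fun ξ => m ξ * n ξ) f := by
  apply ext_fourier
  filter_upwards [fourier_D hm (D n f), fourier_D hn f, fourier_D (hm.mul hn) f] with x h1 h2 h3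
  rw [h1, h2, h3]; push_cast; ring

theorem D_comm {m n : Plane → ℝ} (hm : BddSym m) (hn : BddSym n) (f : L2C) :
    D m (D n f) = D n (D m f) := by
  rw [D_D hm hn, D_D hn hm]; simp_rw [mul_comm]

theorem inner_fourier (f g : L2C) :
    inner ℂ f g = ∫ ξ, conj ((𝓕 f : L2C) ξ) * (𝓕 g : L2C) ξ := by
  rw [← Lp.inner_fourier_eq, inner_eq_integral]

theorem inner_D {m : Plane → ℝ} (hm : BddSym m) (f g : L2C) :
    inner ℂ (D m f) g = inner ℂ f (D m g) := by
  rw [inner_fourier, inner_fourier]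
  apply integral_congr_ae
  filter_upwards [fourier_D hm f, fourier_D hm g] with x h1 h2
  rw [h1, h2]; simp; ring

theorem norm_D_le {m : Plane → ℝ} {C : ℝ} (hm : Measurable m) (hC : ∀ ξ, |m ξ| ≤ C) (f : L2C) :
    ‖D m f‖ ≤ C * ‖f‖ := by
  have hs : BddSym m := ⟨hm, C, hC⟩
  rw [← Lp.norm_fourier_eq (D m f), ← Lp.norm_fourier_eq f]
  refine Lp.norm_le_mul_norm_of_ae_le_mul ?_
  filter_upwards [fourier_D hs f] with x h1
  rw [h1, norm_mul]
  gcongr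
  simpa using hC x

/-! ### Reflections, translations and modulations -/

/-- Reflection `f(x) ↦ f(-x)` on `L²`. -/
noncomputable def reflL : L2C →ₗᵢ[ℂ] L2C :=
  Lp.compMeasurePreservingₗᵢ ℂ (fun x : Plane => -x) (Measure.measurePreserving_neg volume)

theorem coeFn_reflL (f : L2C) : reflL f =ᵐ[volume] fun x => f (-x) :=
  Lp.coeFn_compMeasurePreserving f (Measure.measurePreserving_neg volume)

/-- Translation `f(x) ↦ f(x - ζ)` on `L²`. -/
noncomputable def translL (ζ : Plane) : L2C →ₗᵢ[ℂ] L2C :=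
  Lp.compMeasurePreservingₗᵢ ℂ (fun x : Plane => x - ζ) (measurePreserving_sub_right volume ζ)

theorem coeFn_translL (ζ : Plane) (f : L2C) : translL ζ f =ᵐ[volume] fun x => f (x - ζ) :=
  Lp.coeFn_compMeasurePreserving f (measurePreserving_sub_right volume ζ)

theorem schwartz_induction {p : L2C → Prop} (hc : IsClosed {f | p f})
    (h : ∀ φ : SchwartzMap Plane ℂ, p (φ.toLp 2)) (f : L2C) : p f :=
  DenseRange.induction_on (SchwartzMap.denseRange_toLpCLM (p := 2) ENNReal.ofNat_ne_top) f hc h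

theorem fourier_conjL (f : L2C) :
    (𝓕 (conjL f) : L2C) =ᵐ[volume] fun ξ => conj ((𝓕 f : L2C) (-ξ)) := by
  have key : (𝓕 (conjL f) : L2C) = conjL (reflL (𝓕 f)) := by
    revert f
    apply schwartz_induction
    · apply isClosed_eq
      · exact (Lp.fourierTransformₗᵢ Plane ℂ).continuous.comp conjL.continuous
      · exact conjL.continuous.comp
          (reflL.continuous.comp (Lp.fourierTransformₗᵢ Plane ℂ).continuous)
    · intro φ
      have h1 : conjL (φ.toLp 2) = (φ.postcompCLM (𝕜 := ℝ) (Complex.conjCLE : ℂ →L[ℝ] ℂ)).toLp 2 := by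
        apply Lp.ext
        filter_upwards [coeFn_conjL (φ.toLp 2), φ.coeFn_toLp 2,
          (φ.postcompCLM (𝕜 := ℝ) (Complex.conjCLE : ℂ →L[ℝ] ℂ)).coeFn_toLp 2] with x h1 h2 h3
        rw [h1, h2, h3]; simp
      rw [h1, SchwartzMap.toLp_fourier_eq, SchwartzMap.toLp_fourier_eq]
      apply Lp.ext
      have h5 := (Measure.measurePreserving_neg (volume : Measure Plane)).quasiMeasurePreserving.ae_eq_comp
        ((𝓕 φ).coeFn_toLp 2 volume)
      filter_upwards [coeFn_conjL (reflL ((𝓕 φ).toLp 2)), coeFn_reflL ((𝓕 φ).toLp 2),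
        (𝓕 (φ.postcompCLM (𝕜 := ℝ) (Complex.conjCLE : ℂ →L[ℝ] ℂ))).coeFn_toLp 2, h5] with x h2 h3 h4 h6
      simp only [Function.comp_apply] at h6
      rw [h2, h3, h4, h6, SchwartzMap.fourier_coe, SchwartzMap.fourier_coe, Real.fourier_eq', Real.fourier_eq', ← integral_conj]
      congr with y
      simp [← Complex.exp_conj, map_ofNat]
  rw [key]
  filter_upwards [coeFn_conjL (reflL (𝓕 f)), coeFn_reflL (𝓕 f)] with x h1 h2
  rw [h1, h2]

theorem D_conjL {m : Plane → ℝ} (hm : BddSym m) (he : ∀ ξ, m (-ξ) = m ξ) (f : L2C) :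
    D m (conjL f) = conjL (D m f) := by
  apply ext_fourier
  have h5 := (Measure.measurePreserving_neg (volume : Measure Plane)).quasiMeasurePreserving.ae
        (fourier_D hm f)
  filter_upwards [fourier_D hm (conjL f), fourier_conjL f, fourier_conjL (D m f), h5] with x h1 h2 h3 h4
  rw [h1, h2, h3, h4]; simp [he]

theorem D_conjL_odd {m : Plane → ℝ} (hm : BddSym m) (he : ∀ ξ, m (-ξ) = -m ξ) (f : L2C) :
    D m (conjL f) = -conjL (D m f) := by
  apply ext_fourier
  have h5 := (Measure.measurePreserving_neg (volume : Measure Plane)).quasiMeasurePreserving.ae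
        (fourier_D hm f)
  have h6 : (𝓕 (-conjL (D m f)) : L2C) = -𝓕 (conjL (D m f)) :=
    (Lp.fourierTransformₗᵢ Plane ℂ).map_neg _
  rw [h6]
  filter_upwards [fourier_D hm (conjL f), fourier_conjL f, fourier_conjL (D m f), h5,
    Lp.coeFn_neg (𝓕 (conjL (D m f)) : L2C)] with x h1 h2 h3 h4 h7
  rw [h1, h7, Pi.neg_apply, h2, h3, h4]; simp [he]

/-- The character `x ↦ e^{2πi ζ·x}` is in `L^∞`. -/
theorem memLp_char (ζ : Plane) :
    MemLp (fun x : Plane => (Real.fourierChar (inner ℝ ζ x) : ℂ)) ∞ volume := by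
  refine memLp_top_of_bound (Continuous.aestronglyMeasurable (by fun_prop)) 1 ?_
  filter_upwards with x
  exact (Circle.norm_coe _).le

/-- Modulation by a character translates the Fourier transform. -/
theorem fourier_modulation (ζ : Plane) (f : L2C) :
    (𝓕 (mul (memLp_char ζ).toLp f) : L2C) =ᵐ[volume] fun ξ => (𝓕 f : L2C) (ξ - ζ) := by
  have key : (𝓕 (mul (memLp_char ζ).toLp f) : L2C) = translL ζ (𝓕 f) := by
    revert f
    apply schwartz_induction
    · apply isClosed_eq
      · exact (Lp.fourierTransformₗᵢ Plane ℂ).continuous.comp (mul _).continuous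
      · exact (translL ζ).continuous.comp (Lp.fourierTransformₗᵢ Plane ℂ).continuous
    · intro φ
      have h1 : mul (memLp_char ζ).toLp (φ.toLp 2) = 𝓕⁻ (translL ζ (𝓕 (φ.toLp 2))) := by
        rw [SchwartzMap.toLp_fourier_eq]
        have h2 : translL ζ ((𝓕 φ).toLp 2) = (SchwartzMap.compSubConstCLM ℂ ζ (𝓕 φ)).toLp 2 := by
          apply Lp.ext
          have h5 := (measurePreserving_sub_right (volume : Measure Plane) ζ).quasiMeasurePreserving.ae_eq_comp
            ((𝓕 φ).coeFn_toLp 2 volume)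
          filter_upwards [coeFn_translL ζ ((𝓕 φ).toLp 2), h5,
            (SchwartzMap.compSubConstCLM ℂ ζ (𝓕 φ)).coeFn_toLp 2] with x h6 h7 h8
          simp only [Function.comp_apply] at h7
          rw [h6, h7, h8]; simp
        rw [h2, SchwartzMap.toLp_fourierInv_eq]
        apply Lp.ext
        filter_upwards [coeFn_mul (memLp_char ζ).toLp (φ.toLp 2), (memLp_char ζ).coeFn_toLp,
          φ.coeFn_toLp 2, (𝓕⁻ (SchwartzMap.compSubConstCLM ℂ ζ (𝓕 φ))).coeFn_toLp 2] with x h3 h4 h5 h6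
        rw [h3, h4, h5, h6, SchwartzMap.fourierInv_coe, Real.fourierInv_eq]
        have h9 : φ x = (𝓕⁻ (𝓕 φ)) x := by rw [FourierTransform.fourierInv_fourier_eq]
        rw [h9, SchwartzMap.fourierInv_coe, Real.fourierInv_eq,
          ← integral_sub_right_eq_self _ ζ, ← integral_const_mul]
        congr with v
        simp only [SchwartzMap.compSubConstCLM_apply, Circle.smul_def, smul_eq_mul, inner_sub_left]
        rw [← mul_assoc]
        congr 1
        rw [← Circle.coe_mul, ← AddChar.map_add_eq_mul]
        congr 2
        ring
      rw [h1]
      exact FourierTransform.fourier_fourierInv_eq _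
  rw [key]
  exact coeFn_translL ζ (𝓕 f)

/-! ### Superpositions of plane waves -/

/-- `w` is the superposition `∫ e^{2πi ζ·x} g(ζ) dν(ζ)` of plane waves. -/
structure FRep (w : Linf) (ν : Measure Plane) (g : Plane → ℂ) : Prop where
  sfin : SFinite ν
  integrable : Integrable g ν
  eq : w =ᵐ[volume] fun x => ∫ ζ, (Real.fourierChar (inner ℝ ζ x) : ℂ) * g ζ ∂ν

theorem integrable_conj_mul (f h : L2C) : Integrable (fun x => conj (h x) * f x) volume := by
  have := L2.integrable_inner (𝕜 := ℂ) h f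
  refine this.congr ?_
  filter_upwards with x
  simp [mul_comm]

/-- The pairing of a product, on the Fourier side. -/
theorem FRep.inner_mul {w : Linf} {ν : Measure Plane} {g : Plane → ℂ} (H : FRep w ν g)
    (h f : L2C) :
    inner ℂ h (mul w f) =
      ∫ ζ, g ζ * (∫ ξ, conj ((𝓕 h : L2C) ξ) * (𝓕 f : L2C) (ξ - ζ)) ∂ν := by
  have := H.sfin
  have h1 : ∀ ζ, ∫ ξ, conj ((𝓕 h : L2C) ξ) * (𝓕 f : L2C) (ξ - ζ) =
      ∫ x, conj (h x) * ((Real.fourierChar (inner ℝ ζ x) : ℂ) * f x) := by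
    intro ζ
    have h2 := inner_fourier h (mul (memLp_char ζ).toLp f)
    rw [inner_eq_integral] at h2
    have h3 : ∫ ξ, conj ((𝓕 h : L2C) ξ) * (𝓕 f : L2C) (ξ - ζ) =
        ∫ ξ, conj ((𝓕 h : L2C) ξ) * (𝓕 (mul (memLp_char ζ).toLp f) : L2C) ξ := by
      apply integral_congr_ae
      filter_upwards [fourier_modulation ζ f] with ξ hξ
      rw [hξ]
    rw [h3, ← h2]
    apply integral_congr_ae
    filter_upwards [coeFn_mul (memLp_char ζ).toLp f, (memLp_char ζ).coeFn_toLp] with x h4 h5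
    rw [h4, h5]
  simp_rw [h1]
  have h2 : inner ℂ h (mul w f) = ∫ x, ∫ ζ, (conj (h x) * f x) *
      ((Real.fourierChar (inner ℝ ζ x) : ℂ) * g ζ) ∂ν := by
    rw [inner_eq_integral]
    apply integral_congr_ae
    filter_upwards [coeFn_mul w f, H.eq] with x h4 h5
    rw [h4, h5, integral_const_mul]; ring
  rw [h2, integral_integral_swap]
  · congr with ζ
    rw [← integral_const_mul]
    congr with x
    ring
  · have h3 := (integrable_conj_mul f h).mul_prod H.integrable
    have h4 : AEStronglyMeasurable (fun z : Plane × Plane =>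
        (Real.fourierChar (inner ℝ z.2 z.1) : ℂ)) (volume.prod ν) :=
      Continuous.aestronglyMeasurable (by fun_prop)
    have h5 := h3.bdd_mul (c := 1) h4 (by filter_upwards with z; exact (Circle.norm_coe _).le)
    refine h5.congr ?_
    filter_upwards with z
    change _ = (conj (h z.1) * f z.1) * ((Real.fourierChar (inner ℝ z.2 z.1) : ℂ) * g z.2)
    ring

/-! ### The weights `⟨ξ⟩^r` -/

/-- The weight `⟨ξ⟩^r = (1 + |ξ|²)^{r/2}`. -/
noncomputable def jb (r : ℝ) (ξ : Plane) : ℝ := (1 + ‖ξ‖ ^ 2) ^ (r / 2)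

theorem jb_pos (r : ℝ) (ξ : Plane) : 0 < jb r ξ := by unfold jb; positivity

theorem continuous_jb (r : ℝ) : Continuous (jb r) := by
  unfold jb
  exact Continuous.rpow_const (by fun_prop) (fun x => Or.inl (by positivity))

theorem jb_neg_arg (r : ℝ) (ξ : Plane) : jb r (-ξ) = jb r ξ := by simp [jb]

theorem jb_mul (r t : ℝ) (ξ : Plane) : jb r ξ * jb t ξ = jb (r + t) ξ := by
  unfold jb
  rw [← Real.rpow_add (by positivity)]; ring_nf

@[simp] theorem jb_zero (ξ : Plane) : jb 0 ξ = 1 := by simp [jb]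

theorem jb_two (ξ : Plane) : jb 2 ξ = 1 + ‖ξ‖ ^ 2 := by simp [jb]

theorem jb_mono {r t : ℝ} (h : r ≤ t) (ξ : Plane) : jb r ξ ≤ jb t ξ := by
  unfold jb
  apply Real.rpow_le_rpow_of_exponent_le
  · nlinarith [sq_nonneg ‖ξ‖]
  · linarith

theorem jb_le_one {r : ℝ} (h : r ≤ 0) (ξ : Plane) : jb r ξ ≤ 1 := by
  simpa using jb_mono h ξ

theorem one_le_jb {r : ℝ} (h : 0 ≤ r) (ξ : Plane) : 1 ≤ jb r ξ := by
  simpa using jb_mono h ξ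

theorem jb_eq_rpow (r : ℝ) (ξ : Plane) : jb r ξ = jb 1 ξ ^ r := by
  unfold jb
  rw [← Real.rpow_mul (by positivity)]; ring_nf

theorem jb_one_sq (ξ : Plane) : jb 1 ξ ^ 2 = 1 + ‖ξ‖ ^ 2 := by
  rw [← jb_two, jb_eq_rpow 2]; norm_num

theorem norm_le_jb_one (ξ : Plane) : ‖ξ‖ ≤ jb 1 ξ := by
  have := jb_one_sq ξ
  nlinarith [jb_pos 1 ξ, norm_nonneg ξ]

theorem abs_jb_one_sub_le (ξ η : Plane) : |jb 1 ξ - jb 1 η| ≤ jb 1 (ξ - η) := by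
  refine le_trans ?_ (norm_le_jb_one _)
  have h1 := jb_one_sq ξ
  have h2 := jb_one_sq η
  have h3 := norm_le_jb_one ξ
  have h4 := norm_le_jb_one η
  have h5 : |‖ξ‖ - ‖η‖| ≤ ‖ξ - η‖ := abs_norm_sub_norm_le ξ η
  refine le_trans ?_ h5
  have e : (jb 1 ξ - jb 1 η) * (jb 1 ξ + jb 1 η) = (‖ξ‖ - ‖η‖) * (‖ξ‖ + ‖η‖) := by nlinarith
  have p1 := jb_pos 1 ξ
  have p2 := jb_pos 1 η
  have e2 := congrArg abs e
  rw [abs_mul, abs_mul, abs_of_pos (by positivity : 0 < jb 1 ξ + jb 1 η),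
    abs_of_nonneg (by positivity : 0 ≤ ‖ξ‖ + ‖η‖)] at e2
  by_contra hcon
  push Not at hcon
  have : |‖ξ‖ - ‖η‖| * (‖ξ‖ + ‖η‖) ≤ |‖ξ‖ - ‖η‖| * (jb 1 ξ + jb 1 η) := by gcongr
  nlinarith

/-- Peetre's inequality. -/
theorem jb_peetre {r : ℝ} (hr : 0 ≤ r) (ξ ζ : Plane) :
    jb r ξ ≤ 2 ^ r * (jb r ζ * jb r (ξ - ζ)) := by
  have h := abs_jb_one_sub_le ξ (ξ - ζ)
  rw [sub_sub_cancel] at h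
  have h1 := one_le_jb zero_le_one ζ
  have h2 := one_le_jb zero_le_one (ξ - ζ)
  have h3 : jb 1 ξ ≤ 2 * (jb 1 ζ * jb 1 (ξ - ζ)) := by nlinarith [abs_le.1 h]
  rw [jb_eq_rpow r ξ, jb_eq_rpow r ζ, jb_eq_rpow r (ξ - ζ),
    ← Real.mul_rpow (by linarith) (by linarith), ← Real.mul_rpow (by linarith) (by positivity)]
  exact Real.rpow_le_rpow (jb_pos _ _).le h3 hr

theorem jb_le_add {r : ℝ} (hr : 0 ≤ r) (ξ ζ : Plane) :
    jb r ξ ≤ 2 ^ r * (jb r ζ + jb r (ξ - ζ)) := by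
  have h := abs_jb_one_sub_le ξ (ξ - ζ)
  rw [sub_sub_cancel] at h
  have h1 := jb_pos 1 ζ
  have h2 := jb_pos 1 (ξ - ζ)
  have h3 : jb 1 ξ ≤ 2 * max (jb 1 ζ) (jb 1 (ξ - ζ)) := by
    nlinarith [abs_le.1 h, le_max_left (jb 1 ζ) (jb 1 (ξ - ζ)), le_max_right (jb 1 ζ) (jb 1 (ξ - ζ))]
  have h4 : jb r ξ ≤ 2 ^ r * (max (jb 1 ζ) (jb 1 (ξ - ζ))) ^ r := by
    rw [jb_eq_rpow r ξ, ← Real.mul_rpow (by norm_num) (by positivity)]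
    exact Real.rpow_le_rpow (jb_pos _ _).le h3 hr
  refine h4.trans ?_
  gcongr
  rcases max_cases (jb 1 ζ) (jb 1 (ξ - ζ)) with ⟨h5, -⟩ | ⟨h5, -⟩ <;> rw [h5, ← jb_eq_rpow]
  · linarith [jb_pos r (ξ - ζ)]
  · linarith [jb_pos r ζ]

theorem bddSym_jb {r : ℝ} (hr : r ≤ 0) : BddSym (jb r) :=
  ⟨(continuous_jb r).measurable, 1, fun ξ => by
    rw [abs_of_pos (jb_pos _ _)]; exact jb_le_one hr ξ⟩

/-- The weight `⟨ξ⟩^r` truncated to frequencies `|ξ| ≤ k`. -/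
noncomputable def jbk (r : ℝ) (k : ℕ) (ξ : Plane) : ℝ := if ‖ξ‖ ≤ k then jb r ξ else 0

theorem jbk_nonneg (r : ℝ) (k : ℕ) (ξ : Plane) : 0 ≤ jbk r k ξ := by
  unfold jbk; split_ifs
  · exact (jb_pos _ _).le
  · exact le_rfl

theorem jbk_le (r : ℝ) (k : ℕ) (ξ : Plane) : jbk r k ξ ≤ jb r ξ := by
  unfold jbk; split_ifs
  · exact le_rfl
  · exact (jb_pos _ _).le

theorem jbk_neg_arg (r : ℝ) (k : ℕ) (ξ : Plane) : jbk r k (-ξ) = jbk r k ξ := by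
  simp [jbk, jb_neg_arg]

theorem bddSym_jbk (r : ℝ) (k : ℕ) : BddSym (jbk r k) := by
  refine ⟨?_, jb |r| (EuclideanSpace.single 0 (k : ℝ)), fun ξ => ?_⟩
  · exact Measurable.ite (measurableSet_le measurable_norm measurable_const)
      (continuous_jb r).measurable measurable_const
  · rw [abs_of_nonneg (jbk_nonneg _ _ _)]
    unfold jbk
    split_ifs with h
    · refine (jb_mono (le_abs_self r) ξ).trans ?_
      unfold jb
      apply Real.rpow_le_rpow (by positivity) _ (by positivity)
      simp only [PiLp.norm_single, Real.norm_natCast]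
      gcongr
    · exact (jb_pos _ _).le

theorem jbk_mul_jbk (r t : ℝ) (k : ℕ) (ξ : Plane) : jbk r k ξ * jbk t k ξ = jbk (r + t) k ξ := by
  unfold jbk; split_ifs
  · exact jb_mul r t ξ
  · simp

theorem jb_mul_jbk (r t : ℝ) (k : ℕ) (ξ : Plane) : jb r ξ * jbk t k ξ = jbk (r + t) k ξ := by
  unfold jbk; split_ifs
  · exact jb_mul r t ξ
  · simp

theorem D_jb_jb {r t : ℝ} (hr : r ≤ 0) (ht : t ≤ 0) (f : L2C) :
    D (jb r) (D (jb t) f) = D (jb (r + t)) f := by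
  rw [D_D (bddSym_jb hr) (bddSym_jb ht)]; simp_rw [jb_mul]

theorem D_jb_jbk {r : ℝ} (hr : r ≤ 0) (t : ℝ) (k : ℕ) (f : L2C) :
    D (jb r) (D (jbk t k) f) = D (jbk (r + t) k) f := by
  rw [D_D (bddSym_jb hr) (bddSym_jbk t k)]; simp_rw [jb_mul_jbk]

theorem D_jbk_jb {r : ℝ} (hr : r ≤ 0) (t : ℝ) (k : ℕ) (f : L2C) :
    D (jbk t k) (D (jb r) f) = D (jbk (t + r) k) f := by
  rw [D_comm (bddSym_jbk t k) (bddSym_jb hr), D_jb_jbk hr, add_comm]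

theorem D_jbk_jbk (r t : ℝ) (k : ℕ) (f : L2C) :
    D (jbk r k) (D (jbk t k) f) = D (jbk (r + t) k) f := by
  rw [D_D (bddSym_jbk r k) (bddSym_jbk t k)]; simp_rw [jbk_mul_jbk]

theorem bddSym_one : BddSym (fun _ => 1) := ⟨measurable_const, 1, by simp⟩

theorem D_one (f : L2C) : D (fun _ => 1) f = f := by
  apply ext_fourier
  filter_upwards [fourier_D bddSym_one f] with x h
  rw [h]; simp

theorem D_jb_zero (f : L2C) : D (jb 0) f = f := by
  have : jb 0 = fun _ => 1 := by ext; simp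
  rw [this, D_one]

theorem D_jb_injective {r : ℝ} (hr : r ≤ 0) {f g : L2C} (h : D (jb r) f = D (jb r) g) : f = g := by
  apply ext_fourier
  have h1 := fourier_D (bddSym_jb hr) f
  rw [h] at h1
  filter_upwards [h1, fourier_D (bddSym_jb hr) g] with x h2 h3
  rw [h2] at h3
  have : (jb r x : ℂ) ≠ 0 := by exact_mod_cast (jb_pos r x).ne'
  exact mul_left_cancel₀ this h3

/-! ### Elements of `H^r` as Bessel potentials -/

/-- `f ∈ H^r` with norm at most `C`, for `r ≥ 0`: `f = ⟨D⟩^{-r} F` with `‖F‖ ≤ C`. -/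
def Sob (r C : ℝ) (f : L2C) : Prop := ∃ F : L2C, ‖F‖ ≤ C ∧ D (jb (-r)) F = f

theorem enorm_eq_lintegral (f : L2C) : ‖f‖ₑ = (∫⁻ ξ, ‖(𝓕 f : L2C) ξ‖ₑ ^ (2 : ℝ)) ^ (1 / 2 : ℝ) := by
  have h1 : ‖f‖ₑ = ‖(𝓕 f : L2C)‖ₑ := by
    rw [← ofReal_norm, ← ofReal_norm, Lp.norm_fourier_eq]
  rw [h1, Lp.enorm_def, eLpNorm_eq_lintegral_rpow_enorm_toReal (by norm_num) (by norm_num)]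
  simp

theorem sobolevNorm_D_jb {r : ℝ} (hr : 0 ≤ r) (F : L2C) :
    sobolevNorm r (D (jb (-r)) F) = ‖F‖ₑ := by
  have h1 : ‖F‖ₑ = ‖(𝓕 F : L2C)‖ₑ := by
    rw [← ofReal_norm, ← ofReal_norm, Lp.norm_fourier_eq]
  rw [h1, Lp.enorm_def, sobolevNorm]
  apply eLpNorm_congr_ae
  filter_upwards [fourier_D (bddSym_jb (by linarith : -r ≤ 0)) F] with x hx
  have h2 : jb r x * jb (-r) x = 1 := by rw [jb_mul]; simp
  rw [hx, ← mul_assoc]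
  have h3 : (((1 + ‖x‖ ^ 2) ^ (r / 2) : ℝ) : ℂ) * (jb (-r) x : ℂ) = ((jb r x * jb (-r) x : ℝ) : ℂ) := by
    push_cast [jb]; rfl
  rw [h3, h2]; simp

theorem Sob.sobolevNorm_le {r C : ℝ} (hr : 0 ≤ r) {f : L2C} (h : Sob r C f) :
    sobolevNorm r f ≤ ENNReal.ofReal C := by
  obtain ⟨F, hF, rfl⟩ := h
  rw [sobolevNorm_D_jb hr, ← ofReal_norm]
  exact ENNReal.ofReal_le_ofReal hF

theorem sob_of_sobolevNorm_le {r C : ℝ} (hC : 0 ≤ C) {f : L2C}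
    (hr : 0 ≤ r) (h : sobolevNorm r f ≤ ENNReal.ofReal C) : Sob r C f := by
  have hm : MemLp (fun ξ : Plane => (jb r ξ : ℂ) * (𝓕 f : L2C) ξ) 2 volume := by
    refine ⟨?_, lt_of_le_of_lt h ENNReal.ofReal_lt_top⟩
    exact ((Complex.continuous_ofReal.comp (continuous_jb r)).aestronglyMeasurable).mul
      (Lp.aestronglyMeasurable _)
  let G : L2C := hm.toLp
  have e : (𝓕 (𝓕⁻ G : L2C) : L2C) = G := FourierTransform.fourier_fourierInv_eq _
  have e2 : D (jb (-r)) (𝓕⁻ G) = f := by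
    apply ext_fourier
    filter_upwards [fourier_D (bddSym_jb (by linarith : -r ≤ 0)) (𝓕⁻ G), hm.coeFn_toLp] with x h1 h2
    rw [h1, e, h2, ← mul_assoc, ← Complex.ofReal_mul, jb_mul]; simp
  refine ⟨𝓕⁻ G, ?_, e2⟩
  rw [← e2, sobolevNorm_D_jb hr, ← ofReal_norm] at h
  exact (ENNReal.ofReal_le_ofReal_iff hC).1 h

theorem Sob.nonneg {r C : ℝ} {f : L2C} (h : Sob r C f) : 0 ≤ C := by
  obtain ⟨F, hF, -⟩ := h
  exact (norm_nonneg F).trans hF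

theorem Sob.add {r C C' : ℝ} {f g : L2C} (hf : Sob r C f) (hg : Sob r C' g) :
    Sob r (C + C') (f + g) := by
  obtain ⟨F, hF, rfl⟩ := hf
  obtain ⟨G, hG, rfl⟩ := hg
  exact ⟨F + G, (norm_add_le _ _).trans (add_le_add hF hG), map_add _ _ _⟩

theorem Sob.smul {r C : ℝ} {f : L2C} (hf : Sob r C f) (c : ℂ) : Sob r (‖c‖ * C) (c • f) := by
  obtain ⟨F, hF, rfl⟩ := hf
  exact ⟨c • F, by rw [norm_smul]; gcongr, map_smul _ _ _⟩

theorem Sob.neg {r C : ℝ} {f : L2C} (hf : Sob r C f) : Sob r C (-f) := by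
  obtain ⟨F, hF, rfl⟩ := hf
  exact ⟨-F, by rwa [norm_neg], map_neg _ _⟩

theorem Sob.sub {r C C' : ℝ} {f g : L2C} (hf : Sob r C f) (hg : Sob r C' g) :
    Sob r (C + C') (f - g) := by
  rw [sub_eq_add_neg]; exact hf.add hg.neg

theorem Sob.conj {r C : ℝ} (hr : 0 ≤ r) {f : L2C} (hf : Sob r C f) : Sob r C (conjL f) := by
  obtain ⟨F, hF, rfl⟩ := hf
  exact ⟨conjL F, by rwa [norm_conjL], D_conjL (bddSym_jb (by linarith)) (jb_neg_arg _) F⟩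

theorem Sob.mono {r C C' : ℝ} {f : L2C} (hf : Sob r C f) (h : C ≤ C') : Sob r C' f := by
  obtain ⟨F, hF, rfl⟩ := hf
  exact ⟨F, hF.trans h, rfl⟩

theorem Sob.of_le {r r' C : ℝ} {f : L2C} (hr' : 0 ≤ r') (h : r' ≤ r) (hf : Sob r C f) :
    Sob r' C f := by
  obtain ⟨F, hF, rfl⟩ := hf
  refine ⟨D (jb (r' - r)) F, ?_, ?_⟩
  · refine (norm_D_le (C := 1) (continuous_jb _).measurable (fun ξ => ?_) F).trans (by linarith)
    rw [abs_of_pos (jb_pos _ _)]; exact jb_le_one (by linarith) ξ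
  · rw [D_jb_jb (by linarith) (by linarith)]; congr 2; ring_nf

theorem Sob.norm_le {r C : ℝ} (hr : 0 ≤ r) {f : L2C} (hf : Sob r C f) : ‖f‖ ≤ C := by
  obtain ⟨F, hF, h⟩ := hf.of_le le_rfl hr
  rw [neg_zero, D_jb_zero] at h
  rwa [← h]

/-- A multiplier of order `t` maps `H^r` to `H^{r-t}`. -/
theorem Sob.multiplier {r t c C : ℝ} {m : Plane → ℝ} (hm : BddSym m) (hr : 0 ≤ r) (ht : t ≤ r)
    (hc : ∀ ξ, |m ξ| ≤ c * jb t ξ) {f : L2C} (hf : Sob r C f) :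
    Sob (r - t) (c * C) (D m f) := by
  obtain ⟨F, hF, rfl⟩ := hf
  have hb : ∀ ξ, |m ξ * jb (-t) ξ| ≤ c := by
    intro ξ
    rw [abs_mul, abs_of_pos (jb_pos _ _)]
    calc _ ≤ c * jb t ξ * jb (-t) ξ := by gcongr; exacts [(jb_pos _ _).le, hc ξ]
      _ = c := by rw [mul_assoc, jb_mul]; simp
  have hmeas : Measurable (fun ξ => m ξ * jb (-t) ξ) := hm.meas.mul (continuous_jb _).measurable
  have hs : BddSym (fun ξ => m ξ * jb (-t) ξ) := ⟨hmeas, c, hb⟩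
  have hc0 : 0 ≤ c := (abs_nonneg _).trans (hb 0)
  refine ⟨D (fun ξ => m ξ * jb (-t) ξ) F, ?_, ?_⟩
  · exact (norm_D_le hmeas hb F).trans (by gcongr)
  · rw [D_D (bddSym_jb (by linarith)) hs, D_D hm (bddSym_jb (by linarith))]
    congr 2
    ext ξ
    rw [mul_comm, mul_assoc, jb_mul]; ring_nf

theorem sob_of_forall_jbk {r C : ℝ} (hr : 0 ≤ r) (hC : 0 ≤ C) {f : L2C}
    (h : ∀ k : ℕ, ‖D (jbk r k) f‖ ≤ C) : Sob r C f := by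
  apply sob_of_sobolevNorm_le hC hr
  have h1 : ∀ k : ℕ, eLpNorm (fun ξ : Plane => ((jbk r k ξ : ℝ) : ℂ) * (𝓕 f : L2C) ξ) 2 volume
      ≤ ENNReal.ofReal C := by
    intro k
    rw [← eLpNorm_congr_ae (fourier_D (bddSym_jbk r k) f), ← Lp.enorm_def, ← ofReal_norm,
      Lp.norm_fourier_eq]
    exact ENNReal.ofReal_le_ofReal (h k)
  refine (Lp.eLpNorm_lim_le_liminf_eLpNorm (f := fun (k : ℕ) (ξ : Plane) =>
    ((jbk r k ξ : ℝ) : ℂ) * (𝓕 f : L2C) ξ) (fun k => ?_) _ ?_).trans ?_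
  · exact ((Complex.measurable_ofReal.comp (bddSym_jbk r k).meas).aestronglyMeasurable).mul
      (Lp.aestronglyMeasurable _)
  · filter_upwards with ξ
    apply tendsto_const_nhds.congr'
    obtain ⟨N, hN⟩ := exists_nat_ge ‖ξ‖
    filter_upwards [Filter.eventually_ge_atTop N] with k hk
    have : ‖ξ‖ ≤ k := hN.trans (by exact_mod_cast hk)
    simp [jbk, this, jb]
  · refine Filter.liminf_le_of_le (by isBoundedDefault) ?_
    intro b hb
    obtain ⟨k, hk⟩ := hb.exists
    exact hk.trans (h1 k)

/-- Duality: `f` is in `H^r` if `⟨D⟩^r f`, truncated in frequency, is bounded as a functional on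
`L²`, uniformly in the truncation. -/
theorem sob_of_forall_inner {r C : ℝ} (hr : 0 ≤ r) (hC : 0 ≤ C) {f : L2C}
    (h : ∀ (k : ℕ) (g : L2C), ‖inner ℂ (D (jbk r k) g) f‖ ≤ C * ‖g‖) : Sob r C f := by
  apply sob_of_forall_jbk hr hC
  intro k
  have := h k (D (jbk r k) f)
  rw [inner_D (bddSym_jbk r k), inner_self_eq_norm_sq_to_K] at this
  have e : ‖((‖D (jbk r k) f‖ : ℂ)) ^ 2‖ = ‖D (jbk r k) f‖ ^ 2 := by simp
  have e' : ‖((RCLike.ofReal ‖D (jbk r k) f‖ : ℂ)) ^ 2‖ = ‖D (jbk r k) f‖ ^ 2 := e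
  rw [e'] at this
  by_contra hcon
  push Not at hcon
  nlinarith [norm_nonneg (D (jbk r k) f)]

/-- Bounds in `H^r` pass to limits in a weaker norm. -/
theorem sob_of_tendsto {r C : ℝ} (hr : 0 ≤ r) {f : ℕ → L2C} {g : L2C}
    (h : ∀ k, Sob r C (f k)) (hl : Filter.Tendsto f Filter.atTop (nhds g)) : Sob r C g := by
  apply sob_of_forall_jbk hr (h 0).nonneg
  intro k
  have h1 : Filter.Tendsto (fun n => ‖D (jbk r k) (f n)‖) Filter.atTop (nhds ‖D (jbk r k) g‖) :=
    (((D (jbk r k)).continuous.tendsto g).comp hl).norm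
  refine le_of_tendsto' h1 (fun n => ?_)
  obtain ⟨F, hF, hf⟩ := h n
  rw [← hf, D_jbk_jb (by linarith), add_neg_cancel]
  refine (norm_D_le (C := 1) (bddSym_jbk _ _).meas (fun ξ => ?_) F).trans (by linarith)
  rw [abs_of_nonneg (jbk_nonneg _ _ _)]
  exact (jbk_le _ _ _).trans (by simp)

/-- Interpolation: `‖⟨D⟩^t F‖` is small if `F` is small in `L²` and bounded in `H^r`, `r > t`. -/
theorem norm_interpolation {p q : ℝ} (hq : 0 < q) (hqp : q ≤ p) {ε : ℝ} (hε : 0 < ε) :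
    ∃ K : ℝ, 0 ≤ K ∧ ∀ F : L2C, ‖D (jb (-q)) F‖ ≤ ε * ‖F‖ + K * ‖D (jb (-p)) F‖ := by
  -- split the frequencies according to whether `⟨ξ⟩^{-q} ≤ ε`
  set S : ℝ := ε ^ (-(1 / q)) with hS
  have hSpos : 0 < S := by positivity
  refine ⟨S ^ (p - q), by positivity, fun F => ?_⟩
  let m : Plane → ℝ := fun ξ => if jb (-q) ξ ≤ ε then jb (-q) ξ else 0
  let n : Plane → ℝ := fun ξ => if jb (-q) ξ ≤ ε then 0 else jb (p - q) ξ
  have hset : MeasurableSet {ξ | jb (-q) ξ ≤ ε} :=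
    measurableSet_le (continuous_jb _).measurable measurable_const
  have mm : Measurable m := Measurable.ite hset (continuous_jb _).measurable measurable_const
  have mn : Measurable n := Measurable.ite hset measurable_const (continuous_jb _).measurable
  have bm : ∀ ξ, |m ξ| ≤ ε := by
    intro ξ
    simp only [m]
    split_ifs with h
    · rwa [abs_of_pos (jb_pos _ _)]
    · simpa using hε.le
  have bn : ∀ ξ, |n ξ| ≤ S ^ (p - q) := by
    intro ξ
    simp only [n]
    split_ifs with h
    · simp; positivity
    · rw [abs_of_pos (jb_pos _ _), jb_eq_rpow]
      apply Real.rpow_le_rpow (jb_pos _ _).le _ (by linarith)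
      push Not at h
      rw [jb_eq_rpow] at h
      have h2 := Real.rpow_lt_rpow_of_neg hε h (by have := one_div_pos.2 hq; linarith : -(1 / q) < 0)
      rw [← Real.rpow_mul (jb_pos _ _).le] at h2
      have : -q * -(1 / q) = 1 := by field_simp
      rw [this, Real.rpow_one] at h2
      exact h2.le
  have sm : BddSym m := ⟨mm, ε, bm⟩
  have sn : BddSym n := ⟨mn, _, bn⟩
  have e : D (jb (-q)) F = D m F + D n (D (jb (-p)) F) := by
    rw [D_D sn (bddSym_jb (by linarith))]
    apply ext_fourier
    have h0 : (𝓕 (D m F + D (fun ξ => n ξ * jb (-p) ξ) F) : L2C) = 𝓕 (D m F) +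
      𝓕 (D (fun ξ => n ξ * jb (-p) ξ) F) := (Lp.fourierTransformₗᵢ Plane ℂ).map_add _ _
    rw [h0]
    filter_upwards [fourier_D (bddSym_jb (by linarith : -q ≤ 0)) F, fourier_D sm F,
      fourier_D (sn.mul (bddSym_jb (by linarith : -p ≤ 0))) F,
      Lp.coeFn_add (𝓕 (D m F) : L2C) (𝓕 (D (fun ξ => n ξ * jb (-p) ξ) F))] with x h1 h2 h3 h4
    rw [h4, Pi.add_apply, h1, h2, h3]
    simp only [m, n]
    split_ifs with h
    · simp
    · simp only [Complex.ofReal_zero, zero_mul, zero_add]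
      rw [jb_mul]; ring_nf
  rw [e]
  refine (norm_add_le _ _).trans (add_le_add (norm_D_le mm bm F) (norm_D_le mn bn _))

/-! ### Convolution inequalities -/

/-- The `L²` norm of a nonnegative function. -/
noncomputable def nrm2 (A : Plane → ℝ≥0∞) : ℝ≥0∞ := (∫⁻ ξ, A ξ ^ (2 : ℝ)) ^ (1 / 2 : ℝ)

theorem lintegral_mul_le_nrm2 {A B : Plane → ℝ≥0∞} (hA : Measurable A) (hB : Measurable B) :
    ∫⁻ ξ, A ξ * B ξ ≤ nrm2 A * nrm2 B :=
  ENNReal.lintegral_mul_le_Lp_mul_Lq volume Real.HolderConjugate.two_two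
    hA.aemeasurable hB.aemeasurable

theorem nrm2_comp_sub (B : Plane → ℝ≥0∞) (ζ : Plane) : nrm2 (fun ξ => B (ξ - ζ)) = nrm2 B := by
  unfold nrm2
  rw [lintegral_sub_right_eq_self (fun ξ => B ξ ^ (2 : ℝ)) ζ]

theorem nrm2_comp_sub_left (B : Plane → ℝ≥0∞) (ξ : Plane) : nrm2 (fun ζ => B (ξ - ζ)) = nrm2 B := by
  unfold nrm2
  rw [lintegral_sub_left_eq_self (fun ξ => B ξ ^ (2 : ℝ)) ξ]

/-- Young's inequality for a trilinear form, with the first factor in `L¹(ν)`. -/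
theorem young_left {ν : Measure Plane} (A : Plane → ℝ≥0∞) {H B : Plane → ℝ≥0∞}
    (hA : Measurable A) (hH : Measurable H) (hB : Measurable B) :
    ∫⁻ ζ, A ζ * (∫⁻ ξ, H ξ * B (ξ - ζ)) ∂ν ≤ (∫⁻ ζ, A ζ ∂ν) * (nrm2 H * nrm2 B) := by
  rw [← lintegral_mul_const _ hA]
  refine lintegral_mono fun ζ => ?_
  dsimp only
  gcongr
  rw [← nrm2_comp_sub B ζ]
  exact lintegral_mul_le_nrm2 hH (hB.comp (measurable_id.sub_const ζ))

theorem lintegral_trilinear_swap {A H B : Plane → ℝ≥0∞}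
    (hA : Measurable A) (hH : Measurable H) (hB : Measurable B) :
    ∫⁻ ζ, A ζ * (∫⁻ ξ, H ξ * B (ξ - ζ)) = ∫⁻ ξ, H ξ * (∫⁻ ζ, A ζ * B (ξ - ζ)) := by
  have h1 : ∀ ζ, A ζ * (∫⁻ ξ, H ξ * B (ξ - ζ)) = ∫⁻ ξ, A ζ * (H ξ * B (ξ - ζ)) := fun ζ => by
    rw [lintegral_const_mul]; exact hH.mul (hB.comp (measurable_id.sub_const ζ))
  have h2 : ∀ ξ, H ξ * (∫⁻ ζ, A ζ * B (ξ - ζ)) = ∫⁻ ζ, A ζ * (H ξ * B (ξ - ζ)) := fun ξ => by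
    rw [← lintegral_const_mul]
    · congr with ζ; ring
    · exact hA.mul (hB.comp (measurable_const.sub measurable_id))
  simp_rw [h1, h2]
  rw [lintegral_lintegral_swap]
  apply Measurable.aemeasurable
  exact (hA.comp measurable_fst).mul ((hH.comp measurable_snd).mul
    (hB.comp (measurable_snd.sub measurable_fst)))

/-- Young's inequality for a trilinear form, with the second factor in `L¹`. -/
theorem young_mid {A H B : Plane → ℝ≥0∞}
    (hA : Measurable A) (hH : Measurable H) (hB : Measurable B) :
    ∫⁻ ζ, A ζ * (∫⁻ ξ, H ξ * B (ξ - ζ)) ≤ (∫⁻ ξ, H ξ) * (nrm2 A * nrm2 B) := by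
  rw [lintegral_trilinear_swap hA hH hB, ← lintegral_mul_const _ hH]
  refine lintegral_mono fun ξ => ?_
  dsimp only
  gcongr
  rw [← nrm2_comp_sub_left B ξ]
  exact lintegral_mul_le_nrm2 hA (hB.comp (measurable_const.sub measurable_id))

/-- Young's inequality for a trilinear form, with the third factor in `L¹`. -/
theorem young_right {A H B : Plane → ℝ≥0∞}
    (hA : Measurable A) (hH : Measurable H) (hB : Measurable B) :
    ∫⁻ ζ, A ζ * (∫⁻ ξ, H ξ * B (ξ - ζ)) ≤ (∫⁻ η, B η) * (nrm2 A * nrm2 H) := by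
  have e : ∫⁻ ζ, A ζ * (∫⁻ ξ, H ξ * B (ξ - ζ)) = ∫⁻ η, B η * (∫⁻ ξ, H ξ * A (ξ - η)) := by
    rw [lintegral_trilinear_swap hA hH hB, lintegral_trilinear_swap hB hH hA]
    congr with ξ
    rw [← lintegral_sub_left_eq_self _ ξ]
    congr with ζ
    rw [sub_sub_cancel, _root_.mul_comm (A _)]
  rw [e, _root_.mul_comm (nrm2 A)]
  exact young_left B hB hH hA

/-- `|𝓕 f|`. -/
noncomputable def fhat (f : L2C) (ξ : Plane) : ℝ≥0∞ := ‖(𝓕 f : L2C) ξ‖ₑ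

theorem measurable_fhat (f : L2C) : Measurable (fhat f) := (Lp.stronglyMeasurable _).enorm

theorem nrm2_fhat (f : L2C) : nrm2 (fhat f) = ‖f‖ₑ := (enorm_eq_lintegral f).symm

theorem fourier_D_sub {m : Plane → ℝ} (hm : BddSym m) (f : L2C) (ζ : Plane) :
    ∀ᵐ ξ, (𝓕 (D m f) : L2C) (ξ - ζ) = (m (ξ - ζ) : ℂ) * (𝓕 f : L2C) (ξ - ζ) :=
  (measurePreserving_sub_right (volume : Measure Plane) ζ).quasiMeasurePreserving.ae_eq_comp
    (fourier_D hm f)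

theorem integrable_pairing (h f : L2C) (ζ : Plane) :
    Integrable (fun ξ => conj ((𝓕 h : L2C) ξ) * (𝓕 f : L2C) (ξ - ζ)) volume := by
  refine (integrable_conj_mul (translL ζ (𝓕 f)) (𝓕 h)).congr ?_
  filter_upwards [coeFn_translL ζ (𝓕 f)] with x hx
  rw [hx]

theorem FRep.integrable_outer {w : Linf} {ν : Measure Plane} {g : Plane → ℂ} (H : FRep w ν g)
    (h f : L2C) :
    Integrable (fun ζ => g ζ * ∫ ξ, conj ((𝓕 h : L2C) ξ) * (𝓕 f : L2C) (ξ - ζ)) ν := by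
  refine H.integrable.mul_bdd (c := ‖h‖ * ‖f‖) ?_ ?_
  · have hm : StronglyMeasurable (fun z : Plane × Plane => conj ((𝓕 h : L2C) z.2) * (𝓕 f : L2C) (z.2 - z.1)) := by
      have h1 := (Lp.stronglyMeasurable (𝓕 h : L2C)).comp_measurable
        (measurable_snd : Measurable (fun z : Plane × Plane => z.2))
      have h2 := (Lp.stronglyMeasurable (𝓕 f : L2C)).comp_measurable
        ((measurable_snd.sub measurable_fst) : Measurable (fun z : Plane × Plane => z.2 - z.1))
      exact (Complex.continuous_conj.comp_stronglyMeasurable h1).mul h2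
    exact (hm.integral_prod_right (ν := volume)).aestronglyMeasurable
  · filter_upwards with ζ
    have e : ∫ ξ, conj ((𝓕 h : L2C) ξ) * (𝓕 f : L2C) (ξ - ζ) = inner ℂ (𝓕 h : L2C) (translL ζ (𝓕 f)) := by
      rw [inner_eq_integral]
      apply integral_congr_ae
      filter_upwards [coeFn_translL ζ (𝓕 f)] with x hx
      rw [hx]
    rw [e]
    refine (norm_inner_le_norm _ _).trans ?_
    rw [LinearIsometry.norm_map, Lp.norm_fourier_eq, Lp.norm_fourier_eq]

/-- The commutator bound on the Fourier side: the difference of two weighted pairings with a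
product is controlled by the difference of the symbols. -/
theorem FRep.enorm_inner_sub_le {w : Linf} {ν : Measure Plane} {g : Plane → ℂ} (H : FRep w ν g)
    (h f : L2C) {m₁ m₂ n₁ n₂ : Plane → ℝ} (hm₁ : BddSym m₁) (hm₂ : BddSym m₂) (hn₁ : BddSym n₁)
    (hn₂ : BddSym n₂) :
    ‖inner ℂ (D m₁ h) (mul w (D m₂ f)) - inner ℂ (D n₁ h) (mul w (D n₂ f))‖ₑ ≤
      ∫⁻ ζ, ‖g ζ‖ₑ * (∫⁻ ξ, ‖m₁ ξ * m₂ (ξ - ζ) - n₁ ξ * n₂ (ξ - ζ)‖ₑ *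
        (fhat h ξ * fhat f (ξ - ζ))) ∂ν := by
  rw [H.inner_mul, H.inner_mul, ← integral_sub (H.integrable_outer _ _) (H.integrable_outer _ _)]
  refine (enorm_integral_le_lintegral_enorm _).trans (lintegral_mono fun ζ => ?_)
  dsimp only
  rw [← mul_sub, enorm_mul, ← integral_sub (integrable_pairing _ _ _) (integrable_pairing _ _ _)]
  gcongr
  refine (enorm_integral_le_lintegral_enorm _).trans (lintegral_mono_ae ?_)
  filter_upwards [fourier_D hm₁ h, fourier_D hn₁ h, fourier_D_sub hm₂ f ζ, fourier_D_sub hn₂ f ζ]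
    with ξ h1 h2 h3 h4
  rw [h1, h2, h3, h4]
  have e : conj ((m₁ ξ : ℂ) * (𝓕 h : L2C) ξ) * ((m₂ (ξ - ζ) : ℂ) * (𝓕 f : L2C) (ξ - ζ)) -
      conj ((n₁ ξ : ℂ) * (𝓕 h : L2C) ξ) * ((n₂ (ξ - ζ) : ℂ) * (𝓕 f : L2C) (ξ - ζ)) =
      ((m₁ ξ * m₂ (ξ - ζ) - n₁ ξ * n₂ (ξ - ζ) : ℝ) : ℂ) *
        (conj ((𝓕 h : L2C) ξ) * (𝓕 f : L2C) (ξ - ζ)) := by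
    push_cast; simp; ring
  rw [e, enorm_mul, enorm_mul]
  have e2 : ‖((m₁ ξ * m₂ (ξ - ζ) - n₁ ξ * n₂ (ξ - ζ) : ℝ) : ℂ)‖ₑ =
      ‖m₁ ξ * m₂ (ξ - ζ) - n₁ ξ * n₂ (ξ - ζ)‖ₑ := by
    rw [← ofReal_norm, Complex.norm_real, ofReal_norm]
  rw [e2, RCLike.enorm_conj]
  rfl

/-! ### The embedding of `H²` into `L^∞` -/

/-- The `L²` norm of `⟨ξ⟩^{-q}`, finite for `q > 1`. -/
noncomputable def cq (q : ℝ) : ℝ := (nrm2 (fun ξ => ENNReal.ofReal (jb (-q) ξ))).toReal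

theorem cq_nonneg (q : ℝ) : 0 ≤ cq q := ENNReal.toReal_nonneg

theorem nrm2_jb {q : ℝ} (hq : 1 < q) :
    nrm2 (fun ξ => ENNReal.ofReal (jb (-q) ξ)) = ENNReal.ofReal (cq q) := by
  rw [cq, ENNReal.ofReal_toReal]
  unfold nrm2
  apply ENNReal.rpow_ne_top_of_nonneg (by norm_num)
  have h := integrable_rpow_neg_one_add_norm_sq (E := Plane) (μ := volume) (r := 2 * q)
    (by simp; linarith)
  have e : ∀ ξ : Plane, ENNReal.ofReal (jb (-q) ξ) ^ (2 : ℝ) =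
      ENNReal.ofReal ((1 + ‖ξ‖ ^ 2) ^ (-(2 * q) / 2)) := by
    intro ξ
    rw [ENNReal.ofReal_rpow_of_nonneg (jb_pos _ _).le (by norm_num)]
    unfold jb
    rw [← Real.rpow_mul (by positivity)]; ring_nf
  simp_rw [e]
  exact h.lintegral_lt_top.ne

theorem measurable_ofReal_jb (r : ℝ) : Measurable (fun ξ : Plane => ENNReal.ofReal (jb r ξ)) :=
  ENNReal.measurable_ofReal.comp (continuous_jb r).measurable

theorem lintegral_jb_mul_fhat_le {q : ℝ} (hq : 1 < q) (f : L2C) :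
    ∫⁻ ξ, ENNReal.ofReal (jb (-q) ξ) * fhat f ξ ≤ ENNReal.ofReal (cq q * ‖f‖) := by
  refine (lintegral_mul_le_nrm2 (measurable_ofReal_jb _) (measurable_fhat f)).trans ?_
  rw [nrm2_jb hq, nrm2_fhat, ENNReal.ofReal_mul (cq_nonneg q), ofReal_norm]

theorem fhat_D {m : Plane → ℝ} (hm : BddSym m) (f : L2C) :
    fhat (D m f) =ᵐ[volume] fun ξ => ENNReal.ofReal |m ξ| * fhat f ξ := by
  filter_upwards [fourier_D hm f] with ξ h
  rw [fhat, h, enorm_mul, fhat, ← ofReal_norm (m ξ : ℂ), Complex.norm_real, Real.norm_eq_abs]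

theorem lintegral_fhat_le {q : ℝ} (hq : 1 < q) (F : L2C) :
    ∫⁻ ξ, fhat (D (jb (-q)) F) ξ ≤ ENNReal.ofReal (cq q * ‖F‖) := by
  refine le_trans (le_of_eq ?_) (lintegral_jb_mul_fhat_le hq F)
  apply lintegral_congr_ae
  filter_upwards [fhat_D (bddSym_jb (by linarith : -q ≤ 0)) F] with ξ h
  rw [h, abs_of_pos (jb_pos _ _)]

theorem integrable_fourier {q : ℝ} (hq : 1 < q) (F : L2C) :
    Integrable (𝓕 (D (jb (-q)) F) : L2C) volume :=
  ⟨Lp.aestronglyMeasurable _, lt_of_le_of_lt (lintegral_fhat_le hq F) ENNReal.ofReal_lt_top⟩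

/-- Fourier inversion for `L²` functions with integrable Fourier transform. -/
theorem fourier_inversion_ae {f : L2C} (hf : Integrable (𝓕 f : L2C) volume) :
    f =ᵐ[volume] fun x => ∫ ζ, (Real.fourierChar (inner ℝ ζ x) : ℂ) * (𝓕 f : L2C) ζ := by
  have hcont : Continuous (fun x : Plane => ∫ ζ, (Real.fourierChar (inner ℝ ζ x) : ℂ) * (𝓕 f : L2C) ζ) := by
    refine continuous_of_dominated (bound := fun ζ => ‖(𝓕 f : L2C) ζ‖) (fun x => ?_) (fun x => ?_) hf.norm ?_
    · exact (Continuous.aestronglyMeasurable (by fun_prop)).mul (Lp.aestronglyMeasurable _)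
    · filter_upwards with ζ
      rw [norm_mul, Circle.norm_coe, one_mul]
    · filter_upwards with ζ
      fun_prop
  apply ae_eq_of_integral_contDiff_smul_eq
  · exact ((Lp.memLp f).locallyIntegrable (by norm_num))
  · exact hcont.locallyIntegrable
  intro φ hφ hc
  have hc' : HasCompactSupport (fun x => (φ x : ℂ)) := hc.comp_left Complex.ofReal_zero
  have hφ' : ContDiff ℝ ∞ (fun x => (φ x : ℂ)) := Complex.ofRealCLM.contDiff.comp hφ
  set Φ : SchwartzMap Plane ℂ := hc'.toSchwartzMap hφ' with hΦ
  have h1 : ∫ x, φ x • f x = inner ℂ (Φ.toLp 2) f := by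
    rw [inner_eq_integral]
    apply integral_congr_ae
    filter_upwards [Φ.coeFn_toLp 2] with x hx
    rw [hx, hΦ]
    change _ = conj (φ x : ℂ) * _
    simp
  rw [h1, inner_fourier, SchwartzMap.toLp_fourier_eq]
  have h2 : ∫ ξ, conj (((𝓕 Φ).toLp 2 : L2C) ξ) * (𝓕 f : L2C) ξ = ∫ ξ, conj (𝓕 Φ ξ) * (𝓕 f : L2C) ξ := by
    apply integral_congr_ae
    filter_upwards [(𝓕 Φ).coeFn_toLp 2] with x hx
    rw [hx]
  rw [h2]
  have h3 : ∀ ξ, conj (𝓕 Φ ξ) = ∫ x, (φ x : ℂ) * (Real.fourierChar (inner ℝ ξ x) : ℂ) := by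
    intro ξ
    rw [SchwartzMap.fourier_coe, Real.fourier_eq', ← integral_conj]
    congr with x
    have : Φ x = (φ x : ℂ) := rfl
    rw [this, Real.fourierChar_apply, smul_eq_mul, map_mul, Complex.conj_ofReal, mul_comm, ← Complex.exp_conj,
      real_inner_comm]
    congr 2
    simp [map_ofNat]
  simp_rw [h3]
  have hint : Integrable (fun z : Plane × Plane => (φ z.1 : ℂ) *
      ((Real.fourierChar (inner ℝ z.2 z.1) : ℂ) * (𝓕 f : L2C) z.2)) (volume.prod volume) := by
    have hi : Integrable (fun x => (φ x : ℂ)) volume :=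
      (hφ'.continuous).integrable_of_hasCompactSupport hc'
    have h4 : AEStronglyMeasurable (fun z : Plane × Plane =>
        (Real.fourierChar (inner ℝ z.2 z.1) : ℂ)) (volume.prod volume) :=
      Continuous.aestronglyMeasurable (by fun_prop)
    refine ((hi.mul_prod hf).bdd_mul (c := 1) h4
      (by filter_upwards with z; exact (Circle.norm_coe _).le)).congr ?_
    filter_upwards with z
    ring
  have h5 : ∫ x, φ x • ∫ ζ, (Real.fourierChar (inner ℝ ζ x) : ℂ) * (𝓕 f : L2C) ζ =
      ∫ x, ∫ ζ, (φ x : ℂ) * ((Real.fourierChar (inner ℝ ζ x) : ℂ) * (𝓕 f : L2C) ζ) := by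
    congr with x
    rw [integral_const_mul, Complex.real_smul]
  rw [h5, integral_integral_swap hint]
  congr with ξ
  rw [← integral_mul_const]
  congr with x
  ring

/-- The Sobolev embedding `H^q ⊆ L^∞` for `q > 1`. -/
theorem memLp_top_of_bessel {q : ℝ} (hq : 1 < q) (F : L2C) :
    MemLp (D (jb (-q)) F) ∞ volume ∧ eLpNorm (D (jb (-q)) F) ∞ volume ≤ ENNReal.ofReal (cq q * ‖F‖) := by
  have hb : ∀ᵐ x, ‖(D (jb (-q)) F) x‖ ≤ cq q * ‖F‖ := by
    filter_upwards [fourier_inversion_ae (integrable_fourier hq F)] with x hx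
    rw [hx]
    refine (norm_integral_le_integral_norm _).trans ?_
    have e : ∫ ζ, ‖(Real.fourierChar (inner ℝ ζ x) : ℂ) * (𝓕 (D (jb (-q)) F) : L2C) ζ‖ =
        ∫ ζ, ‖(𝓕 (D (jb (-q)) F) : L2C) ζ‖ := by
      congr with ζ
      rw [norm_mul, Circle.norm_coe, one_mul]
    rw [e, integral_norm_eq_lintegral_enorm (Lp.aestronglyMeasurable _)]
    exact ENNReal.toReal_le_of_le_ofReal (mul_nonneg (cq_nonneg q) (norm_nonneg _))
      (lintegral_fhat_le hq F)
  refine ⟨memLp_top_of_bound (Lp.aestronglyMeasurable _) _ hb, ?_⟩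
  rw [eLpNorm_exponent_top]
  exact eLpNormEssSup_le_of_ae_bound hb

/-- The embedding `H² → L^∞`: `emb a` is the bounded function `⟨D⟩^{-2} a`. -/
noncomputable def emb : L2C →L[ℂ] Linf :=
  LinearMap.mkContinuous
    { toFun := fun a => (memLp_top_of_bessel one_lt_two a).1.toLp
      map_add' := fun a b => by
        rw [← MemLp.toLp_add]
        apply MemLp.toLp_congr
        rw [map_add]
        exact Lp.coeFn_add _ _
      map_smul' := fun c a => by
        rw [RingHom.id_apply, ← MemLp.toLp_const_smul]
        apply MemLp.toLp_congr
        rw [map_smul]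
        exact Lp.coeFn_smul _ _ } (cq 2)
    (fun a => by
      simp only [LinearMap.coe_mk, AddHom.coe_mk, Lp.norm_toLp]
      exact ENNReal.toReal_le_of_le_ofReal (mul_nonneg (cq_nonneg 2) (norm_nonneg _))
        (memLp_top_of_bessel one_lt_two a).2)

theorem coeFn_emb (a : L2C) : emb a =ᵐ[volume] D (jb (-2)) a :=
  MemLp.coeFn_toLp (memLp_top_of_bessel one_lt_two a).1

theorem mul_emb_comm (a b : L2C) :
    mul (emb a) (D (jb (-2)) b) = mul (emb b) (D (jb (-2)) a) := by
  apply Lp.ext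
  filter_upwards [coeFn_mul (emb a) (D (jb (-2)) b), coeFn_mul (emb b) (D (jb (-2)) a),
    coeFn_emb a, coeFn_emb b] with x h1 h2 h3 h4
  rw [h1, h2, h3, h4, mul_comm]

theorem conjI_emb (a : L2C) : conjI (emb a) = emb (conjL a) := by
  apply Lp.ext
  filter_upwards [coeFn_conjI (emb a), coeFn_emb a, coeFn_emb (conjL a),
    coeFn_conjL (D (jb (-2)) a)] with x h1 h2 h3 h4
  rw [h1, h3, h2, D_conjL (bddSym_jb (by norm_num)) (jb_neg_arg _), h4]

theorem frep_emb (a : L2C) : FRep (emb a) volume (𝓕 (D (jb (-2)) a) : L2C) where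
  sfin := inferInstance
  integrable := integrable_fourier one_lt_two a
  eq := (coeFn_emb a).trans (fourier_inversion_ae (integrable_fourier one_lt_two a))

/-! ### Multipliers acting on the Sobolev scale -/

theorem bddSym_zero : BddSym (fun _ => 0) := ⟨measurable_const, 0, by simp⟩

theorem D_zero_sym (f : L2C) : D (fun _ => 0) f = 0 := by
  apply ext_fourier
  have h0 : (𝓕 (0 : L2C) : L2C) = 0 := (Lp.fourierTransformₗᵢ Plane ℂ).map_zero
  rw [h0]
  filter_upwards [fourier_D bddSym_zero f, Lp.coeFn_zero ℂ 2 (volume : Measure Plane)] with x h h2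
  rw [h, h2]; simp

/-- `w` acts by multiplication like a function of `H^r` plus a function all of whose derivatives
are bounded: every difference of two weighted pairings `⟨m₁(D) h, w m₂(D) f⟩` is bounded by the
difference of the symbols, measured against the weight `⟨ζ⟩^r` in the frequency `ζ` of `w` with a
gain of `⟨·⟩^{-q}` in one of the three frequencies. -/
structure IsMult (r q A : ℝ) (w : Linf) : Prop where
  nonneg : 0 ≤ A
  bound : ∀ (h f : L2C) (m₁ m₂ n₁ n₂ : Plane → ℝ), BddSym m₁ → BddSym m₂ → BddSym n₁ → BddSym n₂ →
    ∀ c : ℝ, 0 ≤ c → (∀ ξ ζ : Plane, |m₁ ξ * m₂ (ξ - ζ) - n₁ ξ * n₂ (ξ - ζ)| ≤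
      c * (jb r ζ * (jb (-q) ζ + jb (-q) (ξ - ζ) + jb (-q) ξ))) →
    ‖inner ℂ (D m₁ h) (mul w (D m₂ f)) - inner ℂ (D n₁ h) (mul w (D n₂ f))‖ ≤ c * A * ‖h‖ * ‖f‖

theorem IsMult.add {r q A B : ℝ} {v w : Linf} (hv : IsMult r q A v) (hw : IsMult r q B w) :
    IsMult r q (A + B) (v + w) where
  nonneg := add_nonneg hv.nonneg hw.nonneg
  bound h f m₁ m₂ n₁ n₂ k₁ k₂ k₃ k₄ c hc H := by
    have h1 := hv.bound h f m₁ m₂ n₁ n₂ k₁ k₂ k₃ k₄ c hc H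
    have h2 := hw.bound h f m₁ m₂ n₁ n₂ k₁ k₂ k₃ k₄ c hc H
    simp only [map_add, add_apply, inner_add_right]
    rw [add_sub_add_comm]
    refine (norm_add_le _ _).trans ((add_le_add h1 h2).trans (le_of_eq (by ring)))

theorem lintegral_const_mul_add_add {ν : Measure Plane} (K : ℝ≥0∞) {X Y Z : Plane → ℝ≥0∞}
    (hX : Measurable X) (hY : Measurable Y) (hZ : Measurable Z) :
    ∫⁻ ζ, K * (X ζ + Y ζ + Z ζ) ∂ν = K * (∫⁻ ζ, X ζ ∂ν + ∫⁻ ζ, Y ζ ∂ν + ∫⁻ ζ, Z ζ ∂ν) := by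
  have h1 : ∫⁻ ζ, (X ζ + Y ζ + Z ζ) ∂ν = ∫⁻ ζ, X ζ ∂ν + ∫⁻ ζ, Y ζ ∂ν + ∫⁻ ζ, Z ζ ∂ν := by
    have e2 := lintegral_add_left (μ := ν) (hX.add hY) Z
    have e3 := lintegral_add_left (μ := ν) hX Y
    rw [← e3]
    exact e2
  rw [← h1]
  exact lintegral_const_mul K ((hX.add hY).add hZ)

/-- Functions in `H^r` are multipliers: as `q > 1`, the gain `⟨·⟩^{-q}` makes one of the three Fourier
transforms integrable, and Young's inequality takes the other two in `L²`. -/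
theorem isMult_emb {r q C : ℝ} (hr : 0 ≤ r) (hq : 1 < q) {a : L2C} (ha : Sob r C (D (jb (-2)) a)) :
    IsMult r q (3 * (cq q * C)) (emb a) := by
  obtain ⟨U, hU, hUa⟩ := ha
  have hC0 : 0 ≤ C := (norm_nonneg U).trans hU
  refine ⟨by have := cq_nonneg q; positivity, fun h f m₁ m₂ n₁ n₂ k₁ k₂ k₃ k₄ c hc H => ?_⟩
  have h1 := (frep_emb a).enorm_inner_sub_le h f k₁ k₂ k₃ k₄
  rw [← hUa] at h1
  set al : Plane → ℝ≥0∞ := fun ξ => ENNReal.ofReal (jb (-q) ξ) with hal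
  have mal : Measurable al := measurable_ofReal_jb _
  have mU := measurable_fhat U
  have mh := measurable_fhat h
  have mf := measurable_fhat f
  have h2 : ∫⁻ ζ, ‖(𝓕 (D (jb (-r)) U) : L2C) ζ‖ₑ * (∫⁻ ξ, ‖m₁ ξ * m₂ (ξ - ζ) - n₁ ξ * n₂ (ξ - ζ)‖ₑ *
        (fhat h ξ * fhat f (ξ - ζ))) ≤
      ∫⁻ ζ, ENNReal.ofReal c * ((al ζ * fhat U ζ) * (∫⁻ ξ, fhat h ξ * fhat f (ξ - ζ)) +
        fhat U ζ * (∫⁻ ξ, fhat h ξ * (al (ξ - ζ) * fhat f (ξ - ζ))) +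
        fhat U ζ * (∫⁻ ξ, (al ξ * fhat h ξ) * fhat f (ξ - ζ))) := by
    apply lintegral_mono_ae
    filter_upwards [fhat_D (bddSym_jb (by linarith : -r ≤ 0)) U] with ζ hζ
    rw [← fhat, hζ, abs_of_pos (jb_pos _ _)]
    have mB : Measurable (fun ξ => fhat f (ξ - ζ)) := mf.comp (measurable_id.sub_const ζ)
    have mal' : Measurable (fun ξ => al (ξ - ζ)) := mal.comp (measurable_id.sub_const ζ)
    have h3 : ∫⁻ ξ, ‖m₁ ξ * m₂ (ξ - ζ) - n₁ ξ * n₂ (ξ - ζ)‖ₑ * (fhat h ξ * fhat f (ξ - ζ)) ≤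
        ENNReal.ofReal (c * jb r ζ) * (al ζ * (∫⁻ ξ, fhat h ξ * fhat f (ξ - ζ)) +
         (∫⁻ ξ, fhat h ξ * (al (ξ - ζ) * fhat f (ξ - ζ))) +
         (∫⁻ ξ, (al ξ * fhat h ξ) * fhat f (ξ - ζ))) := by
      have e0 : al ζ * (∫⁻ ξ, fhat h ξ * fhat f (ξ - ζ)) = ∫⁻ ξ, al ζ * (fhat h ξ * fhat f (ξ - ζ)) :=
        (lintegral_const_mul _ (mh.mul mB)).symm
      rw [e0, ← lintegral_const_mul_add_add _ (X := fun ξ => al ζ * (fhat h ξ * fhat f (ξ - ζ)))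
        (Y := fun ξ => fhat h ξ * (al (ξ - ζ) * fhat f (ξ - ζ)))
        (Z := fun ξ => (al ξ * fhat h ξ) * fhat f (ξ - ζ)) ((mh.mul mB).const_mul _)
        (mh.mul (mal'.mul mB)) ((mal.mul mh).mul mB)]
      refine lintegral_mono fun ξ => ?_
      have e : ‖m₁ ξ * m₂ (ξ - ζ) - n₁ ξ * n₂ (ξ - ζ)‖ₑ ≤
          ENNReal.ofReal (c * jb r ζ) * (al ζ + al (ξ - ζ) + al ξ) := by
        rw [hal]
        dsimp only
        rw [← ENNReal.ofReal_add (jb_pos _ _).le (jb_pos _ _).le,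
          ← ENNReal.ofReal_add (add_pos (jb_pos _ _) (jb_pos _ _)).le (jb_pos _ _).le,
          ← ENNReal.ofReal_mul (mul_nonneg hc (jb_pos _ _).le), ← ofReal_norm, Real.norm_eq_abs]
        apply ENNReal.ofReal_le_ofReal
        refine (H ξ ζ).trans (le_of_eq (by ring))
      refine (mul_le_mul_left e _).trans (le_of_eq ?_)
      ring
    refine (mul_le_mul_right h3 _).trans (le_of_eq ?_)
    have e : ENNReal.ofReal (jb (-r) ζ) * ENNReal.ofReal (c * jb r ζ) = ENNReal.ofReal c := by
      rw [← ENNReal.ofReal_mul (jb_pos _ _).le]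
      congr 1
      have : jb (-r) ζ * jb r ζ = 1 := by rw [jb_mul]; simp
      linear_combination c * this
    rw [show ∀ X Y Z W : ℝ≥0∞, X * Y * (Z * W) = (X * Z) * (Y * W) from fun X Y Z W => by ring, e]
    ring
  have h4 := h1.trans h2
  have mI1 : Measurable fun ζ => ∫⁻ ξ, fhat h ξ * fhat f (ξ - ζ) := by
    apply Measurable.lintegral_prod_right' (f := fun z : Plane × Plane => fhat h z.2 * fhat f (z.2 - z.1))
    exact (mh.comp measurable_snd).mul (mf.comp (measurable_snd.sub measurable_fst))
  have mI2 : Measurable fun ζ => ∫⁻ ξ, fhat h ξ * (al (ξ - ζ) * fhat f (ξ - ζ)) := by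
    apply Measurable.lintegral_prod_right'
      (f := fun z : Plane × Plane => fhat h z.2 * (al (z.2 - z.1) * fhat f (z.2 - z.1)))
    exact (mh.comp measurable_snd).mul ((mal.comp (measurable_snd.sub measurable_fst)).mul
      (mf.comp (measurable_snd.sub measurable_fst)))
  have mI3 : Measurable fun ζ => ∫⁻ ξ, (al ξ * fhat h ξ) * fhat f (ξ - ζ) := by
    apply Measurable.lintegral_prod_right'
      (f := fun z : Plane × Plane => (al z.2 * fhat h z.2) * fhat f (z.2 - z.1))
    exact ((mal.comp measurable_snd).mul (mh.comp measurable_snd)).mul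
      (mf.comp (measurable_snd.sub measurable_fst))
  have m1 := (mal.mul mU).mul mI1
  have m2 := mU.mul mI2
  have m3 := mU.mul mI3
  have h5 := lintegral_const_mul_add_add (ν := volume) (ENNReal.ofReal c)
    (X := fun ζ => (al ζ * fhat U ζ) * (∫⁻ ξ, fhat h ξ * fhat f (ξ - ζ)))
    (Y := fun ζ => fhat U ζ * (∫⁻ ξ, fhat h ξ * (al (ξ - ζ) * fhat f (ξ - ζ))))
    (Z := fun ζ => fhat U ζ * (∫⁻ ξ, (al ξ * fhat h ξ) * fhat f (ξ - ζ))) m1 m2 m3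
  rw [h5] at h4
  clear h5
  have y1 := (young_left (ν := volume) (fun ζ => al ζ * fhat U ζ) (mal.mul mU) mh mf).trans
    (mul_le_mul_left (lintegral_jb_mul_fhat_le hq U) _)
  have y2 := (young_right mU mh (mal.mul mf)).trans (mul_le_mul_left (lintegral_jb_mul_fhat_le hq f) _)
  have y3 := (young_mid mU (mal.mul mh) mf).trans (mul_le_mul_left (lintegral_jb_mul_fhat_le hq h) _)
  simp only [nrm2_fhat] at y1 y2 y3
  simp only [← ofReal_norm (_ : L2C)] at y1 y2 y3
  rw [← ENNReal.ofReal_mul (norm_nonneg _), ← ENNReal.ofReal_mul (by have := cq_nonneg q; positivity)]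
    at y1 y2 y3
  have h5 := h4.trans (mul_le_mul_right (add_le_add (add_le_add y1 y2) y3) _)
  have hc0 := cq_nonneg q
  rw [← ENNReal.ofReal_add (by positivity) (by positivity),
    ← ENNReal.ofReal_add (by positivity) (by positivity),
    ← ENNReal.ofReal_mul hc, ← ofReal_norm, ENNReal.ofReal_le_ofReal_iff (by positivity)] at h5
  refine h5.trans ?_
  calc _ = c * (3 * (cq q * ‖U‖)) * ‖h‖ * ‖f‖ := by ring
    _ ≤ _ := by gcongr

/-- A superposition of plane waves whose amplitude has a finite moment of order `r` is a multiplier;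
such a function need not decay at infinity. -/
theorem FRep.isMult {w : Linf} {ν : Measure Plane} {g : Plane → ℂ} (H : FRep w ν g)
    (hg : Measurable g) {r q A : ℝ} (hq : 0 ≤ q) (hA : 0 ≤ A)
    (hb : ∫⁻ ζ, ‖g ζ‖ₑ * ENNReal.ofReal (jb r ζ) ∂ν ≤ ENNReal.ofReal A) :
    IsMult r q (3 * A) w := by
  refine ⟨by positivity, fun h f m₁ m₂ n₁ n₂ k₁ k₂ k₃ k₄ c hc Hs => ?_⟩
  have h1 := H.enorm_inner_sub_le h f k₁ k₂ k₃ k₄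
  have mh := measurable_fhat h
  have mf := measurable_fhat f
  have h2 : ∫⁻ ζ, ‖g ζ‖ₑ * (∫⁻ ξ, ‖m₁ ξ * m₂ (ξ - ζ) - n₁ ξ * n₂ (ξ - ζ)‖ₑ *
        (fhat h ξ * fhat f (ξ - ζ))) ∂ν ≤
      ∫⁻ ζ, ENNReal.ofReal (3 * c) * ((‖g ζ‖ₑ * ENNReal.ofReal (jb r ζ)) *
        (∫⁻ ξ, fhat h ξ * fhat f (ξ - ζ))) ∂ν := by
    refine lintegral_mono fun ζ => ?_
    have mB : Measurable (fun ξ => fhat f (ξ - ζ)) := mf.comp (measurable_id.sub_const ζ)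
    have h3 : ∫⁻ ξ, ‖m₁ ξ * m₂ (ξ - ζ) - n₁ ξ * n₂ (ξ - ζ)‖ₑ * (fhat h ξ * fhat f (ξ - ζ)) ≤
        ENNReal.ofReal (3 * c * jb r ζ) * (∫⁻ ξ, fhat h ξ * fhat f (ξ - ζ)) := by
      have e0 : ENNReal.ofReal (3 * c * jb r ζ) * (∫⁻ ξ, fhat h ξ * fhat f (ξ - ζ)) =
          ∫⁻ ξ, ENNReal.ofReal (3 * c * jb r ζ) * (fhat h ξ * fhat f (ξ - ζ)) :=
        (lintegral_const_mul _ (mh.mul mB)).symm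
      rw [e0]
      refine lintegral_mono fun ξ => ?_
      dsimp only
      gcongr
      rw [← ofReal_norm, Real.norm_eq_abs]
      apply ENNReal.ofReal_le_ofReal
      refine (Hs ξ ζ).trans ?_
      have := jb_le_one (by linarith : -q ≤ 0) ζ
      have := jb_le_one (by linarith : -q ≤ 0) (ξ - ζ)
      have := jb_le_one (by linarith : -q ≤ 0) ξ
      have := (jb_pos r ζ).le
      calc c * (jb r ζ * (jb (-q) ζ + jb (-q) (ξ - ζ) + jb (-q) ξ)) ≤ c * (jb r ζ * (1 + 1 + 1)) := by
            gcongr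
        _ = _ := by ring
    refine (mul_le_mul_right h3 _).trans (le_of_eq ?_)
    rw [ENNReal.ofReal_mul (by positivity)]
    ring
  have h4 := h1.trans h2
  have mI1 : Measurable fun ζ => ∫⁻ ξ, fhat h ξ * fhat f (ξ - ζ) := by
    apply Measurable.lintegral_prod_right' (f := fun z : Plane × Plane => fhat h z.2 * fhat f (z.2 - z.1))
    exact (mh.comp measurable_snd).mul (mf.comp (measurable_snd.sub measurable_fst))
  have mA : Measurable (fun ζ => ‖g ζ‖ₑ * ENNReal.ofReal (jb r ζ)) :=
    hg.enorm.mul (measurable_ofReal_jb r)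
  have h5 : ∫⁻ ζ, ENNReal.ofReal (3 * c) * ((‖g ζ‖ₑ * ENNReal.ofReal (jb r ζ)) *
        (∫⁻ ξ, fhat h ξ * fhat f (ξ - ζ))) ∂ν = ENNReal.ofReal (3 * c) *
        ∫⁻ ζ, (‖g ζ‖ₑ * ENNReal.ofReal (jb r ζ)) * (∫⁻ ξ, fhat h ξ * fhat f (ξ - ζ)) ∂ν :=
    lintegral_const_mul _ (mA.mul mI1)
  rw [h5] at h4
  clear h5
  have y1 := (young_left (ν := ν) _ mA mh mf).trans (mul_le_mul_left hb _)
  simp only [nrm2_fhat] at y1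
  simp only [← ofReal_norm (_ : L2C)] at y1
  rw [← ENNReal.ofReal_mul (norm_nonneg _), ← ENNReal.ofReal_mul hA] at y1
  have h5 := h4.trans (mul_le_mul_right y1 _)
  rw [← ENNReal.ofReal_mul (by positivity), ← ofReal_norm,
    ENNReal.ofReal_le_ofReal_iff (by positivity)] at h5
  refine h5.trans (le_of_eq (by ring))

theorem IsMult.bound_single {r q A : ℝ} {w : Linf} (hw : IsMult r q A w) (h f : L2C)
    {m₁ m₂ : Plane → ℝ} (k₁ : BddSym m₁) (k₂ : BddSym m₂) {c : ℝ} (hc : 0 ≤ c)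
    (H : ∀ ξ ζ : Plane, |m₁ ξ * m₂ (ξ - ζ)| ≤
      c * (jb r ζ * (jb (-q) ζ + jb (-q) (ξ - ζ) + jb (-q) ξ))) :
    ‖inner ℂ (D m₁ h) (mul w (D m₂ f))‖ ≤ c * A * ‖h‖ * ‖f‖ := by
  have := hw.bound h f m₁ m₂ _ _ k₁ k₂ bddSym_zero bddSym_zero c hc (by simpa using H)
  simpa [D_zero_sym] using this

/-- Multiplication acts on `H^t`. -/
theorem IsMult.sob_mul {r q A t C : ℝ} {w : Linf} (hw : IsMult r q A w) (hqr : q ≤ r)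
    (ht : 0 ≤ t) (htr : t ≤ r) (h : q ≤ t ∨ t + q ≤ r) {f : L2C} (hf : Sob t C f) :
    Sob t (2 ^ t * A * C) (mul w f) := by
  have hC := hf.nonneg
  have hA := hw.nonneg
  obtain ⟨F, hF, rfl⟩ := hf
  apply sob_of_forall_inner ht (by positivity)
  intro k g
  refine (hw.bound_single g F (bddSym_jbk t k) (bddSym_jb (by linarith : -t ≤ 0)) (c := 2 ^ t)
    (by positivity) ?_).trans ?_
  · intro ξ ζ
    rw [abs_mul, abs_of_nonneg (jbk_nonneg _ _ _), abs_of_pos (jb_pos _ _)]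
    have p1 := jb_pos (-q) ζ
    have p2 := jb_pos (-q) (ξ - ζ)
    have p3 := jb_pos (-q) ξ
    have p4 := jb_pos r ζ
    have p5 := jb_pos (-t) (ξ - ζ)
    have e1 : jb t (ξ - ζ) * jb (-t) (ξ - ζ) = 1 := by rw [jb_mul]; simp
    have e2 : 1 ≤ jb r ζ * jb (-q) ζ := by rw [jb_mul]; exact one_le_jb (by linarith) ζ
    rcases h with h | h
    · have e3 : jb (-t) (ξ - ζ) ≤ jb (-q) (ξ - ζ) := jb_mono (by linarith) _
      have e4 : jb t ζ ≤ jb r ζ := jb_mono htr ζ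
      calc jbk t k ξ * jb (-t) (ξ - ζ) ≤ 2 ^ t * (jb t ζ + jb t (ξ - ζ)) * jb (-t) (ξ - ζ) := by
            gcongr
            exact (jbk_le _ _ _).trans (jb_le_add ht ξ ζ)
        _ = 2 ^ t * (jb t ζ * jb (-t) (ξ - ζ) + 1) := by rw [mul_assoc, add_mul, e1]
        _ ≤ 2 ^ t * (jb r ζ * jb (-q) (ξ - ζ) + jb r ζ * jb (-q) ζ) := by gcongr
        _ ≤ _ := by gcongr; nlinarith
    · have e3 : jb t ζ ≤ jb r ζ * jb (-q) ζ := by rw [jb_mul]; exact jb_mono (by linarith) ζ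
      calc jbk t k ξ * jb (-t) (ξ - ζ) ≤ 2 ^ t * (jb t ζ * jb t (ξ - ζ)) * jb (-t) (ξ - ζ) := by
            gcongr
            exact (jbk_le _ _ _).trans (jb_peetre ht ξ ζ)
        _ = 2 ^ t * jb t ζ := by rw [mul_assoc, mul_assoc, e1, mul_one]
        _ ≤ 2 ^ t * (jb r ζ * jb (-q) ζ) := by gcongr
        _ ≤ _ := by gcongr; nlinarith
  · calc 2 ^ t * A * ‖g‖ * ‖F‖ ≤ 2 ^ t * A * ‖g‖ * C := by gcongr
      _ = _ := by ring

/-! ### The commutator -/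

theorem abs_rpow_sub_rpow_le {s a b c : ℝ} (hs : 1 ≤ s) (ha : 0 < a) (hb : 0 < b)
    (h : |a - b| ≤ c) : |a ^ s - b ^ s| ≤ s * c * max a b ^ (s - 1) := by
  have key : ∀ {a b : ℝ}, 0 < a → 0 < b → b ≤ a → a ^ s - b ^ s ≤ s * (a - b) * a ^ (s - 1) := by
    intro a b ha hb hab
    have h1 := one_add_mul_self_le_rpow_one_add (s := (b - a) / a) (p := s)
      (by rw [le_div_iff₀ ha]; linarith) hs
    have h2 : 1 + (b - a) / a = b / a := by field_simp; ring
    rw [h2, Real.div_rpow hb.le ha.le, le_div_iff₀ (by positivity)] at h1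
    have h3 : a ^ s = a * a ^ (s - 1) := by
      rw [← Real.rpow_one_add' ha.le (by linarith)]; ring_nf
    have h4 : (1 + s * ((b - a) / a)) * a ^ s = a ^ s + s * (b - a) * a ^ (s - 1) := by
      rw [h3]; field_simp
    rw [h4] at h1
    linarith
  rcases le_total b a with hab | hab
  · rw [abs_of_nonneg (sub_nonneg.2 (Real.rpow_le_rpow hb.le hab (by linarith))), max_eq_left hab]
    refine (key ha hb hab).trans ?_
    gcongr
    exact (le_abs_self _).trans h
  · rw [abs_sub_comm, abs_of_nonneg (sub_nonneg.2 (Real.rpow_le_rpow ha.le hab (by linarith))),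
      max_eq_right hab]
    refine (key hb ha hab).trans ?_
    gcongr
    rw [abs_sub_comm] at h
    exact (le_abs_self _).trans h

/-- The symbol of the commutator, with `a = ⟨ξ⟩`, `b = ⟨ξ - ζ⟩`, `c = ⟨ζ⟩`. If `a` and `b` are
comparable, the mean value theorem gains one power over the separate terms; if not, the larger of
the two is at most a multiple of `c`. -/
theorem commutator_symbol {s a b c : ℝ} (hs : 1 < s) (ha : 1 ≤ a) (hb : 1 ≤ b) (hc : 1 ≤ c)
    (h : |a - b| ≤ c) :
    |a ^ s * b ^ (1 - s) - a ^ (-s) * b ^ (s + 1)| ≤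
      (s * 2 ^ (2 * s + 2)) * (c ^ (s + 1) * (c ^ (-(s - 1)) + b ^ (-(s - 1)) + a ^ (-(s - 1)))) := by
  have a0 : 0 < a := by linarith
  have b0 : 0 < b := by linarith
  have c0 : 0 < c := by linarith
  have hC1 : (1 : ℝ) ≤ 2 ^ (s + 1) := Real.one_le_rpow (by norm_num) (by linarith)
  have hC2 : (2 : ℝ) ^ (s + 1) ≤ s * 2 ^ (2 * s + 2) := by
    have : (2 : ℝ) ^ (s + 1) ≤ 2 ^ (2 * s + 2) := Real.rpow_le_rpow_of_exponent_le (by norm_num) (by linarith)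
    nlinarith
  have T1 : 0 < c ^ (s + 1) * c ^ (-(s - 1)) := by positivity
  have T2 : 0 < c ^ (s + 1) * b ^ (-(s - 1)) := by positivity
  have T3 : 0 < c ^ (s + 1) * a ^ (-(s - 1)) := by positivity
  have hK : 0 < s * (2 : ℝ) ^ (2 * s + 2) := by positivity
  have eb : b ^ (1 - s) = b ^ (-(s - 1)) := by ring_nf
  by_cases h1 : 2 * b < a
  · -- the output frequency dominates
    have hca : a ≤ 2 * c := by linarith [abs_le.1 h]
    have n2 : a ^ (-s) * b ^ (s + 1) ≤ a ^ s * b ^ (1 - s) := by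
      have e : a ^ s * b ^ (1 - s) = a ^ (-s) * b ^ (s + 1) * (a / b) ^ (2 * s) := by
        rw [Real.div_rpow a0.le b0.le, Real.rpow_add b0, Real.rpow_sub b0, Real.rpow_neg a0.le,
          two_mul, Real.rpow_add a0, Real.rpow_add b0]
        field_simp
      rw [e]
      have : 1 ≤ (a / b) ^ (2 * s) := Real.one_le_rpow (by rw [le_div_iff₀ b0]; linarith) (by linarith)
      exact le_mul_of_one_le_right (by positivity) this
    rw [abs_of_nonneg (by linarith)]
    have hh : a ^ s ≤ 2 ^ (s + 1) * c ^ (s + 1) := by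
      calc a ^ s ≤ a ^ (s + 1) := Real.rpow_le_rpow_of_exponent_le ha (by linarith)
        _ ≤ (2 * c) ^ (s + 1) := by gcongr
        _ = _ := Real.mul_rpow (by norm_num) c0.le
    calc a ^ s * b ^ (1 - s) - a ^ (-s) * b ^ (s + 1) ≤ a ^ s * b ^ (1 - s) := by
          linarith [show 0 < a ^ (-s) * b ^ (s + 1) by positivity]
      _ ≤ 2 ^ (s + 1) * c ^ (s + 1) * b ^ (-(s - 1)) := by rw [eb]; gcongr
      _ ≤ s * 2 ^ (2 * s + 2) * c ^ (s + 1) * b ^ (-(s - 1)) := by gcongr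
      _ ≤ _ := by nlinarith
  by_cases h2 : 2 * a < b
  · have hcb : b ≤ 2 * c := by linarith [abs_le.1 h]
    have n2 : a ^ s * b ^ (1 - s) ≤ a ^ (-s) * b ^ (s + 1) := by
      have e : a ^ (-s) * b ^ (s + 1) = a ^ s * b ^ (1 - s) * (b / a) ^ (2 * s) := by
        rw [Real.div_rpow b0.le a0.le, Real.rpow_add b0, Real.rpow_sub b0, Real.rpow_neg a0.le,
          two_mul, Real.rpow_add a0, Real.rpow_add b0]
        field_simp
      rw [e]
      have : 1 ≤ (b / a) ^ (2 * s) := Real.one_le_rpow (by rw [le_div_iff₀ a0]; linarith) (by linarith)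
      exact le_mul_of_one_le_right (by positivity) this
    rw [abs_of_nonpos (by linarith), neg_sub]
    have hh : b ^ (s + 1) ≤ 2 ^ (s + 1) * c ^ (s + 1) := by
      calc b ^ (s + 1) ≤ (2 * c) ^ (s + 1) := by gcongr
        _ = _ := Real.mul_rpow (by norm_num) c0.le
    have hh2 : a ^ (-s) ≤ a ^ (-(s - 1)) := Real.rpow_le_rpow_of_exponent_le ha (by linarith)
    calc a ^ (-s) * b ^ (s + 1) - a ^ s * b ^ (1 - s) ≤ a ^ (-s) * b ^ (s + 1) := by
          linarith [show 0 < a ^ s * b ^ (1 - s) by positivity]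
      _ ≤ a ^ (-(s - 1)) * (2 ^ (s + 1) * c ^ (s + 1)) := by gcongr
      _ ≤ a ^ (-(s - 1)) * (s * 2 ^ (2 * s + 2) * c ^ (s + 1)) := by gcongr
      _ ≤ _ := by nlinarith
  · -- comparable frequencies: the mean value theorem
    push Not at h1 h2
    have e : a ^ s * b ^ (1 - s) - a ^ (-s) * b ^ (s + 1) =
        (a ^ s - b ^ s) * (a ^ s + b ^ s) * (a ^ (-s) * b ^ (1 - s)) := by
      have e1 : a ^ s * a ^ (-s) = 1 := by rw [← Real.rpow_add a0]; simp
      have e2 : b ^ s * b ^ s * b ^ (1 - s) = b ^ (s + 1) := by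
        rw [← Real.rpow_add b0, ← Real.rpow_add b0]; ring_nf
      linear_combination (-(a ^ s * b ^ (1 - s))) * e1 + a ^ (-s) * e2
    have hm : max a b ≤ 2 * b := max_le h1 (by linarith)
    have m1 := abs_rpow_sub_rpow_le hs.le a0 b0 h
    have m2 : max a b ^ (s - 1) ≤ 2 ^ (s - 1) * b ^ (s - 1) := by
      rw [← Real.mul_rpow (by norm_num) b0.le]
      exact Real.rpow_le_rpow (by positivity) hm (by linarith)
    have m3 : a ^ s + b ^ s ≤ 2 ^ (s + 1) * a ^ s := by
      have : b ^ s ≤ 2 ^ s * a ^ s := by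
        rw [← Real.mul_rpow (by norm_num) a0.le]
        exact Real.rpow_le_rpow b0.le h2 (by linarith)
      have h3 : (1 : ℝ) ≤ 2 ^ s := Real.one_le_rpow (by norm_num) (by linarith)
      have h4 : (2 : ℝ) ^ (s + 1) = 2 * 2 ^ s := by rw [Real.rpow_add (by norm_num)]; norm_num; ring
      rw [h4]
      nlinarith [show 0 < a ^ s by positivity]
    rw [e, abs_mul, abs_mul, abs_of_pos (show 0 < a ^ s + b ^ s by positivity),
      abs_of_pos (show 0 < a ^ (-s) * b ^ (1 - s) by positivity)]
    have ec : c ^ (s + 1) * c ^ (-(s - 1)) = c ^ (2 : ℝ) := by rw [← Real.rpow_add c0]; ring_nf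
    have ec2 : c ≤ c ^ (2 : ℝ) := by
      rw [Real.rpow_two]; nlinarith
    have e3 : b ^ (s - 1) * b ^ (1 - s) = 1 := by rw [← Real.rpow_add b0]; simp
    have e4 : a ^ s * a ^ (-s) = 1 := by rw [← Real.rpow_add a0]; simp
    have e5 : (2 : ℝ) ^ (s - 1) * 2 ^ (s + 1) = 2 ^ (2 * s) := by
      rw [← Real.rpow_add (by norm_num)]; ring_nf
    have e6 : (2 : ℝ) ^ (2 * s) ≤ 2 ^ (2 * s + 2) := Real.rpow_le_rpow_of_exponent_le (by norm_num) (by linarith)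
    calc |a ^ s - b ^ s| * (a ^ s + b ^ s) * (a ^ (-s) * b ^ (1 - s))
        ≤ (s * c * (2 ^ (s - 1) * b ^ (s - 1))) * (2 ^ (s + 1) * a ^ s) * (a ^ (-s) * b ^ (1 - s)) := by
          gcongr
          refine m1.trans ?_
          gcongr
      _ = s * c * (2 ^ (s - 1) * 2 ^ (s + 1)) * (b ^ (s - 1) * b ^ (1 - s)) * (a ^ s * a ^ (-s)) := by ring
      _ = s * 2 ^ (2 * s) * c := by rw [e3, e4, e5]; ring
      _ ≤ s * 2 ^ (2 * s + 2) * (c ^ (s + 1) * c ^ (-(s - 1))) := by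
          rw [ec]; gcongr
      _ ≤ _ := by
          gcongr
          linarith [show 0 < b ^ (-(s - 1)) by positivity, show 0 < a ^ (-(s - 1)) by positivity]

/-- The commutator estimate: moving the weight `⟨D⟩^{2s}` from one factor of `∫ h̄ w ⟨D⟩²f` to the
other costs one derivative of `w` only. -/
theorem IsMult.commutator {s A : ℝ} (hs : 2 < s) {w : Linf} (hw : IsMult (s + 1) (s - 1) A w)
    (k : ℕ) (h f : L2C) :
    ‖inner ℂ (D (jbk s k) h) (mul w (D (jbk (1 - s) k) f)) -
      inner ℂ (D (jbk (-s) k) h) (mul w (D (jbk (s + 1) k) f))‖ ≤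
    s * 2 ^ (2 * s + 2) * A * ‖h‖ * ‖f‖ := by
  refine hw.bound h f _ _ _ _ (bddSym_jbk _ _) (bddSym_jbk _ _) (bddSym_jbk _ _) (bddSym_jbk _ _) _
    (by positivity) (fun ξ ζ => ?_)
  by_cases h1 : ‖ξ‖ ≤ k
  · by_cases h2 : ‖ξ - ζ‖ ≤ k
    · simp only [jbk, h1, h2, if_true]
      have h3 := abs_jb_one_sub_le ξ (ξ - ζ)
      rw [sub_sub_cancel] at h3
      have := commutator_symbol (s := s) (by linarith) (one_le_jb zero_le_one ξ)
        (one_le_jb zero_le_one (ξ - ζ)) (one_le_jb zero_le_one ζ) h3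
      simpa only [← jb_eq_rpow] using this
    · have p1 := jb_pos (s + 1) ζ
      have p2 := jb_pos (-(s - 1)) ζ
      have p3 := jb_pos (-(s - 1)) (ξ - ζ)
      have p4 := jb_pos (-(s - 1)) ξ
      simp only [jbk, h2, if_false, mul_zero, sub_zero, abs_zero]
      positivity
  · have p1 := jb_pos (s + 1) ζ
    have p2 := jb_pos (-(s - 1)) ζ
    have p3 := jb_pos (-(s - 1)) (ξ - ζ)
    have p4 := jb_pos (-(s - 1)) ξ
    simp only [jbk, h1, if_false, zero_mul, sub_zero, abs_zero]
    positivity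

/-! ### The line soliton as a multiplier -/

/-- The profile of the line soliton, as a function of one variable. -/
noncomputable def solitonProfile (x : ℝ) : ℝ :=
  2 * Real.sqrt 2 / (Real.exp x + Real.exp (-x))

theorem lineSoliton_eq (x : Plane) : lineSoliton x = solitonProfile (x 0) := rfl

theorem solitonProfile_pos (x : ℝ) : 0 < solitonProfile x := by
  unfold solitonProfile; positivity

theorem hasDerivAt_solitonProfile (x : ℝ) :
    HasDerivAt solitonProfile (-(solitonProfile x * Real.tanh x)) x := by
  have h1 : HasDerivAt (fun x : ℝ => Real.exp x + Real.exp (-x)) (Real.exp x - Real.exp (-x)) x := by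
    have := (Real.hasDerivAt_exp x).add ((Real.hasDerivAt_exp (-x)).comp x (hasDerivAt_neg x))
    convert! this using 1
    ring
  have h2 := (h1.inv (by positivity)).const_mul (2 * Real.sqrt 2)
  refine h2.congr_deriv ?_
  rw [solitonProfile, Real.tanh_eq_sinh_div_cosh, Real.sinh_eq, Real.cosh_eq]
  have : 0 < Real.exp x + Real.exp (-x) := by positivity
  field_simp

theorem hasDerivAt_tanh' (x : ℝ) : HasDerivAt Real.tanh (1 - Real.tanh x ^ 2) x := by
  have h := (Real.hasDerivAt_sinh x).div (Real.hasDerivAt_cosh x) (Real.cosh_pos x).ne'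
  have e : Real.tanh = Real.sinh / Real.cosh := by
    ext y; exact Real.tanh_eq_sinh_div_cosh y
  rw [← e] at h
  refine h.congr_deriv ?_
  rw [Real.tanh_eq_sinh_div_cosh]
  have := Real.cosh_pos x
  field_simp

theorem solitonProfile_le (x : ℝ) : solitonProfile x ≤ 2 * Real.sqrt 2 * Real.exp (-|x|) := by
  unfold solitonProfile
  rw [div_le_iff₀ (by positivity), mul_assoc]
  have h : 1 ≤ Real.exp (-|x|) * (Real.exp x + Real.exp (-x)) := by
    rw [mul_add, ← Real.exp_add, ← Real.exp_add]
    rcases abs_cases x with ⟨h, -⟩ | ⟨h, -⟩ <;> rw [h]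
    · simp; positivity
    · simp; positivity
  nlinarith [Real.sqrt_nonneg 2]

/-- All derivatives of the profile are of the form `Q · p(tanh)` with a polynomial `p`. -/
theorem iteratedDeriv_solitonProfile (n : ℕ) :
    ∃ p : Polynomial ℝ, iteratedDeriv n solitonProfile =
      fun x => solitonProfile x * p.eval (Real.tanh x) := by
  induction n with
  | zero => exact ⟨1, by ext x; simp⟩
  | succ n ih =>
    obtain ⟨p, hp⟩ := ih
    refine ⟨p.derivative * (1 - Polynomial.X ^ 2) - Polynomial.X * p, ?_⟩
    rw [iteratedDeriv_succ, hp]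
    ext x
    have h1 : HasDerivAt (fun x => p.eval (Real.tanh x))
        (p.derivative.eval (Real.tanh x) * (1 - Real.tanh x ^ 2)) x :=
      (p.hasDerivAt (Real.tanh x)).comp x (hasDerivAt_tanh' x)
    refine ((hasDerivAt_solitonProfile x).mul h1).deriv.trans ?_
    simp
    ring

theorem contDiff_solitonProfile : ContDiff ℝ ∞ solitonProfile := by
  unfold solitonProfile
  refine ContDiff.div (by fun_prop) (by fun_prop) (fun x => by positivity)

/-- The profile as a complex-valued Schwartz function. -/
noncomputable def solitonSchwartz : SchwartzMap ℝ ℂ where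
  toFun x := (solitonProfile x : ℂ)
  smooth' := Complex.ofRealCLM.contDiff.comp contDiff_solitonProfile
  decay' := by
    intro k n
    obtain ⟨p, hp⟩ := iteratedDeriv_solitonProfile n
    obtain ⟨B, hB⟩ := (isCompact_Icc (a := (-1 : ℝ)) (b := 1)).exists_bound_of_continuousOn
      (f := fun y => p.eval y) p.continuous.continuousOn
    refine ⟨k.factorial * (2 * Real.sqrt 2) * B, fun x => ?_⟩
    have e : ‖iteratedFDeriv ℝ n (fun x => (solitonProfile x : ℂ)) x‖ = ‖iteratedDeriv n solitonProfile x‖ := by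
      have h1 := Complex.ofRealLI.norm_iteratedFDeriv_comp_left
        (contDiff_solitonProfile.contDiffAt (x := x)) (i := n) (by exact_mod_cast le_top)
      rw [← norm_iteratedFDeriv_eq_norm_iteratedDeriv]
      exact h1
    rw [e, hp, norm_mul]
    have h2 := hB (Real.tanh x) ⟨(Real.neg_one_lt_tanh x).le, (Real.tanh_lt_one x).le⟩
    have h3 : ‖x‖ ^ k ≤ k.factorial * Real.exp |x| := by
      have := Real.pow_div_factorial_le_exp |x| (abs_nonneg x) k
      rw [div_le_iff₀ (by positivity)] at this
      rw [Real.norm_eq_abs]; linarith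
    have h4 := solitonProfile_le x
    rw [Real.norm_of_nonneg (solitonProfile_pos x).le]
    calc ‖x‖ ^ k * (solitonProfile x * ‖p.eval (Real.tanh x)‖)
        ≤ (k.factorial * Real.exp |x|) * ((2 * Real.sqrt 2 * Real.exp (-|x|)) * B) := by
          have := (solitonProfile_pos x).le
          gcongr
      _ = k.factorial * (2 * Real.sqrt 2) * B * (Real.exp |x| * Real.exp (-|x|)) := by ring
      _ = _ := by rw [← Real.exp_add]; simp

theorem lineSoliton_le (x : Plane) : |lineSoliton x| ≤ 2 * Real.sqrt 2 := by
  rw [lineSoliton_eq, abs_of_pos (solitonProfile_pos _)]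
  refine (solitonProfile_le _).trans ?_
  have : Real.exp (-|x 0|) ≤ 1 := Real.exp_le_one_iff.2 (by simp)
  nlinarith [Real.sqrt_nonneg 2]

theorem continuous_lineSoliton : Continuous lineSoliton := by
  unfold lineSoliton
  exact Continuous.div (by fun_prop) (by fun_prop) (fun x => by positivity)

theorem memLp_lineSoliton : MemLp (fun x : Plane => (lineSoliton x : ℂ)) ∞ volume :=
  memLp_top_of_bound (Complex.continuous_ofReal.comp continuous_lineSoliton).aestronglyMeasurable
    (2 * Real.sqrt 2) (by filter_upwards with x; simpa using lineSoliton_le x)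

/-- The line soliton as an element of `L^∞`. -/
noncomputable def Qinf : Linf := memLp_lineSoliton.toLp

theorem coeFn_Qinf : Qinf =ᵐ[volume] fun x => (lineSoliton x : ℂ) := memLp_lineSoliton.coeFn_toLp

@[simp] theorem conjI_Qinf : conjI Qinf = Qinf := by
  apply Lp.ext
  filter_upwards [coeFn_conjI Qinf, coeFn_Qinf] with x h1 h2
  rw [h1, h2]; simp

/-- Lebesgue measure on the line `ξ₂ = 0` in frequency space. -/
noncomputable def lineMeasure : Measure Plane :=
  (volume : Measure ℝ).map (fun a => EuclideanSpace.single (0 : Fin 2) a)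

theorem continuous_single : Continuous (fun a : ℝ => (EuclideanSpace.single (0 : Fin 2) a : Plane)) := by
  have : (fun a : ℝ => (EuclideanSpace.single (0 : Fin 2) a : Plane)) =
      fun a => a • (EuclideanSpace.single (0 : Fin 2) (1 : ℝ) : Plane) := by
    ext a i; fin_cases i <;> simp
  rw [this]; fun_prop

theorem continuous_fourier_profile : Continuous (fun ζ : Plane => (𝓕 solitonSchwartz) (ζ 0)) :=
  (𝓕 solitonSchwartz).continuous.comp (by fun_prop)

theorem frep_Qinf : FRep Qinf lineMeasure (fun ζ => (𝓕 solitonSchwartz) (ζ 0)) where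
  sfin := by unfold lineMeasure; infer_instance
  integrable := by
    unfold lineMeasure
    rw [integrable_map_measure continuous_fourier_profile.aestronglyMeasurable
      continuous_single.measurable.aemeasurable]
    have := (𝓕 solitonSchwartz).integrable (μ := volume)
    refine this.congr ?_
    filter_upwards with a
    simp
  eq := by
    filter_upwards [coeFn_Qinf] with x hx
    rw [hx, lineMeasure, integral_map continuous_single.measurable.aemeasurable]
    · have h1 : (lineSoliton x : ℂ) = (𝓕⁻ (𝓕 solitonSchwartz)) (x 0) := by
        rw [FourierTransform.fourierInv_fourier_eq]; rfl
      rw [h1, SchwartzMap.fourierInv_coe, Real.fourierInv_eq]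
      congr with a
      rw [Circle.smul_def, smul_eq_mul]
      simp [PiLp.inner_apply, _root_.mul_comm]
    · exact (Continuous.aestronglyMeasurable (by fun_prop)).mul
        continuous_fourier_profile.aestronglyMeasurable

/-- The moments of the Fourier transform of the soliton profile are finite. -/
theorem exists_isMult_Qinf (r : ℝ) : ∃ A, ∀ q, 0 ≤ q → IsMult r q A Qinf := by
  set f := 𝓕 solitonSchwartz with hf
  obtain ⟨m, hm⟩ := exists_nat_ge (r / 2)
  have hI : Integrable (fun a : ℝ => 2 ^ m * (‖f a‖ + ‖a‖ ^ (2 * m) * ‖f a‖)) volume :=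
    (((f.integrable (μ := volume)).norm).add (f.integrable_pow_mul volume (2 * m))).const_mul _
  refine ⟨3 * ∫ a : ℝ, 2 ^ m * (‖f a‖ + ‖a‖ ^ (2 * m) * ‖f a‖), fun q hq => ?_⟩
  refine frep_Qinf.isMult continuous_fourier_profile.measurable hq
    (integral_nonneg fun a => by positivity) ?_
  have hmeas : Measurable (fun ζ : Plane => ‖(𝓕 solitonSchwartz) (ζ 0)‖ₑ * ENNReal.ofReal (jb r ζ)) :=
    continuous_fourier_profile.measurable.enorm.mul (measurable_ofReal_jb r)
  rw [lineMeasure, lintegral_map hmeas continuous_single.measurable,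
    ofReal_integral_eq_lintegral_ofReal hI (by filter_upwards with a; positivity)]
  refine lintegral_mono fun a => ?_
  dsimp only
  rw [← ofReal_norm, ← ENNReal.ofReal_mul (norm_nonneg _)]
  apply ENNReal.ofReal_le_ofReal
  have h1 : jb r (EuclideanSpace.single (0 : Fin 2) a : Plane) ≤ 2 ^ m * (1 + ‖a‖ ^ (2 * m)) := by
    unfold jb
    rw [PiLp.norm_single]
    have h2 : (1 : ℝ) ≤ 1 + ‖a‖ ^ 2 := by nlinarith [sq_nonneg ‖a‖]
    calc (1 + ‖a‖ ^ 2) ^ (r / 2) ≤ (1 + ‖a‖ ^ 2) ^ (m : ℝ) := Real.rpow_le_rpow_of_exponent_le h2 hm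
      _ = (1 + ‖a‖ ^ 2) ^ m := Real.rpow_natCast _ _
      _ ≤ 2 ^ (m - 1) * (1 ^ m + (‖a‖ ^ 2) ^ m) := add_pow_le (by norm_num) (by positivity) m
      _ ≤ 2 ^ m * (1 ^ m + (‖a‖ ^ 2) ^ m) := by
          gcongr
          · norm_num
          · omega
      _ = _ := by rw [one_pow, pow_mul]
  have h3 : (EuclideanSpace.single (0 : Fin 2) a : Plane) 0 = a := by simp
  rw [h3]
  calc ‖f a‖ * jb r (EuclideanSpace.single (0 : Fin 2) a : Plane)
      ≤ ‖f a‖ * (2 ^ m * (1 + ‖a‖ ^ (2 * m))) := by gcongr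
    _ = _ := by ring

/-! ### Real and imaginary parts -/

/-- The real part of a complex-valued `L²` function, as a complex-valued function. -/
noncomputable def reC : L2C →L[ℝ] L2C := (2⁻¹ : ℝ) • (ContinuousLinearMap.id ℝ L2C + conjL)

/-- The imaginary part of a complex-valued `L²` function, as a complex-valued function. -/
noncomputable def imC (f : L2C) : L2C := (-Complex.I / 2) • (f - conjL f)

theorem reC_apply (f : L2C) : reC f = (2⁻¹ : ℂ) • (f + conjL f) := by
  have h : reC f = (2⁻¹ : ℝ) • (f + conjL f) := rfl
  rw [h, RCLike.real_smul_eq_coe_smul (K := ℂ)]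
  simp

theorem conjL_reC (f : L2C) : conjL (reC f) = reC f := by
  rw [reC_apply, conjL_smul, map_add, conjL_conjL, add_comm]
  simp [map_ofNat]

theorem conjL_imC (f : L2C) : conjL (imC f) = imC f := by
  rw [imC, conjL_smul, map_sub, conjL_conjL, ← neg_sub f, smul_neg, ← neg_smul]
  congr 1
  simp [map_div₀, map_ofNat, neg_div]

theorem imC_sub (f g : L2C) : imC (f - g) = imC f - imC g := by
  simp only [imC, map_sub, smul_sub]; abel

theorem imC_add (f g : L2C) : imC (f + g) = imC f + imC g := by
  simp only [imC, map_add, smul_sub, smul_add]; abel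

theorem norm_reC_le (f : L2C) : ‖reC f‖ ≤ ‖f‖ := by
  rw [reC_apply, norm_smul]
  have := norm_add_le f (conjL f)
  rw [norm_conjL] at this
  norm_num
  linarith

theorem norm_imC_le (f : L2C) : ‖imC f‖ ≤ ‖f‖ := by
  rw [imC, norm_smul]
  have := norm_sub_le f (conjL f)
  rw [norm_conjL] at this
  have e : ‖-Complex.I / 2‖ = 1 / 2 := by simp
  rw [e]
  linarith

theorem D_reC {m : Plane → ℝ} (hm : BddSym m) (he : ∀ ξ, m (-ξ) = m ξ) (f : L2C) :
    D m (reC f) = reC (D m f) := by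
  rw [reC_apply, reC_apply, map_smul, map_add, D_conjL hm he]

theorem D_imC {m : Plane → ℝ} (hm : BddSym m) (he : ∀ ξ, m (-ξ) = m ξ) (f : L2C) :
    D m (imC f) = imC (D m f) := by
  rw [imC, imC, map_smul, map_sub, D_conjL hm he]

theorem inner_conjL_right (f g : L2C) : inner ℂ f (conjL g) = conj (inner ℂ (conjL f) g) := by
  rw [← inner_conjL_conjL, conjL_conjL, inner_conj_symm]

theorem re_inner_imC (h f : L2C) : (inner ℂ h (imC f)).re = (inner ℂ (reC h) f).im := by
  rw [imC, inner_smul_right, inner_sub_right, inner_conjL_right, reC_apply, inner_smul_left,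
    inner_add_left]
  simp [-inner_conj_symm]
  ring

theorem Sob.reC {r C : ℝ} (hr : 0 ≤ r) {f : L2C} (hf : Sob r C f) : Sob r C (reC f) := by
  rw [reC_apply]
  refine ((hf.add (hf.conj hr)).smul _).mono (le_of_eq ?_)
  norm_num; ring

theorem Sob.imC {r C : ℝ} (hr : 0 ≤ r) {f : L2C} (hf : Sob r C f) : Sob r C (imC f) := by
  refine ((hf.sub (hf.conj hr)).smul _).mono (le_of_eq ?_)
  simp; ring

/-! ### The evolution equation -/

/-- The constant `4π²` in `Δ = 4π² (1 - ⟨D⟩²)`. -/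
noncomputable def kap : ℝ := 4 * Real.pi ^ 2

theorem kap_pos : 0 < kap := by unfold kap; positivity

/-- `u = ⟨D⟩^{-2} a`. -/
noncomputable def uu (a : L2C) : L2C := D (jb (-2)) a

/-- `P = ⟨D⟩^{-1} b`. -/
noncomputable def pp (b : L2C) : L2C := D (jb (-1)) b

/-- `w = u + Q`. -/
noncomputable def ww (a : L2C) : Linf := emb a + Qinf

/-- `Δ u`. -/
noncomputable def lapU (a : L2C) : L2C := (kap : ℂ) • (uu a - a)

/-- `|w|² - Q² = |u|² + 2 Q Re u`. -/
noncomputable def rho (a : L2C) : L2C :=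
  mul (emb a) (conjL (uu a)) + mul Qinf (uu a + conjL (uu a))

/-- The part of `u_t` without derivatives. -/
noncomputable def fu0 (a : L2C) : L2C :=
  Complex.I • (mul (ww a) (rho a) + mul Qinf (mul Qinf (uu a)) - uu a)

/-- The right-hand side `i Δu - i u - i (n w - Q² u)` of the Schrödinger equation, where
`n = Re P - (|w|² - Q²)`. -/
noncomputable def fu (a b : L2C) : L2C :=
  Complex.I • lapU a - Complex.I • mul (ww a) (reC (pp b)) + fu0 a

/-- The part of `∂ₜ|w|²` without derivatives. -/
noncomputable def gg0 (a : L2C) : L2C :=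
  (2 : ℂ) • imC (mul Qinf (uu a) - mul Qinf (mul Qinf (mul Qinf (uu a))) -
    (kap : ℂ) • mul (conjI (ww a)) (uu a))

/-- `∂ₜ|w|² = -2 Im (w̄ Δu) + 2 (Q - Q³) Im u`. -/
noncomputable def gg (a : L2C) : L2C :=
  (2 : ℂ) • imC ((kap : ℂ) • mul (conjI (ww a)) a) + gg0 a

/-- The bounded symbol `2π|ξ| ⟨ξ⟩^{-1}`. -/
noncomputable def absSym (ξ : Plane) : ℝ := 2 * Real.pi * ‖ξ‖ * jb (-1) ξ

/-- `|∇| P`. -/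
noncomputable def absD (b : L2C) : L2C := D absSym b

/-- The right-hand side `-i λ|∇| P + ∂ₜ|w|²` of the equation of `P = n + |w|² - Q² + i M`, where
`n_t = λ|∇| M`. -/
noncomputable def fp (lam : ℝ) (a b : L2C) : L2C := (-(Complex.I * lam)) • absD b + gg a

theorem absSym_nonneg (ξ : Plane) : 0 ≤ absSym ξ := by
  unfold absSym; have := (jb_pos (-1) ξ).le; positivity

theorem absSym_le (ξ : Plane) : absSym ξ ≤ 2 * Real.pi := by
  unfold absSym
  have h : ‖ξ‖ * jb (-1) ξ ≤ 1 := by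
    calc ‖ξ‖ * jb (-1) ξ ≤ jb 1 ξ * jb (-1) ξ := by
          gcongr
          · exact (jb_pos _ _).le
          · exact norm_le_jb_one ξ
      _ = 1 := by rw [jb_mul]; simp
  rw [mul_assoc]
  exact mul_le_of_le_one_right (by positivity) h

theorem bddSym_absSym : BddSym absSym :=
  ⟨by unfold absSym; exact (measurable_const.mul measurable_norm).mul (continuous_jb _).measurable,
    2 * Real.pi, fun ξ => by rw [abs_of_nonneg (absSym_nonneg ξ)]; exact absSym_le ξ⟩

theorem absSym_neg_arg (ξ : Plane) : absSym (-ξ) = absSym ξ := by simp [absSym, jb_neg_arg]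

theorem conjL_uu (a : L2C) : conjL (uu a) = uu (conjL a) :=
  (D_conjL (bddSym_jb (by norm_num)) (jb_neg_arg _) a).symm

theorem conjI_ww (a : L2C) : conjI (ww a) = emb (conjL a) + Qinf := by
  rw [ww, map_add, conjI_emb, conjI_Qinf]

theorem norm_D_jb_le {r : ℝ} (hr : r ≤ 0) (f : L2C) : ‖D (jb r) f‖ ≤ ‖f‖ := by
  refine (norm_D_le (C := 1) (continuous_jb _).measurable (fun ξ => ?_) f).trans (by linarith)
  rw [abs_of_pos (jb_pos _ _)]; exact jb_le_one hr ξ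

/-! ### Maps that are Lipschitz on balls -/

/-- `f` is Lipschitz on every ball. -/
def BallLip {E F : Type*} [NormedAddCommGroup E] [NormedAddCommGroup F] (f : E → F) : Prop :=
  ∀ R : ℝ, ∃ K : ℝ, 0 ≤ K ∧ ∀ x y, ‖x‖ ≤ R → ‖y‖ ≤ R → ‖f x - f y‖ ≤ K * ‖x - y‖

section BallLip

variable {E F G : Type*} [NormedAddCommGroup E] [NormedAddCommGroup F] [NormedAddCommGroup G]

theorem BallLip.bdd {f : E → F} (hf : BallLip f) (R : ℝ) : ∃ B, 0 ≤ B ∧ ∀ x, ‖x‖ ≤ R → ‖f x‖ ≤ B := by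
  obtain ⟨K, hK, h⟩ := hf R
  refine ⟨‖f 0‖ + K * |R|, by positivity, fun x hx => ?_⟩
  have hR : 0 ≤ R := (norm_nonneg x).trans hx
  have := h x 0 hx (by simpa using hR)
  rw [sub_zero] at this
  have h2 : ‖f x‖ ≤ ‖f 0‖ + ‖f x - f 0‖ := by
    have := norm_add_le (f 0) (f x - f 0); rwa [add_sub_cancel] at this
  have h3 : K * ‖x‖ ≤ K * |R| := by gcongr; exact hx.trans (le_abs_self R)
  linarith

theorem BallLip.const (c : F) : BallLip (fun _ : E => c) := fun R => ⟨0, le_rfl, by simp⟩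

theorem BallLip.add {f g : E → F} (hf : BallLip f) (hg : BallLip g) :
    BallLip (fun x => f x + g x) := fun R => by
  obtain ⟨K, hK, h⟩ := hf R
  obtain ⟨L, hL, h'⟩ := hg R
  refine ⟨K + L, by positivity, fun x y hx hy => ?_⟩
  rw [add_sub_add_comm, add_mul]
  exact (norm_add_le _ _).trans (add_le_add (h x y hx hy) (h' x y hx hy))

theorem BallLip.comp_lin {f : E → F} (hf : BallLip f) {L : F → G} {C : ℝ} (hC : 0 ≤ C)
    (hs : ∀ x y, L (x - y) = L x - L y) (hb : ∀ x, ‖L x‖ ≤ C * ‖x‖) : BallLip (fun x => L (f x)) :=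
  fun R => by
  obtain ⟨K, hK, h⟩ := hf R
  refine ⟨C * K, by positivity, fun x y hx hy => ?_⟩
  rw [← hs, mul_assoc]
  refine (hb _).trans ?_
  gcongr
  exact h x y hx hy

theorem BallLip.sub {f g : E → F} (hf : BallLip f) (hg : BallLip g) :
    BallLip (fun x => f x - g x) := by
  simp_rw [sub_eq_add_neg]
  exact hf.add (hg.comp_lin (L := fun x => -x) (C := 1) zero_le_one
    (fun _ _ => by abel) (fun x => by simp))

theorem BallLip.smul [NormedSpace ℂ F] {f : E → F} (hf : BallLip f) (c : ℂ) :
    BallLip (fun x => c • f x) :=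
  hf.comp_lin (L := fun x => c • x) (C := ‖c‖) (norm_nonneg c) (fun _ _ => smul_sub _ _ _)
    (fun _ => (norm_smul _ _).le)

theorem BallLip.clm [NormedSpace ℂ F] [NormedSpace ℂ G] {f : E → F} (hf : BallLip f)
    (L : F →L[ℂ] G) : BallLip (fun x => L (f x)) :=
  hf.comp_lin (norm_nonneg L) (fun _ _ => map_sub _ _ _) (fun x => L.le_opNorm x)

theorem BallLip.clmR [NormedSpace ℝ F] [NormedSpace ℝ G] {f : E → F} (hf : BallLip f)
    (L : F →L[ℝ] G) : BallLip (fun x => L (f x)) :=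
  hf.comp_lin (norm_nonneg L) (fun _ _ => map_sub _ _ _) (fun x => L.le_opNorm x)

theorem BallLip.imC {f : E → L2C} (hf : BallLip f) : BallLip (fun x => imC (f x)) :=
  hf.comp_lin zero_le_one imC_sub (fun x => by rw [one_mul]; exact norm_imC_le x)

theorem BallLip.mul {f : E → Linf} {g : E → L2C} (hf : BallLip f) (hg : BallLip g) :
    BallLip (fun x => mul (f x) (g x)) := fun R => by
  obtain ⟨K, hK, h⟩ := hf R
  obtain ⟨L, hL, h'⟩ := hg R
  obtain ⟨B, hB, hf'⟩ := hf.bdd R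
  obtain ⟨B', hB', hg'⟩ := hg.bdd R
  refine ⟨B * L + K * B', by positivity, fun x y hx hy => ?_⟩
  have e : Zakharov.mul (f x) (g x) - Zakharov.mul (f y) (g y) =
      Zakharov.mul (f x) (g x - g y) + Zakharov.mul (f x - f y) (g y) := by
    rw [map_sub, map_sub, sub_apply]; abel
  rw [e]
  refine (norm_add_le _ _).trans ?_
  have h1 := norm_mul_le (f x) (g x - g y)
  have h2 := norm_mul_le (f x - f y) (g y)
  have h3 : ‖f x‖ * ‖g x - g y‖ ≤ B * (L * ‖x - y‖) := by
    gcongr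
    · exact hf' x hx
    · exact h' x y hx hy
  have h4 : ‖f x - f y‖ * ‖g y‖ ≤ (K * ‖x - y‖) * B' := by
    gcongr
    · exact h x y hx hy
    · exact hg' y hy
  calc _ ≤ B * (L * ‖x - y‖) + (K * ‖x - y‖) * B' := by linarith
    _ = _ := by ring

end BallLip

theorem ballLip_fst : BallLip (fun x : L2C × L2C => x.1) := fun R =>
  ⟨1, zero_le_one, fun x y _ _ => by rw [one_mul, ← Prod.fst_sub]; exact norm_fst_le _⟩

theorem ballLip_snd : BallLip (fun x : L2C × L2C => x.2) := fun R =>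
  ⟨1, zero_le_one, fun x y _ _ => by rw [one_mul, ← Prod.snd_sub]; exact norm_snd_le _⟩

section

variable {E : Type*} [NormedAddCommGroup E] {a : E → L2C}

theorem ballLip_uu (ha : BallLip a) : BallLip (fun x => uu (a x)) := ha.clm (D (jb (-2)))

theorem ballLip_ww (ha : BallLip a) : BallLip (fun x => ww (a x)) :=
  (ha.clm emb).add (BallLip.const _)

theorem ballLip_rho (ha : BallLip a) : BallLip (fun x => rho (a x)) :=
  ((ha.clm emb).mul ((ballLip_uu ha).clmR conjL)).add
    ((BallLip.const Qinf).mul ((ballLip_uu ha).add ((ballLip_uu ha).clmR conjL)))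

theorem ballLip_fu0 (ha : BallLip a) : BallLip (fun x => fu0 (a x)) :=
  ((((ballLip_ww ha).mul (ballLip_rho ha)).add
    ((ballLip_uu ha).clm (mul Qinf) |>.clm (mul Qinf))).sub (ballLip_uu ha)).smul _

theorem ballLip_gg0 (ha : BallLip a) : BallLip (fun x => gg0 (a x)) :=
  (((((ballLip_uu ha).clm (mul Qinf)).sub
    (((ballLip_uu ha).clm (mul Qinf)).clm (mul Qinf) |>.clm (mul Qinf))).sub
      ((((ballLip_ww ha).clmR conjI).mul (ballLip_uu ha)).smul _)).imC).smul _

theorem ballLip_gg (ha : BallLip a) : BallLip (fun x => gg (a x)) :=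
  ((((((ballLip_ww ha).clmR conjI).mul ha).smul _).imC).smul _).add (ballLip_gg0 ha)

end

theorem ballLip_fu : BallLip (fun x : L2C × L2C => fu x.1 x.2) :=
  ((((ballLip_uu ballLip_fst).sub ballLip_fst).smul _ |>.smul _).sub
    (((ballLip_ww ballLip_fst).mul ((ballLip_snd.clm (D (jb (-1)))).clmR reC)).smul _)).add
    (ballLip_fu0 ballLip_fst)

theorem ballLip_fp (lam : ℝ) : BallLip (fun x : L2C × L2C => fp lam x.1 x.2) :=
  ((ballLip_snd.clm (D absSym)).smul _).add (ballLip_gg ballLip_fst)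

/-! ### Sobolev bounds for the right-hand side -/

theorem Sob.of_D_jb {r t C : ℝ} (ht : t ≤ 0) (hr : 0 ≤ r + t) {a : L2C} (h : Sob r C (D (jb t) a)) :
    Sob (r + t) C a := by
  obtain ⟨F, hF, hFa⟩ := h
  refine ⟨F, hF, ?_⟩
  apply D_jb_injective ht
  rw [D_jb_jb ht (by linarith), ← hFa]
  congr 2; ring_nf

/-- The multiplier norm of the soliton. -/
noncomputable def AQ (s : ℝ) : ℝ := (exists_isMult_Qinf (s + 1)).choose

theorem isMult_Qinf {s : ℝ} (hs : 2 < s) : IsMult (s + 1) (s - 1) (AQ s) Qinf :=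
  (exists_isMult_Qinf (s + 1)).choose_spec (s - 1) (by linarith)

theorem AQ_nonneg {s : ℝ} (hs : 2 < s) : 0 ≤ AQ s := (isMult_Qinf hs).nonneg

/-- The multiplier norm of `w = u + Q` for `‖u‖_{H^{s+1}} ≤ R`. -/
noncomputable def AW (s R : ℝ) : ℝ := 3 * (cq (s - 1) * R) + AQ s

theorem isMult_ww {s R : ℝ} (hs : 2 < s) {a : L2C} (ha : Sob (s + 1) R (uu a)) :
    IsMult (s + 1) (s - 1) (AW s R) (ww a) :=
  (isMult_emb (by linarith) (by linarith) ha).add (isMult_Qinf hs)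

theorem isMult_conjI_ww {s R : ℝ} (hs : 2 < s) {a : L2C} (ha : Sob (s + 1) R (uu a)) :
    IsMult (s + 1) (s - 1) (AW s R) (conjI (ww a)) := by
  rw [conjI_ww]
  have : Sob (s + 1) R (uu (conjL a)) := by
    rw [← conjL_uu]; exact ha.conj (by linarith)
  exact (isMult_emb (by linarith) (by linarith) this).add (isMult_Qinf hs)

theorem AW_nonneg {s R : ℝ} (hs : 2 < s) (hR : 0 ≤ R) : 0 ≤ AW s R := by
  have := AQ_nonneg hs
  have := cq_nonneg (s - 1)
  unfold AW; positivity

theorem rho_eq (a : L2C) : rho a = mul (ww a) (conjL (uu a)) + mul Qinf (uu a) := by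
  rw [rho, ww, map_add, map_add, add_apply]; abel

/-- Multiplication by `w` or `Q` on `H^t` for the exponents that occur. -/
theorem IsMult.sob {s A t C : ℝ} {w : Linf} (hs : 2 < s) (hw : IsMult (s + 1) (s - 1) A w)
    (ht : s - 1 ≤ t ∧ t ≤ s + 1) {f : L2C} (hf : Sob t C f) :
    Sob t (2 ^ (s + 1) * A * C) (Zakharov.mul w f) := by
  have hC := hf.nonneg
  have hA := hw.nonneg
  refine (hw.sob_mul (by linarith) (by linarith) ht.2 (Or.inl ht.1) hf).mono ?_
  gcongr
  · norm_num
  · exact ht.2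

/-- A constant bounding products of up to three factors `w` or `Q`. -/
noncomputable def BW (s R : ℝ) : ℝ := 1 + 2 ^ (s + 1) * AW s R

theorem BW_spec {s R t C : ℝ} (hs : 2 < s) (hR : 0 ≤ R) (ht : s - 1 ≤ t ∧ t ≤ s + 1) {f : L2C}
    (hf : Sob t C f) :
    (∀ a, Sob (s + 1) R (uu a) → Sob t (BW s R * C) (mul (ww a) f) ∧
      Sob t (BW s R * C) (mul (conjI (ww a)) f)) ∧ Sob t (BW s R * C) (mul Qinf f) := by
  have hC := hf.nonneg
  have h1 := AQ_nonneg hs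
  have hA : 0 ≤ AW s R := AW_nonneg hs hR
  have h2 : AQ s ≤ AW s R := by
    have := cq_nonneg (s - 1)
    unfold AW
    have : 0 ≤ 3 * (cq (s - 1) * R) := by positivity
    linarith
  have h3 : 2 ^ (s + 1) * AW s R * C ≤ BW s R * C := by unfold BW; gcongr; linarith
  refine ⟨fun a ha => ⟨(isMult_ww hs ha).sob hs ht hf |>.mono h3,
    (isMult_conjI_ww hs ha).sob hs ht hf |>.mono h3⟩, ?_⟩
  refine ((isMult_Qinf hs).sob hs ht hf).mono (le_trans ?_ h3)
  gcongr

theorem one_le_BW {s R : ℝ} (hs : 2 < s) (hR : 0 ≤ R) : 1 ≤ BW s R := by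
  have := AW_nonneg hs hR
  unfold BW
  have : 0 ≤ (2 : ℝ) ^ (s + 1) * AW s R := by positivity
  linarith

theorem sob_rho {s R m : ℝ} (hs : 2 < s) {a : L2C} (ha : Sob (s + 1) R (uu a))
    (hm : Sob (s + 1) m (uu a)) : Sob (s + 1) (2 * BW s R * m) (rho a) := by
  rw [rho_eq]
  have h := BW_spec hs ha.nonneg (t := s + 1) ⟨by linarith, le_rfl⟩ hm
  have h' := BW_spec hs ha.nonneg (t := s + 1) ⟨by linarith, le_rfl⟩ (hm.conj (by linarith))
  exact ((h'.1 a ha).1.add h.2).mono (le_of_eq (by ring))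

theorem sob_fu0 {s R m : ℝ} (hs : 2 < s) {a : L2C} (ha : Sob (s + 1) R (uu a))
    (hm : Sob (s + 1) m (uu a)) : Sob (s + 1) (4 * BW s R ^ 2 * m) (fu0 a) := by
  have hR := ha.nonneg
  have ht : s - 1 ≤ s + 1 ∧ s + 1 ≤ s + 1 := ⟨by linarith, le_rfl⟩
  have h1 := ((BW_spec hs hR ht (sob_rho hs ha hm)).1 a ha).1
  have h2 := (BW_spec hs hR ht ((BW_spec hs hR ht hm).2)).2
  refine (((h1.add h2).sub hm).smul Complex.I).mono ?_
  have hB := one_le_BW hs hR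
  have := hm.nonneg
  rw [Complex.norm_I]
  have : m ≤ BW s R ^ 2 * m := by
    have : 1 ≤ BW s R ^ 2 := by nlinarith
    nlinarith
  nlinarith

theorem sob_gg0 {s R m : ℝ} (hs : 2 < s) {a : L2C} (ha : Sob (s + 1) R (uu a))
    (hm : Sob (s + 1) m (uu a)) : Sob (s + 1) ((4 + 2 * kap) * BW s R ^ 3 * m) (gg0 a) := by
  have hR := ha.nonneg
  have ht : s - 1 ≤ s + 1 ∧ s + 1 ≤ s + 1 := ⟨by linarith, le_rfl⟩
  have h1 := (BW_spec hs hR ht hm).2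
  have h2 := (BW_spec hs hR ht h1).2
  have h3 := (BW_spec hs hR ht h2).2
  have h4 := ((BW_spec hs hR ht hm).1 a ha).2
  refine ((((h1.sub h3).sub (h4.smul (kap : ℂ))).imC (by linarith)).smul 2).mono ?_
  have hB := one_le_BW hs hR
  have hm0 := hm.nonneg
  have hk := kap_pos
  have e1 : ‖(kap : ℂ)‖ = kap := by rw [Complex.norm_real, Real.norm_of_nonneg hk.le]
  rw [e1]
  have h5 : BW s R * m ≤ BW s R ^ 3 * m := by
    have : BW s R ≤ BW s R ^ 3 := le_self_pow₀ hB (by norm_num)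
    gcongr
  have e2 : ‖(2 : ℂ)‖ = 2 := by simp
  rw [e2]
  nlinarith

theorem sob_a {s R : ℝ} (hs : 2 < s) {a : L2C} (ha : Sob (s + 1) R (uu a)) : Sob (s - 1) R a := by
  have := Sob.of_D_jb (t := -2) (by norm_num) (by linarith) ha
  convert this using 1; ring

theorem sob_b {s R : ℝ} (hs : 2 < s) {b : L2C} (hb : Sob s R (pp b)) : Sob (s - 1) R b :=
  Sob.of_D_jb (t := -1) (by norm_num) (by linarith) hb

theorem sob_gg {s R : ℝ} (hs : 2 < s) {a : L2C} (ha : Sob (s + 1) R (uu a)) :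
    Sob (s - 1) ((4 + 4 * kap) * BW s R ^ 3 * R) (gg a) := by
  have hR := ha.nonneg
  have h1 := ((BW_spec hs hR (t := s - 1) ⟨le_rfl, by linarith⟩ (sob_a hs ha)).1 a ha).2
  have h2 := (sob_gg0 hs ha ha).of_le (r' := s - 1) (by linarith) (by linarith)
  refine ((((h1.smul (kap : ℂ)).imC (by linarith)).smul 2).add h2).mono ?_
  have hB := one_le_BW hs hR
  have hk := kap_pos
  have e1 : ‖(kap : ℂ)‖ = kap := by rw [Complex.norm_real, Real.norm_of_nonneg hk.le]
  have e2 : ‖(2 : ℂ)‖ = 2 := by simp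
  rw [e1, e2]
  have h5 : BW s R * R ≤ BW s R ^ 3 * R := by
    have : BW s R ≤ BW s R ^ 3 := le_self_pow₀ hB (by norm_num)
    gcongr
  nlinarith

theorem sob_lapU {s R : ℝ} (hs : 2 < s) {a : L2C} (ha : Sob (s + 1) R (uu a)) :
    Sob (s - 1) (2 * kap * R) (lapU a) := by
  have h := ((ha.of_le (r' := s - 1) (by linarith) (by linarith)).sub (sob_a hs ha)).smul (kap : ℂ)
  refine h.mono (le_of_eq ?_)
  rw [Complex.norm_real, Real.norm_of_nonneg kap_pos.le]; ring

theorem sob_fu {s R : ℝ} (hs : 2 < s) {a b : L2C} (ha : Sob (s + 1) R (uu a))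
    (hb : Sob s R (reC (pp b))) : Sob (s - 1) ((2 * kap + 5) * BW s R ^ 2 * R) (fu a b) := by
  have hR := ha.nonneg
  have h1 := (sob_lapU hs ha).smul Complex.I
  have h2 := ((((BW_spec hs hR (t := s) ⟨by linarith, by linarith⟩ hb).1 a ha).1).smul Complex.I).of_le
    (r' := s - 1) (by linarith) (by linarith)
  have h3 := (sob_fu0 hs ha ha).of_le (r' := s - 1) (by linarith) (by linarith)
  refine ((h1.sub h2).add h3).mono ?_
  have hB := one_le_BW hs hR
  have hk := kap_pos
  rw [Complex.norm_I]
  have h5 : BW s R * R ≤ BW s R ^ 2 * R := by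
    have : BW s R ≤ BW s R ^ 2 := le_self_pow₀ hB (by norm_num)
    gcongr
  have h6 : 2 * kap * R ≤ 2 * kap * (BW s R ^ 2 * R) := by
    have : R ≤ BW s R ^ 2 * R := le_mul_of_one_le_left hR (one_le_pow₀ hB)
    gcongr
  nlinarith

theorem sob_absD {s R : ℝ} (hs : 2 < s) {b : L2C} (hb : Sob s R (pp b)) :
    Sob (s - 1) (2 * Real.pi * R) (absD b) := by
  have := (sob_b hs hb).multiplier (t := 0) (c := 2 * Real.pi) bddSym_absSym (by linarith)
    (by linarith) (fun ξ => by
      rw [abs_of_nonneg (absSym_nonneg ξ), jb_zero, mul_one]; exact absSym_le ξ)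
  simpa [absD] using this

theorem sob_fp {s R lam : ℝ} (hs : 2 < s) (hl : 0 < lam) {a b : L2C} (ha : Sob (s + 1) R (uu a))
    (hb : Sob s R (pp b)) :
    Sob (s - 1) (lam * (2 * Real.pi * R) + (4 + 4 * kap) * BW s R ^ 3 * R) (fp lam a b) := by
  refine (((sob_absD hs hb).smul _).add (sob_gg hs ha)).mono (le_of_eq ?_)
  simp [abs_of_pos hl]

/-! ### The energy estimate -/

theorem inner_D_self_im {m : Plane → ℝ} (hm : BddSym m) (f : L2C) : (inner ℂ f (D m f)).im = 0 := by
  have h := inner_conj_symm (𝕜 := ℂ) f (D m f)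
  rw [inner_D hm] at h
  exact Complex.conj_eq_iff_im.1 h

theorem norm_D_jbk_zero_le (k : ℕ) (f : L2C) : ‖D (jbk 0 k) f‖ ≤ ‖f‖ := by
  refine (norm_D_le (C := 1) (bddSym_jbk 0 k).meas (fun ξ => ?_) f).trans (by linarith)
  rw [abs_of_nonneg (jbk_nonneg _ _ _)]
  exact (jbk_le _ _ _).trans (by simp)

theorem sob_D_jbk {r : ℝ} (hr : 0 ≤ r) (k : ℕ) (f : L2C) : Sob r ‖f‖ (D (jbk (-r) k) f) :=
  ⟨D (jbk 0 k) f, norm_D_jbk_zero_le k f, by rw [D_jb_jbk (by linarith)]; simp⟩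

theorem Sob.norm_inner_le {r C : ℝ} (hr : 0 ≤ r) {f : L2C} (hf : Sob r C f) (h : L2C) :
    ‖inner ℂ h f‖ ≤ ‖D (jb (-r)) h‖ * C := by
  obtain ⟨F, hF, rfl⟩ := hf
  rw [← inner_D (bddSym_jb (by linarith))]
  exact (norm_inner_le_norm _ _).trans (by gcongr)

theorem Sob.norm_inner_jbk_le {r C : ℝ} (hr : 0 ≤ r) {f : L2C} (hf : Sob r C f) (k : ℕ) (h : L2C) :
    ‖inner ℂ (D (jbk r k) h) f‖ ≤ ‖h‖ * C := by
  have hC := hf.nonneg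
  refine (hf.norm_inner_le hr _).trans ?_
  rw [D_jb_jbk (by linarith), neg_add_cancel]
  gcongr
  exact norm_D_jbk_zero_le k h

theorem D_reC_jbk (r : ℝ) (k : ℕ) (f : L2C) : D (jbk r k) (reC f) = reC (D (jbk r k) f) :=
  D_reC (bddSym_jbk r k) (jbk_neg_arg r k) f

/-- The a priori bound in `H^{s+1} × H^s` for frequency-truncated data. The two terms that lose a
derivative combine to a commutator, and the group of the wave equation drops out, so that the
constant depends neither on `lam` nor on the truncation. -/
theorem energy_estimate {s R : ℝ} (hs : 2 < s) (hR : 0 ≤ R) : ∃ K : ℝ, 0 ≤ K ∧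
    ∀ (lam : ℝ) (k : ℕ) (U V : L2C), ‖U‖ ≤ R →
      2 * kap * (inner ℂ U (D (jbk (s + 1) k)
          (fu (D (jbk (1 - s) k) U) (D (jbk (1 - s) k) V)))).re +
        (inner ℂ V (D (jbk s k) (fp lam (D (jbk (1 - s) k) U) (D (jbk (1 - s) k) V)))).re ≤
      K * (2 * kap * ‖U‖ ^ 2 + ‖V‖ ^ 2) := by
  have hk := kap_pos
  have hA := AW_nonneg hs hR
  have hB : 0 ≤ BW s R := zero_le_one.trans (one_le_BW hs hR)
  set C₁ := 4 * BW s R ^ 2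
  set C₂ := (4 + 2 * kap) * BW s R ^ 3
  set C₃ := s * 2 ^ (2 * s + 2) * AW s R
  have hC₁ : 0 ≤ C₁ := by positivity
  have hC₂ : 0 ≤ C₂ := by positivity
  have hC₃ : 0 ≤ C₃ := by positivity
  refine ⟨C₁ + (C₂ + 2 * kap * C₃) * (1 + 1 / (2 * kap)), by positivity, fun lam k U V hU => ?_⟩
  set a := D (jbk (1 - s) k) U with ha
  set b := D (jbk (1 - s) k) V with hb
  have hua : uu a = D (jbk (-(s + 1)) k) U := by
    rw [uu, ha, D_jb_jbk (by norm_num)]; congr 3; ring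
  have hpb : pp b = D (jbk (-s) k) V := by
    rw [pp, hb, D_jb_jbk (by norm_num)]; congr 3; ring
  have hm : Sob (s + 1) ‖U‖ (uu a) := hua ▸ sob_D_jbk (by linarith) k U
  have hRa : Sob (s + 1) R (uu a) := hm.mono hU
  have e1 : (inner ℂ U (D (jbk (s + 1) k) (fu a b))).re =
      (inner ℂ (D (jbk (s + 1) k) U) (fu0 a)).re -
        (inner ℂ (D (jbk (-s) k) (reC V)) (mul (conjI (ww a)) (D (jbk (s + 1) k) U))).im := by
    rw [← inner_D (bddSym_jbk _ _), fu, inner_add_right, inner_sub_right, Complex.add_re,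
      Complex.sub_re]
    have h1 : (inner ℂ (D (jbk (s + 1) k) U) (Complex.I • lapU a)).re = 0 := by
      rw [lapU, hua, ha, inner_D (bddSym_jbk _ _), map_smul, map_smul, map_sub, D_jbk_jbk, D_jbk_jbk,
        inner_smul_right, inner_smul_right, inner_sub_right]
      simp [inner_D_self_im (bddSym_jbk _ _)]
    have h2 : (inner ℂ (D (jbk (s + 1) k) U) (Complex.I • mul (ww a) (reC (pp b)))).re =
        (inner ℂ (D (jbk (-s) k) (reC V)) (mul (conjI (ww a)) (D (jbk (s + 1) k) U))).im := by
      rw [hpb, ← D_reC_jbk, inner_smul_right, inner_mul_right,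
        ← inner_conj_symm (D (jbk (-s) k) (reC V))]
      simp [-inner_conj_symm]
    rw [h1, h2]; ring
  have e2 : (inner ℂ V (D (jbk s k) (fp lam a b))).re =
      (inner ℂ (D (jbk s k) V) (gg0 a)).re +
        2 * kap * (inner ℂ (D (jbk s k) (reC V)) (mul (conjI (ww a)) (D (jbk (1 - s) k) U))).im := by
    rw [← inner_D (bddSym_jbk _ _), fp, gg, inner_add_right, inner_add_right, Complex.add_re,
      Complex.add_re]
    have h1 : (inner ℂ (D (jbk s k) V) ((-(Complex.I * lam)) • absD b)).re = 0 := by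
      rw [absD, hb, D_D bddSym_absSym (bddSym_jbk _ _), inner_D (bddSym_jbk _ _), map_smul,
        D_D (bddSym_jbk _ _) (bddSym_absSym.mul (bddSym_jbk _ _)), inner_smul_right]
      simp [inner_D_self_im ((bddSym_jbk _ _).mul (bddSym_absSym.mul (bddSym_jbk _ _)))]
    have h2 : (inner ℂ (D (jbk s k) V) ((2 : ℂ) • imC ((kap : ℂ) • mul (conjI (ww a)) a))).re =
        2 * kap * (inner ℂ (D (jbk s k) (reC V)) (mul (conjI (ww a)) a)).im := by
      rw [D_reC_jbk, inner_smul_right, show (2 : ℂ) = ((2 : ℝ) : ℂ) by simp, Complex.re_ofReal_mul,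
        re_inner_imC, inner_smul_right, Complex.im_ofReal_mul]
      ring
    rw [h1, h2]; ring
  have b1 : (inner ℂ (D (jbk (s + 1) k) U) (fu0 a)).re ≤ ‖U‖ * (C₁ * ‖U‖) :=
    (Complex.re_le_norm _).trans ((sob_fu0 hs hRa hm).norm_inner_jbk_le (by linarith) k U)
  have b2 : (inner ℂ (D (jbk s k) V) (gg0 a)).re ≤ ‖V‖ * (C₂ * ‖U‖) :=
    (Complex.re_le_norm _).trans (((sob_gg0 hs hRa hm).of_le (r' := s) (by linarith)
      (by linarith)).norm_inner_jbk_le (by linarith) k V)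
  have b3 : (inner ℂ (D (jbk s k) (reC V)) (mul (conjI (ww a)) (D (jbk (1 - s) k) U))).im -
      (inner ℂ (D (jbk (-s) k) (reC V)) (mul (conjI (ww a)) (D (jbk (s + 1) k) U))).im ≤
      C₃ * ‖V‖ * ‖U‖ := by
    rw [← Complex.sub_im]
    refine (Complex.abs_im_le_norm _ |> (le_abs_self _).trans).trans ?_
    refine ((isMult_conjI_ww hs hRa).commutator hs k (reC V) U).trans ?_
    gcongr
    exact norm_reC_le V
  rw [e1, e2]
  have b4 : ‖V‖ * ‖U‖ ≤ (1 + 1 / (2 * kap)) * (2 * kap * ‖U‖ ^ 2 + ‖V‖ ^ 2) := by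
    have : (1 + 1 / (2 * kap)) * (2 * kap * ‖U‖ ^ 2 + ‖V‖ ^ 2) =
      2 * kap * ‖U‖ ^ 2 + ‖V‖ ^ 2 + ‖U‖ ^ 2 + ‖V‖ ^ 2 / (2 * kap) := by field_simp; ring
    rw [this]
    have : 0 ≤ 2 * kap * ‖U‖ ^ 2 := by positivity
    have : 0 ≤ ‖V‖ ^ 2 / (2 * kap) := by positivity
    nlinarith [sq_nonneg (‖U‖ - ‖V‖), sq_nonneg (‖U‖ + ‖V‖)]
  have b5 : 2 * kap * (‖U‖ * (C₁ * ‖U‖)) ≤ C₁ * (2 * kap * ‖U‖ ^ 2 + ‖V‖ ^ 2) := by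
    have : 0 ≤ C₁ * ‖V‖ ^ 2 := by positivity
    linarith
  have b6 : (C₂ + 2 * kap * C₃) * (‖V‖ * ‖U‖) ≤
      (C₂ + 2 * kap * C₃) * ((1 + 1 / (2 * kap)) * (2 * kap * ‖U‖ ^ 2 + ‖V‖ ^ 2)) := by gcongr
  have b7 := mul_le_mul_of_nonneg_left b1 (by positivity : 0 ≤ 2 * kap)
  have b8 := mul_le_mul_of_nonneg_left b3 (by positivity : 0 ≤ 2 * kap)
  linarith

/-! ### The difference estimate -/

theorem ww_sub (a a' : L2C) : ww a - ww a' = emb (a - a') := by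
  rw [ww, ww, map_sub]; abel

theorem mul_sub_mul (w w' : Linf) (f f' : L2C) :
    mul w f - mul w' f' = mul w (f - f') + mul (w - w') f' := by
  rw [map_sub, map_sub, sub_apply]; abel

/-- A function in `H^r` with `r ≥ 2` is `⟨D⟩^{-2}` of an `L²` function. -/
theorem Sob.exists_uu {r C : ℝ} (hr : 2 ≤ r) {f : L2C} (hf : Sob r C f) :
    ∃ g, uu g = f := by
  obtain ⟨F, -, hF⟩ := hf.of_le (r' := 2) (by norm_num) hr
  exact ⟨F, hF⟩

theorem mul_emb_uu (a c : L2C) : mul (emb a) (uu c) = mul (emb c) (uu a) := mul_emb_comm a c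

/-- Multiplication by `w` or `Q` on `H^1`. -/
theorem IsMult.sob_one {r q A C : ℝ} {w : Linf} (hw : IsMult r q A w) (hq : 0 ≤ q) (hr : 1 + q ≤ r)
    {f : L2C} (hf : Sob 1 C f) : Sob 1 (2 * A * C) (Zakharov.mul w f) := by
  have := hw.sob_mul (by linarith) zero_le_one (by linarith) (Or.inr hr) hf
  simpa using this

/-- The product of a difference `d` in `H^1` with a function in `H^s`. -/
theorem sob_one_emb_mul {s R e : ℝ} (hs : 2 < s) {α f : L2C} (hf : Sob s R f)
    (hd : Sob 1 e (uu α)) : Sob 1 (2 * (3 * (cq (s - 1) * R)) * e) (mul (emb α) f) := by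
  obtain ⟨g, rfl⟩ := hf.exists_uu hs.le
  rw [mul_emb_uu]
  exact (isMult_emb (by linarith) (by linarith) hf).sob_one (by linarith) (by linarith) hd

theorem sob_one_rho_sub {s R e : ℝ} (hs : 2 < s) {a a' : L2C} (ha : Sob (s + 1) R (uu a))
    (ha' : Sob (s + 1) R (uu a')) (hd : Sob 1 e (uu (a - a'))) :
    Sob 1 ((12 * (cq (s - 1) * R) + 4 * AQ s) * e) (rho a - rho a') := by
  have hb : conjL (uu a) - conjL (uu a') = conjL (uu (a - a')) := by
    simp only [uu, map_sub]
  have h1 := (isMult_emb (q := s - 1) (by linarith) (by linarith) ha).sob_one (by linarith) (by linarith)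
    (hd.conj zero_le_one)
  have h2 := sob_one_emb_mul hs ((ha'.conj (by linarith)).of_le (r' := s) (by linarith)
    (by linarith)) hd
  have h3 := (isMult_Qinf hs).sob_one (by linarith) (by linarith) (hd.add (hd.conj zero_le_one))
  have e1 : rho a - rho a' = mul (emb a) (conjL (uu (a - a'))) + mul (emb (a - a')) (conjL (uu a'))
      + mul Qinf (uu (a - a') + conjL (uu (a - a'))) := by
    rw [← hb]
    simp only [rho, uu, map_sub, map_add, sub_apply]
    abel
  rw [e1]
  exact ((h1.add h2).add h3).mono (le_of_eq (by ring))

theorem sob_one_fu0_sub {s R : ℝ} (hs : 2 < s) (hR : 0 ≤ R) : ∃ K : ℝ, 0 ≤ K ∧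
    ∀ (e : ℝ) (a a' : L2C), Sob (s + 1) R (uu a) → Sob (s + 1) R (uu a') →
      Sob 1 e (uu (a - a')) → Sob 1 (K * e) (fu0 a - fu0 a') := by
  have hB : 0 ≤ BW s R := zero_le_one.trans (one_le_BW hs hR)
  have hA := AW_nonneg hs hR
  have hQ := AQ_nonneg hs
  have hc := cq_nonneg (s - 1)
  refine ⟨2 * AW s R * (12 * (cq (s - 1) * R) + 4 * AQ s) +
    2 * (3 * (cq (s - 1) * (2 * BW s R * R))) + 2 * AQ s * (2 * AQ s) + 1, by positivity,
    fun e a a' ha ha' hd => ?_⟩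
  have h1 := (isMult_ww hs ha).sob_one (by linarith) (by linarith) (sob_one_rho_sub hs ha ha' hd)
  have h2 := sob_one_emb_mul hs ((sob_rho hs ha' ha').of_le (r' := s) (by linarith) (by linarith)) hd
  have hq := (isMult_Qinf hs)
  have h3 := hq.sob_one (by linarith) (by linarith) (hq.sob_one (by linarith) (by linarith) hd)
  have e1 : fu0 a - fu0 a' = Complex.I • (mul (ww a) (rho a - rho a') + mul (emb (a - a')) (rho a') +
      mul Qinf (mul Qinf (uu (a - a'))) - uu (a - a')) := by
    rw [← ww_sub]
    simp only [fu0, uu, map_sub, sub_apply, smul_add, smul_sub]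
    abel
  rw [e1]
  refine ((((h1.add h2).add h3).sub hd).smul Complex.I).mono (le_of_eq ?_)
  rw [Complex.norm_I]; ring

/-- The product of a difference with a function in `H^{s-1} ⊆ L^∞`. -/
theorem norm_emb_mul_le {s R : ℝ} (hs : 2 < s) {α f : L2C} (hf : Sob (s - 1) R f) :
    ‖mul (emb α) f‖ ≤ cq (s - 1) * R * ‖uu α‖ := by
  obtain ⟨F, hF, rfl⟩ := hf
  obtain ⟨h1, h2⟩ := memLp_top_of_bessel (q := s - 1) (by linarith) F
  have hc := cq_nonneg (s - 1)
  have e1 : mul (emb α) (D (jb (-(s - 1))) F) = mul h1.toLp (uu α) := by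
    apply Lp.ext
    filter_upwards [coeFn_mul (emb α) (D (jb (-(s - 1))) F), coeFn_mul h1.toLp (uu α), coeFn_emb α,
      h1.coeFn_toLp] with x y1 y2 y3 y4
    rw [y1, y2, y3, y4, uu, mul_comm]
  rw [e1]
  refine (norm_mul_le _ _).trans ?_
  gcongr
  rw [Lp.norm_toLp]
  refine (ENNReal.toReal_le_of_le_ofReal (by positivity) h2).trans ?_
  gcongr

/-- The Lipschitz bound for the part of `∂ₜ|w|²` without derivatives costs only the `L²` norm of the
difference of the functions `u`. -/
theorem norm_gg0_sub_le {R : ℝ} (hR : 0 ≤ R) : ∃ K : ℝ, 0 ≤ K ∧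
    ∀ a a' : L2C, ‖a‖ ≤ R → ‖a'‖ ≤ R → ‖gg0 a - gg0 a'‖ ≤ K * ‖uu (a - a')‖ := by
  refine ⟨2 * (‖Qinf‖ + ‖Qinf‖ * (‖Qinf‖ * ‖Qinf‖) +
    kap * (‖(conjI : Linf →L[ℝ] Linf)‖ * (‖emb‖ * R + ‖Qinf‖) + ‖emb‖ * R)), by
      have := kap_pos; positivity, fun a a' ha ha' => ?_⟩
  have hk := kap_pos
  set d := uu (a - a') with hd
  have e1 : mul (conjI (ww a)) (uu a) - mul (conjI (ww a')) (uu a') =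
      mul (conjI (ww a)) d + mul (emb a') (conjL d) := by
    rw [mul_sub_mul, ← map_sub conjI, ww_sub, conjI_emb, mul_emb_uu, ← conjL_uu, hd]
    simp only [uu, map_sub]
  have e2 : gg0 a - gg0 a' = (2 : ℂ) • imC (mul Qinf d - mul Qinf (mul Qinf (mul Qinf d)) -
      (kap : ℂ) • (mul (conjI (ww a)) d + mul (emb a') (conjL d))) := by
    rw [← e1, gg0, gg0, ← smul_sub, ← imC_sub, hd]
    simp only [uu, map_sub, smul_sub]
    congr 2; abel
  rw [e2, norm_smul]
  have n1 : ‖mul Qinf d‖ ≤ ‖Qinf‖ * ‖d‖ := norm_mul_le _ _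
  have n2 : ‖mul Qinf (mul Qinf (mul Qinf d))‖ ≤ ‖Qinf‖ * (‖Qinf‖ * (‖Qinf‖ * ‖d‖)) := by
    refine (norm_mul_le _ _).trans ?_
    gcongr
    refine (norm_mul_le _ _).trans ?_
    gcongr
  have n3 : ‖mul (conjI (ww a)) d‖ ≤
      ‖(conjI : Linf →L[ℝ] Linf)‖ * (‖emb‖ * R + ‖Qinf‖) * ‖d‖ := by
    refine (norm_mul_le _ _).trans ?_
    gcongr
    refine (conjI.le_opNorm _).trans ?_
    gcongr
    refine (norm_add_le _ _).trans ?_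
    gcongr
    exact (emb.le_opNorm _).trans (by gcongr)
  have n4 : ‖mul (emb a') (conjL d)‖ ≤ ‖emb‖ * R * ‖d‖ := by
    refine (norm_mul_le _ _).trans ?_
    rw [norm_conjL]
    gcongr
    exact (emb.le_opNorm _).trans (by gcongr)
  have n5 : ‖(kap : ℂ) • (mul (conjI (ww a)) d + mul (emb a') (conjL d))‖ ≤ kap *
      (‖(conjI : Linf →L[ℝ] Linf)‖ * (‖emb‖ * R + ‖Qinf‖) * ‖d‖ + ‖emb‖ * R * ‖d‖) := by
    rw [norm_smul, Complex.norm_real, Real.norm_of_nonneg hk.le]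
    gcongr
    exact (norm_add_le _ _).trans (add_le_add n3 n4)
  have n6 := norm_imC_le (mul Qinf d - mul Qinf (mul Qinf (mul Qinf d)) -
      (kap : ℂ) • (mul (conjI (ww a)) d + mul (emb a') (conjL d)))
  have n7 := norm_sub_le (mul Qinf d - mul Qinf (mul Qinf (mul Qinf d)))
    ((kap : ℂ) • (mul (conjI (ww a)) d + mul (emb a') (conjL d)))
  have n8 := norm_sub_le (mul Qinf d) (mul Qinf (mul Qinf (mul Qinf d)))
  have n9 : ‖(2 : ℂ)‖ = 2 := by simp
  rw [n9]
  nlinarith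

/-- The energy of a difference. -/
noncomputable def dEnergy (α β : L2C) : ℝ := 2 * kap * ‖D (jb (-1)) α‖ ^ 2 + ‖pp β‖ ^ 2

/-- The difference of two solutions is controlled in `H^1 × L²`: the terms that lose a derivative
cancel exactly. -/
theorem difference_estimate {s R : ℝ} (hs : 2 < s) (hR : 0 ≤ R) : ∃ K : ℝ, 0 ≤ K ∧
    ∀ (lam : ℝ) (a b a' b' : L2C), Sob (s + 1) R (uu a) → Sob (s + 1) R (uu a') →
      Sob s R (reC (pp b')) →
      2 * kap * (inner ℂ (a - a') (fu a b - fu a' b')).re +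
        (inner ℂ (pp (b - b')) (fp lam a b - fp lam a' b')).re ≤
      K * dEnergy (a - a') (b - b') := by
  have hk := kap_pos
  have hc := cq_nonneg (s - 1)
  obtain ⟨K₁, hK₁, H₁⟩ := sob_one_fu0_sub hs hR
  obtain ⟨K₂, hK₂, H₂⟩ := norm_gg0_sub_le hR
  set K₃ := 2 * (3 * (cq (s - 1) * R))
  set K₄ := 2 * kap * (cq (s - 1) * R)
  have hK₃ : 0 ≤ K₃ := by positivity
  have hK₄ : 0 ≤ K₄ := by positivity
  refine ⟨K₁ + K₃ + (K₂ + K₄) * (1 + 1 / (2 * kap)), by positivity, fun lam a b a' b' ha ha' hb' => ?_⟩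
  set α := a - a' with hα
  set β := b - b' with hβ
  set e := ‖D (jb (-1)) α‖ with he
  have hd : Sob 1 e (uu α) := ⟨D (jb (-1)) α, le_rfl, by
    rw [D_jb_jb (by norm_num) (by norm_num), uu]; norm_num⟩
  have hde : ‖uu α‖ ≤ e := hd.norm_le zero_le_one
  have e1 : (inner ℂ α (fu a b - fu a' b')).re =
      (inner ℂ α (fu0 a - fu0 a')).re + (inner ℂ α (mul (emb α) (reC (pp b')))).im -
        (inner ℂ (reC (pp β)) (mul (conjI (ww a)) α)).im := by
    have h0 : fu a b - fu a' b' = Complex.I • lapU α - Complex.I • (mul (ww a) (reC (pp β)) +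
        mul (emb α) (reC (pp b'))) + (fu0 a - fu0 a') := by
      have : mul (ww a) (reC (pp b)) - mul (ww a') (reC (pp b')) = mul (ww a) (reC (pp β)) +
        mul (emb α) (reC (pp b')) := by
        have h' : reC (pp b) - reC (pp b') = reC (pp β) := by simp only [pp, hβ, map_sub]
        rw [mul_sub_mul, ww_sub, h']
      rw [← this, fu, fu, hα]
      simp only [lapU, uu, map_sub, smul_sub]
      abel
    have h1 : (inner ℂ α (Complex.I • lapU α)).re = 0 := by
      have h := inner_D_self_im (bddSym_jb (by norm_num : (-2 : ℝ) ≤ 0)) α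
      have h' := inner_D_self_im bddSym_one α
      rw [D_one] at h'
      rw [lapU, inner_smul_right, inner_smul_right, inner_sub_right, uu]
      simp [-inner_self_eq_norm_sq_to_K, h, h']
    have h2 : (inner ℂ α (Complex.I • mul (ww a) (reC (pp β)))).re =
        (inner ℂ (reC (pp β)) (mul (conjI (ww a)) α)).im := by
      rw [inner_smul_right, inner_mul_right, ← inner_conj_symm (reC (pp β))]
      simp [-inner_conj_symm]
    have h3 : (inner ℂ α (Complex.I • mul (emb α) (reC (pp b')))).re =
        -(inner ℂ α (mul (emb α) (reC (pp b')))).im := by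
      rw [inner_smul_right]; simp
    rw [h0, inner_add_right, inner_sub_right, smul_add, inner_add_right, Complex.add_re,
      Complex.sub_re, Complex.add_re, h1, h2, h3]
    ring
  have e2 : (inner ℂ (pp β) (fp lam a b - fp lam a' b')).re =
      (inner ℂ (pp β) (gg0 a - gg0 a')).re +
      (inner ℂ (pp β) ((2 : ℂ) • imC ((kap : ℂ) • mul (emb (conjL α)) a'))).re +
        2 * kap * (inner ℂ (reC (pp β)) (mul (conjI (ww a)) α)).im := by
    have h0 : fp lam a b - fp lam a' b' = (-(Complex.I * lam)) • absD β +
        (2 : ℂ) • imC ((kap : ℂ) • mul (conjI (ww a)) α) +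
        (2 : ℂ) • imC ((kap : ℂ) • mul (emb (conjL α)) a') + (gg0 a - gg0 a') := by
      have h : mul (conjI (ww a)) a - mul (conjI (ww a')) a' = mul (conjI (ww a)) α +
          mul (emb (conjL α)) a' := by
        rw [mul_sub_mul, ← map_sub conjI, ww_sub, conjI_emb]
      have h' : absD β = absD b - absD b' := by rw [absD, hβ, map_sub]; rfl
      rw [add_assoc (_ • absD β), ← smul_add (2 : ℂ), ← imC_add, ← smul_add, ← h, h', fp, fp, gg, gg,
        smul_sub (kap : ℂ), imC_sub, smul_sub, smul_sub]
      abel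
    have h1 : (inner ℂ (pp β) ((-(Complex.I * lam)) • absD β)).re = 0 := by
      have hm := bddSym_jb (by norm_num : (-1 : ℝ) ≤ 0)
      have h := inner_D_self_im (hm.mul bddSym_absSym) β
      rw [inner_smul_right, pp, absD, inner_D hm, D_D hm bddSym_absSym]
      simp [h]
    have h2 : (inner ℂ (pp β) ((2 : ℂ) • imC ((kap : ℂ) • mul (conjI (ww a)) α))).re =
        2 * kap * (inner ℂ (reC (pp β)) (mul (conjI (ww a)) α)).im := by
      rw [inner_smul_right, show (2 : ℂ) = ((2 : ℝ) : ℂ) by simp, Complex.re_ofReal_mul,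
        re_inner_imC, inner_smul_right, Complex.im_ofReal_mul]
      ring
    rw [h0, inner_add_right, inner_add_right, inner_add_right, Complex.add_re, Complex.add_re,
      Complex.add_re, h1, h2]
    ring
  have b1 : (inner ℂ α (fu0 a - fu0 a')).re ≤ e * (K₁ * e) :=
    (Complex.re_le_norm _).trans ((H₁ e a a' ha ha' hd).norm_inner_le zero_le_one α)
  have b2 : (inner ℂ α (mul (emb α) (reC (pp b')))).im ≤ e * (K₃ * e) :=
    ((le_abs_self _).trans (Complex.abs_im_le_norm _)).trans
      ((sob_one_emb_mul hs hb' hd).norm_inner_le zero_le_one α)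
  have b3 : (inner ℂ (pp β) (gg0 a - gg0 a')).re ≤ ‖pp β‖ * (K₂ * e) := by
    refine (Complex.re_le_norm _).trans ((norm_inner_le_norm _ _).trans ?_)
    gcongr
    refine (H₂ a a' ((sob_a hs ha).norm_le (by linarith)) ((sob_a hs ha').norm_le
      (by linarith))).trans ?_
    gcongr
  have b4 : (inner ℂ (pp β) ((2 : ℂ) • imC ((kap : ℂ) • mul (emb (conjL α)) a'))).re ≤
      ‖pp β‖ * (K₄ * e) := by
    refine (Complex.re_le_norm _).trans ((norm_inner_le_norm _ _).trans ?_)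
    gcongr
    rw [norm_smul]
    have n1 := norm_imC_le ((kap : ℂ) • mul (emb (conjL α)) a')
    have n2 := norm_emb_mul_le hs (α := conjL α) (sob_a hs ha')
    rw [norm_smul, Complex.norm_real, Real.norm_of_nonneg hk.le] at n1
    rw [← conjL_uu, norm_conjL] at n2
    have n3 : cq (s - 1) * R * ‖uu α‖ ≤ cq (s - 1) * R * e := by gcongr
    have n4 : kap * ‖mul (emb (conjL α)) a'‖ ≤ kap * (cq (s - 1) * R * e) := by
      gcongr; exact n2.trans n3
    have n9 : ‖(2 : ℂ)‖ = 2 := by simp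
    rw [n9]
    calc _ ≤ 2 * (kap * (cq (s - 1) * R * e)) := by linarith
      _ = K₄ * e := by ring
  rw [e1, e2, dEnergy, ← he]
  set p := ‖pp β‖
  have hp : 0 ≤ p := norm_nonneg _
  have b5 : p * e ≤ (1 + 1 / (2 * kap)) * (2 * kap * e ^ 2 + p ^ 2) := by
    have : (1 + 1 / (2 * kap)) * (2 * kap * e ^ 2 + p ^ 2) =
      2 * kap * e ^ 2 + p ^ 2 + e ^ 2 + p ^ 2 / (2 * kap) := by field_simp; ring
    rw [this]
    have : 0 ≤ 2 * kap * e ^ 2 := by positivity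
    have : 0 ≤ p ^ 2 / (2 * kap) := by positivity
    nlinarith [sq_nonneg (e - p), sq_nonneg (e + p)]
  have b6 : (K₂ + K₄) * (p * e) ≤
    (K₂ + K₄) * ((1 + 1 / (2 * kap)) * (2 * kap * e ^ 2 + p ^ 2)) := by gcongr
  have b7 : 0 ≤ (K₁ + K₃) * p ^ 2 := by positivity
  have b8 := mul_le_mul_of_nonneg_left (add_le_add b1 b2) (by positivity : 0 ≤ 2 * kap)
  linarith

/-! ### Ordinary differential equations and Gronwall's inequality -/

/-- Gronwall's inequality on `[0,T]`, in differential form. -/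
theorem gronwall_le {e e' : ℝ → ℝ} {T K ε : ℝ} (hK : 0 ≤ K) (hε : 0 ≤ ε)
    (he : ∀ t ∈ Set.Icc 0 T, HasDerivWithinAt e (e' t) (Set.Icc 0 T) t)
    (hb : ∀ t ∈ Set.Icc 0 T, e' t ≤ K * e t + ε) :
    ∀ t ∈ Set.Icc 0 T, e t ≤ (e 0 + ε * t) * Real.exp (K * t) := by
  intro t ht
  have hφ : ∀ x ∈ Set.Icc 0 T, HasDerivWithinAt (fun x => Real.exp (-(K * x)) * e x - ε * x)
      (Real.exp (-(K * x)) * (e' x - K * e x) - ε) (Set.Icc 0 T) x := fun x hx => by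
    have h1 : HasDerivAt (fun x => Real.exp (-(K * x))) (Real.exp (-(K * x)) * -K) x := by
      have := ((hasDerivAt_id x).const_mul K).neg.exp
      simpa using this
    have h2 : HasDerivAt (fun x => ε * x) ε x := by simpa using (hasDerivAt_id x).const_mul ε
    refine ((h1.hasDerivWithinAt.mul (he x hx)).sub h2.hasDerivWithinAt).congr_deriv ?_
    ring
  have hanti : AntitoneOn (fun x => Real.exp (-(K * x)) * e x - ε * x) (Set.Icc 0 T) := by
    apply antitoneOn_of_deriv_nonpos (convex_Icc 0 T) (fun x hx => (hφ x hx).continuousWithinAt)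
    · exact fun x hx => ((hφ x (interior_subset hx)).hasDerivAt
        (mem_interior_iff_mem_nhds.1 hx)).differentiableAt.differentiableWithinAt
    · intro x hx
      have hx' := interior_subset hx
      rw [((hφ x hx').hasDerivAt (mem_interior_iff_mem_nhds.1 hx)).deriv]
      have h1 : Real.exp (-(K * x)) * (e' x - K * e x) ≤ Real.exp (-(K * x)) * ε := by
        gcongr; linarith [hb x hx']
      have h2 : Real.exp (-(K * x)) ≤ 1 := Real.exp_le_one_iff.2 (by
        have := mul_nonneg hK hx'.1; linarith)
      nlinarith
  have h := hanti ⟨le_rfl, ht.1.trans ht.2⟩ ht ht.1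
  simp only [mul_zero, neg_zero, Real.exp_zero, one_mul, sub_zero] at h
  have h2 : e t = Real.exp (K * t) * (Real.exp (-(K * t)) * e t) := by
    rw [← mul_assoc, ← Real.exp_add]; simp
  rw [h2, mul_comm]
  gcongr
  linarith

/-- The radial retraction onto the ball of radius `R`. -/
noncomputable def retr {E : Type*} [NormedAddCommGroup E] [NormedSpace ℝ E] (R : ℝ) (x : E) : E :=
  (R / max R ‖x‖) • x

section

variable {E : Type*} [NormedAddCommGroup E] [NormedSpace ℝ E]

theorem retr_eq_self {R : ℝ} (hR : 0 < R) {x : E} (hx : ‖x‖ ≤ R) : retr R x = x := by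
  rw [retr, max_eq_left hx, div_self hR.ne', one_smul]

theorem norm_retr_le {R : ℝ} (hR : 0 < R) (x : E) : ‖retr R x‖ ≤ R := by
  have hm : 0 < max R ‖x‖ := lt_max_of_lt_left hR
  rw [retr, norm_smul, Real.norm_of_nonneg (by positivity), div_mul_eq_mul_div, div_le_iff₀ hm]
  gcongr
  exact le_max_right _ _

theorem norm_retr_sub_le {R : ℝ} (hR : 0 < R) (x y : E) : ‖retr R x - retr R y‖ ≤ 2 * ‖x - y‖ := by
  have hx : 0 < max R ‖x‖ := lt_max_of_lt_left hR
  have hy : 0 < max R ‖y‖ := lt_max_of_lt_left hR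
  have e : retr R x - retr R y =
      (R / max R ‖x‖) • (x - y) + (R / max R ‖x‖ - R / max R ‖y‖) • y := by
    rw [retr, retr, smul_sub, sub_smul]; abel
  have h1 : ‖(R / max R ‖x‖) • (x - y)‖ ≤ ‖x - y‖ := by
    rw [norm_smul, Real.norm_of_nonneg (by positivity)]
    exact mul_le_of_le_one_left (norm_nonneg _) ((div_le_one hx).2 (le_max_left _ _))
  have h2 : ‖(R / max R ‖x‖ - R / max R ‖y‖) • y‖ ≤ ‖x - y‖ := by
    have h3 : |max R ‖y‖ - max R ‖x‖| ≤ ‖x - y‖ := by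
      have h := abs_max_sub_max_le_abs ‖y‖ ‖x‖ R
      rw [max_comm ‖y‖, max_comm ‖x‖] at h
      refine h.trans ?_
      rw [norm_sub_rev]
      exact abs_norm_sub_norm_le y x
    have h4 : R / max R ‖x‖ - R / max R ‖y‖ =
        (R / max R ‖x‖) * ((max R ‖y‖ - max R ‖x‖) / max R ‖y‖) := by field_simp
    rw [norm_smul, h4, Real.norm_eq_abs, abs_mul,
      abs_of_pos (by positivity : 0 < R / max R ‖x‖), abs_div, abs_of_pos hy, mul_assoc,
      div_mul_eq_mul_div |max R ‖y‖ - max R ‖x‖|]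
    have h5 : |max R ‖y‖ - max R ‖x‖| * ‖y‖ / max R ‖y‖ ≤ ‖x - y‖ := by
      rw [div_le_iff₀ hy]
      gcongr
      exact le_max_right _ _
    exact (mul_le_of_le_one_left (by positivity) ((div_le_one hx).2 (le_max_left _ _))).trans h5
  rw [e, two_mul]
  exact (norm_add_le _ _).trans (add_le_add h1 h2)

/-- A vector field that is Lipschitz on balls, composed with the retraction onto a ball, has global
integral curves. -/
theorem BallLip.exists_integralCurve [CompleteSpace E] {f : E → E} (hf : BallLip f) {R : ℝ}
    (hR : 0 < R) {T : ℝ} (hT : 0 ≤ T) (y₀ : E) :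
    ∃ y : ℝ → E, y 0 = y₀ ∧
      ∀ t ∈ Set.Icc 0 T, HasDerivWithinAt y (f (retr R (y t))) (Set.Icc 0 T) t := by
  obtain ⟨K, hK, hlip⟩ := hf R
  obtain ⟨B, hB, hbdd⟩ := hf.bdd R
  have hpl : IsPicardLindelof (fun _ => fun x => f (retr R x)) (tmin := 0) (tmax := T)
      ⟨0, le_rfl, hT⟩ y₀ ⟨B * T, by positivity⟩ 0 ⟨B, hB⟩ ⟨K * 2, by positivity⟩ := by
    refine ⟨fun t _ => ?_, fun x _ => continuousOn_const, fun t _ x _ =>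
      hbdd _ (norm_retr_le hR x), ?_⟩
    · apply LipschitzOnWith.of_dist_le_mul
      intro x _ y _
      rw [dist_eq_norm, dist_eq_norm]
      refine (hlip _ _ (norm_retr_le hR x) (norm_retr_le hR y)).trans ?_
      change _ ≤ K * 2 * _
      rw [mul_assoc]
      gcongr
      exact norm_retr_sub_le hR x y
    · change B * max (T - 0) (0 - 0) ≤ B * T - 0
      simp [hT]
  exact hpl.exists_eq_forall_mem_Icc_hasDerivWithinAt₀

end

theorem hasDerivWithinAt_norm_sq {f : ℝ → L2C} {f' : L2C} {S : Set ℝ} {t : ℝ}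
    (h : HasDerivWithinAt f f' S t) :
    HasDerivWithinAt (fun t => ‖f t‖ ^ 2) (2 * (inner ℂ (f t) f').re) S t := by
  have h1 := HasDerivWithinAt.inner ℂ h h
  have h2 := Complex.reCLM.hasFDerivAt.comp_hasDerivWithinAt t h1
  have h3 : (fun t => ‖f t‖ ^ 2) = Complex.reCLM ∘ fun t => inner ℂ (f t) (f t) := by
    ext t
    simp [inner_self_eq_norm_sq_to_K, ← Complex.ofReal_pow]
  rw [h3]
  refine h2.congr_deriv ?_
  rw [← inner_conj_symm f' (f t)]
  simp [-inner_conj_symm]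
  ring

/-! ### The frequency-truncated problem -/

theorem one_le_kap : 1 ≤ kap := by
  unfold kap; nlinarith [Real.two_le_pi]

/-- The vector field of the truncated problem, for the unknowns `(⟨D⟩^{s+1} u, ⟨D⟩^s P)`. -/
noncomputable def galerkinField (s lam : ℝ) (k : ℕ) (y : L2C × L2C) : L2C × L2C :=
  (D (jbk (s + 1) k) (fu (D (jbk (1 - s) k) y.1) (D (jbk (1 - s) k) y.2)),
    D (jbk s k) (fp lam (D (jbk (1 - s) k) y.1) (D (jbk (1 - s) k) y.2)))

theorem ballLip_galerkinField (s lam : ℝ) (k : ℕ) : BallLip (galerkinField s lam k) := by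
  intro R
  set L := D (jbk (1 - s) k)
  set A : L2C × L2C →L[ℂ] L2C × L2C := L.prodMap L
  have hA : BallLip (fun y : L2C × L2C => A y) :=
    BallLip.clm (f := fun y : L2C × L2C => y) (fun R => ⟨1, zero_le_one, by simp⟩) A
  have comp : ∀ {f : L2C × L2C → L2C}, BallLip f → BallLip (fun y => f (A y)) := fun {f} hf R => by
    obtain ⟨K, hK, h⟩ := hA R
    obtain ⟨B, hB, hb⟩ := hA.bdd R
    obtain ⟨K', hK', h'⟩ := hf B
    refine ⟨K' * K, by positivity, fun x y hx hy => ?_⟩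
    refine (h' _ _ (hb x hx) (hb y hy)).trans ?_
    rw [mul_assoc]; gcongr; exact h x y hx hy
  obtain ⟨K₁, hK₁, h₁⟩ := ((comp ballLip_fu).clm (D (jbk (s + 1) k))) R
  obtain ⟨K₂, hK₂, h₂⟩ := ((comp (ballLip_fp lam)).clm (D (jbk s k))) R
  refine ⟨max K₁ K₂, le_max_of_le_left hK₁, fun x y hx hy => ?_⟩
  rw [Prod.norm_def]
  refine max_le ((h₁ x y hx hy).trans ?_) ((h₂ x y hx hy).trans ?_)
  · gcongr; exact le_max_left _ _
  · gcongr; exact le_max_right _ _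

/-- The truncated problem has solutions on a time interval, and with bounds, that depend neither on
`lam` nor on the truncation. -/
theorem exists_galerkin {s c : ℝ} (hs : 2 < s) (hc : 0 ≤ c) : ∃ T R : ℝ, 0 < T ∧ 0 ≤ R ∧
    ∀ (lam : ℝ) (k : ℕ) (U₀ V₀ : L2C), ‖U₀‖ ≤ c → ‖V₀‖ ≤ c →
      ∃ U V : ℝ → L2C, U 0 = U₀ ∧ V 0 = V₀ ∧ ∀ t ∈ Set.Icc 0 T, ‖U t‖ ≤ R ∧ ‖V t‖ ≤ R ∧
        HasDerivWithinAt U (D (jbk (s + 1) k)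
          (fu (D (jbk (1 - s) k) (U t)) (D (jbk (1 - s) k) (V t)))) (Set.Icc 0 T) t ∧
        HasDerivWithinAt V (D (jbk s k)
          (fp lam (D (jbk (1 - s) k) (U t)) (D (jbk (1 - s) k) (V t)))) (Set.Icc 0 T) t := by
  have hk := one_le_kap
  set R := 2 * (2 * kap + 1) * (c + 1) with hRdef
  have hR : 0 < R := by positivity
  obtain ⟨K, hK, hE⟩ := energy_estimate hs hR.le
  set T := 1 / (2 * K + 1) with hTdef
  have hT : 0 < T := by positivity
  refine ⟨T, R, hT, hR.le, fun lam k U₀ V₀ hU₀ hV₀ => ?_⟩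
  obtain ⟨y, hy0, hy⟩ := (ballLip_galerkinField s lam k).exists_integralCurve hR hT.le (U₀, V₀)
  set e : ℝ → ℝ := fun t => 2 * kap * ‖(y t).1‖ ^ 2 + ‖(y t).2‖ ^ 2 with he
  have hder : ∀ t ∈ Set.Icc 0 T, HasDerivWithinAt e
      (2 * (2 * kap * (inner ℂ (y t).1 (galerkinField s lam k (retr R (y t))).1).re +
        (inner ℂ (y t).2 (galerkinField s lam k (retr R (y t))).2).re)) (Set.Icc 0 T) t := fun t ht => by
    have h1 := (ContinuousLinearMap.fst ℝ L2C L2C).hasFDerivAt.comp_hasDerivWithinAt t (hy t ht)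
    have h2 := (ContinuousLinearMap.snd ℝ L2C L2C).hasFDerivAt.comp_hasDerivWithinAt t (hy t ht)
    have h3 := hasDerivWithinAt_norm_sq h1
    have h4 := hasDerivWithinAt_norm_sq h2
    refine ((h3.const_mul (2 * kap)).add h4).congr_deriv ?_
    simp only [Function.comp_apply, ContinuousLinearMap.coe_fst', ContinuousLinearMap.coe_snd']
    ring
  have hbd : ∀ t ∈ Set.Icc 0 T,
      2 * (2 * kap * (inner ℂ (y t).1 (galerkinField s lam k (retr R (y t))).1).re +
        (inner ℂ (y t).2 (galerkinField s lam k (retr R (y t))).2).re) ≤ 2 * K * e t + 0 := by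
    intro t ht
    set θ := R / max R ‖y t‖ with hθ
    have hm : 0 < max R ‖y t‖ := lt_max_of_lt_left hR
    have hθ0 : 0 < θ := by positivity
    have hθ1 : θ ≤ 1 := (div_le_one hm).2 (le_max_left _ _)
    have h := hE lam k (retr R (y t)).1 (retr R (y t)).2 ((norm_fst_le _).trans (norm_retr_le hR _))
    have r1 : (retr R (y t)).1 = (θ : ℂ) • (y t).1 := rfl
    have r2 : (retr R (y t)).2 = (θ : ℂ) • (y t).2 := rfl
    have i1 : ∀ f g : L2C, (inner ℂ ((θ : ℂ) • f) g).re = θ * (inner ℂ f g).re := fun f g => by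
      rw [inner_smul_left, Complex.conj_ofReal, Complex.re_ofReal_mul]
    have h' : 2 * kap * (inner ℂ (retr R (y t)).1 (galerkinField s lam k (retr R (y t))).1).re +
        (inner ℂ (retr R (y t)).2 (galerkinField s lam k (retr R (y t))).2).re ≤
        K * (2 * kap * ‖(retr R (y t)).1‖ ^ 2 + ‖(retr R (y t)).2‖ ^ 2) := h
    generalize galerkinField s lam k (retr R (y t)) = g at h' ⊢
    rw [r1, r2, i1, i1, norm_smul, norm_smul, Complex.norm_real, Real.norm_of_nonneg hθ0.le,
      mul_pow, mul_pow] at h'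
    have h3 : θ * (2 * kap * (inner ℂ (y t).1 g.1).re + (inner ℂ (y t).2 g.2).re) ≤
        θ * (θ * (K * e t)) := by
      simp only [he]; linarith
    have h4 := le_of_mul_le_mul_left h3 hθ0
    have h5 : θ * (K * e t) ≤ K * e t := by
      apply mul_le_of_le_one_left _ hθ1
      simp only [he]; positivity
    linarith
  have hg := gronwall_le (by positivity) le_rfl hder hbd
  have hy_le : ∀ t ∈ Set.Icc 0 T, ‖y t‖ ≤ R := by
    intro t ht
    have h1 := hg t ht
    have h2 : Real.exp (2 * K * t) ≤ 4 := by
      have : 2 * K * t ≤ 1 := by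
        have : 2 * K * t ≤ 2 * K * T := by gcongr; exact ht.2
        refine this.trans ?_
        rw [hTdef, mul_one_div, div_le_one (by positivity)]; linarith
      refine (Real.exp_le_exp.2 this).trans ?_
      have := Real.exp_one_lt_d9
      linarith
    have h3 : e 0 ≤ (2 * kap + 1) * c ^ 2 := by
      simp only [he, hy0]
      have : ‖U₀‖ ^ 2 ≤ c ^ 2 := by gcongr
      have : ‖V₀‖ ^ 2 ≤ c ^ 2 := by gcongr
      nlinarith
    have h0 : 0 ≤ e 0 := by simp only [he]; positivity
    have h4 : e t ≤ R ^ 2 := by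
      calc e t ≤ e 0 * Real.exp (2 * K * t) := by simpa using h1
        _ ≤ ((2 * kap + 1) * c ^ 2) * 4 := by gcongr
        _ ≤ R ^ 2 := by
          have q1 : c ^ 2 ≤ (c + 1) ^ 2 := by nlinarith
          have q2 : (2 * kap + 1) ≤ (2 * kap + 1) ^ 2 := by nlinarith
          calc ((2 * kap + 1) * c ^ 2) * 4 ≤ ((2 * kap + 1) ^ 2 * (c + 1) ^ 2) * 4 := by gcongr
            _ = R ^ 2 := by rw [hRdef]; ring
    rw [Prod.norm_def]
    have p1 : 0 ≤ ‖(y t).1‖ ^ 2 := by positivity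
    have p2 : 0 ≤ ‖(y t).2‖ ^ 2 := by positivity
    refine max_le (abs_le_of_sq_le_sq' ?_ hR.le).2 (abs_le_of_sq_le_sq' ?_ hR.le).2
    · simp only [he] at h4; nlinarith
    · simp only [he] at h4; nlinarith
  refine ⟨fun t => (y t).1, fun t => (y t).2, by simp [hy0], by simp [hy0], fun t ht => ?_⟩
  have h := hy t ht
  rw [retr_eq_self hR (hy_le t ht)] at h
  have h1 := (ContinuousLinearMap.fst ℝ L2C L2C).hasFDerivAt.comp_hasDerivWithinAt t h
  have h2 := (ContinuousLinearMap.snd ℝ L2C L2C).hasFDerivAt.comp_hasDerivWithinAt t h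
  exact ⟨(norm_fst_le _).trans (hy_le t ht), (norm_snd_le _).trans (hy_le t ht), h1, h2⟩

/-! ### Removing the truncation -/

theorem D_sub_sym {m n : Plane → ℝ} (hm : BddSym m) (hn : BddSym n) (hmn : BddSym (fun ξ => m ξ - n ξ))
    (f : L2C) : D m f - D n f = D (fun ξ => m ξ - n ξ) f := by
  apply ext_fourier
  have h : (𝓕 (D m f - D n f) : L2C) = 𝓕 (D m f) - 𝓕 (D n f) :=
    map_sub (Lp.fourierTransformₗᵢ Plane ℂ) _ _
  rw [h]
  filter_upwards [Lp.coeFn_sub (𝓕 (D m f) : L2C) (𝓕 (D n f)), fourier_D hm f, fourier_D hn f,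
    fourier_D hmn f] with ξ h1 h2 h3 h4
  rw [h1, Pi.sub_apply, h2, h3, h4]; push_cast; ring

theorem norm_D_jb_sub_D_jbk_le {q : ℝ} (hq : 1 ≤ q) (k : ℕ) (f : L2C) :
    ‖D (jb (-q)) f - D (jbk (-q) k) f‖ ≤ 2 / (k + 1) * ‖f‖ := by
  have hb : ∀ ξ, |jb (-q) ξ - jbk (-q) k ξ| ≤ 2 / (k + 1) := fun ξ => by
    unfold jbk
    split_ifs with h
    · simp; positivity
    · rw [sub_zero, abs_of_pos (jb_pos _ _)]
      refine (jb_mono (by linarith : -q ≤ -1) ξ).trans ?_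
      have h1 := norm_le_jb_one ξ
      have h2 := one_le_jb zero_le_one ξ
      have h3 : jb (-1) ξ * jb 1 ξ = 1 := by rw [jb_mul]; simp
      rw [le_div_iff₀ (by positivity)]
      have h4 := jb_pos (-1) ξ
      push Not at h
      nlinarith
  have hs : BddSym (fun ξ => jb (-q) ξ - jbk (-q) k ξ) :=
    ⟨(continuous_jb _).measurable.sub (bddSym_jbk _ k).meas, _, hb⟩
  rw [D_sub_sym (bddSym_jb (by linarith)) (bddSym_jbk _ _) hs]
  exact norm_D_le hs.meas hb f

theorem Sob.norm_trunc_sub_le {r C : ℝ} (hr : 1 ≤ r) {f : L2C} (hf : Sob r C f) (k : ℕ) :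
    ‖D (jbk 0 k) f - f‖ ≤ 2 / (k + 1) * C := by
  obtain ⟨F, hF, rfl⟩ := hf
  rw [norm_sub_rev, D_jbk_jb (by linarith), zero_add]
  exact (norm_D_jb_sub_D_jbk_le hr k F).trans (by gcongr)

/-- On bounded sets, smallness in a weak norm gives smallness in the intermediate norms. -/
theorem exists_interpolation {p q : ℝ} (hq : 0 < q) (hqp : q ≤ p) (R : ℝ) {ε : ℝ} (hε : 0 < ε) :
    ∃ δ : ℝ, 0 < δ ∧ ∀ F : L2C, ‖F‖ ≤ R → ‖D (jb (-p)) F‖ ≤ δ → ‖D (jb (-q)) F‖ ≤ ε := by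
  obtain ⟨K, hK, h⟩ := norm_interpolation hq hqp (ε := ε / (2 * (|R| + 1))) (by positivity)
  refine ⟨ε / (2 * (K + 1)), by positivity, fun F hF hd => (h F).trans ?_⟩
  have h1 : ε / (2 * (|R| + 1)) * ‖F‖ ≤ ε / 2 := by
    have : ‖F‖ ≤ |R| + 1 := hF.trans ((le_abs_self R).trans (by linarith))
    calc _ ≤ ε / (2 * (|R| + 1)) * (|R| + 1) := by gcongr
      _ = ε / 2 := by field_simp
  have h2 : K * ‖D (jb (-p)) F‖ ≤ ε / 2 := by
    calc _ ≤ (K + 1) * (ε / (2 * (K + 1))) := by gcongr; linarith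
      _ = ε / 2 := by field_simp
  linarith

theorem continuousOn_D_jb_of_bounded {p q R : ℝ} (hq : 0 < q) (hqp : q ≤ p) {S : Set ℝ} {F : ℝ → L2C}
    (hF : ∀ t ∈ S, ‖F t‖ ≤ R) (hc : ContinuousOn (fun t => D (jb (-p)) (F t)) S) :
    ContinuousOn (fun t => D (jb (-q)) (F t)) S := by
  rw [Metric.continuousOn_iff] at hc ⊢
  intro t ht ε hε
  obtain ⟨δ, hδ, h⟩ := exists_interpolation hq hqp (2 * R) (half_pos hε)
  obtain ⟨η, hη, h'⟩ := hc t ht δ hδ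
  refine ⟨η, hη, fun x hx hxt => ?_⟩
  have h1 := h' x hx hxt
  rw [dist_eq_norm, ← map_sub] at h1 ⊢
  have := h (F x - F t) ((norm_sub_le _ _).trans (by linarith [hF x hx, hF t ht])) h1.le
  linarith

theorem hasDerivWithinAt_of_tendstoUniformlyOn {E : Type*} [NormedAddCommGroup E] [NormedSpace ℝ E]
    {g g' : ℕ → ℝ → E} {G h : ℝ → E} {S : Set ℝ} (hS : Convex ℝ S)
    (hg : ∀ k, ∀ t ∈ S, HasDerivWithinAt (g k) (g' k t) S t)
    (hG : ∀ t ∈ S, Tendsto (fun k => g k t) atTop (𝓝 (G t)))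
    (hh : TendstoUniformlyOn g' h atTop S) : ∀ t ∈ S, HasDerivWithinAt G (h t) S t := by
  intro t ht
  rw [hasDerivWithinAt_iff_isLittleO, Asymptotics.isLittleO_iff]
  intro c hc
  have hN := Metric.tendstoUniformlyOn_iff.1 hh (c / 4) (by positivity)
  obtain ⟨N, hN⟩ := eventually_atTop.1 hN
  have h1 := (hasDerivWithinAt_iff_isLittleO.1 (hg N t ht))
  rw [Asymptotics.isLittleO_iff] at h1
  filter_upwards [h1 (by positivity : 0 < c / 4), self_mem_nhdsWithin] with x hx hxS
  have h2 : ‖(g N x - G x) - (g N t - G t)‖ ≤ c / 2 * ‖x - t‖ := by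
    have hl : Tendsto (fun l => ‖(g N x - g l x) - (g N t - g l t)‖) atTop
        (𝓝 ‖(g N x - G x) - (g N t - G t)‖) :=
      ((tendsto_const_nhds.sub (hG x hxS)).sub (tendsto_const_nhds.sub (hG t ht))).norm
    refine le_of_tendsto hl ?_
    filter_upwards [eventually_ge_atTop N] with l hl
    refine Convex.norm_image_sub_le_of_norm_hasDerivWithin_le (f := fun x => g N x - g l x)
      (fun y hy => (hg N y hy).sub (hg l y hy)) (fun y hy => ?_) hS ht hxS
    have e1 := hN N le_rfl y hy
    have e2 := hN l hl y hy
    rw [dist_eq_norm] at e1 e2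
    calc ‖g' N y - g' l y‖ = ‖(h y - g' l y) - (h y - g' N y)‖ := by congr 1; abel
      _ ≤ ‖h y - g' l y‖ + ‖h y - g' N y‖ := norm_sub_le _ _
      _ ≤ c / 2 := by linarith
  have h3 := hN N le_rfl t ht
  rw [dist_eq_norm] at h3
  have h4 : ‖(x - t) • (h t - g' N t)‖ ≤ c / 4 * ‖x - t‖ := by
    rw [norm_smul, mul_comm]; gcongr
  calc ‖G x - G t - (x - t) • h t‖ = ‖(g N x - g N t - (x - t) • g' N t) -
        ((g N x - G x) - (g N t - G t)) - (x - t) • (h t - g' N t)‖ := by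
        rw [smul_sub]; congr 1; abel
    _ ≤ ‖g N x - g N t - (x - t) • g' N t‖ + ‖(g N x - G x) - (g N t - G t)‖ +
        ‖(x - t) • (h t - g' N t)‖ := (norm_sub_le _ _).trans (by gcongr; exact norm_sub_le _ _)
    _ ≤ c * ‖x - t‖ := by linarith

/-- The pairing in the difference estimate, with truncated right-hand sides. -/
theorem re_inner_trunc_le {r C B : ℝ} (hr : 1 ≤ r) {h f f' : L2C} (hB : ‖h‖ ≤ B)
    (hf : Sob r C f) (hf' : Sob r C f') (k l : ℕ) :
    (inner ℂ h (D (jbk 0 k) f - D (jbk 0 l) f')).re ≤ (inner ℂ h (f - f')).re +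
      B * ((2 / (k + 1) + 2 / (l + 1)) * C) := by
  have e : D (jbk 0 k) f - D (jbk 0 l) f' = (f - f') +
      ((D (jbk 0 k) f - f) - (D (jbk 0 l) f' - f')) := by abel
  rw [e, inner_add_right, Complex.add_re]
  gcongr
  refine (Complex.re_le_norm _).trans ((norm_inner_le_norm _ _).trans ?_)
  have h1 := hf.norm_trunc_sub_le hr k
  have h2 := hf'.norm_trunc_sub_le hr l
  have h3 := norm_sub_le (D (jbk 0 k) f - f) (D (jbk 0 l) f' - f')
  have : 0 ≤ B := (norm_nonneg h).trans hB
  gcongr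
  linarith

/-- The truncated solutions form a Cauchy sequence in `H^1 × L²`, uniformly in time. -/
theorem galerkin_cauchy {s c T R lam : ℝ} (hs : 2 < s) (hT : 0 < T) (hR : 0 ≤ R)
    (hlam : 0 < lam) {U V : ℕ → ℝ → L2C} {U₀ V₀ : L2C} (hU₀ : ‖U₀‖ ≤ c) (hV₀ : ‖V₀‖ ≤ c)
    (hU0 : ∀ k, U k 0 = U₀) (hV0 : ∀ k, V k 0 = V₀)
    (h : ∀ k, ∀ t ∈ Set.Icc 0 T, ‖U k t‖ ≤ R ∧ ‖V k t‖ ≤ R ∧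
      HasDerivWithinAt (U k) (D (jbk (s + 1) k)
        (fu (D (jbk (1 - s) k) (U k t)) (D (jbk (1 - s) k) (V k t)))) (Set.Icc 0 T) t ∧
      HasDerivWithinAt (V k) (D (jbk s k)
        (fp lam (D (jbk (1 - s) k) (U k t)) (D (jbk (1 - s) k) (V k t)))) (Set.Icc 0 T) t) :
    ∃ M : ℝ, 0 ≤ M ∧ ∀ k l, ∀ t ∈ Set.Icc 0 T,
      ‖D (jbk (-s) k) (U k t) - D (jbk (-s) l) (U l t)‖ ^ 2 ≤ M * (2 / (k + 1) + 2 / (l + 1)) ∧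
      ‖D (jbk (-s) k) (V k t) - D (jbk (-s) l) (V l t)‖ ^ 2 ≤ M * (2 / (k + 1) + 2 / (l + 1)) := by
  have hk := one_le_kap
  have hc : 0 ≤ c := (norm_nonneg _).trans hU₀
  obtain ⟨K, hK, hD⟩ := difference_estimate hs hR
  set a : ℕ → ℝ → L2C := fun k t => D (jbk (1 - s) k) (U k t) with ha
  set b : ℕ → ℝ → L2C := fun k t => D (jbk (1 - s) k) (V k t) with hb
  have hua : ∀ k, ∀ t ∈ Set.Icc 0 T, Sob (s + 1) R (uu (a k t)) := fun k t ht => by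
    have : uu (a k t) = D (jbk (-(s + 1)) k) (U k t) := by
      simp only [uu, ha]; rw [D_jb_jbk (by norm_num)]; congr 3; ring
    rw [this]
    exact (sob_D_jbk (by linarith) k _).mono (h k t ht).1
  have hpb' : ∀ k t, pp (b k t) = D (jbk (-s) k) (V k t) := fun k t => by
    simp only [pp, hb]; rw [D_jb_jbk (by norm_num)]; congr 3; ring
  have hpb : ∀ k, ∀ t ∈ Set.Icc 0 T, Sob s R (pp (b k t)) := fun k t ht => by
    rw [hpb']
    exact (sob_D_jbk (by linarith) k _).mono (h k t ht).2.1
  have hA : ∀ k t, D (jb (-1)) (a k t) = D (jbk (-s) k) (U k t) := fun k t => by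
    simp only [ha]; rw [D_jb_jbk (by norm_num)]; congr 3; ring
  set Cf := (2 * kap + 5) * BW s R ^ 2 * R
  set Cp := lam * (2 * Real.pi * R) + (4 + 4 * kap) * BW s R ^ 3 * R
  have hB : 0 ≤ BW s R := zero_le_one.trans (one_le_BW hs hR)
  have hCf : 0 ≤ Cf := by positivity
  have hCp : 0 ≤ Cp := by positivity
  have hfu : ∀ k, ∀ t ∈ Set.Icc 0 T, Sob (s - 1) Cf (fu (a k t) (b k t)) := fun k t ht =>
    sob_fu hs (hua k t ht) ((hpb k t ht).reC (by linarith))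
  have hfp : ∀ k, ∀ t ∈ Set.Icc 0 T, Sob (s - 1) Cp (fp lam (a k t) (b k t)) := fun k t ht =>
    sob_fp hs hlam (hua k t ht) (hpb k t ht)
  set M₁ := 2 * (2 * kap * (2 * R * Cf) + 2 * R * Cp) with hM₁
  have hM₁0 : 0 ≤ M₁ := by positivity
  set M := (4 * (2 * kap + 1) * c ^ 2 + M₁ * T) * Real.exp (2 * K * T) with hM
  refine ⟨M, by positivity, fun k l t ht => ?_⟩
  set η : ℝ := 2 / (k + 1) + 2 / (l + 1) with hη
  have hη0 : 0 ≤ η := by positivity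
  have hη4 : η ≤ 4 := by
    have h1 : ∀ k : ℕ, (2 : ℝ) / (k + 1) ≤ 2 := fun k => by
      rw [div_le_iff₀ (by positivity)]; have : (0 : ℝ) ≤ k := k.cast_nonneg; linarith
    linarith [h1 k, h1 l]
  set e : ℝ → ℝ := fun t => 2 * kap * ‖D (jbk (-s) k) (U k t) - D (jbk (-s) l) (U l t)‖ ^ 2 +
    ‖D (jbk (-s) k) (V k t) - D (jbk (-s) l) (V l t)‖ ^ 2 with he
  have he' : ∀ t, e t = dEnergy (a k t - a l t) (b k t - b l t) := fun t => by
    simp only [he, dEnergy, map_sub, hA, ← hpb', pp]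
  have hder : ∀ t ∈ Set.Icc 0 T, HasDerivWithinAt e
      (2 * (2 * kap * (inner ℂ (a k t - a l t)
        (D (jbk 0 k) (fu (a k t) (b k t)) - D (jbk 0 l) (fu (a l t) (b l t)))).re +
        (inner ℂ (pp (b k t - b l t))
          (D (jbk 0 k) (fp lam (a k t) (b k t)) - D (jbk 0 l) (fp lam (a l t) (b l t)))).re))
      (Set.Icc 0 T) t := fun t ht => by
    have d1 : ∀ k, HasDerivWithinAt (fun t => D (jbk (-s) k) (U k t))
        (D (jbk 1 k) (fu (a k t) (b k t))) (Set.Icc 0 T) t := fun k => by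
      have := ((D (jbk (-s) k)).restrictScalars ℝ).hasFDerivAt.comp_hasDerivWithinAt t
        (h k t ht).2.2.1
      refine this.congr_deriv ?_
      change D (jbk (-s) k) (D (jbk (s + 1) k) _) = _
      rw [D_jbk_jbk]; congr 3; ring
    have d2 : ∀ k, HasDerivWithinAt (fun t => D (jbk (-s) k) (V k t))
        (D (jbk 0 k) (fp lam (a k t) (b k t))) (Set.Icc 0 T) t := fun k => by
      have := ((D (jbk (-s) k)).restrictScalars ℝ).hasFDerivAt.comp_hasDerivWithinAt t
        (h k t ht).2.2.2
      refine this.congr_deriv ?_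
      change D (jbk (-s) k) (D (jbk s k) _) = _
      rw [D_jbk_jbk]; congr 3; ring
    have h1 := hasDerivWithinAt_norm_sq ((d1 k).sub (d1 l))
    have h2 := hasDerivWithinAt_norm_sq ((d2 k).sub (d2 l))
    refine ((h1.const_mul (2 * kap)).add h2).congr_deriv ?_
    simp only [Pi.sub_apply]
    rw [← hA, ← hA, ← map_sub, inner_D (bddSym_jb (by norm_num)), map_sub, D_jb_jbk (by norm_num),
      D_jb_jbk (by norm_num), ← hpb', ← hpb', neg_add_cancel]
    have : pp (b k t - b l t) = pp (b k t) - pp (b l t) := map_sub _ _ _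
    rw [this]
    ring
  have hbd : ∀ t ∈ Set.Icc 0 T,
      2 * (2 * kap * (inner ℂ (a k t - a l t)
        (D (jbk 0 k) (fu (a k t) (b k t)) - D (jbk 0 l) (fu (a l t) (b l t)))).re +
        (inner ℂ (pp (b k t - b l t))
          (D (jbk 0 k) (fp lam (a k t) (b k t)) - D (jbk 0 l) (fp lam (a l t) (b l t)))).re) ≤
      2 * K * e t + M₁ * η := fun t ht => by
    have n1 : ‖a k t - a l t‖ ≤ 2 * R := by
      have h1 := (sob_a hs (hua k t ht)).norm_le (by linarith)
      have h2 := (sob_a hs (hua l t ht)).norm_le (by linarith)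
      exact (norm_sub_le _ _).trans (by linarith)
    have n2 : ‖pp (b k t - b l t)‖ ≤ 2 * R := by
      have h1 := (hpb k t ht).norm_le (by linarith)
      have h2 := (hpb l t ht).norm_le (by linarith)
      have : pp (b k t - b l t) = pp (b k t) - pp (b l t) := map_sub _ _ _
      rw [this]
      exact (norm_sub_le _ _).trans (by linarith)
    have i1 := re_inner_trunc_le (by linarith) n1 (hfu k t ht) (hfu l t ht) k l
    have i2 := re_inner_trunc_le (by linarith) n2 (hfp k t ht) (hfp l t ht) k l
    have i3 := hD lam (a k t) (b k t) (a l t) (b l t) (hua k t ht) (hua l t ht)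
      ((hpb l t ht).reC (by linarith))
    rw [← he'] at i3
    rw [← hη] at i1 i2
    have i4 := mul_le_mul_of_nonneg_left i1 (by positivity : 0 ≤ 2 * kap)
    rw [hM₁]
    linarith
  have hg := gronwall_le (by positivity) (by positivity) hder hbd t ht
  have he0 : e 0 ≤ 4 * (2 * kap + 1) * c ^ 2 * η := by
    have d : ∀ f : L2C, ‖f‖ ≤ c → ‖D (jbk (-s) k) f - D (jbk (-s) l) f‖ ^ 2 ≤ 4 * c ^ 2 * η :=
      fun f hf => by
      have h1 := norm_D_jb_sub_D_jbk_le (by linarith : 1 ≤ s) k f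
      have h2 := norm_D_jb_sub_D_jbk_le (by linarith : 1 ≤ s) l f
      have h3 : ‖D (jbk (-s) k) f - D (jbk (-s) l) f‖ ≤ η * c := by
        calc _ = ‖(D (jb (-s)) f - D (jbk (-s) l) f) - (D (jb (-s)) f - D (jbk (-s) k) f)‖ := by
              congr 1; abel
          _ ≤ 2 / (l + 1) * ‖f‖ + 2 / (k + 1) * ‖f‖ := (norm_sub_le _ _).trans (add_le_add h2 h1)
          _ = η * ‖f‖ := by rw [hη]; ring
          _ ≤ η * c := by gcongr
      calc _ ≤ (η * c) ^ 2 := by gcongr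
        _ = η * (c ^ 2 * η) := by ring
        _ ≤ 4 * (c ^ 2 * η) := by gcongr
        _ = _ := by ring
    have d1 := d U₀ hU₀
    have d2 := d V₀ hV₀
    simp only [he, hU0, hV0]
    have := mul_le_mul_of_nonneg_left d1 (by positivity : 0 ≤ 2 * kap)
    linarith
  have hfin : e t ≤ M * η := by
    refine hg.trans ?_
    have q1 : Real.exp (2 * K * t) ≤ Real.exp (2 * K * T) := by
      gcongr; exact ht.2
    have q2 : M₁ * η * t ≤ M₁ * η * T := by gcongr; exact ht.2
    have q3 : e 0 + M₁ * η * t ≤ (4 * (2 * kap + 1) * c ^ 2 + M₁ * T) * η := by linarith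
    calc _ ≤ ((4 * (2 * kap + 1) * c ^ 2 + M₁ * T) * η) * Real.exp (2 * K * T) := by
          gcongr
      _ = M * η := by rw [hM]; ring
  have p1 : 0 ≤ ‖D (jbk (-s) k) (U k t) - D (jbk (-s) l) (U l t)‖ ^ 2 := by positivity
  have p2 : 0 ≤ ‖D (jbk (-s) k) (V k t) - D (jbk (-s) l) (V l t)‖ ^ 2 := by positivity
  simp only [he] at hfin
  constructor <;> nlinarith

/-- Bounded sequences that are Cauchy at the lowest level of regularity are Cauchy at the
intermediate levels. -/
theorem uniformCauchySeqOn_trunc {s R M : ℝ} (hs : 2 < s) (hM : 0 ≤ M) {S : Set ℝ} {U : ℕ → ℝ → L2C}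
    (hU : ∀ k, ∀ t ∈ S, ‖U k t‖ ≤ R)
    (h : ∀ k l, ∀ t ∈ S, ‖D (jbk (-s) k) (U k t) - D (jbk (-s) l) (U l t)‖ ^ 2 ≤
      M * (2 / (k + 1) + 2 / (l + 1))) :
    UniformCauchySeqOn (fun k t => D (jbk (1 - s) k) (U k t)) atTop S := by
  rw [Metric.uniformCauchySeqOn_iff]
  intro ε hε
  obtain ⟨δ, hδ, hi⟩ := exists_interpolation (p := s) (q := s - 1) (by linarith) (by linarith)
    (2 * R) (half_pos hε)
  obtain ⟨N, hN⟩ := exists_nat_gt (4 * M / δ ^ 2)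
  refine ⟨N, fun k hk l hl t ht => ?_⟩
  have hr : ∀ r : ℝ, r ≤ 0 → ∀ k, D (jb r) (D (jbk 0 k) (U k t)) = D (jbk r k) (U k t) :=
    fun r hr k => by rw [D_jb_jbk hr, add_zero]
  have hb : ∀ k : ℕ, N ≤ k → (2 : ℝ) / (k + 1) ≤ 2 / (N + 1) := fun k hk => by
    gcongr
  have h1 : ‖D (jb (-s)) (D (jbk 0 k) (U k t) - D (jbk 0 l) (U l t))‖ ≤ δ := by
    rw [map_sub, hr _ (by linarith), hr _ (by linarith)]
    refine (abs_le_of_sq_le_sq' ((h k l t ht).trans ?_) hδ.le).2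
    have : (2 : ℝ) / (k + 1) + 2 / (l + 1) ≤ 4 / (N + 1) := by
      have h1 := hb k hk
      have h2 := hb l hl
      have h3 : (4 : ℝ) / (N + 1) = 2 / (N + 1) + 2 / (N + 1) := by ring
      linarith
    calc _ ≤ M * (4 / (N + 1)) := by gcongr
      _ ≤ δ ^ 2 := by
        rw [div_lt_iff₀ (by positivity)] at hN
        rw [mul_div_assoc', div_le_iff₀ (by positivity)]
        nlinarith [sq_nonneg δ]
  have h2 := hi _ ((norm_sub_le _ _).trans (by
    have := (norm_D_jbk_zero_le k (U k t)).trans (hU k t ht)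
    have := (norm_D_jbk_zero_le l (U l t)).trans (hU l t ht)
    linarith)) h1
  rw [map_sub, hr _ (by linarith), hr _ (by linarith)] at h2
  rw [dist_eq_norm]
  have e1 : (1 : ℝ) - s = -(s - 1) := by ring
  rw [e1]
  linarith

theorem tendsto_two_div : Tendsto (fun k : ℕ => (2 : ℝ) / (k + 1)) atTop (𝓝 0) := by
  have := (tendsto_one_div_add_atTop_nhds_zero_nat (𝕜 := ℝ)).const_mul 2
  simpa [div_eq_mul_inv] using this

theorem tendsto_D_jbk {q : ℝ} (hq : 1 ≤ q) (f : L2C) :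
    Tendsto (fun k => D (jbk (-q) k) f) atTop (𝓝 (D (jb (-q)) f)) := by
  rw [tendsto_iff_norm_sub_tendsto_zero]
  refine squeeze_zero (fun _ => norm_nonneg _) (fun k => ?_)
    (by simpa using tendsto_two_div.mul_const ‖f‖)
  rw [norm_sub_rev]
  exact norm_D_jb_sub_D_jbk_le hq k f

/-- Uniform convergence of the truncated right-hand sides. -/
theorem BallLip.tendstoUniformlyOn_trunc {F : L2C × L2C → L2C} (hF : BallLip F) {S : Set ℝ}
    {a b : ℕ → ℝ → L2C} {a' b' : ℝ → L2C} {R C r : ℝ} (hr : 1 ≤ r)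
    (ha : TendstoUniformlyOn a a' atTop S) (hb : TendstoUniformlyOn b b' atTop S)
    (ha1 : ∀ k, ∀ t ∈ S, ‖a k t‖ ≤ R) (hb1 : ∀ k, ∀ t ∈ S, ‖b k t‖ ≤ R)
    (ha2 : ∀ t ∈ S, ‖a' t‖ ≤ R) (hb2 : ∀ t ∈ S, ‖b' t‖ ≤ R)
    (hs : ∀ k, ∀ t ∈ S, Sob r C (F (a k t, b k t))) :
    TendstoUniformlyOn (fun k t => D (jbk 0 k) (F (a k t, b k t))) (fun t => F (a' t, b' t))
      atTop S := by
  obtain ⟨K, hK, hL⟩ := hF R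
  rw [Metric.tendstoUniformlyOn_iff] at ha hb ⊢
  intro ε hε
  have hη : 0 < ε / (2 * (K + 1)) := by positivity
  have h0 : ∀ᶠ k : ℕ in atTop, (2 : ℝ) / (k + 1) * C < ε / 2 := by
    have := tendsto_two_div.mul_const C
    rw [zero_mul] at this
    exact this.eventually (gt_mem_nhds (by positivity))
  filter_upwards [ha _ hη, hb _ hη, h0] with k h1 h2 h3 t ht
  have h4 := (hs k t ht).norm_trunc_sub_le hr k
  have h5 := hL (a' t, b' t) (a k t, b k t) (max_le (ha2 t ht) (hb2 t ht))
    (max_le (ha1 k t ht) (hb1 k t ht))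
  have h6 : ‖(a' t, b' t) - (a k t, b k t)‖ ≤ ε / (2 * (K + 1)) := by
    have e1 := h1 t ht
    have e2 := h2 t ht
    rw [dist_eq_norm] at e1 e2
    exact max_le e1.le e2.le
  have h7 : K * ‖(a' t, b' t) - (a k t, b k t)‖ ≤ ε / 2 := by
    calc _ ≤ (K + 1) * (ε / (2 * (K + 1))) := by gcongr; linarith
      _ = ε / 2 := by field_simp
  rw [dist_eq_norm]
  calc _ = ‖(F (a' t, b' t) - F (a k t, b k t)) - (D (jbk 0 k) (F (a k t, b k t)) -
        F (a k t, b k t))‖ := by congr 1; abel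
    _ ≤ _ := norm_sub_le _ _
    _ < ε := by linarith

/-- Solutions of the system for `(u, P)`, with bounds that do not depend on `lam`. -/
theorem exists_solution {s c : ℝ} (hs : 2 < s) (hc : 0 ≤ c) : ∃ T R : ℝ, 0 < T ∧ 0 ≤ R ∧
    ∀ (lam : ℝ) (U₀ V₀ : L2C), 0 < lam → ‖U₀‖ ≤ c → ‖V₀‖ ≤ c →
      ∃ a b : ℝ → L2C, ContinuousOn a (Set.Icc 0 T) ∧ ContinuousOn b (Set.Icc 0 T) ∧
        uu (a 0) = D (jb (-(s + 1))) U₀ ∧ pp (b 0) = D (jb (-s)) V₀ ∧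
        ∀ t ∈ Set.Icc 0 T, Sob (s + 1) R (uu (a t)) ∧ Sob s R (pp (b t)) ∧
          HasDerivWithinAt (fun t => uu (a t)) (fu (a t) (b t)) (Set.Icc 0 T) t ∧
          HasDerivWithinAt (fun t => pp (b t)) (fp lam (a t) (b t)) (Set.Icc 0 T) t := by
  obtain ⟨T, R, hT, hR, hG⟩ := exists_galerkin hs hc
  refine ⟨T, R, hT, hR, fun lam U₀ V₀ hlam hU₀ hV₀ => ?_⟩
  choose U V hU0 hV0 h using fun k => hG lam k U₀ V₀ hU₀ hV₀
  obtain ⟨M, hM, hcau⟩ := galerkin_cauchy hs hT hR hlam hU₀ hV₀ hU0 hV0 h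
  set S := Set.Icc 0 T with hS
  have h0S : (0 : ℝ) ∈ S := ⟨le_rfl, hT.le⟩
  set a : ℕ → ℝ → L2C := fun k t => D (jbk (1 - s) k) (U k t) with ha
  set b : ℕ → ℝ → L2C := fun k t => D (jbk (1 - s) k) (V k t) with hb
  have hca : UniformCauchySeqOn a atTop S := uniformCauchySeqOn_trunc hs hM
    (fun k t ht => (h k t ht).1) (fun k l t ht => (hcau k l t ht).1)
  have hcb : UniformCauchySeqOn b atTop S := uniformCauchySeqOn_trunc hs hM
    (fun k t ht => (h k t ht).2.1) (fun k l t ht => (hcau k l t ht).2)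
  have lim : ∀ {c : ℕ → ℝ → L2C}, UniformCauchySeqOn c atTop S →
      ∃ c' : ℝ → L2C, ∀ t ∈ S, Tendsto (fun k => c k t) atTop (𝓝 (c' t)) := fun {c} hc => by
    have : ∀ t, ∃ L, t ∈ S → Tendsto (fun k => c k t) atTop (𝓝 L) := fun t => by
      by_cases ht : t ∈ S
      · obtain ⟨L, hL⟩ := cauchySeq_tendsto_of_complete (hc.cauchySeq ht)
        exact ⟨L, fun _ => hL⟩
      · exact ⟨0, fun h => absurd h ht⟩
    choose c' hc' using this
    exact ⟨c', fun t ht => hc' t ht⟩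
  obtain ⟨a', ha'⟩ := lim hca
  obtain ⟨b', hb'⟩ := lim hcb
  have hua' : ∀ k t, uu (a k t) = D (jbk (-(s + 1)) k) (U k t) := fun k t => by
    simp only [uu, ha]; rw [D_jb_jbk (by norm_num)]; congr 3; ring
  have hua : ∀ k, ∀ t ∈ S, Sob (s + 1) R (uu (a k t)) := fun k t ht => by
    rw [hua']
    exact (sob_D_jbk (by linarith) k _).mono (h k t ht).1
  have hpb' : ∀ k t, pp (b k t) = D (jbk (-s) k) (V k t) := fun k t => by
    simp only [pp, hb]; rw [D_jb_jbk (by norm_num)]; congr 3; ring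
  have hpb : ∀ k, ∀ t ∈ S, Sob s R (pp (b k t)) := fun k t ht => by
    rw [hpb']
    exact (sob_D_jbk (by linarith) k _).mono (h k t ht).2.1
  have tua : ∀ t ∈ S, Tendsto (fun k => uu (a k t)) atTop (𝓝 (uu (a' t))) := fun t ht =>
    ((D (jb (-2))).continuous.tendsto _).comp (ha' t ht)
  have tpb : ∀ t ∈ S, Tendsto (fun k => pp (b k t)) atTop (𝓝 (pp (b' t))) := fun t ht =>
    ((D (jb (-1))).continuous.tendsto _).comp (hb' t ht)
  have hua2 : ∀ t ∈ S, Sob (s + 1) R (uu (a' t)) := fun t ht =>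
    sob_of_tendsto (by linarith) (fun k => hua k t ht) (tua t ht)
  have hpb2 : ∀ t ∈ S, Sob s R (pp (b' t)) := fun t ht =>
    sob_of_tendsto (by linarith) (fun k => hpb k t ht) (tpb t ht)
  have na : ∀ {x : L2C}, Sob (s + 1) R (uu x) → ‖x‖ ≤ R := fun hx =>
    (sob_a hs hx).norm_le (by linarith)
  have nb : ∀ {x : L2C}, Sob s R (pp x) → ‖x‖ ≤ R := fun hx => (sob_b hs hx).norm_le (by linarith)
  have ua := hca.tendstoUniformlyOn_of_tendsto ha'
  have ub := hcb.tendstoUniformlyOn_of_tendsto hb'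
  have hB : 0 ≤ BW s R := zero_le_one.trans (one_le_BW hs hR)
  have hk := kap_pos
  have ufu := ballLip_fu.tendstoUniformlyOn_trunc (r := s - 1) (by linarith) ua ub
    (fun k t ht => na (hua k t ht)) (fun k t ht => nb (hpb k t ht)) (fun t ht => na (hua2 t ht))
    (fun t ht => nb (hpb2 t ht))
    (fun k t ht => sob_fu hs (hua k t ht) ((hpb k t ht).reC (by linarith)))
  have ufp := (ballLip_fp lam).tendstoUniformlyOn_trunc (r := s - 1) (by linarith) ua ub
    (fun k t ht => na (hua k t ht)) (fun k t ht => nb (hpb k t ht)) (fun t ht => na (hua2 t ht))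
    (fun t ht => nb (hpb2 t ht))
    (fun k t ht => sob_fp hs hlam (hua k t ht) (hpb k t ht))
  have d1 : ∀ k, ∀ t ∈ S, HasDerivWithinAt (fun t => uu (a k t))
      (D (jbk 0 k) (fu (a k t) (b k t))) S t := fun k t ht => by
    simp only [hua']
    have := ((D (jbk (-(s + 1)) k)).restrictScalars ℝ).hasFDerivAt.comp_hasDerivWithinAt t
      (h k t ht).2.2.1
    refine this.congr_deriv ?_
    change D (jbk (-(s + 1)) k) (D (jbk (s + 1) k) _) = _
    rw [D_jbk_jbk, neg_add_cancel]
  have d2 : ∀ k, ∀ t ∈ S, HasDerivWithinAt (fun t => pp (b k t))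
      (D (jbk 0 k) (fp lam (a k t) (b k t))) S t := fun k t ht => by
    simp only [hpb']
    have := ((D (jbk (-s) k)).restrictScalars ℝ).hasFDerivAt.comp_hasDerivWithinAt t
      (h k t ht).2.2.2
    refine this.congr_deriv ?_
    change D (jbk (-s) k) (D (jbk s k) _) = _
    rw [D_jbk_jbk, neg_add_cancel]
  have ca : ∀ k, ContinuousOn (a k) S := fun k =>
    (D (jbk (1 - s) k)).continuous.comp_continuousOn
      (fun t ht => (h k t ht).2.2.1.continuousWithinAt)
  have cb : ∀ k, ContinuousOn (b k) S := fun k =>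
    (D (jbk (1 - s) k)).continuous.comp_continuousOn
      (fun t ht => (h k t ht).2.2.2.continuousWithinAt)
  refine ⟨a', b', ua.continuousOn (Frequently.of_forall ca), ub.continuousOn (Frequently.of_forall cb),
    ?_, ?_, fun t ht => ⟨hua2 t ht, hpb2 t ht, ?_, ?_⟩⟩
  · refine tendsto_nhds_unique (tua 0 h0S) ?_
    simp only [hua', hU0]
    exact tendsto_D_jbk (by linarith) U₀
  · refine tendsto_nhds_unique (tpb 0 h0S) ?_
    simp only [hpb', hV0]
    exact tendsto_D_jbk (by linarith) V₀
  · exact hasDerivWithinAt_of_tendstoUniformlyOn (convex_Icc 0 T) d1 tua ufu t ht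
  · exact hasDerivWithinAt_of_tendstoUniformlyOn (convex_Icc 0 T) d2 tpb ufp t ht

/-! ### The density and its time derivatives -/

/-- A product `B (f t) (g t)` with `g` vanishing at the point is differentiable there if `g` is
differentiable and `f` merely continuous. -/
theorem hasDerivWithinAt_bilin {E F G : Type*} [NormedAddCommGroup E]
    [NormedAddCommGroup F] [NormedSpace ℝ F] [NormedAddCommGroup G] [NormedSpace ℝ G]
    {B : E → F → G} (hB : Continuous fun p : E × F => B p.1 p.2)
    (hs : ∀ x (c : ℝ) y, B x (c • y) = c • B x y) {f : ℝ → E} {g : ℝ → F} {g' : F} {S : Set ℝ}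
    {t : ℝ} (hf : ContinuousWithinAt f S t) (hg : HasDerivWithinAt g g' S t) (h0 : g t = 0) :
    HasDerivWithinAt (fun x => B (f x) (g x)) (B (f t) g') S t := by
  rw [hasDerivWithinAt_iff_tendsto_slope] at hg ⊢
  have h1 : ∀ x, B x 0 = 0 := fun x => by simpa using hs x 0 0
  have h2 : (slope (fun x => B (f x) (g x)) t) = fun x => B (f x) (slope g t x) := by
    ext x
    simp only [slope, vsub_eq_sub, h0, h1, sub_zero, hs]
  rw [h2]
  have h3 : Tendsto (fun x => (f x, slope g t x)) (𝓝[S \ {t}] t) (𝓝 (f t, g')) :=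
    (hf.tendsto.mono_left (nhdsWithin_mono _ Set.sdiff_subset)).prodMk_nhds hg
  exact (hB.tendsto (f t, g')).comp h3

theorem real_smul_eq (c : ℝ) (f : L2C) : c • f = (c : ℂ) • f :=
  RCLike.real_smul_eq_coe_smul (K := ℂ) c f

theorem mul_real_smul (w : Linf) (c : ℝ) (f : L2C) : mul w (c • f) = c • mul w f := by
  rw [real_smul_eq, real_smul_eq, map_smul]

theorem continuous_mul : Continuous fun p : Linf × L2C => mul p.1 p.2 :=
  mul.isBoundedBilinearMap.continuous

theorem HasDerivWithinAt.clmC {f : ℝ → L2C} {f' : L2C} {S : Set ℝ} {t : ℝ}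
    (h : HasDerivWithinAt f f' S t) (L : L2C →L[ℂ] L2C) :
    HasDerivWithinAt (fun t => L (f t)) (L f') S t :=
  (L.restrictScalars ℝ).hasFDerivAt.comp_hasDerivWithinAt t h

theorem HasDerivWithinAt.clmR {E F : Type*} [NormedAddCommGroup E] [NormedSpace ℝ E]
    [NormedAddCommGroup F] [NormedSpace ℝ F] {f : ℝ → E} {f' : E} {S : Set ℝ} {t : ℝ}
    (h : HasDerivWithinAt f f' S t) (L : E →L[ℝ] F) :
    HasDerivWithinAt (fun t => L (f t)) (L f') S t :=
  L.hasFDerivAt.comp_hasDerivWithinAt t h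

theorem uu_sub (a a' : L2C) : uu (a - a') = uu a - uu a' := map_sub _ _ _

theorem pp_sub (b b' : L2C) : pp (b - b') = pp b - pp b' := map_sub _ _ _

theorem rho_expand (a a₀ : L2C) : rho a = rho a₀ + (mul (emb a) (conjL (uu a - uu a₀)) +
    mul (emb (conjL a₀)) (uu a - uu a₀) + mul Qinf ((uu a - uu a₀) + conjL (uu a - uu a₀))) := by
  have h1 : mul (emb (conjL a₀)) (uu a) = mul (emb a) (conjL (uu a₀)) := by
    rw [mul_emb_uu, conjL_uu]
  have h2 : mul (emb (conjL a₀)) (uu a₀) = mul (emb a₀) (conjL (uu a₀)) := by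
    rw [mul_emb_uu, conjL_uu]
  simp only [rho, map_sub, map_add, h1, h2]
  abel

/-- The density `|w|² - Q²` is differentiable in `L²` although `u` is so in `L²` only, because `u` is
continuous in `H²` and hence in `L^∞`. -/
theorem hasDerivWithinAt_rho {a : ℝ → L2C} {u' : L2C} {S : Set ℝ} {t : ℝ}
    (ha : ContinuousWithinAt a S t) (hu : HasDerivWithinAt (fun t => uu (a t)) u' S t) :
    HasDerivWithinAt (fun t => rho (a t))
      (mul (ww (a t)) (conjL u') + mul (conjI (ww (a t))) u') S t := by
  have hd : HasDerivWithinAt (fun x => uu (a x) - uu (a t)) u' S t := hu.sub_const _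
  have h1 := hasDerivWithinAt_bilin continuous_mul mul_real_smul
    (emb.continuous.continuousAt.comp_continuousWithinAt ha) (HasDerivWithinAt.clmR hd conjL)
    (by simp)
  have h2 := HasDerivWithinAt.clmC hd (mul (emb (conjL (a t))))
  have h3 := HasDerivWithinAt.clmC (hd.add (HasDerivWithinAt.clmR hd conjL)) (mul Qinf)
  have h4 := ((h1.add h2).add h3).const_add (rho (a t))
  refine (h4.congr_deriv ?_).congr (fun x _ => rho_expand (a x) (a t)) (rho_expand (a t) (a t))
  rw [conjI_ww, ww]
  simp only [Function.comp_apply, map_add, add_apply]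
  abel

theorem reC_I_smul (f : L2C) : reC (Complex.I • f) = -imC f := by
  rw [reC_apply, imC, conjL_smul, Complex.conj_I, smul_add, smul_smul, smul_smul, smul_sub, neg_sub,
    ← sub_eq_zero]
  have e1 : (2⁻¹ : ℂ) * Complex.I = -(-Complex.I / 2) := by ring
  have e2 : (2⁻¹ : ℂ) * -Complex.I = (-Complex.I / 2) := by ring
  rw [e1, e2, neg_smul]
  abel

theorem reC_eq_self {f : L2C} (h : conjL f = f) : reC f = f := by
  rw [reC_apply, h, ← two_smul ℂ f, smul_smul]; norm_num

theorem imC_eq_zero {f : L2C} (h : conjL f = f) : imC f = 0 := by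
  rw [imC, h, sub_self, smul_zero]

theorem imC_real_smul (c : ℝ) (f : L2C) : imC ((c : ℂ) • f) = (c : ℂ) • imC f := by
  rw [imC, imC, conjL_smul, Complex.conj_ofReal, ← smul_sub, smul_comm]

theorem reC_real_smul (c : ℝ) (f : L2C) : reC ((c : ℂ) • f) = (c : ℂ) • reC f := by
  rw [← real_smul_eq, map_smul, real_smul_eq]

theorem imC_I_smul (f : L2C) : imC (Complex.I • f) = reC f := by
  have h := reC_I_smul (Complex.I • f)
  rw [smul_smul, Complex.I_mul_I, neg_one_smul, map_neg] at h
  exact (neg_inj.1 h).symm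

theorem conjL_mul_conjI_mul {w : Linf} {f : L2C} (hf : conjL f = f) :
    conjL (mul (conjI w) (mul w f)) = mul (conjI w) (mul w f) := by
  rw [conjL_mul, conjL_mul, conjI_conjI, hf, mul_left_comm']

theorem conjL_mul_Qinf {f : L2C} (hf : conjL f = f) : conjL (mul Qinf f) = mul Qinf f := by
  rw [conjL_mul, conjI_Qinf, hf]

theorem conjL_emb_conj_mul (a : L2C) :
    conjL (mul (emb (conjL a)) (uu a)) = mul (emb (conjL a)) (uu a) := by
  rw [conjL_mul, conjI_emb, conjL_conjL, conjL_uu, mul_emb_uu]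

theorem conjL_rho (a : L2C) : conjL (rho a) = rho a := by
  have h : mul (emb a) (conjL (uu a)) = mul (emb (conjL a)) (uu a) := by
    rw [conjL_uu, mul_emb_uu]
  rw [rho, h, map_add, conjL_emb_conj_mul, conjL_mul_Qinf]
  rw [map_add, conjL_conjL, add_comm]

theorem conjL_gg (a : L2C) : conjL (gg a) = gg a := by
  rw [gg, gg0, map_add, conjL_smul, conjL_smul, conjL_imC, conjL_imC]
  simp [map_ofNat]

/-- The equation `∂ₜ|w|² = 2 Re (w̄ u_t)`: the interaction with `n` drops out because `n` is real. -/
theorem gg_eq (a b : L2C) :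
    mul (ww a) (conjL (fu a b)) + mul (conjI (ww a)) (fu a b) = gg a := by
  have h1 : mul (ww a) (conjL (fu a b)) = conjL (mul (conjI (ww a)) (fu a b)) := by
    rw [conjL_mul, conjI_conjI]
  have h2 : conjL (mul (conjI (ww a)) (fu a b)) + mul (conjI (ww a)) (fu a b) =
      (2 : ℂ) • reC (mul (conjI (ww a)) (fu a b)) := by
    rw [reC_apply, smul_smul, mul_inv_cancel₀ two_ne_zero, one_smul, add_comm]
  have h3 : mul (conjI (ww a)) (fu a b) = Complex.I • (mul (conjI (ww a)) (lapU a) -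
      mul (conjI (ww a)) (mul (ww a) (reC (pp b))) + mul (conjI (ww a)) (mul (ww a) (rho a)) +
      mul (conjI (ww a)) (mul Qinf (mul Qinf (uu a))) - mul (conjI (ww a)) (uu a)) := by
    simp only [fu, fu0, map_add, map_sub, map_smul, smul_add, smul_sub]
    abel
  have h4 : imC (mul (conjI (ww a)) (mul Qinf (mul Qinf (uu a)))) =
      imC (mul Qinf (mul Qinf (mul Qinf (uu a)))) := by
    rw [conjI_ww, map_add, add_apply, imC_add, mul_left_comm' _ Qinf, mul_left_comm' _ Qinf,
      imC_eq_zero (conjL_mul_Qinf (conjL_mul_Qinf (conjL_emb_conj_mul a))), zero_add]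
  have h5 : imC (mul (conjI (ww a)) (uu a)) = imC (mul Qinf (uu a)) := by
    rw [conjI_ww, map_add, add_apply, imC_add, imC_eq_zero (conjL_emb_conj_mul a), zero_add]
  rw [h1, h2, h3, reC_I_smul, imC_sub, imC_add, imC_add, imC_sub,
    imC_eq_zero (conjL_mul_conjI_mul (conjL_reC (pp b))),
    imC_eq_zero (conjL_mul_conjI_mul (conjL_rho a)), h4, h5, gg, gg0, lapU, map_smul, map_sub,
    smul_sub, imC_sub, imC_sub, imC_sub, ← smul_add]
  congr 1
  abel

/-- A solution of the system for `(u, P)`, in terms of `a = ⟨D⟩² u` and `b = ⟨D⟩ P`. -/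
structure IsSol (lam T : ℝ) (a b : ℝ → L2C) : Prop where
  cont : ContinuousOn a (Set.Icc 0 T)
  deriv_u : ∀ t ∈ Set.Icc 0 T, HasDerivWithinAt (fun t => uu (a t)) (fu (a t) (b t)) (Set.Icc 0 T) t
  deriv_p : ∀ t ∈ Set.Icc 0 T,
    HasDerivWithinAt (fun t => pp (b t)) (fp lam (a t) (b t)) (Set.Icc 0 T) t

/-- The density `n = Re P - (|w|² - Q²)`. -/
noncomputable def nn (a b : L2C) : L2C := reC (pp b) - rho a

theorem conjL_nn (a b : L2C) : conjL (nn a b) = nn a b := by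
  rw [nn, map_sub, conjL_reC, conjL_rho]

theorem reC_fp (lam : ℝ) (a b : L2C) : reC (fp lam a b) = (lam : ℂ) • absD (imC b) + gg a := by
  have e : (-(Complex.I * lam)) • absD b = Complex.I • ((-lam : ℝ) : ℂ) • absD b := by
    rw [smul_smul]; congr 1; push_cast; ring
  rw [fp, map_add, reC_eq_self (conjL_gg a), e, reC_I_smul, imC_real_smul, absD, absD,
    D_imC bddSym_absSym absSym_neg_arg]
  push_cast
  rw [neg_smul, neg_neg]

theorem imC_fp (lam : ℝ) (a b : L2C) : imC (fp lam a b) = -((lam : ℂ) • absD (reC b)) := by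
  have e : (-(Complex.I * lam)) • absD b = Complex.I • ((-lam : ℝ) : ℂ) • absD b := by
    rw [smul_smul]; congr 1; push_cast; ring
  rw [fp, imC_add, imC_eq_zero (conjL_gg a), e, imC_I_smul, reC_real_smul, absD, absD,
    D_reC bddSym_absSym absSym_neg_arg]
  push_cast
  rw [neg_smul, add_zero]

theorem absD_absD (f : L2C) : absD (absD f) = -lapU f := by
  rw [absD, absD, D_D bddSym_absSym bddSym_absSym]
  apply ext_fourier
  have e : (𝓕 (-lapU f) : L2C) = (kap : ℂ) • ((𝓕 f : L2C) - 𝓕 (uu f)) := by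
    have h : -lapU f = (kap : ℂ) • (f - uu f) := by
      rw [lapU, ← smul_neg, neg_sub]
    rw [h]
    exact (map_smul (Lp.fourierTransformₗᵢ Plane ℂ) _ _).trans
      (congrArg _ (map_sub (Lp.fourierTransformₗᵢ Plane ℂ) _ _))
  rw [e]
  filter_upwards [fourier_D (bddSym_absSym.mul bddSym_absSym) f,
    fourier_D (bddSym_jb (by norm_num : (-2 : ℝ) ≤ 0)) f,
    Lp.coeFn_smul (kap : ℂ) ((𝓕 f : L2C) - 𝓕 (uu f)),
    Lp.coeFn_sub (𝓕 f : L2C) (𝓕 (uu f))] with ξ h1 h2 h3 h4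
  rw [h1, h3, Pi.smul_apply, h4, Pi.sub_apply, uu, h2, smul_eq_mul]
  have h5 : jb (-2) ξ * (1 + ‖ξ‖ ^ 2) = 1 := by rw [← jb_two, jb_mul]; norm_num
  have h6 : jb (-1) ξ * jb (-1) ξ = jb (-2) ξ := by rw [jb_mul]; norm_num
  have h7 : absSym ξ * absSym ξ = kap * (1 - jb (-2) ξ) := by
    unfold absSym kap
    calc _ = 4 * Real.pi ^ 2 * ‖ξ‖ ^ 2 * (jb (-1) ξ * jb (-1) ξ) := by ring
      _ = _ := by rw [h6]; linear_combination 4 * Real.pi ^ 2 * h5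
  rw [h7]; push_cast; ring

theorem conjL_lapU (a : L2C) : conjL (lapU a) = lapU (conjL a) := by
  rw [lapU, lapU, conjL_smul, Complex.conj_ofReal, map_sub, conjL_uu]

theorem continuous_lapU : Continuous lapU := by
  unfold lapU uu; fun_prop

section

variable {lam T : ℝ} {a b : ℝ → L2C}

theorem IsSol.deriv_rho (h : IsSol lam T a b) {t : ℝ} (ht : t ∈ Set.Icc 0 T) :
    HasDerivWithinAt (fun t => rho (a t)) (gg (a t)) (Set.Icc 0 T) t :=
  (hasDerivWithinAt_rho (h.cont t ht) (h.deriv_u t ht)).congr_deriv (gg_eq _ _)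

/-- The equation `n_t = λ|∇| M`: the time derivatives of `|w|²` in `n = N - |w|² + Q²` cancel. -/
theorem IsSol.deriv_nn (h : IsSol lam T a b) {t : ℝ} (ht : t ∈ Set.Icc 0 T) :
    HasDerivWithinAt (fun t => nn (a t) (b t)) ((lam : ℂ) • absD (imC (b t))) (Set.Icc 0 T) t := by
  refine ((HasDerivWithinAt.clmR (h.deriv_p t ht) reC).sub (h.deriv_rho ht)).congr_deriv ?_
  rw [reC_fp, add_sub_cancel_right]

/-- A curve is differentiable if it is so in a weaker norm with a derivative that is continuous in
the stronger norm. -/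
theorem hasDerivWithinAt_of_D_jb {r : ℝ} (hr : r ≤ 0) {z z' : ℝ → L2C}
    (hc : ContinuousOn z' (Set.Icc 0 T))
    (h : ∀ t ∈ Set.Icc 0 T,
      HasDerivWithinAt (fun t => D (jb r) (z t)) (D (jb r) (z' t)) (Set.Icc 0 T) t) :
    ∀ t ∈ Set.Icc 0 T, HasDerivWithinAt z (z' t) (Set.Icc 0 T) t := by
  intro t ht
  have hT : 0 ≤ T := ht.1.trans ht.2
  set y : ℝ → L2C := Set.IccExtend hT ((Set.Icc 0 T).domRestrict z') with hy
  have hyc : Continuous y := hc.domRestrict.Icc_extend'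
  have hyz : ∀ x ∈ Set.Icc 0 T, y x = z' x := fun x hx => by
    rw [hy, Set.IccExtend_of_mem _ _ hx]; rfl
  set W : ℝ → L2C := fun x => z 0 + ∫ τ in (0 : ℝ)..x, y τ with hW
  have hWd : ∀ x, HasDerivAt W (y x) x := fun x =>
    (intervalIntegral.integral_hasDerivAt_right (hyc.intervalIntegrable _ _)
      (hyc.stronglyMeasurableAtFilter _ _) hyc.continuousAt).const_add _
  have hconst : ∀ x ∈ Set.Icc 0 T, D (jb r) (z x) - D (jb r) (W x) = 0 := by
    intro x hx
    have hd : ∀ x ∈ Set.Icc 0 T, HasDerivWithinAt (fun x => D (jb r) (z x) - D (jb r) (W x)) 0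
        (Set.Icc 0 T) x := fun x hx => by
      refine ((h x hx).sub (HasDerivWithinAt.clmC (hWd x).hasDerivWithinAt (D (jb r)))).congr_deriv ?_
      rw [hyz x hx, sub_self]
    have := (convex_Icc 0 T).norm_image_sub_le_of_norm_hasDerivWithin_le (C := 0) hd (by simp)
      (⟨le_rfl, hT⟩ : (0 : ℝ) ∈ Set.Icc 0 T) hx
    rw [zero_mul, norm_le_zero_iff, sub_eq_zero] at this
    rw [this, hW]; simp
  have hzW : ∀ x ∈ Set.Icc 0 T, z x = W x := fun x hx =>
    D_jb_injective hr (sub_eq_zero.1 (hconst x hx))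
  rw [← hyz t ht]
  exact (hWd t).hasDerivWithinAt.congr hzW (hzW t ht)

/-- `n_t` is differentiable, and the wave equation `n_tt = λ² Δ(n + |w|² - Q²)` holds. -/
theorem IsSol.deriv_nn_deriv {s R : ℝ} (hs : 2 < s) (h : IsSol lam T a b)
    (hb : ∀ t ∈ Set.Icc 0 T, Sob s R (pp (b t))) :
    ∃ c : ℝ → L2C, (∀ t ∈ Set.Icc 0 T, Sob (s - 2) R (c t) ∧ conjL (c t) = c t ∧
        uu (c t) = nn (a t) (b t) + rho (a t) ∧
        HasDerivWithinAt (fun t => (lam : ℂ) • absD (imC (b t))) (((lam ^ 2 : ℝ) : ℂ) • lapU (c t))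
          (Set.Icc 0 T) t) ∧ ContinuousOn c (Set.Icc 0 T) := by
  have : ∀ t, ∃ F : L2C, t ∈ Set.Icc 0 T → ‖F‖ ≤ R ∧ D (jb (-s)) F = pp (b t) := fun t => by
    by_cases ht : t ∈ Set.Icc 0 T
    · obtain ⟨F, hF⟩ := hb t ht
      exact ⟨F, fun _ => hF⟩
    · exact ⟨0, fun h => absurd h ht⟩
  choose F hF using this
  set β : ℝ → L2C := fun t => D (jb (-(s - 2))) (F t) with hβ
  have hβ2 : ∀ t ∈ Set.Icc 0 T, uu (β t) = pp (b t) := fun t ht => by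
    rw [hβ, uu, D_jb_jb (by norm_num) (by linarith), ← (hF t ht).2]; congr 3; ring
  have hβ1 : ∀ t ∈ Set.Icc 0 T, D (jb (-1)) (β t) = b t := fun t ht => by
    apply D_jb_injective (by norm_num : (-1 : ℝ) ≤ 0)
    rw [D_jb_jb (by norm_num) (by norm_num)]
    change _ = pp (b t)
    rw [← hβ2 t ht, uu]; norm_num
  have hpc : ContinuousOn (fun t => D (jb (-s)) (F t)) (Set.Icc 0 T) :=
    ContinuousOn.congr (fun t ht => (h.deriv_p t ht).continuousWithinAt) (fun t ht => (hF t ht).2)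
  have hβc : ContinuousOn β (Set.Icc 0 T) :=
    continuousOn_D_jb_of_bounded (by linarith) (by linarith) (fun t ht => (hF t ht).1) hpc
  have hcc : ContinuousOn (fun t => reC (β t)) (Set.Icc 0 T) := reC.continuous.comp_continuousOn hβc
  have hdz : ∀ t ∈ Set.Icc 0 T, HasDerivWithinAt (fun t => absD (imC (b t)))
      ((lam : ℂ) • lapU (reC (β t))) (Set.Icc 0 T) t := by
    refine hasDerivWithinAt_of_D_jb (r := -1) (by norm_num)
      (((continuous_const_smul (lam : ℂ)).comp continuous_lapU).comp_continuousOn hcc) fun t ht => ?_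
    have hm := bddSym_jb (by norm_num : (-1 : ℝ) ≤ 0)
    have e1 : ∀ t, D (jb (-1)) (absD (imC (b t))) = D absSym (reC (-(Complex.I • pp (b t)))) :=
      fun t => by
      rw [absD, D_comm hm bddSym_absSym, D_imC hm (jb_neg_arg _), map_neg, reC_I_smul, neg_neg]; rfl
    simp only [e1]
    have h1 := HasDerivWithinAt.clmC ((HasDerivWithinAt.clmC (h.deriv_p t ht)
      (Complex.I • ContinuousLinearMap.id ℂ L2C)).neg |> fun q => HasDerivWithinAt.clmR q reC)
      (D absSym)
    refine h1.congr_deriv ?_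
    have e2 : (Complex.I • ContinuousLinearMap.id ℂ L2C) (fp lam (a t) (b t)) =
      Complex.I • fp lam (a t) (b t) := rfl
    rw [e2, map_neg, reC_I_smul, neg_neg, imC_fp, map_neg, map_smul, ← hβ1 t ht,
      ← D_reC hm (jb_neg_arg _)]
    have e3 : D absSym (absD (D (jb (-1)) (reC (β t)))) = -lapU (D (jb (-1)) (reC (β t))) :=
      absD_absD _
    rw [e3, smul_neg, neg_neg, map_smul]
    congr 1
    rw [lapU, lapU, map_smul, map_sub, uu, uu, D_comm hm (bddSym_jb (by norm_num))]
  refine ⟨fun t => reC (β t), fun t ht => ⟨?_, conjL_reC _, ?_, ?_⟩, hcc⟩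
  · exact Sob.reC (by linarith) ⟨F t, (hF t ht).1, rfl⟩
  · rw [nn, sub_add_cancel, uu, D_reC (bddSym_jb (by norm_num)) (jb_neg_arg _)]
    exact congrArg _ (hβ2 t ht)
  · refine (HasDerivWithinAt.clmC (hdz t ht) ((lam : ℂ) • ContinuousLinearMap.id ℂ L2C)).congr_deriv ?_
    change (lam : ℂ) • ((lam : ℂ) • lapU _) = _
    rw [smul_smul]; congr 1; push_cast; ring

/-! ### Uniqueness for the system -/

theorem inner_real_smul (x : L2C) (c : ℝ) (y : L2C) : inner ℂ x (c • y) = c • inner ℂ x y := by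
  rw [real_smul_eq, inner_smul_right]; rfl

/-- The square of the `H¹` norm of a curve that is differentiable in `L²` and continuous in `H²`. -/
theorem hasDerivWithinAt_norm_sq_D_jb {α : ℝ → L2C} {f' : L2C} {S : Set ℝ} {t : ℝ}
    (hα : ContinuousWithinAt α S t) (hd : HasDerivWithinAt (fun t => uu (α t)) f' S t) :
    HasDerivWithinAt (fun t => ‖D (jb (-1)) (α t)‖ ^ 2) (2 * (inner ℂ (α t) f').re) S t := by
  have hd' : HasDerivWithinAt (fun x => uu (α x) - uu (α t)) f' S t := hd.sub_const _
  have h1 := hasDerivWithinAt_bilin (B := fun x y : L2C => inner ℂ x y) continuous_inner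
    inner_real_smul hα hd' (by simp)
  have h2 := hasDerivWithinAt_bilin (B := fun x y : L2C => inner ℂ x y) continuous_inner
    inner_real_smul (continuousWithinAt_const (b := α t)) hd' (by simp)
  have h3 := (HasDerivWithinAt.clmR h1 Complex.reCLM).add (HasDerivWithinAt.clmR h2 Complex.reCLM)
  have e : ∀ x, ‖D (jb (-1)) (α x)‖ ^ 2 = ‖D (jb (-1)) (α t)‖ ^ 2 +
      (Complex.reCLM (inner ℂ (α x) (uu (α x) - uu (α t))) +
        Complex.reCLM (inner ℂ (α t) (uu (α x) - uu (α t)))) := fun x => by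
    have n : ∀ f : L2C, ‖D (jb (-1)) f‖ ^ 2 = (inner ℂ f (uu f)).re := fun f => by
      have : inner ℂ f (uu f) = inner ℂ (D (jb (-1)) f) (D (jb (-1)) f) := by
        rw [inner_D (bddSym_jb (by norm_num)), D_jb_jb (by norm_num) (by norm_num), uu]; norm_num
      rw [this, inner_self_eq_norm_sq_to_K]
      norm_cast
    have sym : (inner ℂ (α x) (uu (α t))).re = (inner ℂ (α t) (uu (α x))).re := by
      rw [uu, uu, ← inner_D (bddSym_jb (by norm_num)), ← inner_conj_symm, Complex.conj_re]
    rw [n, n, inner_sub_right, inner_sub_right]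
    simp only [Complex.reCLM_apply, Complex.sub_re, sym]
    ring
  refine ((h3.const_add (‖D (jb (-1)) (α t)‖ ^ 2)).congr_deriv ?_).congr (fun x _ => e x) (e t)
  simp only [Complex.reCLM_apply]; ring

/-- Uniqueness, by the difference estimate and Gronwall. -/
theorem IsSol.unique {s R : ℝ} (hs : 2 < s) (hR : 0 ≤ R) {a' b' : ℝ → L2C}
    (h : IsSol lam T a b) (h' : IsSol lam T a' b')
    (ha : ∀ t ∈ Set.Icc 0 T, Sob (s + 1) R (uu (a t)))
    (ha' : ∀ t ∈ Set.Icc 0 T, Sob (s + 1) R (uu (a' t)))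
    (hb' : ∀ t ∈ Set.Icc 0 T, Sob s R (reC (pp (b' t))))
    (ha0 : uu (a 0) = uu (a' 0)) (hb0 : pp (b 0) = pp (b' 0)) :
    ∀ t ∈ Set.Icc 0 T, a t = a' t ∧ b t = b' t := by
  obtain ⟨K, hK, hD⟩ := difference_estimate hs hR
  have hk := kap_pos
  intro t ht
  have hder : ∀ t ∈ Set.Icc 0 T, HasDerivWithinAt (fun t => dEnergy (a t - a' t) (b t - b' t))
      (2 * (2 * kap * (inner ℂ (a t - a' t) (fu (a t) (b t) - fu (a' t) (b' t))).re +
        (inner ℂ (pp (b t - b' t)) (fp lam (a t) (b t) - fp lam (a' t) (b' t))).re))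
      (Set.Icc 0 T) t := fun t ht => by
    have hu : HasDerivWithinAt (fun t => uu (a t - a' t)) (fu (a t) (b t) - fu (a' t) (b' t))
        (Set.Icc 0 T) t := by
      simp only [uu_sub]; exact (h.deriv_u t ht).sub (h'.deriv_u t ht)
    have hp : HasDerivWithinAt (fun t => pp (b t - b' t)) (fp lam (a t) (b t) - fp lam (a' t) (b' t))
        (Set.Icc 0 T) t := by
      simp only [pp_sub]; exact (h.deriv_p t ht).sub (h'.deriv_p t ht)
    have h1 := hasDerivWithinAt_norm_sq_D_jb ((h.cont t ht).sub (h'.cont t ht)) hu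
    have h2 := hasDerivWithinAt_norm_sq hp
    refine ((h1.const_mul (2 * kap)).add h2).congr_deriv ?_
    simp only [Pi.sub_apply]
    ring
  have hg := gronwall_le (ε := 0) (by positivity : 0 ≤ 2 * K) le_rfl hder (fun t ht => by
    have := hD lam (a t) (b t) (a' t) (b' t) (ha t ht) (ha' t ht) (hb' t ht)
    linarith) t ht
  have ha0' := D_jb_injective (by norm_num) ha0
  have hb0' := D_jb_injective (by norm_num) hb0
  have e0 : dEnergy (a 0 - a' 0) (b 0 - b' 0) = 0 := by
    rw [ha0', hb0', dEnergy, pp]; simp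
  rw [e0, zero_mul, add_zero, zero_mul, dEnergy] at hg
  have n1 : 0 ≤ 2 * kap * ‖D (jb (-1)) (a t - a' t)‖ ^ 2 := by positivity
  have n2 : 0 ≤ ‖pp (b t - b' t)‖ ^ 2 := by positivity
  have z1 : ‖D (jb (-1)) (a t - a' t)‖ ^ 2 = 0 := by
    have : 2 * kap * ‖D (jb (-1)) (a t - a' t)‖ ^ 2 = 0 := by linarith
    exact (mul_eq_zero.1 this).resolve_left (by positivity)
  have z2 : ‖pp (b t - b' t)‖ ^ 2 = 0 := by linarith
  rw [sq_eq_zero_iff, norm_eq_zero] at z1 z2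
  constructor
  · refine D_jb_injective (r := -1) (by norm_num) ?_
    rwa [map_sub, sub_eq_zero] at z1
  · refine D_jb_injective (r := -1) (by norm_num) ?_
    rwa [pp_sub, sub_eq_zero] at z2

end

/-! ### Smooth compactly supported functions on the plane -/

/-- The class in `L²` of a square integrable function; zero for other functions. -/
noncomputable def toL2 (g : Plane → ℂ) : L2C :=
  open Classical in if h : MemLp g 2 volume then h.toLp g else 0

theorem coeFn_toL2 {g : Plane → ℂ} (h : MemLp g 2 volume) : toL2 g =ᵐ[volume] g := by
  rw [toL2, dif_pos h]; exact h.coeFn_toLp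

theorem toL2_add {g h : Plane → ℂ} (hg : MemLp g 2 volume) (hh : MemLp h 2 volume) :
    toL2 (fun x => g x + h x) = toL2 g + toL2 h := by
  apply Lp.ext
  filter_upwards [coeFn_toL2 (hg.add hh), coeFn_toL2 hg, coeFn_toL2 hh,
    Lp.coeFn_add (toL2 g) (toL2 h)] with x h1 h2 h3 h4
  rw [h4, Pi.add_apply, h2, h3]; exact h1

theorem toL2_smul {g : Plane → ℂ} (c : ℂ) (hg : MemLp g 2 volume) :
    toL2 (fun x => c * g x) = c • toL2 g := by
  apply Lp.ext
  filter_upwards [coeFn_toL2 (hg.const_mul c), coeFn_toL2 hg, Lp.coeFn_smul c (toL2 g)]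
    with x h1 h2 h3
  rw [h3, Pi.smul_apply, h2]; exact h1

/-- The bilinear pairing `∫ φ u` on `L²`. -/
noncomputable def bip (φ u : L2C) : ℂ := inner ℂ (conjL φ) u

theorem bip_eq_integral (φ u : L2C) : bip φ u = ∫ x, u x * φ x := by
  rw [bip, inner_eq_integral]
  apply integral_congr_ae
  filter_upwards [coeFn_conjL φ] with x hx
  rw [hx]; simp [mul_comm]

theorem bip_toL2 {g : Plane → ℂ} (hg : MemLp g 2 volume) (u : L2C) :
    bip (toL2 g) u = ∫ x, u x * g x := by
  rw [bip_eq_integral]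
  apply integral_congr_ae
  filter_upwards [coeFn_toL2 hg] with x hx
  rw [hx]

theorem bip_add_right (φ u v : L2C) : bip φ (u + v) = bip φ u + bip φ v := inner_add_right _ _ _

theorem bip_sub_right (φ u v : L2C) : bip φ (u - v) = bip φ u - bip φ v := inner_sub_right _ _ _

theorem bip_smul_right (φ : L2C) (c : ℂ) (u : L2C) : bip φ (c • u) = c * bip φ u :=
  inner_smul_right _ _ _

theorem bip_add_left (φ ψ u : L2C) : bip (φ + ψ) u = bip φ u + bip ψ u := by
  rw [bip, map_add, inner_add_left, bip, bip]

theorem bip_smul_left (c : ℂ) (φ u : L2C) : bip (c • φ) u = c * bip φ u := by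
  rw [bip, conjL_smul, inner_smul_left, Complex.conj_conj, bip]

theorem continuous_bip : Continuous fun p : L2C × L2C => bip p.1 p.2 := by
  unfold bip; fun_prop

theorem HasDerivWithinAt.bip {φ u : ℝ → L2C} {φ' u' : L2C} {S : Set ℝ} {t : ℝ}
    (hφ : HasDerivWithinAt φ φ' S t) (hu : HasDerivWithinAt u u' S t) :
    HasDerivWithinAt (fun t => bip (φ t) (u t)) (bip φ' (u t) + bip (φ t) u') S t := by
  refine (HasDerivWithinAt.inner ℂ (HasDerivWithinAt.clmR hφ conjL) hu).congr_deriv ?_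
  rw [add_comm]; rfl

theorem bip_lapU (z c : L2C) : bip (lapU z) (uu c) = bip (uu z) (lapU c) := by
  have h2 := bddSym_jb (by norm_num : (-2 : ℝ) ≤ 0)
  rw [bip, bip, conjL_lapU, conjL_uu, lapU, lapU, inner_smul_left, inner_smul_right, inner_sub_left,
    inner_sub_right, Complex.conj_ofReal, uu, uu]
  congr 2
  rw [inner_D h2]

/-- A smooth compactly supported function on the plane. -/
structure IsCc {F : Type} [NormedAddCommGroup F] [NormedSpace ℝ F] (φ : Plane → F) : Prop where
  smooth : ContDiff ℝ ∞ φ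
  compact : HasCompactSupport φ

/-- The `j`-th partial derivative. -/
noncomputable def pd {F : Type} [NormedAddCommGroup F] [NormedSpace ℝ F] (j : Fin 2) (φ : Plane → F)
    (x : Plane) : F := fderiv ℝ φ x (EuclideanSpace.single j (1 : ℝ))

section IsCc

variable {F : Type} [NormedAddCommGroup F] [NormedSpace ℝ F] {φ : Plane → F}

theorem IsCc.pd (h : IsCc φ) (j : Fin 2) : IsCc (pd j φ) :=
  ⟨(h.smooth.fderiv_right (m := ∞) (by simp)).clm_apply contDiff_const, h.compact.fderiv_apply ℝ _⟩

theorem IsCc.memLp (h : IsCc φ) (p : ℝ≥0∞) : MemLp φ p volume :=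
  h.smooth.continuous.memLp_of_hasCompactSupport h.compact

theorem laplacian_eq_pd (h : ContDiff ℝ 2 φ) (x : Plane) :
    Δ φ x = Zakharov.pd 0 (Zakharov.pd 0 φ) x + Zakharov.pd 1 (Zakharov.pd 1 φ) x := by
  rw [InnerProductSpace.laplacian_eq_iteratedFDeriv_orthonormalBasis φ
    (EuclideanSpace.basisFun (Fin 2) ℝ)]
  have hd : DifferentiableAt ℝ (fderiv ℝ φ) x :=
    ((h.fderiv_right (m := 1) (by norm_num)).differentiable (by norm_num)).differentiableAt
  have e : ∀ j : Fin 2, Zakharov.pd j (Zakharov.pd j φ) x = iteratedFDeriv ℝ 2 φ x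
      ![(EuclideanSpace.basisFun (Fin 2) ℝ) j, (EuclideanSpace.basisFun (Fin 2) ℝ) j] := fun j => by
    rw [iteratedFDeriv_two_apply]
    have : Zakharov.pd j φ = fun y => (fderiv ℝ φ y) (EuclideanSpace.single j (1 : ℝ)) := rfl
    rw [Zakharov.pd, this, fderiv_clm_apply hd (differentiableAt_const _)]
    simp
  rw [e, e]
  simp only [Fin.sum_univ_two]

end IsCc

theorem IsCc.laplacian {φ : Plane → ℂ} (h : IsCc φ) : IsCc (Δ φ) := by
  have e : Δ φ = fun x => Zakharov.pd 0 (Zakharov.pd 0 φ) x + Zakharov.pd 1 (Zakharov.pd 1 φ) x :=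
    funext fun x => laplacian_eq_pd (contDiff_infty.1 h.smooth 2) x
  rw [e]
  exact ⟨((h.pd 0).pd 0).smooth.add ((h.pd 1).pd 1).smooth,
    ((h.pd 0).pd 0).compact.add ((h.pd 1).pd 1).compact⟩

theorem fourier_pd {φ : Plane → ℂ} (h : IsCc φ) (j : Fin 2) :
    (𝓕 (toL2 (pd j φ)) : L2C) =ᵐ[volume]
      fun ξ => (2 * Real.pi * Complex.I) * ((ξ j : ℝ) : ℂ) * (𝓕 (toL2 φ) : L2C) ξ := by
  set Φ : SchwartzMap Plane ℂ := h.compact.toSchwartzMap h.smooth with hΦ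
  set m : Plane := EuclideanSpace.single j (1 : ℝ) with hm
  have e1 : toL2 φ = Φ.toLp 2 := by
    apply Lp.ext
    filter_upwards [coeFn_toL2 (h.memLp 2), Φ.coeFn_toLp 2] with x h1 h2
    rw [h1, h2]; rfl
  have e2 : toL2 (pd j φ) = (LineDeriv.lineDerivOp m Φ).toLp 2 := by
    apply Lp.ext
    filter_upwards [coeFn_toL2 ((h.pd j).memLp 2), (LineDeriv.lineDerivOp m Φ).coeFn_toLp 2]
      with x h1 h2
    rw [h1, h2, SchwartzMap.lineDerivOp_apply_eq_fderiv]; rfl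
  rw [e1, e2, SchwartzMap.toLp_fourier_eq, SchwartzMap.toLp_fourier_eq,
    SchwartzMap.fourier_lineDerivOp_eq]
  filter_upwards [SchwartzMap.coeFn_toLp ((2 * Real.pi * Complex.I) •
    SchwartzMap.smulLeftCLM ℂ (inner ℝ · m) (𝓕 Φ)) 2 volume, (𝓕 Φ).coeFn_toLp 2] with ξ h1 h2
  have ht : (inner ℝ · m : Plane → ℝ).HasTemperateGrowth := by fun_prop
  rw [h1, h2, _root_.smul_apply, SchwartzMap.smulLeftCLM_apply_apply ht, hm,
    EuclideanSpace.inner_single_right]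
  simp [mul_assoc]

/-- A smooth compactly supported function is `⟨D⟩^{-2} z` with `z` in `L²`, and its Laplacian is
the one used for solutions. -/
theorem IsCc.exists_uu {φ : Plane → ℂ} (h : IsCc φ) :
    ∃ z, uu z = toL2 φ ∧ lapU z = toL2 (Δ φ) := by
  have hk := kap_pos
  set z : L2C := toL2 φ - ((kap⁻¹ : ℝ) : ℂ) • toL2 (Δ φ) with hz
  have h0 := fourier_pd h 0
  have h1 := fourier_pd h 1
  have h00 := fourier_pd (h.pd 0) 0
  have h11 := fourier_pd (h.pd 1) 1
  have e : toL2 (Δ φ) = toL2 (Zakharov.pd 0 (Zakharov.pd 0 φ)) +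
      toL2 (Zakharov.pd 1 (Zakharov.pd 1 φ)) := by
    rw [← toL2_add (((h.pd 0).pd 0).memLp 2) (((h.pd 1).pd 1).memLp 2)]
    congr 1
    exact funext fun x => laplacian_eq_pd (contDiff_infty.1 h.smooth 2) x
  have hu : uu z = toL2 φ := by
    apply ext_fourier
    have l1 : (𝓕 z : L2C) = 𝓕 (toL2 φ) - ((kap⁻¹ : ℝ) : ℂ) •
        ((𝓕 (toL2 (Zakharov.pd 0 (Zakharov.pd 0 φ))) : L2C) +
          𝓕 (toL2 (Zakharov.pd 1 (Zakharov.pd 1 φ)))) := by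
      rw [hz, e]
      refine (map_sub (Lp.fourierTransformₗᵢ Plane ℂ) _ _).trans ?_
      rw [map_smul, map_add]; rfl
    have hf := fourier_D (bddSym_jb (by norm_num : (-2 : ℝ) ≤ 0)) z
    rw [l1] at hf
    filter_upwards [hf, h0, h1, h00, h11,
      Lp.coeFn_sub (𝓕 (toL2 φ) : L2C) (((kap⁻¹ : ℝ) : ℂ) •
        ((𝓕 (toL2 (Zakharov.pd 0 (Zakharov.pd 0 φ))) : L2C) +
          𝓕 (toL2 (Zakharov.pd 1 (Zakharov.pd 1 φ))))),
      Lp.coeFn_smul ((kap⁻¹ : ℝ) : ℂ) ((𝓕 (toL2 (Zakharov.pd 0 (Zakharov.pd 0 φ))) : L2C) +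
          𝓕 (toL2 (Zakharov.pd 1 (Zakharov.pd 1 φ)))),
      Lp.coeFn_add (𝓕 (toL2 (Zakharov.pd 0 (Zakharov.pd 0 φ))) : L2C)
          (𝓕 (toL2 (Zakharov.pd 1 (Zakharov.pd 1 φ))))] with ξ a1 a2 a3 a4 a5 a6 a7 a8
    rw [uu, a1, a6, Pi.sub_apply, a7, Pi.smul_apply, a8, Pi.add_apply, a4, a5, a2, a3, smul_eq_mul]
    have hn : ‖ξ‖ ^ 2 = ξ 0 ^ 2 + ξ 1 ^ 2 := by
      rw [EuclideanSpace.norm_sq_eq, Fin.sum_univ_two, Real.norm_eq_abs, Real.norm_eq_abs, sq_abs,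
        sq_abs]
    have hj : jb (-2) ξ * (1 + (ξ 0 ^ 2 + ξ 1 ^ 2)) = 1 := by
      rw [← hn, ← jb_two, jb_mul]; norm_num
    have hj' : (jb (-2) ξ : ℂ) * (1 + ((ξ 0 : ℂ) ^ 2 + (ξ 1 : ℂ) ^ 2)) = 1 := by exact_mod_cast hj
    have hkk : ((kap⁻¹ : ℝ) : ℂ) * (2 * Real.pi * Complex.I) ^ 2 = -1 := by
      have hp : (Real.pi : ℂ) ≠ 0 := by exact_mod_cast Real.pi_ne_zero
      rw [mul_pow, Complex.I_sq, kap]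
      push_cast
      field_simp
      norm_num
    linear_combination (𝓕 (toL2 φ) : L2C) ξ * hj' - (jb (-2) ξ : ℂ) * ((ξ 0 : ℂ) ^ 2 + (ξ 1 : ℂ) ^ 2) *
      (𝓕 (toL2 φ) : L2C) ξ * hkk
  refine ⟨z, hu, ?_⟩
  rw [lapU, hu, hz, sub_sub_cancel, smul_smul, ← Complex.ofReal_mul, mul_inv_cancel₀ hk.ne']
  simp

/-- The Laplacian of an element of `H²` in the sense of distributions is `lapU`. -/
theorem IsCc.bip_laplacian {φ : Plane → ℂ} (h : IsCc φ) (c : L2C) :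
    bip (toL2 (Δ φ)) (uu c) = bip (toL2 φ) (lapU c) := by
  obtain ⟨z, h1, h2⟩ := h.exists_uu
  rw [← h1, ← h2, bip_lapU]

/-! ### The equation of the soliton -/

theorem hasFDerivAt_comp_coord {f : ℝ → ℝ} {f' : ℝ} {x : Plane} (h : HasDerivAt f f' (x 0)) :
    HasFDerivAt (fun x : Plane => f (x 0))
      (f' • (EuclideanSpace.proj (0 : Fin 2) : Plane →L[ℝ] ℝ)) x := by
  have h1 : HasFDerivAt (fun x : Plane => x 0) (EuclideanSpace.proj (0 : Fin 2) : Plane →L[ℝ] ℝ) x :=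
    (EuclideanSpace.proj (0 : Fin 2) : Plane →L[ℝ] ℝ).hasFDerivAt
  exact h.comp_hasFDerivAt x h1

theorem hasDerivAt_solitonProfile_deriv (x : ℝ) :
    HasDerivAt (fun x => -(solitonProfile x * Real.tanh x))
      (solitonProfile x - solitonProfile x ^ 3) x := by
  refine (((hasDerivAt_solitonProfile x).mul (hasDerivAt_tanh' x)).neg).congr_deriv ?_
  have hq : solitonProfile x ^ 2 = 2 * (1 - Real.tanh x ^ 2) := by
    have hc := Real.cosh_pos x
    have h1 : solitonProfile x = Real.sqrt 2 / Real.cosh x := by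
      rw [solitonProfile, Real.cosh_eq]
      have : 0 < Real.exp x + Real.exp (-x) := by positivity
      field_simp
    rw [h1, Real.tanh_eq_sinh_div_cosh, div_pow, div_pow, Real.sq_sqrt (by norm_num)]
    have := Real.cosh_sq_sub_sinh_sq x
    field_simp
    linarith
  linear_combination (solitonProfile x) * hq

/-- Green's formula for the soliton, which solves `Q'' = Q - Q³`. -/
theorem integral_lineSoliton_laplacian {φ : Plane → ℂ} (h : IsCc φ) :
    ∫ x, (lineSoliton x : ℂ) * Δ φ x =
      ∫ x, ((lineSoliton x - lineSoliton x ^ 3 : ℝ) : ℂ) * φ x := by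
  have hint : ∀ {g : Plane → ℝ} {ψ : Plane → ℂ}, Continuous g → IsCc ψ →
      Integrable (fun x => g x • ψ x) volume := fun hg hψ =>
    (hg.smul hψ.smooth.continuous).integrable_of_hasCompactSupport hψ.compact.smul_left
  have hdiff : ∀ {ψ : Plane → ℂ}, IsCc ψ → ∀ x, DifferentiableAt ℝ ψ x := fun hψ x =>
    (hψ.smooth.differentiable (by simp)).differentiableAt
  set q₁ : Plane → ℝ := fun x => -(solitonProfile (x 0) * Real.tanh (x 0)) with hq₁
  have hQ : ∀ x, HasFDerivAt lineSoliton (q₁ x • (EuclideanSpace.proj (0 : Fin 2) : Plane →L[ℝ] ℝ)) x :=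
    fun x => hasFDerivAt_comp_coord (hasDerivAt_solitonProfile (x 0))
  have hQ₁ : ∀ x, HasFDerivAt q₁ ((lineSoliton x - lineSoliton x ^ 3) •
      (EuclideanSpace.proj (0 : Fin 2) : Plane →L[ℝ] ℝ)) x :=
    fun x => hasFDerivAt_comp_coord (hasDerivAt_solitonProfile_deriv (x 0))
  have cQ := continuous_lineSoliton
  have cq : Continuous q₁ := continuous_iff_continuousAt.2 fun x => (hQ₁ x).continuousAt
  have f0 : ∀ x, fderiv ℝ lineSoliton x (EuclideanSpace.single 0 1) = q₁ x := fun x => by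
    rw [(hQ x).fderiv]; simp
  have f1 : ∀ x, fderiv ℝ lineSoliton x (EuclideanSpace.single 1 1) = 0 := fun x => by
    rw [(hQ x).fderiv]; simp
  have f2 : ∀ x, fderiv ℝ q₁ x (EuclideanSpace.single 0 1) = lineSoliton x - lineSoliton x ^ 3 :=
    fun x => by rw [(hQ₁ x).fderiv]; simp
  have i1 : ∫ x, lineSoliton x • pd 1 (pd 1 φ) x = 0 := by
    have := integral_smul_fderiv_eq_neg_fderiv_smul_of_integrable (μ := volume) (f := lineSoliton)
      (g := pd 1 φ) (v := EuclideanSpace.single 1 1) (by simp [f1]) (hint cQ ((h.pd 1).pd 1))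
      (hint cQ (h.pd 1)) (fun x _ => (hQ x).differentiableAt) (fun x _ => hdiff (h.pd 1) x)
    simp only [f1, zero_smul, integral_zero, neg_zero] at this
    exact this
  have i2 : ∫ x, lineSoliton x • pd 0 (pd 0 φ) x = -∫ x, q₁ x • pd 0 φ x := by
    have := integral_smul_fderiv_eq_neg_fderiv_smul_of_integrable (μ := volume) (f := lineSoliton)
      (g := pd 0 φ) (v := EuclideanSpace.single 0 1) (by simpa [f0] using hint cq (h.pd 0))
      (hint cQ ((h.pd 0).pd 0))
      (hint cQ (h.pd 0)) (fun x _ => (hQ x).differentiableAt) (fun x _ => hdiff (h.pd 0) x)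
    simp only [f0] at this
    exact this
  have i3 : ∫ x, q₁ x • pd 0 φ x = -∫ x, (lineSoliton x - lineSoliton x ^ 3) • φ x := by
    have := integral_smul_fderiv_eq_neg_fderiv_smul_of_integrable (μ := volume) (f := q₁)
      (g := φ) (v := EuclideanSpace.single 0 1)
      (by simp only [f2]; exact hint (g := fun x => lineSoliton x - lineSoliton x ^ 3) (cQ.sub (cQ.pow 3)) h) (hint cq (h.pd 0))
      (hint cq h) (fun x _ => (hQ₁ x).differentiableAt) (fun x _ => hdiff h x)
    simp only [f2] at this
    exact this
  have e1 : ∀ x, (lineSoliton x : ℂ) * Δ φ x =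
      lineSoliton x • pd 0 (pd 0 φ) x + lineSoliton x • pd 1 (pd 1 φ) x := fun x => by
    rw [laplacian_eq_pd (contDiff_infty.1 h.smooth 2) x, Complex.real_smul,
      Complex.real_smul]; ring
  simp_rw [e1]
  rw [integral_add (hint cQ ((h.pd 0).pd 0)) (hint cQ ((h.pd 1).pd 1)), i1, i2, i3, neg_neg, add_zero]
  rfl

/-! ### Test functions -/

section TestFunction

variable {F : Type} [NormedAddCommGroup F] [NormedSpace ℝ F] {T : ℝ} {ψ : ℝ → Plane → F}

theorem IsTestFunction.dir (h : IsTestFunction T ψ) (v : ℝ × Plane) :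
    IsTestFunction T (fun t x => fderiv ℝ (Function.uncurry ψ) (t, x) v) where
  smooth := (h.smooth.fderiv_right (m := ∞) (by simp)).clm_apply contDiff_const
  compact_support := h.compact_support.fderiv_apply ℝ v
  support_subset := (tsupport_fderiv_apply_subset ℝ v).trans h.support_subset

theorem IsTestFunction.add {ψ' : ℝ → Plane → F} (h : IsTestFunction T ψ) (h' : IsTestFunction T ψ') :
    IsTestFunction T (fun t x => ψ t x + ψ' t x) where
  smooth := h.smooth.add h'.smooth
  compact_support := h.compact_support.add h'.compact_support
  support_subset := (tsupport_add (Function.uncurry ψ) (Function.uncurry ψ')).trans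
    (Set.union_subset h.support_subset h'.support_subset)

theorem IsTestFunction.comp_clm {G : Type} [NormedAddCommGroup G] [NormedSpace ℝ G]
    (h : IsTestFunction T ψ) (L : F →L[ℝ] G) : IsTestFunction T (fun t x => L (ψ t x)) where
  smooth := L.contDiff.comp h.smooth
  compact_support := h.compact_support.comp_left (map_zero L)
  support_subset := (tsupport_comp_subset (map_zero L) (Function.uncurry ψ)).trans h.support_subset

theorem IsTestFunction.hasDerivAt_time (h : IsTestFunction T ψ) (t : ℝ) (x : Plane) :
    HasDerivAt (fun τ => ψ τ x) (fderiv ℝ (Function.uncurry ψ) (t, x) (1, 0)) t := by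
  have h1 : HasFDerivAt (Function.uncurry ψ) (fderiv ℝ (Function.uncurry ψ) (t, x)) (t, x) :=
    (h.smooth.differentiable (by simp)).differentiableAt.hasFDerivAt
  have h2 : HasDerivAt (fun τ : ℝ => (τ, x)) ((1 : ℝ), (0 : Plane)) t :=
    (hasDerivAt_id t).prodMk (hasDerivAt_const t x)
  exact h1.comp_hasDerivAt t h2

theorem IsTestFunction.deriv (h : IsTestFunction T ψ) :
    IsTestFunction T (fun t x => deriv (fun τ => ψ τ x) t) := by
  have e : (fun t x => _root_.deriv (fun τ => ψ τ x) t) =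
      fun t x => fderiv ℝ (Function.uncurry ψ) (t, x) (1, 0) := by
    ext t x; exact (h.hasDerivAt_time t x).deriv
  rw [e]; exact h.dir _

theorem IsTestFunction.pd_eq (h : IsTestFunction T ψ) (j : Fin 2) (t : ℝ) (x : Plane) :
    pd j (ψ t) x = fderiv ℝ (Function.uncurry ψ) (t, x) (0, EuclideanSpace.single j (1 : ℝ)) := by
  have h1 : HasFDerivAt (Function.uncurry ψ) (fderiv ℝ (Function.uncurry ψ) (t, x)) (t, x) :=
    (h.smooth.differentiable (by simp)).differentiableAt.hasFDerivAt
  have h2 : HasFDerivAt (fun y : Plane => (t, y)) (ContinuousLinearMap.inr ℝ ℝ Plane) x :=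
    hasFDerivAt_prodMk_right t x
  have h3 : HasFDerivAt (ψ t) ((fderiv ℝ (Function.uncurry ψ) (t, x)).comp
      (ContinuousLinearMap.inr ℝ ℝ Plane)) x := h1.comp x h2
  rw [pd, h3.fderiv]; rfl

theorem IsTestFunction.pd (h : IsTestFunction T ψ) (j : Fin 2) :
    IsTestFunction T (fun t => pd j (ψ t)) := by
  have e : (fun t => Zakharov.pd j (ψ t)) = fun t x =>
      fderiv ℝ (Function.uncurry ψ) (t, x) (0, EuclideanSpace.single j (1 : ℝ)) := by
    ext t x; exact h.pd_eq j t x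
  rw [e]; exact h.dir _

theorem IsTestFunction.isCc (h : IsTestFunction T ψ) (t : ℝ) : IsCc (ψ t) where
  smooth := h.smooth.comp (contDiff_prodMk_right t)
  compact := by
    have h1 : IsCompact (Prod.snd '' tsupport (Function.uncurry ψ)) :=
      h.compact_support.image continuous_snd
    refine HasCompactSupport.intro h1 fun x hx => ?_
    by_contra hne
    exact hx ⟨(t, x), subset_tsupport _ hne, rfl⟩

theorem IsTestFunction.laplacian (h : IsTestFunction T ψ) :
    IsTestFunction T (fun t => Δ (ψ t)) := by
  have e : (fun t => Δ (ψ t)) = fun t x => Zakharov.pd 0 (Zakharov.pd 0 (ψ t)) x +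
      Zakharov.pd 1 (Zakharov.pd 1 (ψ t)) x := by
    ext t x
    exact laplacian_eq_pd (contDiff_infty.1 (h.isCc t).smooth 2) x
  rw [e]
  exact ((h.pd 0).pd 0).add ((h.pd 1).pd 1)

theorem IsTestFunction.eq_zero (h : IsTestFunction T ψ) {t : ℝ} (ht : T ≤ t) (x : Plane) :
    ψ t x = 0 := by
  by_contra hne
  have := h.support_subset (subset_tsupport (Function.uncurry ψ)
    (show (t, x) ∈ Function.support (Function.uncurry ψ) from hne))
  exact absurd this.1 (not_lt.2 ht)

theorem IsTestFunction.exists_radius (h : IsTestFunction T ψ) :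
    ∃ r : ℝ, ∀ t x, r < ‖x‖ → ψ t x = 0 := by
  obtain ⟨r, hr⟩ := (h.compact_support.image continuous_snd).isBounded.exists_norm_le
  refine ⟨r, fun t x hx => ?_⟩
  by_contra hne
  exact absurd (hr x ⟨(t, x), subset_tsupport _ hne, rfl⟩) (not_le.2 hx)

end TestFunction

theorem memLp_indicator_ball {g : Plane → ℂ} (hg : Continuous g) (r : ℝ) (p : ℝ≥0∞) :
    MemLp ((Metric.closedBall 0 r).indicator g) p volume := by
  obtain ⟨C, hC⟩ := (isCompact_closedBall (0 : Plane) r).exists_bound_of_continuousOn hg.continuousOn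
  have h1 : MemLp g p (volume.restrict (Metric.closedBall 0 r)) := by
    have : IsFiniteMeasure ((volume : Measure Plane).restrict (Metric.closedBall 0 r)) :=
      ⟨by rw [Measure.restrict_apply_univ]; exact measure_closedBall_lt_top⟩
    refine MemLp.of_bound hg.aestronglyMeasurable C ?_
    exact (ae_restrict_iff' Metric.isClosed_closedBall.measurableSet).2 (Eventually.of_forall hC)
  exact (memLp_indicator_iff_restrict Metric.isClosed_closedBall.measurableSet).2 h1

/-- A continuous function, cut off outside the ball of radius `r`, as an element of `L²`. -/
noncomputable def loc (r : ℝ) (g : Plane → ℂ) : L2C := toL2 ((Metric.closedBall 0 r).indicator g)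

theorem bip_loc {r : ℝ} {g ψ : Plane → ℂ} (hg : Continuous g) (hψ : MemLp ψ 2 volume)
    (hr : ∀ x, r < ‖x‖ → ψ x = 0) : bip (toL2 ψ) (loc r g) = ∫ x, g x * ψ x := by
  rw [bip_toL2 hψ]
  apply integral_congr_ae
  filter_upwards [coeFn_toL2 (memLp_indicator_ball hg r 2)] with x hx
  rw [loc, hx]
  by_cases h : x ∈ Metric.closedBall (0 : Plane) r
  · rw [Set.indicator_of_mem h]
  · rw [hr x (by simpa using h)]; simp

/-- A test function is differentiable in time as a curve in `L²`. -/
theorem IsTestFunction.hasDerivAt_toL2 {T : ℝ} {ψ : ℝ → Plane → ℂ} (h : IsTestFunction T ψ) (t : ℝ) :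
    HasDerivAt (fun t => toL2 (ψ t)) (toL2 (fun x => _root_.deriv (fun τ => ψ τ x) t)) t := by
  obtain ⟨r, hr⟩ := h.exists_radius
  obtain ⟨r', hr'⟩ := h.deriv.exists_radius
  obtain ⟨C, hC⟩ := ContDiff.lipschitzWith_of_hasCompactSupport h.deriv.compact_support
    h.deriv.smooth (by simp)
  set ρ := max r r'
  set χ : L2C := loc ρ (fun _ => 1) with hχ
  have key : ∀ τ x, ‖ψ τ x - ψ t x - ((τ - t : ℝ) : ℂ) * _root_.deriv (fun τ => ψ τ x) t‖ ≤
      C * |τ - t| * |τ - t| := fun τ x => by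
    have hd : ∀ y ∈ Set.uIcc t τ, HasDerivWithinAt
        (fun y => ψ y x - ((y - t : ℝ) : ℂ) * _root_.deriv (fun τ => ψ τ x) t)
        (_root_.deriv (fun τ => ψ τ x) y - _root_.deriv (fun τ => ψ τ x) t) (Set.uIcc t τ) y :=
      fun y _ => by
        have h1 := (h.hasDerivAt_time y x).differentiableAt.hasDerivAt
        have h2 : HasDerivAt (fun y : ℝ => ((y - t : ℝ) : ℂ)) 1 y := by
          simpa using ((hasDerivAt_id y).sub_const t).ofReal_comp
        have h3 := h1.sub (h2.mul_const (_root_.deriv (fun τ => ψ τ x) t))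
        rw [one_mul] at h3
        exact h3.hasDerivWithinAt
    have := (convex_uIcc t τ).norm_image_sub_le_of_norm_hasDerivWithin_le (C := C * |τ - t|) hd
      (fun y hy => by
        have h1 := hC.dist_le_mul (y, x) (t, x)
        rw [dist_eq_norm, Prod.dist_eq, dist_self, max_eq_left dist_nonneg, Real.dist_eq] at h1
        exact h1.trans (mul_le_mul_of_nonneg_left (Set.abs_sub_left_of_mem_uIcc hy) C.2)) Set.left_mem_uIcc Set.right_mem_uIcc
    rw [Real.norm_eq_abs] at this
    refine le_trans (le_of_eq ?_) this
    congr 1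
    simp; ring
  have hle : ∀ τ, ‖toL2 (ψ τ) - toL2 (ψ t) -
      (τ - t) • toL2 (fun x => _root_.deriv (fun τ => ψ τ x) t)‖ ≤ C * |τ - t| * |τ - t| * ‖χ‖ := by
    intro τ
    apply Lp.norm_le_mul_norm_of_ae_le_mul
    rw [real_smul_eq]
    filter_upwards [coeFn_toL2 ((h.isCc τ).memLp 2), coeFn_toL2 ((h.isCc t).memLp 2),
      coeFn_toL2 ((h.deriv.isCc t).memLp 2),
      coeFn_toL2 (memLp_indicator_ball (g := fun _ => 1) continuous_const ρ 2),
      Lp.coeFn_sub (toL2 (ψ τ) - toL2 (ψ t))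
        (((τ - t : ℝ) : ℂ) • toL2 (fun x => _root_.deriv (fun τ => ψ τ x) t)),
      Lp.coeFn_sub (toL2 (ψ τ)) (toL2 (ψ t)),
      Lp.coeFn_smul ((τ - t : ℝ) : ℂ) (toL2 (fun x => _root_.deriv (fun τ => ψ τ x) t))]
      with x h1 h2 h3 h4 h5 h6 h7
    rw [h5, Pi.sub_apply, h6, Pi.sub_apply, h7, Pi.smul_apply, h1, h2, h3, hχ, loc, h4, smul_eq_mul]
    by_cases hx : x ∈ Metric.closedBall (0 : Plane) ρ
    · rw [Set.indicator_of_mem hx, norm_one, mul_one]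
      exact key τ x
    · have hx' : ρ < ‖x‖ := by simpa using hx
      rw [hr τ x ((le_max_left _ _).trans_lt hx'), hr t x ((le_max_left _ _).trans_lt hx'),
        hr' t x ((le_max_right _ _).trans_lt hx')]
      simp; positivity
  rw [hasDerivAt_iff_isLittleO, Asymptotics.isLittleO_iff]
  intro c hc
  have hev : ∀ᶠ τ in 𝓝 t, |τ - t| ≤ c / (C * ‖χ‖ + 1) := by
    have : Metric.closedBall t (c / (C * ‖χ‖ + 1)) ∈ 𝓝 t :=
      Metric.closedBall_mem_nhds t (by positivity)
    filter_upwards [this] with τ hτ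
    simpa [Real.dist_eq] using hτ
  filter_upwards [hev] with τ hτ
  refine (hle τ).trans ?_
  rw [Real.norm_eq_abs]
  calc _ = (C * ‖χ‖) * |τ - t| * |τ - t| := by ring
    _ ≤ (C * ‖χ‖ + 1) * (c / (C * ‖χ‖ + 1)) * |τ - t| := by gcongr; linarith
    _ = c * |τ - t| := by field_simp

theorem IsTestFunction.continuous_toL2 {T : ℝ} {ψ : ℝ → Plane → ℂ} (h : IsTestFunction T ψ) :
    Continuous (fun t => toL2 (ψ t)) :=
  continuous_iff_continuousAt.2 fun t => (h.hasDerivAt_toL2 t).continuousAt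

/-! ### Real-valued functions -/

theorem coeFn_toComplex (f : L2R) : toComplex f =ᵐ[volume] fun x => ((f x : ℝ) : ℂ) :=
  Complex.ofRealCLM.coeFn_compLp f

theorem continuous_toComplex : Continuous toComplex :=
  (Complex.ofRealCLM.compLpL 2 (volume : Measure Plane)).continuous

theorem toComplex_injective : Function.Injective toComplex := fun f g h => by
  apply Lp.ext
  have h1 : (toComplex f : Plane → ℂ) = toComplex g := by rw [h]
  filter_upwards [coeFn_toComplex f, coeFn_toComplex g] with x hf hg
  rw [h1, hg] at hf
  exact (Complex.ofReal_injective hf).symm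

/-- The real part, as a real-valued function. -/
noncomputable def reL : L2C →L[ℝ] L2R := Complex.reCLM.compLpL 2 (volume : Measure Plane)

theorem coeFn_reL (f : L2C) : reL f =ᵐ[volume] fun x => (f x).re := Complex.reCLM.coeFn_compLp f

theorem conjL_toComplex (f : L2R) : conjL (toComplex f) = toComplex f := by
  apply Lp.ext
  filter_upwards [coeFn_conjL (toComplex f), coeFn_toComplex f] with x h1 h2
  rw [h1, h2, Complex.conj_ofReal]

theorem toComplex_reL {f : L2C} (h : conjL f = f) : toComplex (reL f) = f := by
  apply Lp.ext
  have h0 : (conjL f : Plane → ℂ) = f := by rw [h]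
  filter_upwards [coeFn_conjL f, coeFn_toComplex (reL f), coeFn_reL f] with x h1 h2 h3
  rw [h2, h3]
  rw [h0] at h1
  exact Complex.conj_eq_iff_re.1 h1.symm

/-! ### Essentially bounded curves -/

/-- Membership of the curve `x` in `L^∞([0,T]; E)`. -/
structure EssBdd {E : Type*} [NormedAddCommGroup E] (T : ℝ) (x : ℝ → E) : Prop where
  meas : AEStronglyMeasurable x (volume.restrict (Set.Icc 0 T))
  bdd : ∃ R, ∀ᵐ t ∂(volume.restrict (Set.Icc 0 T)), ‖x t‖ ≤ R

theorem BallLip.continuous {E F : Type*} [NormedAddCommGroup E] [NormedAddCommGroup F] {f : E → F}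
    (h : BallLip f) : Continuous f := by
  refine continuous_iff_continuousAt.2 fun x => ?_
  obtain ⟨K, hK, hf⟩ := h (‖x‖ + 1)
  have hev : ∀ᶠ y in 𝓝 x, ‖f y - f x‖ ≤ K * ‖y - x‖ := by
    filter_upwards [Metric.ball_mem_nhds x one_pos] with y hy
    refine hf y x ?_ (by linarith)
    have : ‖y - x‖ < 1 := by rwa [← dist_eq_norm]
    linarith [norm_le_norm_add_norm_sub' y x]
  have h0 : Tendsto (fun y => K * ‖y - x‖) (𝓝 x) (𝓝 0) := by
    have : Continuous fun y => K * ‖y - x‖ := by fun_prop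
    simpa using this.tendsto x
  exact tendsto_iff_norm_sub_tendsto_zero.2
    (squeeze_zero' (Eventually.of_forall fun _ => norm_nonneg _) hev h0)

section EssBdd

variable {E F : Type*} [NormedAddCommGroup E] [NormedAddCommGroup F] {T : ℝ}

theorem EssBdd.comp {x : ℝ → E} (h : EssBdd T x) {f : E → F} (hf : BallLip f) :
    EssBdd T (fun t => f (x t)) := by
  obtain ⟨R, hR⟩ := h.bdd
  obtain ⟨B, -, hB⟩ := hf.bdd R
  exact ⟨hf.continuous.comp_aestronglyMeasurable h.meas, B, hR.mono fun t ht => hB _ ht⟩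

theorem EssBdd.prodMk {x : ℝ → E} {y : ℝ → F} (hx : EssBdd T x) (hy : EssBdd T y) :
    EssBdd T (fun t => (x t, y t)) := by
  obtain ⟨R, hR⟩ := hx.bdd
  obtain ⟨R', hR'⟩ := hy.bdd
  refine ⟨hx.meas.prodMk hy.meas, max R R', ?_⟩
  filter_upwards [hR, hR'] with t h1 h2
  exact max_le_max h1 h2

theorem EssBdd.of_continuousOn {x : ℝ → E} (h : ContinuousOn x (Set.Icc 0 T)) : EssBdd T x := by
  obtain ⟨R, hR⟩ := isCompact_Icc.exists_bound_of_continuousOn h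
  exact ⟨h.aestronglyMeasurable_of_isCompact isCompact_Icc measurableSet_Icc, R,
    (ae_restrict_iff' measurableSet_Icc).2 (Eventually.of_forall hR)⟩

theorem EssBdd.integrable {x : ℝ → E} (h : EssBdd T x) :
    Integrable x (volume.restrict (Set.Icc 0 T)) := by
  obtain ⟨R, hR⟩ := h.bdd
  exact Integrable.of_bound h.meas R hR

end EssBdd

theorem EssBdd.bip {T : ℝ} {φ x : ℝ → L2C} (hφ : Continuous φ) (hx : EssBdd T x) :
    EssBdd T (fun t => bip (φ t) (x t)) := by
  obtain ⟨R, hR⟩ := hx.bdd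
  obtain ⟨C, hC⟩ := (EssBdd.of_continuousOn (T := T) hφ.continuousOn).bdd
  refine ⟨continuous_bip.comp_aestronglyMeasurable (hφ.aestronglyMeasurable.prodMk hx.meas),
    C * R, ?_⟩
  filter_upwards [hR, hC] with t h1 h2
  refine (norm_inner_le_norm _ _).trans ?_
  rw [norm_conjL]
  exact mul_le_mul h2 h1 (norm_nonneg _) ((norm_nonneg _).trans h2)

/-- The fundamental theorem of calculus on `[0,T]`. -/
theorem setIntegral_deriv_eq {E : Type*} [NormedAddCommGroup E] [NormedSpace ℝ E] [CompleteSpace E]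
    {T : ℝ} (hT : 0 ≤ T) {G G' : ℝ → E} (hG : ∀ t ∈ Set.Icc 0 T, HasDerivWithinAt G (G' t) (Set.Icc 0 T) t)
    (hG' : ContinuousOn G' (Set.Icc 0 T)) : ∫ t in Set.Icc 0 T, G' t = G T - G 0 := by
  rw [integral_Icc_eq_integral_Ioc, ← intervalIntegral.integral_of_le hT]
  refine intervalIntegral.integral_eq_sub_of_hasDerivAt_of_le hT
    (fun t ht => (hG t ht).continuousWithinAt) (fun t ht => ?_) ?_
  · exact (hG t (Set.Ioo_subset_Icc_self ht)).hasDerivAt (Icc_mem_nhds ht.1 ht.2)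
  · exact (by simpa [Set.uIcc_of_le hT] using hG' : ContinuousOn G' (Set.uIcc 0 T)).intervalIntegrable

/-! ### The weak Schrödinger equation -/

/-- The right-hand side of the equation for `u_t`, in terms of `u` and `n`. -/
noncomputable def sf (a N : L2C) : L2C :=
  Complex.I • (lapU a - uu a - mul (ww a) N + mul Qinf (mul Qinf (uu a)))

theorem ballLip_nonlin : BallLip (fun x : L2C × L2C =>
    mul (ww x.1) x.2 - mul Qinf (mul Qinf (uu x.1))) :=
  ((ballLip_ww ballLip_fst).mul ballLip_snd).sub
    (((ballLip_uu ballLip_fst).clm (mul Qinf)).clm (mul Qinf))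

theorem ballLip_lapU {E : Type*} [NormedAddCommGroup E] {a : E → L2C} (ha : BallLip a) :
    BallLip (fun x => lapU (a x)) :=
  ((ballLip_uu ha).sub ha).smul _

theorem sf_eq (a N : L2C) : sf a N = Complex.I • (lapU a - uu a -
    (mul (ww a) N - mul Qinf (mul Qinf (uu a)))) := by
  rw [sf]; congr 1; abel

theorem ballLip_sf : BallLip (fun x : L2C × L2C => sf x.1 x.2) := by
  simp only [sf_eq]
  exact (((ballLip_lapU ballLip_fst).sub (ballLip_uu ballLip_fst)).sub ballLip_nonlin).smul _

theorem continuousOn_sf {S : Set ℝ} {a N : ℝ → L2C} (ha : ContinuousOn a S) (hN : ContinuousOn N S) :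
    ContinuousOn (fun t => sf (a t) (N t)) S := by
  have h1 : ContinuousOn (fun t => (a t, N t)) S := ContinuousOn.prodMk ha hN
  exact (ballLip_sf.continuous.comp_continuousOn h1).congr fun t _ => rfl

theorem sf_nn (a b : L2C) : sf a (nn a b) = fu a b := by
  rw [sf, nn, fu, fu0, map_sub, ← smul_sub, ← smul_add]; congr 1; abel

theorem integrable_mul_isCc {g ψ : Plane → ℂ} (hg : Continuous g) (hψ : IsCc ψ) :
    Integrable (fun x => g x * ψ x) volume :=
  (hg.mul hψ.smooth.continuous).integrable_of_hasCompactSupport hψ.compact.mul_left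

theorem integrable_coeFn_mul_isCc (u : L2C) {ψ : Plane → ℂ} (hψ : IsCc ψ) :
    Integrable (fun x => u x * ψ x) volume :=
  (Lp.memLp u).integrable_mul (hψ.memLp 2)

theorem continuous_cQ : Continuous fun x => (lineSoliton x : ℂ) :=
  Complex.continuous_ofReal.comp continuous_lineSoliton

theorem integral_add_soliton (u : L2C) {g ψ : Plane → ℂ} (hg : Continuous g) (hψ : IsCc ψ) :
    ∫ x, (u x + g x) * ψ x = bip (toL2 ψ) u + ∫ x, g x * ψ x := by
  rw [bip_toL2 (hψ.memLp 2), ← integral_add (integrable_coeFn_mul_isCc u hψ)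
    (integrable_mul_isCc hg hψ)]
  simp only [add_mul]

/-- The integral on the right of the weak Schrödinger equation, separated from the term `Q³` that
only involves the soliton. -/
theorem integral_nonlin (a : L2C) (n : L2R) {ψ : Plane → ℂ} (hψ : IsCc ψ) :
    ∫ x, ((n x - lineSoliton x ^ 2 : ℝ) : ℂ) * (uu a x + (lineSoliton x : ℂ)) * ψ x =
      bip (toL2 ψ) (mul (ww a) (toComplex n) - mul Qinf (mul Qinf (uu a))) -
        ∫ x, ((lineSoliton x ^ 3 : ℝ) : ℂ) * ψ x := by
  have hc : Continuous fun x : Plane => ((lineSoliton x ^ 3 : ℝ) : ℂ) :=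
    Complex.continuous_ofReal.comp (continuous_lineSoliton.pow 3)
  rw [bip_toL2 (hψ.memLp 2), ← integral_sub (integrable_coeFn_mul_isCc _ hψ)
    (integrable_mul_isCc hc hψ)]
  apply integral_congr_ae
  filter_upwards [Lp.coeFn_sub (mul (ww a) (toComplex n)) (mul Qinf (mul Qinf (uu a))),
    coeFn_mul (ww a) (toComplex n), coeFn_mul Qinf (mul Qinf (uu a)), coeFn_mul Qinf (uu a),
    coeFn_toComplex n, coeFn_Qinf, Lp.coeFn_add (emb a) Qinf, coeFn_emb a]
    with x h1 h2 h3 h4 h5 h6 h7 h8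
  rw [h1, Pi.sub_apply, h2, h3, h4, h5, ww, h7, Pi.add_apply, h8, h6]
  simp only [uu]
  push_cast
  ring

theorem IsTestFunction.hasDerivAt_integral {T : ℝ} {ψ : ℝ → Plane → ℂ} (h : IsTestFunction T ψ)
    {g : Plane → ℂ} (hg : Continuous g) (t : ℝ) :
    HasDerivAt (fun t => ∫ x, g x * ψ t x) (∫ x, g x * _root_.deriv (fun τ => ψ τ x) t) t := by
  obtain ⟨r, hr⟩ := h.exists_radius
  obtain ⟨r', hr'⟩ := h.deriv.exists_radius
  have h1 := HasDerivWithinAt.bip (h.hasDerivAt_toL2 t).hasDerivWithinAt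
    (hasDerivWithinAt_const t Set.univ (loc (max r r') g))
  rw [hasDerivWithinAt_univ] at h1
  have e1 : ∀ t, bip (toL2 (ψ t)) (loc (max r r') g) = ∫ x, g x * ψ t x := fun t =>
    bip_loc hg ((h.isCc t).memLp 2) fun x hx => hr t x ((le_max_left _ _).trans_lt hx)
  have e2 : bip (toL2 (fun x => _root_.deriv (fun τ => ψ τ x) t)) (loc (max r r') g) =
      ∫ x, g x * _root_.deriv (fun τ => ψ τ x) t :=
    bip_loc hg ((h.deriv.isCc t).memLp 2) fun x hx => hr' t x ((le_max_right _ _).trans_lt hx)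
  simp only [e1, e2] at h1
  refine h1.congr_deriv ?_
  rw [bip, inner_zero_right, add_zero]

theorem IsTestFunction.continuous_integral {T : ℝ} {ψ : ℝ → Plane → ℂ} (h : IsTestFunction T ψ)
    {g : Plane → ℂ} (hg : Continuous g) : Continuous fun t => ∫ x, g x * ψ t x :=
  continuous_iff_continuousAt.2 fun t => (h.hasDerivAt_integral hg t).continuousAt

theorem IsTestFunction.setIntegral_deriv {T : ℝ} (hT : 0 ≤ T) {ψ : ℝ → Plane → ℂ}
    (h : IsTestFunction T ψ) {g : Plane → ℂ} (hg : Continuous g) :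
    ∫ t in Set.Icc 0 T, ∫ x, g x * _root_.deriv (fun τ => ψ τ x) t = -∫ x, g x * ψ 0 x := by
  rw [setIntegral_deriv_eq hT (fun t _ => (h.hasDerivAt_integral hg t).hasDerivWithinAt)
    (h.deriv.continuous_integral hg).continuousOn]
  simp [h.eq_zero le_rfl]

/-- The weak Schrödinger equation without the terms that only involve the soliton: these cancel,
because the soliton is a stationary solution. -/
theorem schrodinger_iff {T : ℝ} (hT : 0 ≤ T) {u₀ : L2C} {u a : ℝ → L2C} {n : ℝ → L2R}
    (ha : EssBdd T a) (hn : EssBdd T (fun t => toComplex (n t)))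
    (hu : ∀ᵐ t ∂(volume.restrict (Set.Icc 0 T)), u t = uu (a t))
    {ψ : ℝ → Plane → ℂ} (h : IsTestFunction T ψ) :
    (-Complex.I * (∫ x, (u₀ x + (lineSoliton x : ℂ)) * ψ 0 x) +
      (∫ t in Set.Icc 0 T, ∫ x, (u t x + (lineSoliton x : ℂ)) *
        (-Complex.I * deriv (fun τ => ψ τ x) t - ψ t x + Δ (ψ t) x)) =
    ∫ t in Set.Icc 0 T, ∫ x,
      ((n t x - lineSoliton x ^ 2 : ℝ) : ℂ) * (u t x + (lineSoliton x : ℂ)) * ψ t x) ↔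
    bip (toL2 (ψ 0)) u₀ + ∫ t in Set.Icc 0 T,
      (bip (toL2 (fun x => deriv (fun τ => ψ τ x) t)) (uu (a t)) +
        bip (toL2 (ψ t)) (sf (a t) (toComplex (n t)))) = 0 := by
  set cQ3 : Plane → ℂ := fun x => ((lineSoliton x ^ 3 : ℝ) : ℂ) with hcQ3
  have hc3 : Continuous cQ3 := Complex.continuous_ofReal.comp (continuous_lineSoliton.pow 3)
  have hcQ := continuous_cQ
  set μ := (volume : Measure ℝ).restrict (Set.Icc 0 T)
  set A : ℝ → ℂ := fun t => bip (toL2 (fun x => deriv (fun τ => ψ τ x) t)) (uu (a t)) +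
    bip (toL2 (ψ t)) (sf (a t) (toComplex (n t)))
  set B : ℝ → ℂ := fun t => bip (toL2 (ψ t))
    (mul (ww (a t)) (toComplex (n t)) - mul Qinf (mul Qinf (uu (a t))))
  have iA : Integrable A μ :=
    ((ha.comp (ballLip_uu fun R => ⟨1, zero_le_one, fun x y _ _ => (one_mul _).ge⟩)).bip
      h.deriv.continuous_toL2).integrable.add
      (((ha.prodMk hn).comp ballLip_sf).bip h.continuous_toL2).integrable
  have iB : Integrable B μ := (((ha.prodMk hn).comp ballLip_nonlin).bip h.continuous_toL2).integrable
  have i3 : Integrable (fun t => ∫ x, cQ3 x * ψ t x) μ :=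
    (EssBdd.of_continuousOn (h.continuous_integral hc3).continuousOn).integrable
  have iq : Integrable (fun t => ∫ x, (lineSoliton x : ℂ) * deriv (fun τ => ψ τ x) t) μ :=
    (EssBdd.of_continuousOn (h.deriv.continuous_integral hcQ).continuousOn).integrable
  have eR : ∫ t in Set.Icc 0 T, ∫ x, ((n t x - lineSoliton x ^ 2 : ℝ) : ℂ) *
      (u t x + (lineSoliton x : ℂ)) * ψ t x = ∫ t in Set.Icc 0 T, (B t - ∫ x, cQ3 x * ψ t x) := by
    apply integral_congr_ae
    filter_upwards [hu] with t ht
    rw [ht]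
    exact integral_nonlin (a t) (n t) (h.isCc t)
  have hΨ : ∀ t, IsCc (fun x => -Complex.I * deriv (fun τ => ψ τ x) t - ψ t x + Δ (ψ t) x) :=
    fun t => ⟨((contDiff_const.mul (h.deriv.isCc t).smooth).sub (h.isCc t).smooth).add
      (h.isCc t).laplacian.smooth,
      ((h.deriv.isCc t).compact.mul_left.sub (h.isCc t).compact).add (h.isCc t).laplacian.compact⟩
  have pw : ∀ t, ∫ x, (uu (a t) x + (lineSoliton x : ℂ)) *
      (-Complex.I * deriv (fun τ => ψ τ x) t - ψ t x + Δ (ψ t) x) =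
      (B t - ∫ x, cQ3 x * ψ t x) +
        -Complex.I * (A t + ∫ x, (lineSoliton x : ℂ) * deriv (fun τ => ψ τ x) t) := fun t => by
    have hd := h.deriv.isCc t
    have hψ := h.isCc t
    have e1 : toL2 (fun x => -Complex.I * deriv (fun τ => ψ τ x) t - ψ t x + Δ (ψ t) x) =
        -Complex.I • toL2 (fun x => deriv (fun τ => ψ τ x) t) + (-1 : ℂ) • toL2 (ψ t) +
          toL2 (Δ (ψ t)) := by
      have m1 : MemLp (fun x => -Complex.I * deriv (fun τ => ψ τ x) t + -1 * ψ t x) 2 volume :=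
        ((hd.memLp 2).const_mul _).add ((hψ.memLp 2).const_mul _)
      rw [← toL2_smul _ (hd.memLp 2), ← toL2_smul _ (hψ.memLp 2), ← toL2_add ((hd.memLp 2).const_mul _)
        ((hψ.memLp 2).const_mul _), ← toL2_add m1 (hψ.laplacian.memLp 2)]
      congr 1; ext x; ring
    have e2 : ∫ x, (lineSoliton x : ℂ) *
        (-Complex.I * deriv (fun τ => ψ τ x) t - ψ t x + Δ (ψ t) x) =
        -Complex.I * (∫ x, (lineSoliton x : ℂ) * deriv (fun τ => ψ τ x) t) -
          ∫ x, cQ3 x * ψ t x := by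
      have j1 := (integrable_mul_isCc hcQ hd).const_mul (-Complex.I)
      have j2 := integrable_mul_isCc hcQ hψ
      have j3 := integrable_mul_isCc hcQ hψ.laplacian
      have j4 := integrable_mul_isCc hc3 hψ
      have e : ∀ x, (lineSoliton x : ℂ) * (-Complex.I * deriv (fun τ => ψ τ x) t - ψ t x + Δ (ψ t) x) =
          (-Complex.I * ((lineSoliton x : ℂ) * deriv (fun τ => ψ τ x) t) -
            (lineSoliton x : ℂ) * ψ t x) + (lineSoliton x : ℂ) * Δ (ψ t) x := fun x => by ring
      have e' : ∀ x, ((lineSoliton x - lineSoliton x ^ 3 : ℝ) : ℂ) * ψ t x =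
          (lineSoliton x : ℂ) * ψ t x - cQ3 x * ψ t x := fun x => by
        simp only [hcQ3]; push_cast; ring
      have j12 : Integrable (fun x => -Complex.I * ((lineSoliton x : ℂ) * deriv (fun τ => ψ τ x) t) -
        (lineSoliton x : ℂ) * ψ t x) volume := j1.sub j2
      simp_rw [e]
      rw [integral_add j12 j3, integral_sub j1 j2, integral_lineSoliton_laplacian hψ,
        integral_const_mul]
      simp_rw [e']
      rw [integral_sub j2 j4]
      ring
    rw [integral_add_soliton _ hcQ (hΨ t), e1, e2, bip_add_left, bip_add_left, bip_smul_left,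
      bip_smul_left, hψ.bip_laplacian]
    simp only [A, B, sf_eq, bip_smul_right, bip_sub_right]
    linear_combination (-(bip (toL2 (ψ t)) (lapU (a t))) + bip (toL2 (ψ t)) (uu (a t)) +
      bip (toL2 (ψ t)) (mul (ww (a t)) (toComplex (n t))) -
      bip (toL2 (ψ t)) (mul Qinf (mul Qinf (uu (a t))))) * (-Complex.I_mul_I)
  have eL : ∫ t in Set.Icc 0 T, ∫ x, (u t x + (lineSoliton x : ℂ)) *
      (-Complex.I * deriv (fun τ => ψ τ x) t - ψ t x + Δ (ψ t) x) =
      (∫ t in Set.Icc 0 T, (B t - ∫ x, cQ3 x * ψ t x)) +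
        -Complex.I * ((∫ t in Set.Icc 0 T, A t) - ∫ x, (lineSoliton x : ℂ) * ψ 0 x) := by
    have k1 : Integrable (fun t => B t - ∫ x, cQ3 x * ψ t x) μ := iB.sub i3
    have k2 : Integrable (fun t => A t + ∫ x, (lineSoliton x : ℂ) * deriv (fun τ => ψ τ x) t) μ :=
      iA.add iq
    rw [sub_eq_add_neg, ← h.setIntegral_deriv hT hcQ, ← integral_add iA iq, ← integral_const_mul,
      ← integral_add k1 (k2.const_mul _)]
    apply integral_congr_ae
    filter_upwards [hu] with t ht
    rw [ht]
    exact pw t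
  rw [eR, eL, integral_add_soliton _ hcQ (h.isCc 0)]
  constructor
  · intro hh
    have : Complex.I * (bip (toL2 (ψ 0)) u₀ + ∫ t in Set.Icc 0 T, A t) = 0 := by
      linear_combination -hh
    exact (mul_eq_zero.1 this).resolve_left Complex.I_ne_zero
  · intro hh
    linear_combination -Complex.I * hh

/-! ### The weak wave equation -/

theorem pd_ofReal {φ : Plane → ℝ} (h : Differentiable ℝ φ) (j : Fin 2) :
    pd j (fun x => (φ x : ℂ)) = fun x => ((pd j φ x : ℝ) : ℂ) := by
  ext x
  have := (Complex.ofRealCLM.hasFDerivAt (x := φ x)).comp x (h x).hasFDerivAt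
  rw [pd, pd]
  exact congrArg (fun L : Plane →L[ℝ] ℂ => L (EuclideanSpace.single j (1 : ℝ))) this.fderiv

theorem IsCc.ofReal {φ : Plane → ℝ} (h : IsCc φ) : IsCc (fun x => (φ x : ℂ)) :=
  ⟨Complex.ofRealCLM.contDiff.comp h.smooth, h.compact.comp_left Complex.ofReal_zero⟩

theorem laplacian_ofReal {φ : Plane → ℝ} (h : IsCc φ) :
    Δ (fun x => (φ x : ℂ)) = fun x => ((Δ φ x : ℝ) : ℂ) := by
  ext x
  rw [laplacian_eq_pd (contDiff_infty.1 h.ofReal.smooth 2), laplacian_eq_pd (contDiff_infty.1 h.smooth 2),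
    pd_ofReal (h.smooth.differentiable (by simp)), pd_ofReal (h.smooth.differentiable (by simp)),
    pd_ofReal ((h.pd 0).smooth.differentiable (by simp)),
    pd_ofReal ((h.pd 1).smooth.differentiable (by simp))]
  push_cast; rfl

theorem IsTestFunction.ofReal {T : ℝ} {ψ : ℝ → Plane → ℝ} (h : IsTestFunction T ψ) :
    IsTestFunction T (fun t x => (ψ t x : ℂ)) := h.comp_clm Complex.ofRealCLM

theorem IsTestFunction.deriv_ofReal {T : ℝ} {ψ : ℝ → Plane → ℝ} (h : IsTestFunction T ψ) (t : ℝ)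
    (x : Plane) : _root_.deriv (fun τ => (ψ τ x : ℂ)) t = ((_root_.deriv (fun τ => ψ τ x) t : ℝ) : ℂ) :=
  (h.hasDerivAt_time t x).differentiableAt.hasDerivAt.ofReal_comp.deriv

theorem continuous_cQ2 : Continuous fun x => ((lineSoliton x ^ 2 : ℝ) : ℂ) :=
  Complex.continuous_ofReal.comp (continuous_lineSoliton.pow 2)

theorem integral_toComplex_mul (n : L2R) {φ : Plane → ℝ} (h : IsCc φ) :
    ((∫ x, n x * φ x : ℝ) : ℂ) = bip (toL2 (fun x => (φ x : ℂ))) (toComplex n) := by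
  rw [bip_toL2 (h.ofReal.memLp 2), ← integral_complex_ofReal]
  apply integral_congr_ae
  filter_upwards [coeFn_toComplex n] with x hx
  rw [hx]; push_cast; rfl

theorem integral_sub_soliton_sq (n : L2R) {φ : Plane → ℝ} (h : IsCc φ) :
    ((∫ x, (n x - lineSoliton x ^ 2) * φ x : ℝ) : ℂ) =
      bip (toL2 (fun x => (φ x : ℂ))) (toComplex n) - ∫ x, ((lineSoliton x ^ 2 : ℝ) : ℂ) * (φ x : ℂ) := by
  rw [bip_toL2 (h.ofReal.memLp 2), ← integral_complex_ofReal,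
    ← integral_sub (integrable_coeFn_mul_isCc _ h.ofReal) (integrable_mul_isCc continuous_cQ2 h.ofReal)]
  apply integral_congr_ae
  filter_upwards [coeFn_toComplex n] with x hx
  rw [hx]; push_cast; ring

/-- The integral of `|u + Q|²`, separated from the term that only involves the soliton. -/
theorem integral_norm_sq_mul (a : L2C) {φ : Plane → ℝ} (h : IsCc φ) :
    ((∫ x, ‖uu a x + (lineSoliton x : ℂ)‖ ^ 2 * φ x : ℝ) : ℂ) =
      bip (toL2 (fun x => (φ x : ℂ))) (rho a) + ∫ x, ((lineSoliton x ^ 2 : ℝ) : ℂ) * (φ x : ℂ) := by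
  rw [bip_toL2 (h.ofReal.memLp 2), ← integral_complex_ofReal,
    ← integral_add (integrable_coeFn_mul_isCc _ h.ofReal) (integrable_mul_isCc continuous_cQ2 h.ofReal)]
  apply integral_congr_ae
  rw [rho]
  filter_upwards [Lp.coeFn_add (mul (emb a) (conjL (uu a))) (mul Qinf (uu a + conjL (uu a))),
    coeFn_mul (emb a) (conjL (uu a)), coeFn_mul Qinf (uu a + conjL (uu a)),
    Lp.coeFn_add (uu a) (conjL (uu a)), coeFn_conjL (uu a), coeFn_Qinf, coeFn_emb a]
    with x h1 h2 h3 h4 h5 h6 h7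
  rw [h1, Pi.add_apply, h2, h3, h4, Pi.add_apply, h5, h6, h7]
  change _ = (uu a x * _ + _) * _ + _
  have : ((‖uu a x + (lineSoliton x : ℂ)‖ ^ 2 : ℝ) : ℂ) =
      (uu a x + (lineSoliton x : ℂ)) * conj (uu a x + (lineSoliton x : ℂ)) := by
    rw [Complex.mul_conj, Complex.normSq_eq_norm_sq]
  rw [Complex.ofReal_mul, this, map_add, Complex.conj_ofReal]
  push_cast
  ring

/-- The weak wave equation without the terms that only involve the soliton. -/
theorem wave_iff {lam T : ℝ} (hl : 0 < lam) (hT : 0 ≤ T) {n₀ n₁ : L2R} {f₀ : Fin 2 → L2R}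
    (hdiv : IsWeakDivergence n₁ f₀) {u a : ℝ → L2C} {n : ℝ → L2R}
    (ha : EssBdd T a) (hn : EssBdd T (fun t => toComplex (n t)))
    (hu : ∀ᵐ t ∂(volume.restrict (Set.Icc 0 T)), u t = uu (a t))
    {ψ : ℝ → Plane → ℝ} (h : IsTestFunction T ψ) :
    ((1 / lam ^ 2) *
        ((∑ j, ∫ x, f₀ j x * partialDeriv j (ψ 0) x) +
          (∫ x, (n₀ x - lineSoliton x ^ 2) * deriv (fun τ => ψ τ x) 0) +
          (∫ t in Set.Icc 0 T, ∫ x,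
            (n t x - lineSoliton x ^ 2) * iteratedDeriv 2 (fun τ => ψ τ x) t)) -
      (∫ t in Set.Icc 0 T, ∫ x, (n t x - lineSoliton x ^ 2) * Δ (ψ t) x) =
    ∫ t in Set.Icc 0 T, ∫ x, ‖u t x + (lineSoliton x : ℂ)‖ ^ 2 * Δ (ψ t) x) ↔
    bip (toL2 (fun x => ((deriv (fun τ => ψ τ x) 0 : ℝ) : ℂ))) (toComplex n₀) -
      bip (toL2 (fun x => (ψ 0 x : ℂ))) (toComplex n₁) +
      ∫ t in Set.Icc 0 T,
        (bip (toL2 (fun x => ((deriv (fun σ => deriv (fun τ => ψ τ x) σ) t : ℝ) : ℂ)))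
            (toComplex (n t)) -
          ((lam ^ 2 : ℝ) : ℂ) * bip (toL2 (Δ fun x => (ψ t x : ℂ)))
            (toComplex (n t) + rho (a t))) = 0 := by
  set μ := (volume : Measure ℝ).restrict (Set.Icc 0 T)
  have hΔ : IsTestFunction T (fun t => Δ (ψ t)) := h.laplacian
  set N : ℝ → L2C := fun t => toComplex (n t)
  set q2 : (Plane → ℝ) → ℂ := fun φ => ∫ x, ((lineSoliton x ^ 2 : ℝ) : ℂ) * (φ x : ℂ) with hq2
  have hrho : EssBdd T (fun t => rho (a t)) :=
    ha.comp (ballLip_rho fun R => ⟨1, zero_le_one, fun x y _ _ => (one_mul _).ge⟩)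
  have i1 := (hn.bip h.deriv.deriv.ofReal.continuous_toL2).integrable
  have i2 := (hn.bip hΔ.ofReal.continuous_toL2).integrable
  have i3 := (hrho.bip hΔ.ofReal.continuous_toL2).integrable
  have j1 : Integrable (fun t => q2 fun x => deriv (fun σ => deriv (fun τ => ψ τ x) σ) t) μ :=
    (EssBdd.of_continuousOn (h.deriv.deriv.ofReal.continuous_integral continuous_cQ2).continuousOn).integrable
  have j2 : Integrable (fun t => q2 (Δ (ψ t))) μ :=
    (EssBdd.of_continuousOn (hΔ.ofReal.continuous_integral continuous_cQ2).continuousOn).integrable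
  have e1 : ((∑ j, ∫ x, f₀ j x * partialDeriv j (ψ 0) x : ℝ) : ℂ) =
      -bip (toL2 (fun x => (ψ 0 x : ℂ))) (toComplex n₁) := by
    rw [← integral_toComplex_mul _ (h.isCc 0), hdiv (ψ 0) (h.isCc 0).smooth (h.isCc 0).compact]
    push_cast; ring
  have e2 := integral_sub_soliton_sq n₀ (h.deriv.isCc 0)
  have e3 : ((∫ t in Set.Icc 0 T, ∫ x,
      (n t x - lineSoliton x ^ 2) * iteratedDeriv 2 (fun τ => ψ τ x) t : ℝ) : ℂ) =
      (∫ t in Set.Icc 0 T, bip (toL2 (fun x => ((deriv (fun σ => deriv (fun τ => ψ τ x) σ) t : ℝ) : ℂ)))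
        (N t)) + q2 (fun x => deriv (fun τ => ψ τ x) 0) := by
    have := h.deriv.ofReal.setIntegral_deriv hT continuous_cQ2
    simp only [h.deriv.deriv_ofReal] at this
    rw [← sub_neg_eq_add, ← this, ← integral_sub i1 j1, ← integral_complex_ofReal]
    refine integral_congr_ae (Eventually.of_forall fun t => ?_)
    simp only [iteratedDeriv_succ, iteratedDeriv_zero]
    exact integral_sub_soliton_sq (n t) (h.deriv.deriv.isCc t)
  have e4 : ((∫ t in Set.Icc 0 T, ∫ x, (n t x - lineSoliton x ^ 2) * Δ (ψ t) x : ℝ) : ℂ) =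
      (∫ t in Set.Icc 0 T, bip (toL2 (fun x => ((Δ (ψ t) x : ℝ) : ℂ))) (N t)) -
        ∫ t in Set.Icc 0 T, q2 (Δ (ψ t)) := by
    rw [← integral_sub i2 j2, ← integral_complex_ofReal]
    exact integral_congr_ae (Eventually.of_forall fun t =>
      integral_sub_soliton_sq (n t) (hΔ.isCc t))
  have e5 : ((∫ t in Set.Icc 0 T, ∫ x, ‖u t x + (lineSoliton x : ℂ)‖ ^ 2 * Δ (ψ t) x : ℝ) : ℂ) =
      (∫ t in Set.Icc 0 T, bip (toL2 (fun x => ((Δ (ψ t) x : ℝ) : ℂ))) (rho (a t))) +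
        ∫ t in Set.Icc 0 T, q2 (Δ (ψ t)) := by
    rw [← integral_add i3 j2, ← integral_complex_ofReal]
    apply integral_congr_ae
    filter_upwards [hu] with t ht
    rw [ht]
    exact integral_norm_sq_mul (a t) (hΔ.isCc t)
  have e6 : ∫ t in Set.Icc 0 T,
      (bip (toL2 (fun x => ((deriv (fun σ => deriv (fun τ => ψ τ x) σ) t : ℝ) : ℂ))) (N t) -
        ((lam ^ 2 : ℝ) : ℂ) * bip (toL2 (Δ fun x => (ψ t x : ℂ))) (N t + rho (a t))) =
      (∫ t in Set.Icc 0 T,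
        bip (toL2 (fun x => ((deriv (fun σ => deriv (fun τ => ψ τ x) σ) t : ℝ) : ℂ))) (N t)) -
      ((lam ^ 2 : ℝ) : ℂ) * ((∫ t in Set.Icc 0 T, bip (toL2 (fun x => ((Δ (ψ t) x : ℝ) : ℂ))) (N t)) +
        ∫ t in Set.Icc 0 T, bip (toL2 (fun x => ((Δ (ψ t) x : ℝ) : ℂ))) (rho (a t))) := by
    have i23 : Integrable (fun t => bip (toL2 (fun x => ((Δ (ψ t) x : ℝ) : ℂ))) (N t) +
      bip (toL2 (fun x => ((Δ (ψ t) x : ℝ) : ℂ))) (rho (a t))) μ := i2.add i3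
    rw [← integral_add i2 i3, ← integral_const_mul, ← integral_sub i1 (i23.const_mul _)]
    refine integral_congr_ae (Eventually.of_forall fun t => ?_)
    simp only [laplacian_ofReal (h.isCc t), bip_add_right]
  rw [e6, ← Complex.ofReal_inj, Complex.ofReal_sub, Complex.ofReal_mul, Complex.ofReal_add,
    Complex.ofReal_add, e1, e2, e3, e4, e5]
  have hl2 : ((lam ^ 2 : ℝ) : ℂ) ≠ 0 := by exact_mod_cast (pow_pos hl 2).ne'
  have hl3 : ((1 / lam ^ 2 : ℝ) : ℂ) * ((lam ^ 2 : ℝ) : ℂ) = 1 := by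
    rw [← Complex.ofReal_mul, one_div, inv_mul_cancel₀ (pow_pos hl 2).ne', Complex.ofReal_one]
  generalize ((1 / lam ^ 2 : ℝ) : ℂ) = l at hl3 ⊢
  generalize ((lam ^ 2 : ℝ) : ℂ) = L at hl2 hl3 ⊢
  have hl0 : l ≠ 0 := left_ne_zero_of_mul_eq_one hl3
  constructor
  · intro hh
    refine (mul_eq_zero.1 (?_ : l * _ = 0)).resolve_left hl0
    linear_combination hh - ((∫ t in Set.Icc 0 T, bip (toL2 (fun x => ((Δ (ψ t) x : ℝ) : ℂ))) (N t)) +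
        ∫ t in Set.Icc 0 T, bip (toL2 (fun x => ((Δ (ψ t) x : ℝ) : ℂ))) (rho (a t))) * hl3
  · intro hh
    linear_combination l * hh + ((∫ t in Set.Icc 0 T, bip (toL2 (fun x => ((Δ (ψ t) x : ℝ) : ℂ))) (N t)) +
        ∫ t in Set.Icc 0 T, bip (toL2 (fun x => ((Δ (ψ t) x : ℝ) : ℂ))) (rho (a t))) * hl3

theorem conjL_smul_absD_imC (lam : ℝ) (b : L2C) :
    conjL ((lam : ℂ) • absD (imC b)) = (lam : ℂ) • absD (imC b) := by
  rw [conjL_smul, Complex.conj_ofReal, absD, ← D_conjL bddSym_absSym absSym_neg_arg, conjL_imC]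

theorem IsTestFunction.bip_eq_zero {T : ℝ} {ψ : ℝ → Plane → ℂ} (h : IsTestFunction T ψ) (u : L2C) :
    Zakharov.bip (toL2 (ψ T)) u = 0 := by
  rw [bip_toL2 ((h.isCc T).memLp 2)]
  simp [h.eq_zero le_rfl]

/-- Integration by parts in time against a test function. -/
theorem setIntegral_bip_deriv {T : ℝ} (hT : 0 ≤ T) {ψ : ℝ → Plane → ℂ} (hψ : IsTestFunction T ψ)
    {u u' : ℝ → L2C} (hu : ∀ t ∈ Set.Icc 0 T, HasDerivWithinAt u (u' t) (Set.Icc 0 T) t)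
    (hc : ContinuousOn u' (Set.Icc 0 T)) :
    ∫ t in Set.Icc 0 T, (bip (toL2 (fun x => deriv (fun τ => ψ τ x) t)) (u t) +
      bip (toL2 (ψ t)) (u' t)) = -bip (toL2 (ψ 0)) (u 0) := by
  rw [setIntegral_deriv_eq hT (G := fun t => bip (toL2 (ψ t)) (u t)) (fun t ht => HasDerivWithinAt.bip
    (hψ.hasDerivAt_toL2 t).hasDerivWithinAt (hu t ht)), hψ.bip_eq_zero, zero_sub]
  refine ContinuousOn.add ?_ ?_
  · exact continuous_bip.comp_continuousOn (hψ.deriv.continuous_toL2.continuousOn.prodMk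
      fun t ht => (hu t ht).continuousWithinAt)
  · exact continuous_bip.comp_continuousOn (hψ.continuous_toL2.continuousOn.prodMk hc)

section

variable {lam T : ℝ} {a b : ℝ → L2C}

theorem IsSol.continuousOn_nn (h : IsSol lam T a b) :
    ContinuousOn (fun t => nn (a t) (b t)) (Set.Icc 0 T) :=
  fun _ ht => (h.deriv_nn ht).continuousWithinAt

theorem IsSol.continuousOn_fu (h : IsSol lam T a b) :
    ContinuousOn (fun t => fu (a t) (b t)) (Set.Icc 0 T) := by
  exact (continuousOn_sf h.cont h.continuousOn_nn).congr fun t _ => (sf_nn (a t) (b t)).symm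

theorem toComplex_reL_nn (a b : L2C) : toComplex (reL (nn a b)) = nn a b :=
  toComplex_reL (conjL_nn a b)

/-- Two integrations by parts in time turn the wave equation into its weak form. -/
theorem IsSol.setIntegral_wave {c : ℝ → L2C} (h : IsSol lam T a b) (hT : 0 ≤ T)
    (hc : ∀ t ∈ Set.Icc 0 T, uu (c t) = nn (a t) (b t) + rho (a t))
    (hd : ∀ t ∈ Set.Icc 0 T, HasDerivWithinAt (fun t => (lam : ℂ) • absD (imC (b t)))
      (((lam ^ 2 : ℝ) : ℂ) • lapU (c t)) (Set.Icc 0 T) t)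
    (hcc : ContinuousOn c (Set.Icc 0 T)) {ψ : ℝ → Plane → ℝ} (hψ : IsTestFunction T ψ) :
    ∫ t in Set.Icc 0 T,
      (bip (toL2 (fun x => ((deriv (fun σ => deriv (fun τ => ψ τ x) σ) t : ℝ) : ℂ))) (nn (a t) (b t)) -
        ((lam ^ 2 : ℝ) : ℂ) * bip (toL2 (Δ fun x => (ψ t x : ℂ))) (nn (a t) (b t) + rho (a t))) =
      bip (toL2 (fun x => (ψ 0 x : ℂ))) ((lam : ℂ) • absD (imC (b 0))) -
        bip (toL2 (fun x => ((deriv (fun τ => ψ τ x) 0 : ℝ) : ℂ))) (nn (a 0) (b 0)) := by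
  have hNc : ContinuousOn (fun t => (lam : ℂ) • absD (imC (b t))) (Set.Icc 0 T) :=
    fun t ht => (hd t ht).continuousWithinAt
  have hlc : ContinuousOn (fun t => ((lam ^ 2 : ℝ) : ℂ) • lapU (c t)) (Set.Icc 0 T) :=
    ((continuous_const_smul ((lam ^ 2 : ℝ) : ℂ)).comp continuous_lapU).comp_continuousOn hcc
  have h1 := setIntegral_bip_deriv hT hψ.deriv.ofReal (fun t ht => h.deriv_nn ht) hNc
  have h2 := setIntegral_bip_deriv hT hψ.ofReal hd hlc
  simp only [hψ.deriv_ofReal] at h2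
  simp only [hψ.deriv.deriv_ofReal] at h1
  have i1 : Integrable (fun t =>
      bip (toL2 (fun x => ((deriv (fun σ => deriv (fun τ => ψ τ x) σ) t : ℝ) : ℂ))) (nn (a t) (b t)) +
        bip (toL2 (fun x => ((deriv (fun τ => ψ τ x) t : ℝ) : ℂ))) ((lam : ℂ) • absD (imC (b t))))
      (volume.restrict (Set.Icc 0 T)) :=
    ((EssBdd.of_continuousOn h.continuousOn_nn).bip hψ.deriv.deriv.ofReal.continuous_toL2).integrable.add
      ((EssBdd.of_continuousOn hNc).bip hψ.deriv.ofReal.continuous_toL2).integrable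
  have i2 : Integrable (fun t =>
      bip (toL2 (fun x => ((deriv (fun τ => ψ τ x) t : ℝ) : ℂ))) ((lam : ℂ) • absD (imC (b t))) +
        bip (toL2 (fun x => (ψ t x : ℂ))) (((lam ^ 2 : ℝ) : ℂ) • lapU (c t)))
      (volume.restrict (Set.Icc 0 T)) :=
    ((EssBdd.of_continuousOn hNc).bip hψ.deriv.ofReal.continuous_toL2).integrable.add
      ((EssBdd.of_continuousOn hlc).bip hψ.ofReal.continuous_toL2).integrable
  rw [sub_eq_neg_add, ← h1, ← sub_neg_eq_add, ← h2, ← integral_sub i1 i2]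
  refine setIntegral_congr_fun measurableSet_Icc fun t ht => ?_
  beta_reduce
  rw [← hc t ht, (hψ.isCc t).ofReal.bip_laplacian, bip_smul_right _ ((lam ^ 2 : ℝ) : ℂ)]
  ring

/-- Solutions of the system for `(u, P)` are weak solutions of the Zakharov system. -/
theorem IsSol.isWeakSolution {s R : ℝ} (hs : 2 < s) (hl : 0 < lam) (hT : 0 ≤ T)
    (h : IsSol lam T a b) (hb : ∀ t ∈ Set.Icc 0 T, Sob s R (pp (b t)))
    {n₀ : L2R} {f₀ : Fin 2 → L2R} (hn0 : nn (a 0) (b 0) = toComplex n₀)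
    (hdiv : IsWeakDivergence (reL ((lam : ℂ) • absD (imC (b 0)))) f₀) :
    IsWeakSolution lam T (uu (a 0)) n₀ f₀ (fun t => uu (a t)) (fun t => reL (nn (a t) (b t))) := by
  have ha := EssBdd.of_continuousOn h.cont
  have hn : EssBdd T (fun t => toComplex (reL (nn (a t) (b t)))) := by
    simp only [toComplex_reL_nn]; exact EssBdd.of_continuousOn h.continuousOn_nn
  constructor
  · intro ψ hψ
    refine (schrodinger_iff hT ha hn (Eventually.of_forall fun _ => rfl) hψ).2 ?_
    simp only [toComplex_reL_nn, sf_nn]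
    rw [setIntegral_bip_deriv hT hψ h.deriv_u h.continuousOn_fu, add_neg_cancel]
  · intro ψ hψ
    refine (wave_iff hl hT hdiv ha hn (Eventually.of_forall fun _ => rfl) hψ).2 ?_
    obtain ⟨c, hc, hcc⟩ := h.deriv_nn_deriv hs hb
    simp only [toComplex_reL_nn]
    rw [h.setIntegral_wave hT (fun t ht => (hc t ht).2.2.1) (fun t ht => (hc t ht).2.2.2) hcc hψ, hn0,
      toComplex_reL (conjL_smul_absD_imC _ _)]
    ring

end

/-! ### Evolution equations in the sense of distributions -/

/-- Smooth functions of time with compact support in `(-∞, T)`. -/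
structure IsTimeTest (T : ℝ) (θ : ℝ → ℝ) : Prop where
  smooth : ContDiff ℝ ∞ θ
  compact : HasCompactSupport θ
  support_subset : tsupport θ ⊆ Set.Iio T

theorem IsTimeTest.eq_zero {T : ℝ} {θ : ℝ → ℝ} (h : IsTimeTest T θ) {t : ℝ} (ht : T ≤ t) : θ t = 0 := by
  by_contra hne
  exact absurd (h.support_subset (subset_tsupport θ hne)) (not_lt.2 ht)

theorem IsTimeTest.hasDerivAt {T : ℝ} {θ : ℝ → ℝ} (h : IsTimeTest T θ) (t : ℝ) :
    HasDerivAt θ (deriv θ t) t :=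
  (h.smooth.differentiable (by simp)).differentiableAt.hasDerivAt

theorem IsTimeTest.deriv {T : ℝ} {θ : ℝ → ℝ} (h : IsTimeTest T θ) : IsTimeTest T (deriv θ) where
  smooth := (contDiff_infty_iff_deriv.1 h.smooth).2
  compact := h.compact.deriv
  support_subset := (closure_minimal support_deriv_subset (isClosed_tsupport θ)).trans h.support_subset

/-- A test function of time has, near nonnegative times, a test function as antiderivative. -/
theorem IsTimeTest.exists_antideriv {T : ℝ} {ϑ : ℝ → ℝ} (h : IsTimeTest T ϑ) :
    ∃ θ, IsTimeTest T θ ∧ ∀ t, -1 < t → _root_.deriv θ t = ϑ t := by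
  obtain ⟨t₁, ht₁, hz⟩ : ∃ t₁ < T, ∀ t, t₁ < t → ϑ t = 0 := by
    rcases (tsupport ϑ).eq_empty_or_nonempty with he | hne
    · exact ⟨T - 1, by linarith, fun t _ => by
        by_contra hne
        exact absurd (subset_tsupport ϑ hne) (by simp [he])⟩
    · obtain ⟨t₁, h1, h2⟩ := IsCompact.exists_isGreatest h.compact hne
      refine ⟨t₁, h.support_subset h1, fun t ht => ?_⟩
      by_contra hne
      exact absurd (h2 (subset_tsupport ϑ hne)) (not_le.2 ht)
  have hc := h.smooth.continuous
  set F : ℝ → ℝ := fun t => ∫ τ in T..t, ϑ τ with hF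
  have hFd : ∀ t, HasDerivAt F (ϑ t) t := fun t =>
    intervalIntegral.integral_hasDerivAt_right (hc.intervalIntegrable _ _)
      (hc.stronglyMeasurableAtFilter _ _) hc.continuousAt
  have hFs : ContDiff ℝ ∞ F := by
    refine contDiff_infty_iff_deriv.2 ⟨fun t => (hFd t).differentiableAt, ?_⟩
    rw [funext fun t => (hFd t).deriv]
    exact h.smooth
  have hF0 : ∀ t, t₁ ≤ t → F t = 0 := fun t ht => by
    refine intervalIntegral.integral_zero_ae (Eventually.of_forall fun τ hτ => hz τ ?_)
    exact (le_min ht₁.le ht).trans_lt hτ.1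
  set χ : ℝ → ℝ := fun t => Real.smoothTransition (t + 2) with hχ
  have hχs : ContDiff ℝ ∞ χ := Real.smoothTransition.contDiff.comp (contDiff_id.add contDiff_const)
  have hsub : Function.support (fun t => χ t * F t) ⊆ Set.Icc (-2) t₁ := fun t ht => by
    constructor
    · by_contra hlt
      exact ht (by simp [hχ, Real.smoothTransition.zero_of_nonpos (by linarith : t + 2 ≤ 0)])
    · by_contra hlt
      exact ht (by simp [hF0 t (not_le.1 hlt).le])
  have hts : tsupport (fun t => χ t * F t) ⊆ Set.Icc (-2) t₁ := closure_minimal hsub isClosed_Icc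
  refine ⟨fun t => χ t * F t, ⟨hχs.mul hFs, isCompact_Icc.of_isClosed_subset (isClosed_tsupport _) hts,
    hts.trans fun t ht => ht.2.trans_lt ht₁⟩, fun t ht => ?_⟩
  have he : (fun t => χ t * F t) =ᶠ[𝓝 t] F := by
    filter_upwards [Ioi_mem_nhds ht] with x hx
    have hx' : (1 : ℝ) ≤ x + 2 := by have : -1 < x := hx; linarith
    simp only [hχ, Real.smoothTransition.one_of_one_le hx', one_mul]
  exact (he.hasDerivAt_iff.2 (hFd t)).deriv

section

variable {E : Type*} [NormedAddCommGroup E] [NormedSpace ℝ E] {T : ℝ}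

theorem EssBdd.smul {θ : ℝ → ℝ} (hθ : Continuous θ) {x : ℝ → E} (hx : EssBdd T x) :
    EssBdd T (fun t => θ t • x t) := by
  obtain ⟨R, hR⟩ := hx.bdd
  obtain ⟨C, hC⟩ := (EssBdd.of_continuousOn (T := T) hθ.continuousOn).bdd
  refine ⟨hθ.aestronglyMeasurable.smul hx.meas, C * R, ?_⟩
  filter_upwards [hR, hC] with t h1 h2
  rw [norm_smul]
  exact mul_le_mul h2 h1 (norm_nonneg _) ((norm_nonneg _).trans h2)

/-- The primitive of an essentially bounded curve. -/
noncomputable def prim (x₀ : E) (y : ℝ → E) (t : ℝ) : E := x₀ + ∫ τ in (0 : ℝ)..t, y τ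

theorem prim_zero (x₀ : E) (y : ℝ → E) : prim x₀ y 0 = x₀ := by simp [prim]

theorem EssBdd.continuousOn_prim (hT : 0 ≤ T) {y : ℝ → E} (hy : EssBdd T y) (x₀ : E) :
    ContinuousOn (prim x₀ y) (Set.Icc 0 T) := by
  have h : IntegrableOn y (Set.uIcc 0 T) volume := by rw [Set.uIcc_of_le hT]; exact hy.integrable
  have := intervalIntegral.continuousOn_primitive_interval h
  rw [Set.uIcc_of_le hT] at this
  exact continuousOn_const.add this

theorem eqOn_of_hasDerivWithinAt {x y x' : ℝ → E}
    (hx : ∀ t ∈ Set.Icc 0 T, HasDerivWithinAt x (x' t) (Set.Icc 0 T) t)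
    (hy : ∀ t ∈ Set.Icc 0 T, HasDerivWithinAt y (x' t) (Set.Icc 0 T) t) (h0 : x 0 = y 0) :
    ∀ t ∈ Set.Icc 0 T, x t = y t := by
  intro t ht
  have hd : ∀ t ∈ Set.Icc 0 T, HasDerivWithinAt (fun t => x t - y t) 0 (Set.Icc 0 T) t :=
    fun t ht => ((hx t ht).sub (hy t ht)).congr_deriv (sub_self _)
  have := (convex_Icc 0 T).norm_image_sub_le_of_norm_hasDerivWithin_le (C := 0) hd (by simp)
    (⟨le_rfl, ht.1.trans ht.2⟩ : (0 : ℝ) ∈ Set.Icc 0 T) ht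
  rwa [h0, sub_self, sub_zero, zero_mul, norm_le_zero_iff, sub_eq_zero] at this

variable [CompleteSpace E]

theorem hasDerivWithinAt_prim {y z : ℝ → E} (hz : ContinuousOn z (Set.Icc 0 T))
    (hyz : y =ᵐ[volume.restrict (Set.Icc 0 T)] z) (x₀ : E) {t : ℝ} (ht : t ∈ Set.Icc 0 T) :
    HasDerivWithinAt (prim x₀ y) (z t) (Set.Icc 0 T) t := by
  have hT : 0 ≤ T := ht.1.trans ht.2
  set z' : ℝ → E := Set.IccExtend hT ((Set.Icc 0 T).domRestrict z) with hz'
  have hzc : Continuous z' := hz.domRestrict.Icc_extend'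
  have hzz : ∀ x ∈ Set.Icc 0 T, z' x = z x := fun x hx => by
    rw [hz', Set.IccExtend_of_mem _ _ hx]; rfl
  have hd : HasDerivAt (prim x₀ z') (z' t) t :=
    (intervalIntegral.integral_hasDerivAt_right (hzc.intervalIntegrable _ _)
      (hzc.stronglyMeasurableAtFilter _ _) hzc.continuousAt).const_add _
  have he : ∀ t ∈ Set.Icc 0 T, prim x₀ y t = prim x₀ z' t := fun t ht => by
    rw [prim, prim]
    congr 1
    apply intervalIntegral.integral_congr_ae
    filter_upwards [(ae_restrict_iff' measurableSet_Icc).1 hyz] with x hx hxt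
    rw [Set.uIoc_of_le ht.1] at hxt
    have hm : x ∈ Set.Icc 0 T := ⟨hxt.1.le, hxt.2.trans ht.2⟩
    rw [hx hm, hzz x hm]
  rw [← hzz t ht]
  exact hd.hasDerivWithinAt.congr he (he t ht)

/-- Integration by parts against a primitive. -/
theorem EssBdd.integral_smul_prim (hT : 0 ≤ T) {y : ℝ → E} (hy : EssBdd T y) (x₀ : E) {θ : ℝ → ℝ}
    (hθ : IsTimeTest T θ) :
    ∫ t in Set.Icc 0 T, (deriv θ t • prim x₀ y t + θ t • y t) = -(θ 0 • x₀) := by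
  set ν := (volume : Measure ℝ).restrict (Set.Icc 0 T) with hν
  have hθc := hθ.smooth.continuous
  have hdc := hθ.deriv.smooth.continuous
  have hftc : ∀ t ∈ Set.Icc 0 T, ∫ τ in Set.Icc t T, deriv θ τ = -θ t := fun t ht => by
    rw [integral_Icc_eq_integral_Ioc, ← intervalIntegral.integral_of_le ht.2,
      intervalIntegral.integral_eq_sub_of_hasDerivAt (fun τ _ => hθ.hasDerivAt τ)
        (hdc.intervalIntegrable _ _), hθ.eq_zero le_rfl, zero_sub]
  -- the integral of `θ' ∫₀ᵗ y` over the triangle `0 ≤ τ ≤ t ≤ T`, in both orders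
  set S : Set (ℝ × ℝ) := {p | p.2 ≤ p.1} with hS
  have hSm : MeasurableSet S := measurableSet_le measurable_snd measurable_fst
  have hint : Integrable (Function.uncurry fun t τ => S.indicator (fun p => deriv θ p.1 • y p.2) (t, τ))
      (ν.prod ν) :=
    ((EssBdd.of_continuousOn hdc.continuousOn).integrable.smul_prod hy.integrable).indicator hSm
  have hswap := integral_integral_swap hint
  have hl : ∫ t, ∫ τ, S.indicator (fun p => deriv θ p.1 • y p.2) (t, τ) ∂ν ∂ν =
      ∫ t in Set.Icc 0 T, deriv θ t • ∫ τ in (0 : ℝ)..t, y τ := by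
    refine setIntegral_congr_fun measurableSet_Icc fun t ht => ?_
    have e : ∀ τ, S.indicator (fun p => deriv θ p.1 • y p.2) (t, τ) =
        (Set.Iic t).indicator (fun τ => deriv θ t • y τ) τ := fun τ => rfl
    rw [integral_congr_ae (Eventually.of_forall e)]
    rw [hν, setIntegral_indicator measurableSet_Iic, integral_smul, intervalIntegral.integral_of_le ht.1,
      ← integral_Icc_eq_integral_Ioc]
    congr 3
    ext τ
    exact ⟨fun h => ⟨h.1.1, h.2⟩, fun h => ⟨⟨h.1, h.2.trans ht.2⟩, h.2⟩⟩
  have hr : ∫ τ, ∫ t, S.indicator (fun p => deriv θ p.1 • y p.2) (t, τ) ∂ν ∂ν =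
      -∫ τ in Set.Icc 0 T, θ τ • y τ := by
    rw [← integral_neg]
    refine setIntegral_congr_fun measurableSet_Icc fun τ ht => ?_
    have e : ∀ t, S.indicator (fun p => deriv θ p.1 • y p.2) (t, τ) =
        (Set.Ici τ).indicator (fun t => deriv θ t • y τ) t := fun t => rfl
    rw [integral_congr_ae (Eventually.of_forall e)]
    rw [hν, setIntegral_indicator measurableSet_Ici, integral_smul_const, ← neg_smul, ← hftc τ ht]
    congr 3
    ext t
    exact ⟨fun h => ⟨h.2, h.1.2⟩, fun h => ⟨⟨ht.1.trans h.1, h.2⟩, h.1⟩⟩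
  have hP : EssBdd T (fun t => deriv θ t • prim x₀ y t) :=
    (EssBdd.of_continuousOn (hy.continuousOn_prim hT x₀)).smul hdc
  have hP0 : EssBdd T (fun t => deriv θ t • ∫ τ in (0 : ℝ)..t, y τ) := by
    have : ContinuousOn (fun t => ∫ τ in (0 : ℝ)..t, y τ) (Set.Icc 0 T) :=
      (hy.continuousOn_prim hT (0 : E)).congr fun t _ => by simp [prim]
    exact (EssBdd.of_continuousOn this).smul hdc
  have e1 : ∫ t in Set.Icc 0 T, deriv θ t • prim x₀ y t =
      (∫ t in Set.Icc 0 T, deriv θ t • x₀) + ∫ t in Set.Icc 0 T, deriv θ t • ∫ τ in (0 : ℝ)..t, y τ := by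
    rw [← integral_add ((EssBdd.of_continuousOn continuousOn_const).smul hdc).integrable hP0.integrable]
    simp only [prim, smul_add]
  rw [integral_add hP.integrable (hy.smul hθc).integrable, e1, ← hl, hswap, hr, neg_add_cancel_right,
    integral_smul_const, hftc 0 ⟨le_rfl, hT⟩, neg_smul]

/-- A weak solution of `x' = y`, `x(0) = x₀` is the primitive of `y`. -/
theorem EssBdd.eq_prim (hT : 0 ≤ T) {x y : ℝ → E} (hx : EssBdd T x) (hy : EssBdd T y) {x₀ : E}
    (h : ∀ θ, IsTimeTest T θ →
      θ 0 • x₀ + ∫ t in Set.Icc 0 T, (deriv θ t • x t + θ t • y t) = 0) :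
    x =ᵐ[volume.restrict (Set.Icc 0 T)] prim x₀ y := by
  have hP := EssBdd.of_continuousOn (hy.continuousOn_prim hT x₀)
  have hi : IntegrableOn (fun t => x t - prim x₀ y t) (Set.Icc 0 T) volume :=
    hx.integrable.sub hP.integrable
  have key := isOpen_Ioo.ae_eq_zero_of_integral_contDiff_smul_eq_zero (U := Set.Ioo 0 T)
    (f := fun t => x t - prim x₀ y t) (μ := volume)
    (hi.mono_set Set.Ioo_subset_Icc_self).locallyIntegrableOn fun g hg hgc hgs => by
      have hgt : IsTimeTest T g := ⟨hg, hgc, hgs.trans fun t ht => ht.2⟩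
      obtain ⟨θ, hθ, hθd⟩ := hgt.exists_antideriv
      have h1 := h θ hθ
      have h2 := hy.integral_smul_prim hT x₀ hθ
      have j1 : IntegrableOn (fun t => deriv θ t • x t + θ t • y t) (Set.Icc 0 T) volume :=
        ((hx.smul hθ.deriv.smooth.continuous).integrable).add
          (hy.smul hθ.smooth.continuous).integrable
      have j2 : IntegrableOn (fun t => deriv θ t • prim x₀ y t + θ t • y t) (Set.Icc 0 T) volume :=
        ((hP.smul hθ.deriv.smooth.continuous).integrable).add
          (hy.smul hθ.smooth.continuous).integrable
      have h3 : ∫ t in Set.Icc 0 T, ((deriv θ t • x t + θ t • y t) -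
          (deriv θ t • prim x₀ y t + θ t • y t)) = 0 := by
        refine (integral_sub j1 j2).trans ?_
        rw [h2, sub_neg_eq_add, add_comm]
        exact h1
      rw [← setIntegral_eq_integral_of_forall_compl_eq_zero (s := Set.Icc 0 T), ← h3]
      · refine setIntegral_congr_fun measurableSet_Icc fun t ht => ?_
        rw [hθd t (by linarith [ht.1]), smul_sub]
        abel
      · intro t ht
        have : g t = 0 := by
          by_contra hne
          exact ht (Set.Ioo_subset_Icc_self (hgs (subset_tsupport g hne)))
        rw [this, zero_smul]
  rw [Filter.EventuallyEq, ← restrict_Ioo_eq_restrict_Icc, ae_restrict_iff' measurableSet_Ioo]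
  filter_upwards [key] with t ht hm
  exact sub_eq_zero.1 (ht hm)

/-- A weak solution of `x'' = y`, `x(0) = x₀`, `x'(0) = x₁` is the second primitive of `y`. -/
theorem EssBdd.eq_prim_prim (hT : 0 ≤ T) {x y : ℝ → E} (hx : EssBdd T x) (hy : EssBdd T y) {x₀ x₁ : E}
    (h : ∀ θ, IsTimeTest T θ →
      deriv θ 0 • x₀ - θ 0 • x₁ + ∫ t in Set.Icc 0 T, (deriv (deriv θ) t • x t - θ t • y t) = 0) :
    x =ᵐ[volume.restrict (Set.Icc 0 T)] prim x₀ (prim x₁ y) := by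
  have hP := EssBdd.of_continuousOn (hy.continuousOn_prim hT x₁)
  refine hx.eq_prim hT hP fun ϑ hϑ => ?_
  obtain ⟨θ, hθ, hθd⟩ := hϑ.exists_antideriv
  have hdd : ∀ t, -1 < t → deriv (deriv θ) t = deriv ϑ t := fun t ht => by
    apply EventuallyEq.deriv_eq
    filter_upwards [Ioi_mem_nhds ht] with x hx
    exact hθd x hx
  have h1 := h θ hθ
  have h2 := hy.integral_smul_prim hT x₁ hθ
  have j1 := ((hx.smul hθ.deriv.deriv.smooth.continuous).integrable).sub
        (hy.smul hθ.smooth.continuous).integrable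
  have j2 := ((hP.smul hθ.deriv.smooth.continuous).integrable).add
        (hy.smul hθ.smooth.continuous).integrable
  have h3 : ∫ t in Set.Icc 0 T, (deriv ϑ t • x t + ϑ t • prim x₁ y t) =
      (∫ t in Set.Icc 0 T, (deriv (deriv θ) t • x t - θ t • y t)) +
        ∫ t in Set.Icc 0 T, (deriv θ t • prim x₁ y t + θ t • y t) := by
    refine Eq.trans ?_ (integral_add j1 j2)
    refine setIntegral_congr_fun measurableSet_Icc fun t ht => ?_
    rw [hθd t (by linarith [ht.1]), hdd t (by linarith [ht.1])]
    abel
  rw [h3, h2, ← hθd 0 (by norm_num), ← h1]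
  abel

end

/-! ### Weak solutions solve integral equations in `L²` -/

theorem eq_zero_of_forall_bip {f : L2C}
    (h : ∀ φ : Plane → ℝ, IsCc φ → bip (toL2 fun x => (φ x : ℂ)) f = 0) : f = 0 := by
  rw [Lp.eq_zero_iff_ae_eq_zero]
  refine ae_eq_zero_of_integral_contDiff_smul_eq_zero
    ((Lp.memLp f).locallyIntegrable (by norm_num)) fun g hg hgc => ?_
  have := h g ⟨hg, hgc⟩
  rw [bip_toL2 ((IsCc.ofReal ⟨hg, hgc⟩).memLp 2)] at this
  simp only [Complex.real_smul, mul_comm] at this ⊢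
  exact this

theorem bip_real_smul (φ : L2C) (c : ℝ) (u : L2C) : bip φ (c • u) = (c : ℂ) * bip φ u := by
  rw [real_smul_eq, bip_smul_right]

theorem bip_integral {T : ℝ} {x : ℝ → L2C} (hx : EssBdd T x) (φ : L2C) :
    bip φ (∫ t in Set.Icc 0 T, x t) = ∫ t in Set.Icc 0 T, bip φ (x t) :=
  (integral_inner hx.integrable (conjL φ)).symm

theorem IsTimeTest.isTestFunction {T : ℝ} {θ : ℝ → ℝ} (hθ : IsTimeTest T θ) {φ : Plane → ℝ}
    (hφ : IsCc φ) : IsTestFunction T (fun t x => θ t * φ x) := by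
  have hsub : tsupport (Function.uncurry fun t x => θ t * φ x) ⊆ tsupport θ ×ˢ tsupport φ := by
    refine closure_minimal (fun p hp => ?_) ((isClosed_tsupport θ).prod (isClosed_tsupport φ))
    exact ⟨subset_tsupport θ (left_ne_zero_of_mul hp), subset_tsupport φ (right_ne_zero_of_mul hp)⟩
  exact ⟨(hθ.smooth.comp contDiff_fst).mul (hφ.smooth.comp contDiff_snd),
    (hθ.compact.prod hφ.compact).of_isClosed_subset (isClosed_tsupport _) hsub,
    hsub.trans fun p hp => ⟨hθ.support_subset hp.1, trivial⟩⟩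

theorem toL2_ofReal_mul {φ : Plane → ℝ} (hφ : IsCc φ) (c : ℝ) :
    toL2 (fun x => ((c * φ x : ℝ) : ℂ)) = (c : ℂ) • toL2 (fun x => (φ x : ℂ)) := by
  rw [← toL2_smul _ (hφ.ofReal.memLp 2)]
  simp only [Complex.ofReal_mul]

/-- The Schrödinger equation in `L²`. -/
theorem IsWeakSolution.eq_prim_u {lam T : ℝ} (hT : 0 ≤ T) {u₀ : L2C} {n₀ : L2R} {f₀ : Fin 2 → L2R}
    {u a : ℝ → L2C} {n : ℝ → L2R} (h : IsWeakSolution lam T u₀ n₀ f₀ u n)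
    (ha : EssBdd T a) (hn : EssBdd T (fun t => toComplex (n t)))
    (hu : ∀ᵐ t ∂(volume.restrict (Set.Icc 0 T)), u t = uu (a t)) :
    u =ᵐ[volume.restrict (Set.Icc 0 T)] prim u₀ (fun t => sf (a t) (toComplex (n t))) := by
  have hU : EssBdd T (fun t => uu (a t)) :=
    ha.comp (ballLip_uu fun R => ⟨1, zero_le_one, fun x y _ _ => (one_mul _).ge⟩)
  have hS := (ha.prodMk hn).comp ballLip_sf
  refine EventuallyEq.trans hu (hU.eq_prim hT hS fun θ hθ => eq_zero_of_forall_bip fun φ hφ => ?_)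
  have hψ := hθ.isTestFunction hφ
  have hw := (schrodinger_iff hT ha hn hu hψ.ofReal).1 (h.schrodinger _ hψ.ofReal)
  have hd : ∀ t x, deriv (fun τ => θ τ * φ x) t = deriv θ t * φ x := fun t x => by
    rw [deriv_mul_const (hθ.hasDerivAt t).differentiableAt]
  simp only [hψ.deriv_ofReal, hd, toL2_ofReal_mul hφ, bip_smul_left] at hw
  have hi := (hU.smul hθ.deriv.smooth.continuous)
  have hj := (hS.smul hθ.smooth.continuous)
  have hij : EssBdd T (fun t => deriv θ t • uu (a t) + θ t • sf (a t) (toComplex (n t))) :=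
    (hi.prodMk hj).comp (f := fun p : L2C × L2C => p.1 + p.2) (ballLip_fst.add ballLip_snd)
  rw [bip_add_right, bip_real_smul, bip_integral hij, ← hw]
  simp only [bip_add_right, bip_real_smul]

/-- The wave equation in `L²`. -/
theorem IsWeakSolution.eq_prim_n {lam T : ℝ} (hl : 0 < lam) (hT : 0 ≤ T) {u₀ : L2C} {n₀ n₁ : L2R}
    {f₀ : Fin 2 → L2R} (hdiv : IsWeakDivergence n₁ f₀)
    {u a c : ℝ → L2C} {n : ℝ → L2R} (h : IsWeakSolution lam T u₀ n₀ f₀ u n)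
    (ha : EssBdd T a) (hn : EssBdd T (fun t => toComplex (n t)))
    (hu : ∀ᵐ t ∂(volume.restrict (Set.Icc 0 T)), u t = uu (a t)) (hc : EssBdd T c)
    (hcn : ∀ᵐ t ∂(volume.restrict (Set.Icc 0 T)), toComplex (n t) + rho (a t) = uu (c t)) :
    (fun t => toComplex (n t)) =ᵐ[volume.restrict (Set.Icc 0 T)]
      prim (toComplex n₀) (prim (toComplex n₁) fun t => (lam ^ 2) • lapU (c t)) := by
  have hL : EssBdd T (fun t => (lam ^ 2) • lapU (c t)) :=
    (hc.comp (ballLip_lapU fun R => ⟨1, zero_le_one, fun x y _ _ => (one_mul _).ge⟩)).smul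
      (θ := fun _ => lam ^ 2) continuous_const
  refine hn.eq_prim_prim hT hL fun θ hθ => eq_zero_of_forall_bip fun φ hφ => ?_
  have hψ := hθ.isTestFunction hφ
  have hw := (wave_iff hl hT hdiv ha hn hu hψ).1 (h.wave _ hψ)
  have hd : ∀ t x, deriv (fun τ => θ τ * φ x) t = deriv θ t * φ x := fun t x => by
    rw [deriv_mul_const (hθ.hasDerivAt t).differentiableAt]
  have hdd : ∀ t x, deriv (fun τ => deriv θ τ * φ x) t = deriv (deriv θ) t * φ x := fun t x => by
    rw [deriv_mul_const (hθ.deriv.hasDerivAt t).differentiableAt]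
  simp only [hd, hdd, toL2_ofReal_mul hφ, bip_smul_left] at hw
  have hi := (hn.smul hθ.deriv.deriv.smooth.continuous)
  have hj := (hL.smul hθ.smooth.continuous)
  have hij : EssBdd T (fun t => deriv (deriv θ) t • toComplex (n t) - θ t • (lam ^ 2) • lapU (c t)) :=
    (hi.prodMk hj).comp (f := fun p : L2C × L2C => p.1 - p.2) (ballLip_fst.sub ballLip_snd)
  rw [bip_add_right, bip_sub_right, bip_real_smul, bip_real_smul, bip_integral hij, ← hw]
  congr 1
  apply integral_congr_ae
  filter_upwards [hcn] with t ht
  rw [ht, (hψ.isCc t).ofReal.bip_laplacian, toL2_ofReal_mul hφ, bip_smul_left, bip_sub_right,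
    bip_real_smul, bip_real_smul, bip_real_smul]
  ring

/-! ### Uniqueness of weak solutions -/

/-- Frequency truncations converge in `L²`. -/
theorem tendsto_D_jbk_zero {q : ℝ} (hq : 0 < q) (F : L2C) :
    Tendsto (fun k : ℕ => D (jbk 0 k) (D (jb (-q)) F)) atTop (𝓝 (D (jb (-q)) F)) := by
  rw [Metric.tendsto_atTop]
  intro ε hε
  obtain ⟨δ, hδ, h⟩ := exists_interpolation (p := q + 1) hq (by linarith) (2 * ‖F‖) (half_pos hε)
  have hF : Sob (q + 1) ‖F‖ (D (jb (-(q + 1))) F) := ⟨F, le_rfl, rfl⟩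
  have ht : Tendsto (fun k : ℕ => 2 / ((k : ℝ) + 1) * ‖F‖) atTop (𝓝 0) := by
    simpa using tendsto_two_div.mul_const ‖F‖
  obtain ⟨N, hN⟩ := eventually_atTop.1 (ht.eventually (gt_mem_nhds hδ))
  refine ⟨N, fun k hk => ?_⟩
  rw [dist_eq_norm]
  have hcomm : ∀ r : ℝ, 0 ≤ r → D (jbk 0 k) (D (jb (-r)) F) - D (jb (-r)) F =
      D (jb (-r)) (D (jbk 0 k) F - F) := fun r hr => by
    rw [map_sub, D_comm (bddSym_jbk _ _) (bddSym_jb (by linarith))]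
  have h1 := hF.norm_trunc_sub_le (by linarith) k
  rw [hcomm _ (by linarith)] at h1
  rw [hcomm q hq.le]
  refine (h _ ?_ (h1.trans (hN k hk).le)).trans_lt (by linarith)
  refine (norm_sub_le _ _).trans ?_
  linarith [norm_D_jbk_zero_le k F]

section

variable {T r R : ℝ}

/-- A curve that is bounded in `H^r`, `r > 2`, is `⟨D⟩^{-2} a` with `a` bounded and measurable. -/
theorem EssBdd.exists_uu (hr : 2 < r) {v : ℝ → L2C} (hv : EssBdd T v)
    (hb : ∀ᵐ t ∂(volume.restrict (Set.Icc 0 T)), Sob r R (v t)) :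
    ∃ a, EssBdd T a ∧ ∀ᵐ t ∂(volume.restrict (Set.Icc 0 T)), v t = uu (a t) := by
  have : ∀ t, ∃ F : L2C, Sob r R (v t) → ‖F‖ ≤ R ∧ D (jb (-r)) F = v t := fun t => by
    by_cases h : Sob r R (v t)
    · obtain ⟨F, hF⟩ := h
      exact ⟨F, fun _ => hF⟩
    · exact ⟨0, fun h' => absurd h' h⟩
  choose F hF using this
  have hva : ∀ t, Sob r R (v t) → v t = uu (D (jb (-(r - 2))) (F t)) := fun t h => by
    rw [uu, D_jb_jb (by norm_num) (by linarith), ← (hF t h).2]; congr 3; ring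
  refine ⟨fun t => D (jb (-(r - 2))) (F t), ⟨?_, R, ?_⟩, hb.mono hva⟩
  · refine aestronglyMeasurable_of_tendsto_ae atTop (f := fun k t => D (jbk 2 k) (v t))
      (fun k => (D (jbk 2 k)).continuous.comp_aestronglyMeasurable hv.meas) ?_
    filter_upwards [hb] with t ht
    have := tendsto_D_jbk_zero (q := r - 2) (by linarith) (F t)
    refine this.congr fun k => ?_
    rw [hva t ht, uu, D_jbk_jb (r := -2) (by norm_num)]
    norm_num
  · filter_upwards [hb] with t ht
    exact (norm_D_jb_le (by linarith) _).trans (hF t ht).1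

theorem Sob.norm_D_jbk_le {r C : ℝ} (hr : 0 ≤ r) {f : L2C} (h : Sob r C f) (k : ℕ) :
    ‖D (jbk r k) f‖ ≤ C := by
  obtain ⟨F, hF, rfl⟩ := h
  rw [D_jbk_jb (by linarith), add_neg_cancel]
  exact (norm_D_jbk_zero_le k F).trans hF

/-- A bound in `H^r` at almost every time holds at every time, if the curve is continuous in `L²`. -/
theorem sob_of_ae_sob (hT : 0 < T) (hr : 0 ≤ r) (hR : 0 ≤ R) {v : ℝ → L2C}
    (hv : ContinuousOn v (Set.Icc 0 T))
    (hb : ∀ᵐ t ∂(volume.restrict (Set.Icc 0 T)), Sob r R (v t)) :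
    ∀ t ∈ Set.Icc 0 T, Sob r R (v t) := by
  intro t ht
  refine sob_of_forall_jbk hr hR fun k => ?_
  have hc : ContinuousOn (fun t => max ‖D (jbk r k) (v t)‖ R) (Set.Icc 0 T) :=
    ((D (jbk r k)).continuous.comp_continuousOn hv).norm.sup continuousOn_const
  have he : (fun t => max ‖D (jbk r k) (v t)‖ R) =ᵐ[volume.restrict (Set.Icc 0 T)] fun _ => R := by
    filter_upwards [hb] with x hx
    exact max_eq_right (hx.norm_D_jbk_le hr k)
  have := Measure.eqOn_Icc_of_ae_eq volume hT.ne he hc continuousOn_const ht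
  exact max_eq_right_iff.1 this

/-- A continuous curve in `L²` that is bounded in `H^r`, `r > 2`, is continuous in `H²`. -/
theorem exists_continuousOn_uu (hr : 2 < r) {v : ℝ → L2C} (hv : ContinuousOn v (Set.Icc 0 T))
    (hb : ∀ t ∈ Set.Icc 0 T, Sob r R (v t)) :
    ∃ a, ContinuousOn a (Set.Icc 0 T) ∧ ∀ t ∈ Set.Icc 0 T, uu (a t) = v t := by
  have : ∀ t, ∃ F : L2C, t ∈ Set.Icc 0 T → ‖F‖ ≤ R ∧ D (jb (-r)) F = v t := fun t => by
    by_cases ht : t ∈ Set.Icc 0 T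
    · obtain ⟨F, hF⟩ := hb t ht
      exact ⟨F, fun _ => hF⟩
    · exact ⟨0, fun h => absurd h ht⟩
  choose F hF using this
  refine ⟨fun t => D (jb (-(r - 2))) (F t), ?_, fun t ht => ?_⟩
  · exact continuousOn_D_jb_of_bounded (by linarith) (by linarith) (fun t ht => (hF t ht).1)
      (hv.congr fun t ht => (hF t ht).2)
  · rw [uu, D_jb_jb (by norm_num) (by linarith), ← (hF t ht).2]; congr 3; ring

theorem MemLInftySobolev.essBdd (hr : 0 ≤ r) {v : ℝ → L2C} (h : MemLInftySobolev T r v) :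
    ∃ R, 0 ≤ R ∧ EssBdd T v ∧ ∀ᵐ t ∂(volume.restrict (Set.Icc 0 T)), Sob r R (v t) := by
  obtain ⟨hm, M, hM⟩ := h
  have hs : ∀ᵐ t ∂(volume.restrict (Set.Icc 0 T)), Sob r M (v t) := by
    filter_upwards [hM] with t ht
    exact sob_of_sobolevNorm_le M.2 hr (ht.trans_eq ENNReal.ofReal_coe_nnreal.symm)
  exact ⟨M, M.2, ⟨hm, M, hs.mono fun t ht => ht.norm_le hr⟩, hs⟩

theorem MemLInftySobolevReal.toComplex {n : ℝ → L2R} (h : MemLInftySobolevReal T r n) :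
    MemLInftySobolev T r (fun t => toComplex (n t)) :=
  ⟨continuous_toComplex.comp_aestronglyMeasurable h.1, h.2⟩

end

theorem sob_add_rho {s R : ℝ} (hs : 2 < s) {a N : L2C} (ha : Sob (s + 1) R (uu a)) (hN : Sob s R N) :
    Sob s (R + 2 * BW s R * R) (N + rho a) :=
  hN.add ((sob_rho hs ha ha).of_le (by linarith) (by linarith))

theorem pp_D_jb (c : L2C) : pp (D (jb (-1)) c) = uu c := by
  rw [pp, D_jb_jb (by norm_num) (by norm_num), uu]; norm_num

/-- The wave `P = N + i M`, where `b = ⟨D⟩ P` is given by `c = ⟨D⟩² N` and `μ = ⟨D⟩ M`. -/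
theorem reC_pp_add {c μ : L2C} (hc : conjL c = c) (hμ : conjL μ = μ) :
    pp (D (jb (-1)) c + Complex.I • μ) = uu c + Complex.I • pp μ ∧
      reC (pp (D (jb (-1)) c + Complex.I • μ)) = uu c := by
  have h1 : pp (D (jb (-1)) c + Complex.I • μ) = uu c + Complex.I • pp μ := by
    rw [← pp_D_jb, pp, map_add, map_smul, pp]; rfl
  refine ⟨h1, ?_⟩
  have h2 : conjL (pp μ) = pp μ := by
    rw [pp, ← D_conjL (bddSym_jb (by norm_num)) (jb_neg_arg _), hμ]
  rw [h1, map_add, reC_I_smul, imC_eq_zero h2, neg_zero, add_zero, reC_eq_self]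
  rw [conjL_uu, hc]

/-- A real solution of the coupled Schrödinger and wave equations gives a solution of the
system for `(u, P)`. The imaginary part of `P` is found from `M_t = -λ |D| N`. -/
theorem exists_isSol_of_wave {lam T : ℝ} {a c W Y : ℝ → L2C} {μ₀ : L2C}
    (hac : ContinuousOn a (Set.Icc 0 T)) (hcc : ContinuousOn c (Set.Icc 0 T))
    (hc : ∀ t ∈ Set.Icc 0 T, uu (c t) = W t + rho (a t))
    (hcr : ∀ t ∈ Set.Icc 0 T, conjL (c t) = c t)
    (hu : ∀ t ∈ Set.Icc 0 T,
      HasDerivWithinAt (fun t => uu (a t)) (sf (a t) (W t)) (Set.Icc 0 T) t)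
    (hW : ∀ t ∈ Set.Icc 0 T, HasDerivWithinAt W (Y t) (Set.Icc 0 T) t)
    (hY : ∀ t ∈ Set.Icc 0 T, HasDerivWithinAt Y (lam ^ 2 • lapU (c t)) (Set.Icc 0 T) t)
    (hμ₀ : conjL μ₀ = μ₀) (hY₀ : Y 0 = (lam : ℂ) • absD μ₀) :
    ∃ b, IsSol lam T a b ∧ ∀ t ∈ Set.Icc 0 T, reC (pp (b t)) = uu (c t) ∧
      (t = 0 → pp (b t) = uu (c t) + Complex.I • pp μ₀) := by
  have hAc : ContinuousOn (fun t => absD (c t)) (Set.Icc 0 T) :=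
    (D absSym).continuous.comp_continuousOn hcc
  set μ : ℝ → L2C := fun t => reC (μ₀ - (lam : ℂ) • prim 0 (fun t => absD (c t)) t) with hμdef
  have hμr : ∀ t, conjL (μ t) = μ t := fun t => conjL_reC _
  have hμ0 : μ 0 = μ₀ := by
    simp only [hμdef, prim_zero, smul_zero, sub_zero]; exact reC_eq_self hμ₀
  have hcA : ∀ t ∈ Set.Icc 0 T, conjL (absD (c t)) = absD (c t) := fun t ht => by
    rw [absD, ← D_conjL bddSym_absSym absSym_neg_arg, hcr t ht]
  have hμd : ∀ t ∈ Set.Icc 0 T, HasDerivWithinAt μ (-((lam : ℂ) • absD (c t))) (Set.Icc 0 T) t :=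
    fun t ht => by
    have h1 := hasDerivWithinAt_prim hAc (EventuallyEq.refl _ _) (0 : L2C) ht
    have h2 := HasDerivWithinAt.clmC h1 ((lam : ℂ) • ContinuousLinearMap.id ℂ L2C)
    refine (HasDerivWithinAt.clmR (h2.const_sub μ₀) reC).congr_deriv ?_
    change reC (-((lam : ℂ) • absD (c t))) = _
    rw [map_neg, reC_real_smul, reC_eq_self (hcA t ht)]
  have hYμ : ∀ t ∈ Set.Icc 0 T, Y t = (lam : ℂ) • absD (μ t) := by
    refine eqOn_of_hasDerivWithinAt hY (fun t ht => ?_) (by rw [hμ0, hY₀])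
    refine (HasDerivWithinAt.clmC (hμd t ht) ((lam : ℂ) • D absSym)).congr_deriv ?_
    change (lam : ℂ) • absD (-((lam : ℂ) • absD (c t))) = _
    have e : absD (-((lam : ℂ) • absD (c t))) = -((lam : ℂ) • absD (absD (c t))) := by
      rw [absD, map_neg, map_smul]; rfl
    rw [e, absD_absD, smul_neg, smul_neg, smul_neg, neg_neg, smul_smul, real_smul_eq]
    congr 1; push_cast; ring
  have hbp := fun t (ht : t ∈ Set.Icc 0 T) => reC_pp_add (hcr t ht) (hμr t)
  set b : ℝ → L2C := fun t => D (jb (-1)) (c t) + Complex.I • μ t with hb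
  have hnn : ∀ t ∈ Set.Icc 0 T, nn (a t) (b t) = W t := fun t ht => by
    rw [nn, (hbp t ht).2, hc t ht, add_sub_cancel_right]
  have hau : ∀ t ∈ Set.Icc 0 T,
      HasDerivWithinAt (fun t => uu (a t)) (fu (a t) (b t)) (Set.Icc 0 T) t := fun t ht => by
    rw [← sf_nn, hnn t ht]
    exact hu t ht
  refine ⟨b, ⟨hac, hau, fun t ht => ?_⟩, fun t ht => ⟨(hbp t ht).2, ?_⟩⟩
  · have hd : HasDerivWithinAt (fun t => W t + rho (a t) + Complex.I • pp (μ t))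
        (Y t + gg (a t) + Complex.I • pp (-((lam : ℂ) • absD (c t)))) (Set.Icc 0 T) t := by
      refine ((hW t ht).add ?_).add ?_
      · exact (hasDerivWithinAt_rho (hac t ht) (hau t ht)).congr_deriv (gg_eq _ _)
      · exact HasDerivWithinAt.clmC (hμd t ht) (Complex.I • D (jb (-1)))
    have he : ∀ t ∈ Set.Icc 0 T, pp (b t) = W t + rho (a t) + Complex.I • pp (μ t) := fun t ht => by
      rw [(hbp t ht).1, hc t ht]
    refine (hd.congr he (he t ht)).congr_deriv ?_
    have e1 : absD (b t) = D (jb (-1)) (absD (c t)) + Complex.I • absD (μ t) := by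
      rw [absD, map_add, map_smul, D_comm bddSym_absSym (bddSym_jb (by norm_num))]; rfl
    have e2 : pp (-((lam : ℂ) • absD (c t))) = -((lam : ℂ) • D (jb (-1)) (absD (c t))) := by
      rw [pp, map_neg, map_smul]
    rw [fp, e1, e2, hYμ t ht, smul_add, smul_smul, smul_neg, smul_smul, neg_smul]
    have e3 : -(Complex.I * (lam : ℂ)) * Complex.I = lam := by
      linear_combination (-(lam : ℂ)) * Complex.I_mul_I
    rw [e3]
    abel
  · rintro rfl
    rw [(hbp 0 ht).1, hμ0]

/-- A weak solution in the class of the theorem comes from a solution of the system for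
`(u, P)`. -/
theorem IsWeakSolution.exists_isSol {s lam T : ℝ} (hs : 2 < s) (hl : 0 < lam) (hT : 0 < T)
    {u₀ : L2C} {n₀ n₁ : L2R} {f₀ : Fin 2 → L2R} (hdiv : IsWeakDivergence n₁ f₀) {μ₀ : L2C}
    (hμ₀ : conjL μ₀ = μ₀) (hn₁ : toComplex n₁ = (lam : ℂ) • absD μ₀) {v : ℝ → L2C} {m : ℝ → L2R}
    (hv : MemLInftySobolev T (s + 1) v) (hm : MemLInftySobolevReal T s m)
    (h : IsWeakSolution lam T u₀ n₀ f₀ v m) :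
    ∃ a b R, IsSol lam T a b ∧ 0 ≤ R ∧ (∀ t ∈ Set.Icc 0 T, Sob (s + 1) R (uu (a t))) ∧
      (∀ t ∈ Set.Icc 0 T, Sob s R (reC (pp (b t)))) ∧ uu (a 0) = u₀ ∧
      pp (b 0) = toComplex n₀ + rho (a 0) + Complex.I • pp μ₀ ∧
      (∀ᵐ t ∂(volume.restrict (Set.Icc 0 T)), v t = uu (a t) ∧ toComplex (m t) = nn (a t) (b t)) := by
  obtain ⟨R₁, hR₁, hvb, hvS⟩ := hv.essBdd (by linarith)
  obtain ⟨R₂, hR₂, hmb, hmS⟩ := hm.toComplex.essBdd (by linarith)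
  set ν := (volume : Measure ℝ).restrict (Set.Icc 0 T) with hν
  set R := R₁ + R₂
  set N : ℝ → L2C := fun t => toComplex (m t)
  have h0 : (0 : ℝ) ∈ Set.Icc 0 T := ⟨le_rfl, hT.le⟩
  replace hvS : ∀ᵐ t ∂ν, Sob (s + 1) R (v t) := hvS.mono fun t ht => ht.mono (by linarith)
  replace hmS : ∀ᵐ t ∂ν, Sob s R (N t) := hmS.mono fun t ht => ht.mono (by linarith)
  have hR : 0 ≤ R := by positivity
  obtain ⟨a₁, ha₁, hva₁⟩ := hvb.exists_uu (by linarith) hvS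
  have hρ : EssBdd T (fun t => rho (a₁ t)) :=
    ha₁.comp (ballLip_rho fun R => ⟨1, zero_le_one, fun x y _ _ => (one_mul _).ge⟩)
  have hNρ : EssBdd T (fun t => N t + rho (a₁ t)) :=
    (hmb.prodMk hρ).comp (f := fun p : L2C × L2C => p.1 + p.2) (ballLip_fst.add ballLip_snd)
  have hNρS : ∀ᵐ t ∂ν, Sob s (R + 2 * BW s R * R) (N t + rho (a₁ t)) := by
    filter_upwards [hvS, hmS, hva₁] with t h1 h2 h3
    exact sob_add_rho hs (h3 ▸ h1) h2
  obtain ⟨c₁, hc₁, hcn₁⟩ := hNρ.exists_uu hs hNρS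
  have hV := h.eq_prim_u hT.le ha₁ hmb hva₁
  have hM := h.eq_prim_n hl hT.le hdiv ha₁ hmb hva₁ hc₁ hcn₁
  -- the continuous versions of `u` and `n`
  set V : ℝ → L2C := prim u₀ (fun t => sf (a₁ t) (N t)) with hVdef
  set Y : ℝ → L2C := prim (toComplex n₁) (fun t => lam ^ 2 • lapU (c₁ t)) with hYdef
  set W : ℝ → L2C := prim (toComplex n₀) Y with hWdef
  have hVc : ContinuousOn V (Set.Icc 0 T) :=
    ((ha₁.prodMk hmb).comp ballLip_sf).continuousOn_prim hT.le u₀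
  have hLb : EssBdd T (fun t => lam ^ 2 • lapU (c₁ t)) :=
    (hc₁.comp (ballLip_lapU fun R => ⟨1, zero_le_one, fun x y _ _ => (one_mul _).ge⟩)).smul
      (θ := fun _ => lam ^ 2) continuous_const
  have hYc : ContinuousOn Y (Set.Icc 0 T) := hLb.continuousOn_prim hT.le _
  have hWc : ContinuousOn W (Set.Icc 0 T) := (EssBdd.of_continuousOn hYc).continuousOn_prim hT.le _
  have hVS : ∀ t ∈ Set.Icc 0 T, Sob (s + 1) R (V t) := by
    refine sob_of_ae_sob hT (by linarith) hR hVc ?_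
    filter_upwards [hV, hvS] with t h1 h2
    rwa [← h1]
  have hWS : ∀ t ∈ Set.Icc 0 T, Sob s R (W t) := by
    refine sob_of_ae_sob hT (by linarith) hR hWc ?_
    filter_upwards [hM, hmS] with t h1 h2
    rwa [← h1]
  have hWr : ∀ t ∈ Set.Icc 0 T, conjL (W t) = W t := by
    refine Measure.eqOn_Icc_of_ae_eq volume hT.ne ?_ (conjL.continuous.comp_continuousOn hWc) hWc
    filter_upwards [hM] with t h1
    rw [← h1, conjL_toComplex]
  obtain ⟨a, hac, ha⟩ := exists_continuousOn_uu (by linarith) hVc hVS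
  have hrc : ContinuousOn (fun t => rho (a t)) (Set.Icc 0 T) :=
    (ballLip_rho fun R => ⟨1, zero_le_one, fun x y _ _ => (one_mul _).ge⟩).continuous.comp_continuousOn
      (f := a) (g := rho) hac
  have hcS : ∀ t ∈ Set.Icc 0 T, Sob s (R + 2 * BW s R * R) (W t + rho (a t)) := fun t ht =>
    sob_add_rho hs (by rw [ha t ht]; exact hVS t ht) (hWS t ht)
  obtain ⟨c, hcc, hc⟩ := exists_continuousOn_uu hs (hWc.add hrc) hcS
  change ∀ t ∈ Set.Icc 0 T, uu (c t) = W t + rho (a t) at hc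
  have hcr : ∀ t ∈ Set.Icc 0 T, conjL (c t) = c t := fun t ht => by
    apply D_jb_injective (by norm_num : (-2 : ℝ) ≤ 0)
    change uu _ = uu _
    rw [← conjL_uu, hc t ht]
    rw [map_add, hWr t ht, conjL_rho]
  have haa : a₁ =ᵐ[ν] a := by
    filter_upwards [hV, hva₁, ae_restrict_mem measurableSet_Icc] with t h1 h2 h3
    apply D_jb_injective (by norm_num : (-2 : ℝ) ≤ 0)
    change uu _ = uu _
    rw [← h2, h1, ha t h3]
  have hca : c₁ =ᵐ[ν] c := by
    filter_upwards [hM, haa, hcn₁, ae_restrict_mem measurableSet_Icc] with t h1 h2 h3 h4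
    apply D_jb_injective (by norm_num : (-2 : ℝ) ≤ 0)
    change uu _ = uu _
    rw [← h3, hc t h4, h2]
    rw [← h1]
  have hWY : ∀ t ∈ Set.Icc 0 T, HasDerivWithinAt W (Y t) (Set.Icc 0 T) t := fun t ht =>
    hasDerivWithinAt_prim (y := Y) (z := Y) hYc (EventuallyEq.refl _ _) (toComplex n₀) ht
  have hLc : ContinuousOn (fun t => lam ^ 2 • lapU (c t)) (Set.Icc 0 T) :=
    ((continuous_const_smul (lam ^ 2)).comp continuous_lapU).comp_continuousOn hcc
  have hLL : (fun t => lam ^ 2 • lapU (c₁ t)) =ᵐ[ν] fun t => lam ^ 2 • lapU (c t) := by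
    filter_upwards [hca] with x hx
    rw [hx]
  have hYd : ∀ t ∈ Set.Icc 0 T, HasDerivWithinAt Y (lam ^ 2 • lapU (c t)) (Set.Icc 0 T) t :=
    fun t ht => hasDerivWithinAt_prim hLc hLL (toComplex n₁) ht
  have hFc : ContinuousOn (fun t => sf (a t) (W t)) (Set.Icc 0 T) :=
    continuousOn_sf hac hWc
  have hFF : (fun t => sf (a₁ t) (N t)) =ᵐ[ν] fun t => sf (a t) (W t) := by
    filter_upwards [haa, hM] with x hx hx'
    rw [hx]
    exact congrArg _ hx'
  have hVd : ∀ t ∈ Set.Icc 0 T, HasDerivWithinAt V (sf (a t) (W t)) (Set.Icc 0 T) t :=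
    fun t ht => hasDerivWithinAt_prim hFc hFF u₀ ht
  have hY₀ : Y 0 = (lam : ℂ) • absD μ₀ := (prim_zero _ _).trans hn₁
  obtain ⟨b, hsol, hb⟩ := exists_isSol_of_wave hac hcc hc hcr
    (fun t ht => (hVd t ht).congr ha (ha t ht)) hWY hYd hμ₀ hY₀
  have hB : 0 ≤ 2 * BW s R * R := by have := one_le_BW hs hR; positivity
  refine ⟨a, b, R + 2 * BW s R * R, hsol, by positivity, fun t ht => ?_, fun t ht => ?_, ?_, ?_, ?_⟩
  · rw [ha t ht]
    exact (hVS t ht).mono (by linarith)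
  · rw [(hb t ht).1, hc t ht]; exact hcS t ht
  · rw [ha 0 h0]; exact prim_zero _ _
  · rw [(hb 0 h0).2 rfl, hc 0 h0]
    have hW0 : W 0 = toComplex n₀ := prim_zero _ _
    rw [hW0]
  · filter_upwards [hV, hM, ae_restrict_mem measurableSet_Icc] with t h1 h2 h3
    refine ⟨by rw [h1, ha t h3], ?_⟩
    rw [nn, (hb t h3).1, hc t h3, add_sub_cancel_right]
    exact h2

/-! ### The initial data of the wave -/

/-- The symbol `ξ_j / |ξ|` of the Riesz transform (up to the factor `-i`). -/
noncomputable def rieszSym (j : Fin 2) (ξ : Plane) : ℝ := ξ j / ‖ξ‖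

theorem abs_coord_le (j : Fin 2) (ξ : Plane) : |ξ j| ≤ ‖ξ‖ := PiLp.norm_apply_le ξ j

theorem abs_rieszSym_le (j : Fin 2) (ξ : Plane) : |rieszSym j ξ| ≤ 1 := by
  rw [rieszSym, abs_div, abs_norm]
  exact div_le_one_of_le₀ (abs_coord_le j ξ) (norm_nonneg _)

theorem bddSym_rieszSym (j : Fin 2) : BddSym (rieszSym j) := by
  refine ⟨?_, 1, abs_rieszSym_le j⟩
  unfold rieszSym
  fun_prop

theorem rieszSym_neg_arg (j : Fin 2) (ξ : Plane) : rieszSym j (-ξ) = -rieszSym j ξ := by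
  rw [rieszSym, rieszSym, norm_neg, PiLp.neg_apply, neg_div]

/-- `|D|` times the Riesz transform is a derivative. -/
theorem absSym_mul_rieszSym (j : Fin 2) (ξ : Plane) :
    absSym ξ * rieszSym j ξ = 2 * Real.pi * ξ j * jb (-1) ξ := by
  rw [absSym, rieszSym]
  by_cases h : ‖ξ‖ = 0
  · have : ξ = 0 := norm_eq_zero.1 h
    subst this; simp
  · field_simp

theorem bip_D_even {m : Plane → ℝ} (hm : BddSym m) (he : ∀ ξ, m (-ξ) = m ξ) (f g : L2C) :
    bip f (D m g) = bip (D m f) g := by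
  rw [bip, bip, ← D_conjL hm he, inner_D hm]

theorem bip_D_odd {m : Plane → ℝ} (hm : BddSym m) (he : ∀ ξ, m (-ξ) = -m ξ) (f g : L2C) :
    bip f (D m g) = -bip (D m f) g := by
  rw [bip, bip, ← inner_neg_left, ← D_conjL_odd hm he, inner_D hm]

theorem D_jb_toL2_pd {φ : Plane → ℂ} (h : IsCc φ) (j : Fin 2) :
    D (jb (-1)) (toL2 (pd j φ)) = Complex.I • D (fun ξ => absSym ξ * rieszSym j ξ) (toL2 φ) := by
  apply ext_fourier
  have e : (𝓕 (Complex.I • D (fun ξ => absSym ξ * rieszSym j ξ) (toL2 φ)) : L2C) =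
      Complex.I • (𝓕 (D (fun ξ => absSym ξ * rieszSym j ξ) (toL2 φ)) : L2C) :=
    map_smul (Lp.fourierTransformₗᵢ Plane ℂ) _ _
  rw [e]
  filter_upwards [fourier_D (bddSym_jb (by norm_num : (-1 : ℝ) ≤ 0)) (toL2 (pd j φ)), fourier_pd h j,
    fourier_D (bddSym_absSym.mul (bddSym_rieszSym j)) (toL2 φ),
    Lp.coeFn_smul Complex.I (𝓕 (D (fun ξ => absSym ξ * rieszSym j ξ) (toL2 φ)) : L2C)]
    with ξ h1 h2 h3 h4
  rw [h1, h2, h4, Pi.smul_apply, h3, absSym_mul_rieszSym, smul_eq_mul]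
  push_cast
  ring

/-- The partial derivative of `⟨D⟩^{-1} g` in the sense of distributions. -/
theorem bip_pd {φ : Plane → ℂ} (h : IsCc φ) (j : Fin 2) (g : L2C) :
    bip (toL2 (pd j φ)) (D (jb (-1)) g) =
      -bip (toL2 φ) (Complex.I • absD (D (rieszSym j) g)) := by
  rw [bip_D_even (bddSym_jb (by norm_num)) (jb_neg_arg _), D_jb_toL2_pd h, bip_smul_left,
    bip_smul_right, absD, D_D bddSym_absSym (bddSym_rieszSym j),
    bip_D_odd (bddSym_absSym.mul (bddSym_rieszSym j)) fun ξ => by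
      rw [absSym_neg_arg, rieszSym_neg_arg, mul_neg]]
  ring

/-- The initial velocity `∇ · f₀` is `λ |D| M` with `M` as regular as `λ⁻¹ f₀`. -/
theorem exists_initial_velocity {s lam C : ℝ} (hs : 2 < s) (hl : 0 < lam) {f₀ : Fin 2 → L2R}
    (hf : ∀ j, Sob s (lam * C) (toComplex (f₀ j))) :
    ∃ μ₀ : L2C, conjL μ₀ = μ₀ ∧ Sob s (2 * C) (pp μ₀) ∧
      IsWeakDivergence (reL ((lam : ℂ) • absD μ₀)) f₀ := by
  have hm1 := bddSym_jb (by norm_num : (-1 : ℝ) ≤ 0)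
  choose G hG hGf using hf
  set g : Fin 2 → L2C := fun j => D (jb (1 - s)) (G j) with hg
  have hgf : ∀ j, D (jb (-1)) (g j) = toComplex (f₀ j) := fun j => by
    rw [← hGf, hg, D_jb_jb (by norm_num) (by linarith)]; congr 3; ring
  have hgr : ∀ j, conjL (g j) = g j := fun j => by
    apply D_jb_injective (by norm_num : (-1 : ℝ) ≤ 0)
    rw [D_conjL hm1 (jb_neg_arg _), hgf, conjL_toComplex]
  have hlc : (lam : ℂ) ≠ 0 := by exact_mod_cast hl.ne'
  set μ₀ : L2C := ((lam⁻¹ : ℝ) : ℂ) • ∑ j, Complex.I • D (rieszSym j) (g j) with hμ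
  have hμr : conjL μ₀ = μ₀ := by
    rw [hμ, conjL_smul, Complex.conj_ofReal, map_sum]
    congr 1
    refine Finset.sum_congr rfl fun j _ => ?_
    have h := D_conjL_odd (bddSym_rieszSym j) (rieszSym_neg_arg j) (g j)
    rw [hgr] at h
    rw [conjL_smul, Complex.conj_I, neg_smul, ← smul_neg, ← h]
  have habs : (lam : ℂ) • absD μ₀ = ∑ j, Complex.I • absD (D (rieszSym j) (g j)) := by
    rw [hμ, absD, map_smul, smul_smul, map_sum]
    push_cast
    rw [mul_inv_cancel₀ hlc, one_smul]
    refine Finset.sum_congr rfl fun j _ => ?_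
    rw [map_smul]; rfl
  refine ⟨μ₀, hμr, ?_, ?_⟩
  · have e : pp μ₀ = ((lam⁻¹ : ℝ) : ℂ) • ∑ j, Complex.I • D (rieszSym j) (toComplex (f₀ j)) := by
      rw [hμ, pp, map_smul, map_sum]
      congr 1
      refine Finset.sum_congr rfl fun j _ => ?_
      rw [map_smul, D_comm hm1 (bddSym_rieszSym j), hgf]
    have hj : ∀ j, Sob s (lam * C) (Complex.I • D (rieszSym j) (toComplex (f₀ j))) := fun j => by
      have h1 := Sob.multiplier (t := 0) (c := 1) (bddSym_rieszSym j) (by linarith) (by linarith)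
        (fun ξ => by rw [jb_zero, mul_one]; exact abs_rieszSym_le j ξ)
        (⟨G j, hG j, hGf j⟩ : Sob s (lam * C) (toComplex (f₀ j)))
      have h2 := h1.smul Complex.I
      rwa [Complex.norm_I, one_mul, one_mul, sub_zero] at h2
    rw [e, Fin.sum_univ_two]
    refine (((hj 0).add (hj 1)).smul _).mono (le_of_eq ?_)
    rw [Complex.norm_real, Real.norm_of_nonneg (by positivity)]
    field_simp
    ring
  · intro φ hφ hφc
    have hcc : IsCc φ := ⟨hφ, hφc⟩
    rw [← Complex.ofReal_inj, integral_toComplex_mul _ hcc, toComplex_reL, habs]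
    · have e : ∀ j, ((∫ x, f₀ j x * partialDeriv j φ x : ℝ) : ℂ) =
          -bip (toL2 fun x => (φ x : ℂ)) (Complex.I • absD (D (rieszSym j) (g j))) := fun j => by
        rw [← bip_pd hcc.ofReal, hgf, pd_ofReal (hφ.differentiable (by simp))]
        exact integral_toComplex_mul _ (hcc.pd j)
      rw [Fin.sum_univ_two, Fin.sum_univ_two, bip_add_right, Complex.ofReal_neg, Complex.ofReal_add, e, e]
      ring
    · rw [conjL_smul, Complex.conj_ofReal, absD, ← D_conjL bddSym_absSym absSym_neg_arg, hμr]

theorem sobolevNormReal_le_sobolevNormVec (r : ℝ) (f : Fin 2 → L2R) (j : Fin 2) :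
    sobolevNormReal r (f j) ≤ sobolevNormVec r f := by
  have h : (sobolevNormReal r (f j) ^ (2 : ℝ)) ^ (1 / 2 : ℝ) = sobolevNormReal r (f j) := by
    rw [← ENNReal.rpow_mul]; norm_num
  rw [← h, sobolevNormVec]
  exact ENNReal.rpow_le_rpow (Finset.single_le_sum (f := fun j => sobolevNormReal r (f j) ^ (2 : ℝ))
    (fun _ _ => zero_le) (Finset.mem_univ j)) (by norm_num)

/-- The Sobolev bounds contained in the assumption on the data. -/
theorem sob_data {s lam : ℝ} (hs : 2 < s) (hl : 0 < lam) {C₁ : ℝ≥0} {u₀ : L2C} {n₀ : L2R}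
    {f₀ : Fin 2 → L2R} (h : sobolevNorm (s + 1) u₀ + sobolevNormReal s n₀ +
      ENNReal.ofReal (1 / lam) * sobolevNormVec s f₀ ≤ (C₁ : ℝ≥0∞)) :
    Sob (s + 1) C₁ u₀ ∧ Sob s C₁ (toComplex n₀) ∧ ∀ j, Sob s (lam * C₁) (toComplex (f₀ j)) := by
  have hC : (C₁ : ℝ≥0∞) = ENNReal.ofReal (C₁ : ℝ) := ENNReal.ofReal_coe_nnreal.symm
  rw [hC] at h
  have h12 := le_self_add.trans h
  refine ⟨sob_of_sobolevNorm_le C₁.2 (by linarith) (le_self_add.trans h12),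
    sob_of_sobolevNorm_le C₁.2 (by linarith) (le_add_self.trans h12), fun j => ?_⟩
  refine sob_of_sobolevNorm_le (mul_nonneg hl.le C₁.2) (by linarith) ?_
  have h3 := le_add_self.trans h
  have h4 : ENNReal.ofReal lam * (ENNReal.ofReal (1 / lam) * sobolevNormVec s f₀) =
      sobolevNormVec s f₀ := by
    rw [← mul_assoc, ← ENNReal.ofReal_mul hl.le, mul_one_div_cancel hl.ne', ENNReal.ofReal_one, one_mul]
  calc sobolevNorm s (toComplex (f₀ j)) ≤ sobolevNormVec s f₀ := sobolevNormReal_le_sobolevNormVec s f₀ j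
    _ ≤ ENNReal.ofReal lam * ENNReal.ofReal (C₁ : ℝ) := by rw [← h4]; gcongr
    _ = ENNReal.ofReal (lam * C₁) := (ENNReal.ofReal_mul hl.le).symm

theorem sob_absD_of_sob {r R : ℝ} (hr : 0 ≤ r) {b : L2C} (hb : Sob r R b) :
    Sob r (2 * Real.pi * R) (absD b) := by
  have := hb.multiplier (t := 0) (c := 2 * Real.pi) bddSym_absSym hr hr (fun ξ => by
      rw [abs_of_nonneg (absSym_nonneg ξ), jb_zero, mul_one]; exact absSym_le ξ)
  simpa [absD] using this

theorem MemLInftySobolev.of_sob {T r R : ℝ} (hr : 0 ≤ r) {v : ℝ → L2C}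
    (hv : ContinuousOn v (Set.Icc 0 T)) (h : ∀ t ∈ Set.Icc 0 T, Sob r R (v t)) :
    MemLInftySobolev T r v := by
  refine ⟨hv.aestronglyMeasurable_of_isCompact isCompact_Icc measurableSet_Icc, R.toNNReal, ?_⟩
  exact (ae_restrict_iff' measurableSet_Icc).2 (Eventually.of_forall fun t ht => (h t ht).sobolevNorm_le hr)

theorem MemLInftySobolevReal.of_sob {T r R : ℝ} (hr : 0 ≤ r) {n : ℝ → L2R}
    (hv : ContinuousOn n (Set.Icc 0 T)) (h : ∀ t ∈ Set.Icc 0 T, Sob r R (Zakharov.toComplex (n t))) :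
    MemLInftySobolevReal T r n := by
  refine ⟨hv.aestronglyMeasurable_of_isCompact isCompact_Icc measurableSet_Icc, R.toNNReal, ?_⟩
  exact (ae_restrict_iff' measurableSet_Icc).2 (Eventually.of_forall fun t ht => (h t ht).sobolevNorm_le hr)

theorem ofReal_mul_sobolevNormReal_le {r l K : ℝ} (hr : 0 ≤ r) (hl : 0 < l) {n : L2R}
    (h : Sob r (l * K) (toComplex n)) : ENNReal.ofReal (1 / l) * sobolevNormReal r n ≤ ENNReal.ofReal K := by
  have h1 : sobolevNormReal r n ≤ ENNReal.ofReal (l * K) := h.sobolevNorm_le hr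
  calc _ ≤ ENNReal.ofReal (1 / l) * ENNReal.ofReal (l * K) := by gcongr
    _ = ENNReal.ofReal K := by
      rw [← ENNReal.ofReal_mul (by positivity), ← mul_assoc, one_div_mul_cancel hl.ne', one_mul]

end Zakharov

theorem theorem2 (s : ℝ) (hs : 2 < s) (C₁ : ℝ≥0) :
    ∃ T : ℝ, 0 < T ∧ ∃ C₂ : ℝ≥0, ∀ lam : ℝ, 0 < lam →
      ∀ (u₀ : Zakharov.L2C) (n₀ : Zakharov.L2R) (f₀ : Fin 2 → Zakharov.L2R),
        Zakharov.sobolevNorm (s + 1) u₀ + Zakharov.sobolevNormReal s n₀ +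
            ENNReal.ofReal (1 / lam) * Zakharov.sobolevNormVec s f₀ ≤ (C₁ : ℝ≥0∞) →
        ∃ (u : ℝ → Zakharov.L2C) (n : ℝ → Zakharov.L2R),
          -- `(u, n)` is a solution in the class of the theorem ...
          (Zakharov.MemLInftySobolev T (s + 1) u ∧ Zakharov.MemLInftySobolevReal T s n ∧
            Zakharov.IsWeakSolution lam T u₀ n₀ f₀ u n) ∧
          -- ... it is the only one ...
          (∀ (v : ℝ → Zakharov.L2C) (m : ℝ → Zakharov.L2R),
            Zakharov.MemLInftySobolev T (s + 1) v → Zakharov.MemLInftySobolevReal T s m →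
            Zakharov.IsWeakSolution lam T u₀ n₀ f₀ v m →
            v =ᵐ[volume.restrict (Set.Icc 0 T)] u ∧
              m =ᵐ[volume.restrict (Set.Icc 0 T)] n) ∧
          -- ... and it has time derivatives, takes the data, and obeys the uniform bound.
          ∃ (ut : ℝ → Zakharov.L2C) (nt ntt : ℝ → Zakharov.L2R),
            Zakharov.HasTimeDeriv T u ut ∧ Zakharov.HasTimeDeriv T n nt ∧
            Zakharov.HasTimeDeriv T nt ntt ∧
            u 0 = u₀ ∧ n 0 = n₀ ∧ Zakharov.IsWeakDivergence (nt 0) f₀ ∧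
            ∀ t ∈ Set.Icc 0 T,
              Zakharov.sobolevNorm (s + 1) (u t) + Zakharov.sobolevNorm (s - 1) (ut t) +
                Zakharov.sobolevNormReal s (n t) +
                ENNReal.ofReal (1 / lam) * Zakharov.sobolevNormReal (s - 1) (nt t) +
                ENNReal.ofReal (1 / lam ^ 2) * Zakharov.sobolevNormReal (s - 2) (ntt t) ≤
              (C₂ : ℝ≥0∞) := by
  have hB₁ : 0 ≤ Zakharov.BW s C₁ := zero_le_one.trans (Zakharov.one_le_BW hs C₁.2)
  have hC₁ : (0 : ℝ) ≤ C₁ := C₁.2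
  -- the data of the system for `(u, P)` are bounded by `c`, whatever `lam` is
  set c : ℝ := C₁ + (C₁ + 2 * Zakharov.BW s C₁ * C₁ + 2 * C₁) with hcdef
  have hc : 0 ≤ c := by positivity
  obtain ⟨T, R, hT, hR, hex⟩ := Zakharov.exists_solution hs hc
  have hB : 0 ≤ Zakharov.BW s R := zero_le_one.trans (Zakharov.one_le_BW hs hR)
  have hk := Zakharov.kap_pos
  have h0 : (0 : ℝ) ∈ Set.Icc 0 T := ⟨le_rfl, hT.le⟩
  refine ⟨T, hT, (R + (2 * Zakharov.kap + 5) * Zakharov.BW s R ^ 2 * R +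
    (R + 2 * Zakharov.BW s R * R) + 2 * Real.pi * R + 2 * Real.pi * (2 * Real.pi * R)).toNNReal,
    fun lam hl u₀ n₀ f₀ hdata => ?_⟩
  obtain ⟨hu₀, hn₀, hf₀⟩ := Zakharov.sob_data hs hl hdata
  obtain ⟨μ₀, hμr, hμS, hdiv⟩ := Zakharov.exists_initial_velocity hs hl hf₀
  obtain ⟨a₀, ha₀⟩ := hu₀.exists_uu (by linarith)
  have hP₀ : Zakharov.Sob s (C₁ + 2 * Zakharov.BW s C₁ * C₁ + 2 * C₁)
      (Zakharov.toComplex n₀ + Zakharov.rho a₀ + Complex.I • Zakharov.pp μ₀) := by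
    have h1 := Zakharov.sob_add_rho hs (ha₀ ▸ hu₀) hn₀
    have h2 := hμS.smul Complex.I
    rw [Complex.norm_I, one_mul] at h2
    exact h1.add h2
  obtain ⟨U₀, hU₀, hU₀'⟩ := hu₀
  obtain ⟨V₀, hV₀, hV₀'⟩ := hP₀
  obtain ⟨a, b, hac, -, ha0, hb0, hab⟩ := hex lam U₀ V₀ hl
    (hU₀.trans (by rw [hcdef]; have : 0 ≤ 2 * Zakharov.BW s C₁ * C₁ := by positivity
                   linarith)) (hV₀.trans (by linarith))
  rw [hU₀'] at ha0
  rw [hV₀'] at hb0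
  have haa : a 0 = a₀ := Zakharov.D_jb_injective (by norm_num : (-2 : ℝ) ≤ 0) (ha0.trans ha₀.symm)
  have hsol : Zakharov.IsSol lam T a b :=
    ⟨hac, fun t ht => (hab t ht).2.2.1, fun t ht => (hab t ht).2.2.2⟩
  have hbS : ∀ t ∈ Set.Icc 0 T, Zakharov.Sob s R (Zakharov.pp (b t)) := fun t ht => (hab t ht).2.1
  obtain ⟨d, hd, -⟩ := hsol.deriv_nn_deriv hs hbS
  have hPr := Zakharov.reC_I_smul (Zakharov.pp μ₀)
  have hm1 := Zakharov.bddSym_jb (by norm_num : (-1 : ℝ) ≤ 0)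
  have hpμ : Zakharov.conjL (Zakharov.pp μ₀) = Zakharov.pp μ₀ := by
    rw [Zakharov.pp, ← Zakharov.D_conjL hm1 (Zakharov.jb_neg_arg _), hμr]
  rw [Zakharov.imC_eq_zero hpμ, neg_zero] at hPr
  have hnr : Zakharov.conjL (Zakharov.toComplex n₀ + Zakharov.rho a₀) =
      Zakharov.toComplex n₀ + Zakharov.rho a₀ := by
    rw [map_add, Zakharov.conjL_toComplex, Zakharov.conjL_rho]
  have hnn0 : Zakharov.nn (a 0) (b 0) = Zakharov.toComplex n₀ := by
    rw [Zakharov.nn, hb0, map_add, hPr, add_zero, Zakharov.reC_eq_self hnr, haa, add_sub_cancel_right]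
  have himb : Zakharov.imC (b 0) = μ₀ := by
    apply Zakharov.D_jb_injective (by norm_num : (-1 : ℝ) ≤ 0)
    rw [Zakharov.D_imC hm1 (Zakharov.jb_neg_arg _)]
    change Zakharov.imC (Zakharov.pp (b 0)) = Zakharov.pp μ₀
    rw [hb0, Zakharov.imC_add, Zakharov.imC_eq_zero hnr, zero_add, Zakharov.imC_I_smul,
      Zakharov.reC_eq_self hpμ]
  have hdiv' : Zakharov.IsWeakDivergence
      (Zakharov.reL ((lam : ℂ) • Zakharov.absD (Zakharov.imC (b 0)))) f₀ := by rwa [himb]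
  have hnS : ∀ t ∈ Set.Icc 0 T, Zakharov.Sob s (R + 2 * Zakharov.BW s R * R)
      (Zakharov.toComplex (Zakharov.reL (Zakharov.nn (a t) (b t)))) := fun t ht => by
    rw [Zakharov.toComplex_reL_nn, Zakharov.nn]
    exact ((hbS t ht).reC (by linarith)).sub
      ((Zakharov.sob_rho hs (hab t ht).1 (hab t ht).1).of_le (by linarith) (by linarith))
  refine ⟨fun t => Zakharov.uu (a t), fun t => Zakharov.reL (Zakharov.nn (a t) (b t)),
    ⟨?_, ?_, ?_⟩, fun v m hv hm hw => ?_, fun t => Zakharov.fu (a t) (b t),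
    fun t => Zakharov.reL ((lam : ℂ) • Zakharov.absD (Zakharov.imC (b t))),
    fun t => Zakharov.reL (((lam ^ 2 : ℝ) : ℂ) • Zakharov.lapU (d t)), hsol.deriv_u, fun t ht => ?_,
    fun t ht => ?_, ha0, ?_, hdiv', fun t ht => ?_⟩
  · exact Zakharov.MemLInftySobolev.of_sob (by linarith)
      (fun t ht => (hsol.deriv_u t ht).continuousWithinAt) fun t ht => (hab t ht).1
  · exact Zakharov.MemLInftySobolevReal.of_sob (by linarith)
      (Zakharov.reL.continuous.comp_continuousOn hsol.continuousOn_nn) hnS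
  · have := hsol.isWeakSolution hs hl hT.le hbS hnn0 hdiv'
    rwa [ha0] at this
  · have hn₁ : Zakharov.toComplex (Zakharov.reL ((lam : ℂ) • Zakharov.absD (Zakharov.imC (b 0)))) =
        (lam : ℂ) • Zakharov.absD μ₀ := by
      rw [Zakharov.toComplex_reL (Zakharov.conjL_smul_absD_imC _ _), himb]
    obtain ⟨a', b', R', hsol', hR', ha', hb', ha0', hb0', hae⟩ :=
      hw.exists_isSol hs hl hT hdiv' hμr hn₁ hv hm
    have haa' : a' 0 = a₀ :=
      Zakharov.D_jb_injective (by norm_num : (-2 : ℝ) ≤ 0) (ha0'.trans ha₀.symm)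
    have heq := hsol.unique hs (R := R + R') (by positivity) hsol'
      (fun t ht => (hab t ht).1.mono (by linarith)) (fun t ht => (ha' t ht).mono (by linarith))
      (fun t ht => (hb' t ht).mono (by linarith)) (ha0.trans ha0'.symm) (by rw [hb0, hb0', haa'])
    constructor
    · filter_upwards [hae, ae_restrict_mem measurableSet_Icc] with t h1 h2
      rw [h1.1, (heq t h2).1]
    · filter_upwards [hae, ae_restrict_mem measurableSet_Icc] with t h1 h2
      apply Zakharov.toComplex_injective
      rw [h1.2, Zakharov.toComplex_reL_nn, (heq t h2).1, (heq t h2).2]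
  · exact Zakharov.HasDerivWithinAt.clmR (hsol.deriv_nn ht) Zakharov.reL
  · exact Zakharov.HasDerivWithinAt.clmR (hd t ht).2.2.2 Zakharov.reL
  · apply Zakharov.toComplex_injective
    rw [Zakharov.toComplex_reL_nn, hnn0]
  · have b1 := (hab t ht).1.sobolevNorm_le (by linarith)
    have b2 := (Zakharov.sob_fu hs (hab t ht).1 ((hbS t ht).reC (by linarith))).sobolevNorm_le
      (by linarith)
    have b3 := (hnS t ht).sobolevNorm_le (by linarith)
    have b4 : ENNReal.ofReal (1 / lam) * Zakharov.sobolevNormReal (s - 1)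
        (Zakharov.reL ((lam : ℂ) • Zakharov.absD (Zakharov.imC (b t)))) ≤
        ENNReal.ofReal (2 * Real.pi * R) := by
      refine Zakharov.ofReal_mul_sobolevNormReal_le (by linarith) hl ?_
      rw [Zakharov.toComplex_reL (Zakharov.conjL_smul_absD_imC _ _)]
      have := (Zakharov.sob_absD_of_sob (by linarith)
        ((Zakharov.sob_b hs (hbS t ht)).imC (by linarith))).smul (lam : ℂ)
      rwa [Complex.norm_real, Real.norm_of_nonneg hl.le] at this
    have b5 : ENNReal.ofReal (1 / lam ^ 2) * Zakharov.sobolevNormReal (s - 2)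
        (Zakharov.reL (((lam ^ 2 : ℝ) : ℂ) • Zakharov.lapU (d t))) ≤
        ENNReal.ofReal (2 * Real.pi * (2 * Real.pi * R)) := by
      obtain ⟨e1, e2, -, -⟩ := hd t ht
      refine Zakharov.ofReal_mul_sobolevNormReal_le (by linarith) (pow_pos hl 2) ?_
      rw [Zakharov.toComplex_reL (by
        rw [Zakharov.conjL_smul, Complex.conj_ofReal, Zakharov.conjL_lapU, e2])]
      have h1 := (Zakharov.sob_absD_of_sob (by linarith)
        (Zakharov.sob_absD_of_sob (by linarith) e1)).neg
      rw [Zakharov.absD_absD, neg_neg] at h1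
      have h2 := h1.smul ((lam ^ 2 : ℝ) : ℂ)
      rwa [Complex.norm_real, Real.norm_of_nonneg (pow_pos hl 2).le] at h2
    have p1 : 0 ≤ (2 * Zakharov.kap + 5) * Zakharov.BW s R ^ 2 * R := by positivity
    have p2 : 0 ≤ R + 2 * Zakharov.BW s R * R := by positivity
    have p3 : 0 ≤ 2 * Real.pi * R := by positivity
    have p4 : 0 ≤ 2 * Real.pi * (2 * Real.pi * R) := by positivity
    refine (add_le_add (add_le_add (add_le_add (add_le_add b1 b2) b3) b4) b5).trans (le_of_eq ?_)
    rw [← ENNReal.ofReal_add hR p1, ← ENNReal.ofReal_add (by positivity) p2,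
      ← ENNReal.ofReal_add (by positivity) p3, ← ENNReal.ofReal_add (by positivity) p4]
    rfl
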